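/- **Setting.** Sites are integers $n\in\mathbb Z$. The lattice fields are $\phi_{\pm n},F_{\pm n}$ (commuting) and $\chi_{\pm n},\bar\chi_{\pm n}$ (anticommuting); there are finitely many site-independent constants $\rho^i_\pm$ (commuting) and $\zeta^i_{\rho\pm}$ (anticommuting), $i=1,\dots,N_{CF}$, and Grassmann variables $\theta_\pm$. The fermion number $N_F$ is $0$ for $\phi_\pm,F_\pm,\rho^i_\pm$, is $1$ for $\chi_\pm,\theta_\pm$ and is $-1$ for $\bar\chi_\pm,\zeta^i_{\rho\pm}$. A complex coefficient $C_{m_0\cdots m_I}$ ($I\ge 0$, $m_j\in\mathbb Z$) is a *translationally invariant local coefficient* (TILC) if it is invariant under the simultaneous shift of all sites by $1$ and $|C_{m_0\cdots m_I}|\le L e^{-M|m_a-m_b|}$ for some $L,M>0$ and all sites and all $a,b$. Let $\nabla_{mn}=\nabla(m-n)$ be a difference operator: a TILC, not identically zero, with $\sum_k\nabla(k)=0$; $(\nabla A)_n=\sum_m\nabla_{nm}A_m$. With left derivatives and $A\cdot B=\sum_nA_nB_n$, the supercharges are $$Q'_\pm=\pm\bar\chi_\pm\cdot\tfrac{\partial}{\partial\phi_\pm}+F_\pm\cdot\tfrac{\partial}{\partial\chi_\pm}\mp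 i\nabla\phi_\mp\cdot\tfrac{\partial}{\partial\chi_\mp}-i\nabla\bar\chi_\mp\cdot\tfrac{\partial}{\partial F_\mp}\pm\sum_i\zeta^i_{\rho\pm}\tfrac{\partial}{\partial\rho^i_\pm}.$$ The superfields are $$\Phi_\pm=\phi_\pm\pm\theta_\pm\bar\chi_\pm,\quad \Upsilon_\pm=F_\pm-i\theta_\mp\nabla\bar\chi_\pm,\quad \Psi_\pm=\chi_\pm+\theta_\pm\{F_\pm-i\theta_\mp\nabla\bar\chi_\pm\}\pm i\theta_\mp\nabla\phi_\pm,\quad S_\pm=\bar\chi_\pm,$$ with fermion numbers $0,0,1,-1$, and the constant superfields are $\rho^i_\pm(\theta_\pm)=\rho^i_\pm\pm\theta_\pm\zeta^i_{\rho\pm}$ and $\zeta^i_{\rho\pm}$, with fermion numbers $0$ and $-1$. Berezin integration is $\int d^2\theta=\int d\theta_-\,d\theta_+$, $\int d^2\theta\,\theta_+\theta_-=1$. A *local functional* of the superfields with fermion number $q$ is a sum of terms $$\sum_{k_0,\dots,k_r\in\mathbb Z}C_{k_0\cdots k_r}\,c_1\cdots c_l\;\Xi^0_{k_0}\cdots\Xi^r_{k_r},$$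 where $l,r\ge0$, $c_1,\dots,c_l$ are constant superfields, $\Xi^0,\dots,\Xi^r$ are site-dependent superfields (at least one), $C$ is a TILC, and the total fermion number is $q$; its degree is $l+r+1$. There are finitely many terms in each degree. If only finitely many degrees occur, the functional is polynomial; otherwise it is a formal power series. A coefficient $C_{mn_1\cdots n_k}$ ($k\ge0$), symmetric in $n_1,\dots,n_k$, satisfies the *cyclic Leibniz rule* (CLR) if, for all $n_0,\dots,n_k$, $$\sum_{p\text{ cyclic perm. of }\{0,\dots,k\}}\ \sum_m\nabla_{mn_{p(0)}}C_{mn_{p(1)}\cdots n_{p(k)}}=0.$$ *$\pm$type CLR extended terms with $N_F=1$* are sums over $k\ge0$ of terms $$\sum_{m,n_1,\dots,n_k}C'_{mn_1\cdots n_k}\big(\rho^i_\pm(\theta_\pm)\big)\,\Psi_{\pm m}\Phi_{\pm n_1}\cdots\Phi_{\pm n_k},$$ where $C'$ is a polynomial or formal power series in the constant superfields $\rho^i_\pm(\theta_\pm)$ of the same sign, all of whose coefficients are TILCs satisfying the CLR; the degree of a term of order $l$ in the $\rho^i_\pm(\theta_\pm)$ is $l+k+1$. **Proposition 4.** Let $S'$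 be a local functional of the superfields with $N_F=0$ and $Q'_+S'=Q'_-S'=0$. Then $$S'=\int d^2\theta\,\mathcal T'(+,-)-\int d^2\theta\,\theta_-\,\mathcal C_+ +\int d^2\theta\,\theta_+\,\mathcal C_-,$$ where $\mathcal T'(+,-)$ is a local functional of the superfields with $N_F=2$ and $\mathcal C_\pm$ are $\pm$type CLR extended terms with $N_F=1$. Moreover, if only degrees in a given set $D\subseteq\mathbb N$ occur in $S'$, then $\mathcal T'$ and $\mathcal C_\pm$ can be chosen with degrees in $D$ only; in particular they are polynomial if $S'$ is. -/

import Mathlib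

/-! Lattice supersymmetric complex quantum mechanics on the site lattice `ℤ`: fields, constant
superfields, nilpotent supercharges, superfields, local functionals and cyclic-Leibniz-rule terms. -/

namespace LatticeSusy

/-- The label `±` carried by every field. -/
inductive Sgn
  | plus
  | minus
  deriving DecidableEq

/-- The opposite label. -/
def Sgn.opp : Sgn → Sgn
  | Sgn.plus => Sgn.minus
  | Sgn.minus => Sgn.plus

/-- The label `±` as the number `±1`. -/
def Sgn.toC : Sgn → ℂ
  | Sgn.plus => 1
  | Sgn.minus => -1

/-- The generators: the lattice fields `φ, χ̄, χ, F` with label `±` and site `n ∈ ℤ`, the constants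
`ρ^i, ζ^i` with label `±` and `i` in `Fin N`, and the Grassmann variables `θ_±`. -/
inductive Gen (N : ℕ)
  | phi (s : Sgn) (n : ℤ)
  | chibar (s : Sgn) (n : ℤ)
  | chi (s : Sgn) (n : ℤ)
  | F (s : Sgn) (n : ℤ)
  | rho (s : Sgn) (i : Fin N)
  | zeta (s : Sgn) (i : Fin N)
  | theta (s : Sgn)
  deriving DecidableEq

/-- Grassmann parity of a generator. -/
def Gen.odd {N : ℕ} : Gen N → Bool
  | Gen.phi _ _ => false
  | Gen.chibar _ _ => true
  | Gen.chi _ _ => true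
  | Gen.F _ _ => false
  | Gen.rho _ _ => false
  | Gen.zeta _ _ => true
  | Gen.theta _ => true

/-- Every generator counts as one field, except that `θ_±` does not count. -/
def Gen.isField {N : ℕ} : Gen N → Bool
  | Gen.theta _ => false
  | _ => true

/-- The sign in `a b = ε(a,b) b a`. -/
def eps {N : ℕ} (a b : Gen N) : ℂ := if a.odd && b.odd then -1 else 1

/-! ### Formal power series in the (super)commuting generators

A formal power series `f`, with complex coefficients and possibly infinitely many terms, is recorded
by its Taylor coefficients `f [a₁, …, a_r] = (∂_{a_r} ⋯ ∂_{a₁} f)` at the origin, with left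
derivatives. A family of numbers indexed by words comes from a formal series exactly if it picks up
the sign `ε(a,b)` when two neighbouring letters `a`, `b` are exchanged. -/

/-- Left derivative, on families indexed by words. -/
def rawD {N : ℕ} (a : Gen N) (f : List (Gen N) → ℂ) : List (Gen N) → ℂ := fun w => f (a :: w)

/-- `f ↦ (-1)^{|a||f|} f`, extended linearly. -/
def rawS {N : ℕ} (a : Gen N) (f : List (Gen N) → ℂ) : List (Gen N) → ℂ :=
  fun w => (w.map (eps a)).prod * f w

/-- The product, determined by its value at the origin and by the graded Leibniz rule
`∂_a (f h) = (∂_a f) h + (-1)^{|a||f|} f (∂_a h)`. -/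
def rawMul {N : ℕ} (f h : List (Gen N) → ℂ) : List (Gen N) → ℂ
  | [] => f [] * h []
  | a :: w => rawMul (rawD a f) h w + rawMul (rawS a f) (rawD a h) w

theorem eps_comm {N : ℕ} (a b : Gen N) : eps a b = eps b a := by
  simp [eps, Bool.and_comm]

theorem eps_sq {N : ℕ} (a b : Gen N) : eps a b * eps a b = 1 := by
  unfold eps; split_ifs <;> norm_num

theorem rawMul_add_left {N : ℕ} (f f' h : List (Gen N) → ℂ) :
    rawMul (f + f') h = rawMul f h + rawMul f' h := by
  funext w
  induction w generalizing f f' h with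
  | nil => simp [rawMul, add_mul]
  | cons a w ih =>
    have h1 : rawD a (f + f') = rawD a f + rawD a f' := rfl
    have h2 : rawS a (f + f') = rawS a f + rawS a f' := by
      funext u; simp [rawS, mul_add]
    simp only [rawMul, h1, h2, ih, Pi.add_apply]; ring

theorem rawMul_add_right {N : ℕ} (f h h' : List (Gen N) → ℂ) :
    rawMul f (h + h') = rawMul f h + rawMul f h' := by
  funext w
  induction w generalizing f h h' with
  | nil => simp [rawMul, mul_add]
  | cons a w ih =>
    have h1 : rawD a (h + h') = rawD a h + rawD a h' := rfl
    simp only [rawMul, h1, ih, Pi.add_apply]; ring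

theorem rawD_smul {N : ℕ} (a : Gen N) (c : ℂ) (f : List (Gen N) → ℂ) :
    rawD a (c • f) = c • rawD a f := rfl

theorem rawS_smul {N : ℕ} (a : Gen N) (c : ℂ) (f : List (Gen N) → ℂ) :
    rawS a (c • f) = c • rawS a f := by
  funext u; simp [rawS]; ring

theorem rawMul_smul_left {N : ℕ} (c : ℂ) (f h : List (Gen N) → ℂ) :
    rawMul (c • f) h = c • rawMul f h := by
  funext w
  induction w generalizing f h with
  | nil => simp [rawMul, mul_assoc]
  | cons a w ih =>
    simp only [rawMul, rawD_smul, rawS_smul, ih, Pi.smul_apply, smul_eq_mul]; ring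

theorem rawMul_smul_right {N : ℕ} (c : ℂ) (f h : List (Gen N) → ℂ) :
    rawMul f (c • h) = c • rawMul f h := by
  funext w
  induction w generalizing f h with
  | nil => simp [rawMul]; ring
  | cons a w ih =>
    simp only [rawMul, rawD_smul, ih, Pi.smul_apply, smul_eq_mul]; ring

theorem rawD_rawS {N : ℕ} (a b : Gen N) (f : List (Gen N) → ℂ) :
    rawD b (rawS a f) = eps a b • rawS a (rawD b f) := by
  funext w; simp [rawD, rawS]; ring

theorem rawS_comm {N : ℕ} (a b : Gen N) (f : List (Gen N) → ℂ) :
    rawS b (rawS a f) = rawS a (rawS b f) := by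
  funext w; simp [rawS]; ring

theorem rawS_rawMul {N : ℕ} (a : Gen N) (f h : List (Gen N) → ℂ) :
    rawS a (rawMul f h) = rawMul (rawS a f) (rawS a h) := by
  funext w
  induction w generalizing f h with
  | nil => simp [rawMul, rawS]
  | cons b w ih =>
    have e1 := ih (rawD b f) h
    have e2 := ih (rawS b f) (rawD b h)
    simp only [rawMul, rawD_rawS, rawMul_smul_left, rawMul_smul_right, Pi.smul_apply,
      smul_eq_mul, rawS_comm a b, ← e1, ← e2]
    simp only [rawS, List.map_cons, List.prod_cons, rawMul]; ring

theorem rawD_rawMul {N : ℕ} (a : Gen N) (f h : List (Gen N) → ℂ) :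
    rawD a (rawMul f h) = rawMul (rawD a f) h + rawMul (rawS a f) (rawD a h) := rfl

theorem rawMul_assoc {N : ℕ} (f g h : List (Gen N) → ℂ) :
    rawMul (rawMul f g) h = rawMul f (rawMul g h) := by
  funext w
  induction w generalizing f g h with
  | nil => simp [rawMul, mul_assoc]
  | cons a w ih =>
    have l : rawMul (rawMul f g) h (a :: w)
        = rawMul (rawD a (rawMul f g)) h w + rawMul (rawS a (rawMul f g)) (rawD a h) w := rfl
    have r : rawMul f (rawMul g h) (a :: w)
        = rawMul (rawD a f) (rawMul g h) w + rawMul (rawS a f) (rawD a (rawMul g h)) w := rfl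
    rw [l, r, rawD_rawMul, rawD_rawMul, rawS_rawMul, rawMul_add_left, rawMul_add_right]
    simp only [Pi.add_apply, ih]; ring

/-- The graded symmetry that characterizes Taylor coefficients of formal series. -/
def GradedSymm {N : ℕ} (f : List (Gen N) → ℂ) : Prop :=
  ∀ (u v : List (Gen N)) (a b : Gen N), f (u ++ a :: b :: v) = eps a b * f (u ++ b :: a :: v)

theorem GradedSymm.rawD {N : ℕ} {f : List (Gen N) → ℂ} (hf : GradedSymm f) (c : Gen N) :
    GradedSymm (rawD c f) := fun u v a b => hf (c :: u) v a b

theorem GradedSymm.rawS {N : ℕ} {f : List (Gen N) → ℂ} (hf : GradedSymm f) (c : Gen N) :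
    GradedSymm (rawS c f) := by
  intro u v a b
  simp only [LatticeSusy.rawS, hf u v a b, List.map_append, List.map_cons, List.prod_append,
    List.prod_cons]
  ring

theorem GradedSymm.rawMul {N : ℕ} {f h : List (Gen N) → ℂ} (hf : GradedSymm f)
    (hh : GradedSymm h) : GradedSymm (rawMul f h) := by
  intro u
  induction u generalizing f h with
  | nil =>
    intro v a b
    have cf : LatticeSusy.rawD b (LatticeSusy.rawD a f)
        = eps a b • LatticeSusy.rawD a (LatticeSusy.rawD b f) := by
      funext w; exact hf [] w a b
    have ch : LatticeSusy.rawD b (LatticeSusy.rawD a h)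
        = eps a b • LatticeSusy.rawD a (LatticeSusy.rawD b h) := by
      funext w; exact hh [] w a b
    simp only [List.nil_append, LatticeSusy.rawMul, cf, ch, rawD_rawS, rawMul_smul_left,
      rawMul_smul_right, Pi.smul_apply, smul_eq_mul, rawS_comm a b, eps_comm b a]
    linear_combination (-LatticeSusy.rawMul (LatticeSusy.rawS b (LatticeSusy.rawD a f))
      (LatticeSusy.rawD b h) v) * eps_sq a b
  | cons c u ih =>
    intro v a b
    have e1 := ih (hf.rawD c) hh v a b
    have e2 := ih (hf.rawS c) (hh.rawD c) v a b
    simp only [List.cons_append, LatticeSusy.rawMul, e1, e2]; ring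

/-- Formal power series in the generators: even generators commute, odd ones anticommute. The
topology is that of coefficientwise convergence. -/
def Series (N : ℕ) : Submodule ℂ (List (Gen N) → ℂ) where
  carrier := {f | GradedSymm f}
  add_mem' := by
    intro f g hf hg u v a b
    simp only [Pi.add_apply, hf u v a b, hg u v a b]; ring
  zero_mem' := by intro u v a b; simp
  smul_mem' := by
    intro c f hf u v a b
    simp only [Pi.smul_apply, hf u v a b, smul_eq_mul]; ring

/-- The constant series `1`. -/
def rawOne {N : ℕ} : List (Gen N) → ℂ
  | [] => 1
  | _ :: _ => 0

theorem rawMul_zero_left {N : ℕ} (h : List (Gen N) → ℂ) : rawMul 0 h = 0 := by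
  simpa using rawMul_smul_left 0 0 h

theorem rawMul_zero_right {N : ℕ} (f : List (Gen N) → ℂ) : rawMul f 0 = 0 := by
  simpa using rawMul_smul_right 0 f 0

theorem rawOne_mul {N : ℕ} (f : List (Gen N) → ℂ) : rawMul rawOne f = f := by
  funext w
  induction w generalizing f with
  | nil => simp [rawMul, rawOne]
  | cons a w ih =>
    have h1 : rawD a (rawOne : List (Gen N) → ℂ) = 0 := rfl
    have h2 : rawS a (rawOne : List (Gen N) → ℂ) = rawOne := by
      funext u; cases u <;> simp [rawS, rawOne]
    simp [rawMul, h1, h2, rawMul_zero_left, ih, rawD]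

theorem rawMul_one {N : ℕ} (f : List (Gen N) → ℂ) : rawMul f rawOne = f := by
  funext w
  induction w generalizing f with
  | nil => simp [rawMul, rawOne]
  | cons a w ih =>
    have h1 : rawD a (rawOne : List (Gen N) → ℂ) = 0 := rfl
    simp [rawMul, h1, rawMul_zero_right, ih, rawD]

theorem rawOne_symm {N : ℕ} : GradedSymm (rawOne : List (Gen N) → ℂ) := by
  intro u v a b; cases u <;> simp [rawOne]

instance instRingSeries (N : ℕ) : Ring (Series N) :=
  { (inferInstance : AddCommGroup (Series N)) with
    mul := fun f h => ⟨rawMul f.1 h.1, f.2.rawMul h.2⟩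
    one := ⟨rawOne, rawOne_symm⟩
    left_distrib := fun f g h => Subtype.ext (rawMul_add_right f.1 g.1 h.1)
    right_distrib := fun f g h => Subtype.ext (rawMul_add_left f.1 g.1 h.1)
    zero_mul := fun f => Subtype.ext (rawMul_zero_left f.1)
    mul_zero := fun f => Subtype.ext (rawMul_zero_right f.1)
    mul_assoc := fun f g h => Subtype.ext (rawMul_assoc f.1 g.1 h.1)
    one_mul := fun f => Subtype.ext (rawOne_mul f.1)
    mul_one := fun f => Subtype.ext (rawMul_one f.1) }

/-- A generator as a formal series. -/
noncomputable def X {N : ℕ} (g : Gen N) : Series N :=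
  ⟨fun w => if w = [g] then 1 else 0, by
    intro u v a b
    have h : ∀ c d : Gen N, u ++ c :: d :: v ≠ [g] := by
      intro c d e
      have := congrArg List.length e
      simp at this
      omega
    simp [h]⟩

/-- Left derivative `∂/∂a`. -/
def deriv {N : ℕ} (a : Gen N) : Series N →ₗ[ℂ] Series N where
  toFun f := ⟨rawD a f.1, f.2.rawD a⟩
  map_add' _ _ := rfl
  map_smul' _ _ := rfl

/-- The part of a series that is homogeneous of degree `d` in the lattice fields and the constants
together (`θ_±` is not counted). -/
def homogPart {N : ℕ} (d : ℕ) (f : Series N) : Series N :=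
  ⟨fun w => if w.countP Gen.isField = d then f.1 w else 0, by
    intro u v a b
    have h : (u ++ a :: b :: v).countP Gen.isField = (u ++ b :: a :: v).countP Gen.isField := by
      simp only [List.countP_append, List.countP_cons]; omega
    simp only [h, f.2 u v a b]
    split_ifs <;> simp⟩

/-! ### Difference operator and supercharges -/

/-- A translationally invariant local coefficient (TILC) with `n` site indices: invariant under
simultaneous translation, with exponential decay in all differences of sites. -/
structure IsTILC {n : ℕ} (C : (Fin n → ℤ) → ℂ) : Prop where
  translation : ∀ k : Fin n → ℤ, C (fun i => k i + 1) = C k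
  decay : ∃ L M : ℝ, 0 < L ∧ 0 < M ∧
    ∀ (k : Fin n → ℤ) (i j : Fin n), ‖C k‖ ≤ L * Real.exp (-M * |((k i - k j : ℤ) : ℝ)|)

/-- `∇_{mn} = ∇(m - n)` is a local difference operator: it is a TILC, annihilates constants, and
is not identically zero. -/
structure IsDifferenceOperator (nabla : ℤ → ℂ) : Prop where
  tilc : IsTILC (n := 2) (fun k => nabla (k 0 - k 1))
  annihilates_constants : HasSum nabla 0
  ne_zero : nabla ≠ 0

/-- `(∇ A)_n = ∑_m ∇(n - m) A_m` for a family `A` of generators. For distinct generators each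
coefficient of this sum has at most one nonzero term. -/
noncomputable def applyNabla {N : ℕ} (nabla : ℤ → ℂ) (A : ℤ → Gen N) (n : ℤ) : Series N :=
  ∑' m : ℤ, nabla (n - m) • X (A m)

/-- The supercharges `Q'_±` on fields and constants:
`Q'_s = s χ̄_s·∂/∂φ_s + F_s·∂/∂χ_s - s i ∇φ_{-s}·∂/∂χ_{-s} - i ∇χ̄_{-s}·∂/∂F_{-s}
  + s ∑_i ζ^i_s ∂/∂ρ^i_s`. -/
noncomputable def Q {N : ℕ} (nabla : ℤ → ℂ) (s : Sgn) (f : Series N) : Series N :=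
  (∑' n : ℤ,
    (s.toC • (X (Gen.chibar s n) * deriv (Gen.phi s n) f)
      + X (Gen.F s n) * deriv (Gen.chi s n) f
      - (s.toC * Complex.I) • (applyNabla nabla (Gen.phi s.opp) n * deriv (Gen.chi s.opp n) f)
      - Complex.I • (applyNabla nabla (Gen.chibar s.opp) n * deriv (Gen.F s.opp n) f)))
  + s.toC • ∑ i : Fin N, X (Gen.zeta s i) * deriv (Gen.rho s i) f

/-- `∫ d²θ = ∫ dθ₋ dθ₊`, normalized by `∫ d²θ θ₊ θ₋ = 1`. -/
def berezin {N : ℕ} (f : Series N) : Series N :=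
  deriv (Gen.theta Sgn.minus) (deriv (Gen.theta Sgn.plus) f)

/-! ### Superfields -/

/-- `Φ_± = φ_± ± θ_± χ̄_±`. -/
noncomputable def Phi {N : ℕ} (s : Sgn) (n : ℤ) : Series N :=
  X (Gen.phi s n) + s.toC • (X (Gen.theta s) * X (Gen.chibar s n))

/-- `Υ_± = F_± - i θ_∓ ∇χ̄_±`. -/
noncomputable def Upsilon {N : ℕ} (nabla : ℤ → ℂ) (s : Sgn) (n : ℤ) : Series N :=
  X (Gen.F s n) - Complex.I • (X (Gen.theta s.opp) * applyNabla nabla (Gen.chibar s) n)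

/-- `Ψ_± = χ_± + θ_± {F_± - i θ_∓ ∇χ̄_±} ± i θ_∓ ∇φ_±`. -/
noncomputable def Psi {N : ℕ} (nabla : ℤ → ℂ) (s : Sgn) (n : ℤ) : Series N :=
  X (Gen.chi s n)
    + X (Gen.theta s) *
      (X (Gen.F s n) - Complex.I • (X (Gen.theta s.opp) * applyNabla nabla (Gen.chibar s) n))
    + (s.toC * Complex.I) • (X (Gen.theta s.opp) * applyNabla nabla (Gen.phi s) n)

/-- `S_± = χ̄_±`. -/
noncomputable def Ssf {N : ℕ} (s : Sgn) (n : ℤ) : Series N := X (Gen.chibar s n)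

/-- The constant superfield `ρ^i_±(θ_±) = ρ^i_± ± θ_± ζ^i_±`. -/
noncomputable def rhoSF {N : ℕ} (s : Sgn) (i : Fin N) : Series N :=
  X (Gen.rho s i) + s.toC • (X (Gen.theta s) * X (Gen.zeta s i))

/-- The constant superfield `ζ^i_±(θ_±) = ζ^i_±`. -/
noncomputable def zetaSF {N : ℕ} (s : Sgn) (i : Fin N) : Series N := X (Gen.zeta s i)

/-- Names of the site-dependent superfields. -/
inductive FieldLetter
  | Phi (s : Sgn)
  | Psi (s : Sgn)
  | Upsilon (s : Sgn)
  | S (s : Sgn)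

/-- Names of the constant superfields. -/
inductive ConstLetter (N : ℕ)
  | rho (s : Sgn) (i : Fin N)
  | zeta (s : Sgn) (i : Fin N)

/-- Fermion number `N_F` of a site-dependent superfield. -/
def FieldLetter.nF : FieldLetter → ℤ
  | FieldLetter.Phi _ => 0
  | FieldLetter.Psi _ => 1
  | FieldLetter.Upsilon _ => 0
  | FieldLetter.S _ => -1

/-- Fermion number `N_F` of a constant superfield. -/
def ConstLetter.nF {N : ℕ} : ConstLetter N → ℤ
  | ConstLetter.rho _ _ => 0
  | ConstLetter.zeta _ _ => -1

/-- The superfield with a given name at site `n`. -/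
noncomputable def FieldLetter.val {N : ℕ} (nabla : ℤ → ℂ) : FieldLetter → ℤ → Series N
  | FieldLetter.Phi s, n => LatticeSusy.Phi s n
  | FieldLetter.Psi s, n => LatticeSusy.Psi nabla s n
  | FieldLetter.Upsilon s, n => LatticeSusy.Upsilon nabla s n
  | FieldLetter.S s, n => Ssf s n

/-- The constant superfield with a given name. -/
noncomputable def ConstLetter.val {N : ℕ} : ConstLetter N → Series N
  | ConstLetter.rho s i => rhoSF s i
  | ConstLetter.zeta s i => zetaSF s i

/-! ### Local functionals and CLR terms -/

/-- `x` is a sum `∑_k C_k c₁ ⋯ c_l Ξ⁰_{k₀} ⋯ Ξʳ_{k_r}` over lattice sites, of total degree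
`d = l + r + 1` and fermion number `q`, with constant superfields `c`, site-dependent superfields
`Ξ` (at least one) and a TILC `C`. -/
def IsLocalMonomial {N : ℕ} (nabla : ℤ → ℂ) (q : ℤ) (d : ℕ) (x : Series N) : Prop :=
  ∃ (w : List (ConstLetter N)) (r : ℕ) (t : Fin (r + 1) → FieldLetter)
    (C : (Fin (r + 1) → ℤ) → ℂ),
    IsTILC C ∧ w.length + (r + 1) = d ∧ (w.map ConstLetter.nF).sum + ∑ i, (t i).nF = q ∧
    HasSum (fun k : Fin (r + 1) → ℤ =>
      C k • ((w.map ConstLetter.val).prod *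
        (List.ofFn fun i => (t i).val nabla (k i)).prod)) x

/-- Local functionals of the superfields with fermion number `q` all of whose terms have total
degree in `D`: in each degree a finite linear combination of sums as above. With `D` finite these
are polynomial functionals, with `D = Set.univ` arbitrary formal power series. -/
def IsLocalFunctional {N : ℕ} (nabla : ℤ → ℂ) (q : ℤ) (D : Set ℕ) (x : Series N) : Prop :=
  ∀ d : ℕ, (d ∈ D → homogPart d x ∈ Submodule.span ℂ {y | IsLocalMonomial nabla q d y}) ∧
    (d ∉ D → homogPart d x = 0)

/-- The cyclic Leibniz rule for a coefficient `C_{m n₁ ⋯ n_k}`, symmetric in `n₁, …, n_k`: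
`∑_{p cyclic} ∑_m ∇_{m n_{p(0)}} C_{m n_{p(1)} ⋯ n_{p(k)}} = 0`
(the addition of indices is modulo `k + 1`). -/
structure IsCLR (nabla : ℤ → ℂ) {k : ℕ} (C : (Fin (k + 1) → ℤ) → ℂ) : Prop where
  symm : ∀ (m : ℤ) (n : Fin k → ℤ) (σ : Equiv.Perm (Fin k)),
    C (Fin.cons m (n ∘ σ)) = C (Fin.cons m n)
  cyclic : ∀ n : Fin (k + 1) → ℤ,
    ∑ p : Fin (k + 1), ∑' m : ℤ,
      nabla (m - n p) * C (Fin.cons m (fun j : Fin k => n (p + j.succ))) = 0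

/-- `x` is a sum `∑ C_{m n₁ ⋯ n_k} ρ^{i₁}_±(θ_±) ⋯ ρ^{i_l}_±(θ_±) Ψ_{±m} Φ_{±n₁} ⋯ Φ_{±n_k}` of total
degree `d = l + k + 1`, where `C` is a TILC that satisfies the cyclic Leibniz rule. -/
def IsCLRMonomial {N : ℕ} (nabla : ℤ → ℂ) (s : Sgn) (d : ℕ) (x : Series N) : Prop :=
  ∃ (w : List (Fin N)) (k : ℕ) (C : (Fin (k + 1) → ℤ) → ℂ),
    IsTILC C ∧ IsCLR nabla C ∧ w.length + (k + 1) = d ∧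
    HasSum (fun m : Fin (k + 1) → ℤ =>
      C m • ((w.map (rhoSF s)).prod *
        (Psi nabla s (m 0) * (List.ofFn fun j : Fin k => Phi s (m j.succ)).prod))) x

/-- `±`type CLR extended terms with `N_F = 1`, of total degrees in `D`: sums over `k` of
`∑ C'_{m n₁ ⋯ n_k}(ρ_±(θ_±)) Ψ_{±m} Φ_{±n₁} ⋯ Φ_{±n_k}`, where every coefficient of `C'`, expanded
in powers of the `ρ^i_±(θ_±)`, is a TILC satisfying the cyclic Leibniz rule. -/
def IsCLRExtended {N : ℕ} (nabla : ℤ → ℂ) (s : Sgn) (D : Set ℕ) (x : Series N) : Prop :=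
  ∀ d : ℕ, (d ∈ D → homogPart d x ∈ Submodule.span ℂ {y | IsCLRMonomial nabla s d y}) ∧
    (d ∉ D → homogPart d x = 0)

end LatticeSusy

/-!
On superfields the supercharge `Q_r` acts as the derivative `∂/∂θ_r`. A local functional is
therefore determined by its Taylor coefficients at `θ_± = 0`, where it is an arbitrary local,
translation invariant coefficient function in the component fields (`LocalCoeffs.isLoc`);
conversely such a function is lifted back to a local functional by replacing every letter with its
superfield (`IsLoc.exists_lift`). Closedness under both supercharges says that `S'` is free of `θ`,
while at `θ = 0` the integral `∫ d²θ T` becomes `-Q₊Q₋T`, and `∫ d²θ θ_∓ C` becomes, up to sign,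
`Q_± C`. What has to be shown is a cohomological statement about `Q₊` and `Q₋` on local coefficient
functions, one degree at a time.

Call `φ_s, F_s, χ_s, χ̄_s, ρ_s, ζ_s` the letters of label `s`. There is an odd derivation `K_s`
which undoes the ultralocal part of `Q_s`: its anticommutator with `Q_s` counts the letters of
label `s`, and it anticommutes with `Q_{-s}`. So a closed function in which both labels occur is
`Q₊Q₋`-exact (`IsLoc.eq_QD_QD`), and one in which only the label `s` occurs is `Q_s A` with `Q_{-s}
A = 0` and `A` of the same label (`IsLoc.eq_QD`). On letters of label `s`, the operator `Q_{-s}` is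
a Koszul differential which sends `χ_s` to `∇φ_s` and `F_s` to `∇χ̄_s`, up to factors. The function
`A` has fermion number `1`, so it contains at least one `χ_s`. If it contains exactly one, and no
`F_s`, then it is linear in `χ_s` with coefficients in `φ_s` and `ρ_s`, and `Q_{-s} A = 0` is
exactly the cyclic Leibniz rule (`isCLR_of_closed`, `IsLoc.exists_clr_lift`). If the number of
letters `χ_s` and `F_s` is at least two, then `A` is `Q_{-s}`-exact (`IsLoc.exists_primitive`), and
`Q_s A` is again `Q₊Q₋`-exact.

The last exactness is where analysis enters. The symbol of `∇` vanishes somewhere on the unit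
circle, because `∇` annihilates constants; hence `∇` has no translation invariant inverse with
decaying coefficients, and the usual Koszul homotopy is not available on local functions. Decaying
sequences are better behaved. The symbol is holomorphic near the unit circle and does not vanish
identically, so it has no zeros on nearby circles, and its Laurent expansions on the two sides of
the unit circle can be combined into a kernel which inverts `∇` on sequences with slow exponential
decay away from the origin and preserves that decay (`IsDifferenceOperator.exists_inverse`). The
corresponding homotopy has an anticommutator with `Q_{-s}` which acts on linear functions by an
idempotent, so that a polynomial in it vanishes on the coefficients of interest. This yields
primitives for coefficient functions decaying away from the origin (`exists_primitive`). The first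
variation `∂A/∂a`, for a letter `a` at the origin, is of this kind: locality of `A` becomes decay
away from the origin. Translating primitives of the first variation over the lattice and
contracting them with the letters, as in Euler's formula for homogeneous functions (`euler`,
`LinDer.Adm.app_euler`), gives a primitive of a nonzero multiple of `A` which is translation
invariant and local.
-/

namespace LatticeSusy

variable {N : ℕ}

/-! ### Words and letters -/

/-- A family of numbers indexed by words: the Taylor coefficients of a formal series when it is
graded symmetric. -/
abbrev Raw (N : ℕ) := List (Gen N) → ℂ

/-- The site of a lattice field; constants and `θ_±` have none. -/
def Gen.site : Gen N → Option ℤ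
  | Gen.phi _ n => some n
  | Gen.chibar _ n => some n
  | Gen.chi _ n => some n
  | Gen.F _ n => some n
  | Gen.rho _ _ => none
  | Gen.zeta _ _ => none
  | Gen.theta _ => none

/-- The distance of a letter from the origin of the lattice; it is `0` for letters without site. -/
def Gen.sz (a : Gen N) : ℝ := match a.site with
  | some n => |(n : ℝ)|
  | none => 0

/-- The sum of the distances of the letters of a word from the origin. -/
def wsz (w : List (Gen N)) : ℝ := (w.map Gen.sz).sum

theorem Gen.sz_nonneg (a : Gen N) : 0 ≤ a.sz := by
  unfold Gen.sz; split <;> simp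

@[simp] theorem wsz_cons (a : Gen N) (w : List (Gen N)) : wsz (a :: w) = a.sz + wsz w := by
  simp [wsz]

@[simp] theorem wsz_nil : wsz ([] : List (Gen N)) = 0 := rfl

theorem wsz_nonneg (w : List (Gen N)) : 0 ≤ wsz w := by
  induction w with
  | nil => simp
  | cons a w ih => rw [wsz_cons]; have := a.sz_nonneg; linarith

/-- An odd derivation of the algebra that is linear in the generators, recorded by its columns: the
generator `a` occurs with coefficient `ker a n` in the image of the generator `src a n`, and
in no other image. -/
structure LinDer (N : ℕ) where
  src : Gen N → ℤ → Gen N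
  ker : Gen N → ℤ → ℂ

/-- The linear functional by which the derivation acts on the first letter `a` of a word. -/
noncomputable def LinDer.col (M : LinDer N) (a : Gen N) (u : Gen N → ℂ) : ℂ :=
  ∑' n : ℤ, M.ker a n * u (M.src a n)

/-- The sign for moving an odd operator past the letter `a`. -/
def Gen.sg (a : Gen N) : ℂ := if a.odd then -1 else 1

/-- The action of an odd linear derivation on Taylor coefficients, from
`∂_a (M f) = ∑_b M_{ba} ∂_b f + (-1)^{|a|} M (∂_a f)`. -/
noncomputable def LinDer.app (M : LinDer N) : Raw N → Raw N
  | _, [] => 0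
  | f, a :: w => M.col a (fun b => f (b :: w)) + a.sg * M.app (rawD a f) w

theorem LinDer.app_nil (M : LinDer N) (f : Raw N) : M.app f [] = 0 := by
  simp [LinDer.app]

theorem LinDer.app_cons (M : LinDer N) (f : Raw N) (a : Gen N) (w : List (Gen N)) :
    M.app f (a :: w) = M.col a (fun b => f (b :: w)) + a.sg * M.app (rawD a f) w := by
  rw [LinDer.app]

theorem Gen.sg_sq (a : Gen N) : a.sg * a.sg = 1 := by
  unfold Gen.sg; split_ifs <;> norm_num

theorem Gen.norm_sg (a : Gen N) : ‖a.sg‖ = 1 := by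
  unfold Gen.sg; split_ifs <;> norm_num

/-- The derivation changes the parity of every generator. -/
def LinDer.IsOdd (M : LinDer N) : Prop :=
  ∀ a n, M.ker a n ≠ 0 → (M.src a n).odd = !a.odd

/-! ### Bounds that make the infinite sums converge

`T` is a set of admissible rates of exponential decay; `{0}` stands for boundedness, `Set.Ioi 0` for
exponential decay away from the origin. -/

/-- In each length, the coefficients are bounded by `L * exp (-t * wsz w)` with some rate `t ∈ T`.
-/
def Tame (T : Set ℝ) (f : Raw N) : Prop :=
  ∀ d : ℕ, ∃ t ∈ T, ∃ L : ℝ, 0 ≤ L ∧ ∀ w, w.length = d → ‖f w‖ ≤ L * Real.exp (-(t * wsz w))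

/-- The same bound for functions of one letter. -/
def UTame (T : Set ℝ) (u : Gen N → ℂ) : Prop :=
  ∃ t ∈ T, ∃ B : ℝ, 0 ≤ B ∧ ∀ b, ‖u b‖ ≤ B * Real.exp (-(t * b.sz))

/-- The same bound for families indexed by a letter, jointly in the letter and the word. -/
def JTame (T : Set ℝ) (F : Gen N → Raw N) : Prop :=
  ∀ d : ℕ, ∃ t ∈ T, ∃ L : ℝ, 0 ≤ L ∧
    ∀ b w, w.length = d → ‖F b w‖ ≤ L * Real.exp (-(t * wsz (b :: w)))

/-- The columns of the derivation are summable against the weights, with uniform bounds. -/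
def LinDer.Adm (M : LinDer N) (T : Set ℝ) : Prop :=
  ∀ t ∈ T, ∃ t' ∈ T, ∃ G : ℝ, 0 ≤ G ∧ ∀ a,
    Summable (fun n => ‖M.ker a n‖ * Real.exp (-(t * (M.src a n).sz))) ∧
    ∑' n, ‖M.ker a n‖ * Real.exp (-(t * (M.src a n).sz)) ≤ G * Real.exp (-(t' * a.sz))

theorem exp_rate_le {s t x : ℝ} (h : s ≤ t) (hx : 0 ≤ x) :
    Real.exp (-(t * x)) ≤ Real.exp (-(s * x)) := by
  apply Real.exp_le_exp.mpr
  have := mul_le_mul_of_nonneg_right h hx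
  linarith

theorem min_mem_rates {T : Set ℝ} {s t : ℝ} (hs : s ∈ T) (ht : t ∈ T) : min s t ∈ T := by
  rcases min_choice s t with h | h <;> rw [h] <;> assumption

theorem Tame.add {T : Set ℝ} {f g : Raw N} (hf : Tame T f) (hg : Tame T g) : Tame T (f + g) := by
  intro d
  obtain ⟨s, hs, L, hL, h1⟩ := hf d
  obtain ⟨t, ht, L', hL', h2⟩ := hg d
  refine ⟨min s t, min_mem_rates hs ht, L + L', by positivity, fun w hw => ?_⟩
  calc ‖(f + g) w‖ ≤ ‖f w‖ + ‖g w‖ := norm_add_le _ _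
    _ ≤ L * Real.exp (-(s * wsz w)) + L' * Real.exp (-(t * wsz w)) :=
        add_le_add (h1 w hw) (h2 w hw)
    _ ≤ L * Real.exp (-(min s t * wsz w)) + L' * Real.exp (-(min s t * wsz w)) :=
        add_le_add
          (mul_le_mul_of_nonneg_left (exp_rate_le (min_le_left _ _) (wsz_nonneg w)) hL)
          (mul_le_mul_of_nonneg_left (exp_rate_le (min_le_right _ _) (wsz_nonneg w)) hL')
    _ = _ := by ring

theorem Tame.smul {T : Set ℝ} {f : Raw N} (hf : Tame T f) (c : ℂ) : Tame T (c • f) := by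
  intro d
  obtain ⟨s, hs, L, hL, h1⟩ := hf d
  refine ⟨s, hs, ‖c‖ * L, by positivity, fun w hw => ?_⟩
  rw [Pi.smul_apply, smul_eq_mul, norm_mul, mul_assoc]
  exact mul_le_mul_of_nonneg_left (h1 w hw) (norm_nonneg c)

theorem Tame.zero {T : Set ℝ} (hT : T.Nonempty) : Tame T (0 : Raw N) := by
  intro d
  obtain ⟨t, ht⟩ := hT
  exact ⟨t, ht, 0, le_rfl, fun w _ => by simp⟩

theorem Tame.rawD {T : Set ℝ} {f : Raw N} (hf : Tame T f) (a : Gen N) : Tame T (rawD a f) := by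
  intro d
  obtain ⟨s, hs, L, hL, h1⟩ := hf (d + 1)
  refine ⟨s, hs, L * Real.exp (-(s * a.sz)), by positivity, fun w hw => ?_⟩
  refine (h1 (a :: w) (by simp [hw])).trans (le_of_eq ?_)
  rw [wsz_cons, mul_assoc, ← Real.exp_add]; congr 2; ring

theorem Tame.mono_of_le {T : Set ℝ} {f g : Raw N} (hf : Tame T f) (h : ∀ w, ‖g w‖ ≤ ‖f w‖) :
    Tame T g := by
  intro d
  obtain ⟨s, hs, L, hL, h1⟩ := hf d
  exact ⟨s, hs, L, hL, fun w hw => (h w).trans (h1 w hw)⟩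

theorem Tame.bounded {f : Raw N} (hf : Tame (Set.Ioi 0) f) : Tame {0} f := by
  intro d
  obtain ⟨s, hs, L, hL, h1⟩ := hf d
  refine ⟨0, Set.mem_singleton 0, L, hL, fun w hw => (h1 w hw).trans ?_⟩
  exact mul_le_mul_of_nonneg_left (exp_rate_le (le_of_lt hs) (wsz_nonneg w)) hL

theorem Tame.utame {T : Set ℝ} {f : Raw N} (hf : Tame T f) (w : List (Gen N)) :
    UTame T (fun b => f (b :: w)) := by
  obtain ⟨s, hs, L, hL, h1⟩ := hf (w.length + 1)
  refine ⟨s, hs, L * Real.exp (-(s * wsz w)), by positivity, fun b => ?_⟩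
  refine (h1 (b :: w) (by simp)).trans (le_of_eq ?_)
  rw [wsz_cons, mul_assoc, ← Real.exp_add]; congr 2; ring

theorem Tame.jtame {T : Set ℝ} {f : Raw N} (hf : Tame T f) : JTame T (fun b => LatticeSusy.rawD b f) := by
  intro d
  obtain ⟨s, hs, L, hL, h1⟩ := hf (d + 1)
  exact ⟨s, hs, L, hL, fun b w hw => h1 (b :: w) (by simp [hw])⟩

theorem JTame.tame {T : Set ℝ} {F : Gen N → Raw N} (hF : JTame T F) (b : Gen N) : Tame T (F b) := by
  intro d
  obtain ⟨s, hs, L, hL, h1⟩ := hF d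
  refine ⟨s, hs, L * Real.exp (-(s * b.sz)), by positivity, fun w hw => ?_⟩
  refine (h1 b w hw).trans (le_of_eq ?_)
  rw [wsz_cons, mul_assoc, ← Real.exp_add]; congr 2; ring

theorem JTame.utame {T : Set ℝ} {F : Gen N → Raw N} (hF : JTame T F) (w : List (Gen N)) :
    UTame T (fun b => F b w) := by
  obtain ⟨s, hs, L, hL, h1⟩ := hF w.length
  refine ⟨s, hs, L * Real.exp (-(s * wsz w)), by positivity, fun b => ?_⟩
  refine (h1 b w rfl).trans (le_of_eq ?_)
  rw [wsz_cons, mul_assoc, ← Real.exp_add]; congr 2; ring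

theorem JTame.rawD {T : Set ℝ} {F : Gen N → Raw N} (hF : JTame T F) (a : Gen N) :
    JTame T (fun b => rawD a (F b)) := by
  intro d
  obtain ⟨s, hs, L, hL, h1⟩ := hF (d + 1)
  refine ⟨s, hs, L * Real.exp (-(s * a.sz)), by positivity, fun b w hw => ?_⟩
  refine (h1 b (a :: w) (by simp [hw])).trans (le_of_eq ?_)
  rw [wsz_cons, wsz_cons, wsz_cons, mul_assoc, ← Real.exp_add]; congr 2; ring

/-! ### Columns of derivations -/

theorem LinDer.col_summable_of_bound {M : LinDer N} {a : Gen N} {u : Gen N → ℂ} {t B : ℝ}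
    (hs : Summable (fun n => ‖M.ker a n‖ * Real.exp (-(t * (M.src a n).sz))))
    (hu : ∀ b, ‖u b‖ ≤ B * Real.exp (-(t * b.sz))) :
    Summable (fun n => ‖M.ker a n * u (M.src a n)‖) ∧
    ∑' n, ‖M.ker a n * u (M.src a n)‖ ≤
      B * ∑' n, ‖M.ker a n‖ * Real.exp (-(t * (M.src a n).sz)) := by
  have key : ∀ n, ‖M.ker a n * u (M.src a n)‖ ≤
      B * (‖M.ker a n‖ * Real.exp (-(t * (M.src a n).sz))) := fun n => by
    rw [norm_mul]
    calc _ ≤ ‖M.ker a n‖ * (B * Real.exp (-(t * (M.src a n).sz))) :=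
          mul_le_mul_of_nonneg_left (hu _) (norm_nonneg _)
      _ = _ := by ring
  have s1 := Summable.of_nonneg_of_le (fun n => norm_nonneg _) key (hs.mul_left B)
  refine ⟨s1, ?_⟩
  rw [← tsum_mul_left]
  exact s1.tsum_le_tsum key (hs.mul_left B)

theorem LinDer.Adm.summable {M : LinDer N} {T : Set ℝ} (hM : M.Adm T) {u : Gen N → ℂ}
    (hu : UTame T u) (a : Gen N) : Summable (fun n => M.ker a n * u (M.src a n)) := by
  obtain ⟨t, ht, B, hB, h⟩ := hu
  obtain ⟨t', _, G, _, h'⟩ := hM t ht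
  exact (LinDer.col_summable_of_bound (h' a).1 h).1.of_norm

theorem LinDer.col_bound {M : LinDer N} {a : Gen N} {u : Gen N → ℂ} {t B C : ℝ} (hB : 0 ≤ B)
    (hs : Summable (fun n => ‖M.ker a n‖ * Real.exp (-(t * (M.src a n).sz))) ∧
      ∑' n, ‖M.ker a n‖ * Real.exp (-(t * (M.src a n).sz)) ≤ C)
    (hu : ∀ b, ‖u b‖ ≤ B * Real.exp (-(t * b.sz))) : ‖M.col a u‖ ≤ B * C := by
  obtain ⟨s1, s2⟩ := LinDer.col_summable_of_bound hs.1 hu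
  exact (norm_tsum_le_tsum_norm s1).trans (s2.trans (mul_le_mul_of_nonneg_left hs.2 hB))

theorem LinDer.Adm.utame {M : LinDer N} {T : Set ℝ} (hM : M.Adm T) {u : Gen N → ℂ}
    (hu : UTame T u) : UTame T (fun a => M.col a u) := by
  obtain ⟨t, ht, B, hB, h⟩ := hu
  obtain ⟨t', ht', G, hG, h'⟩ := hM t ht
  refine ⟨t', ht', B * G, by positivity, fun a => ?_⟩
  rw [mul_assoc]
  exact LinDer.col_bound hB (h' a) h

theorem LinDer.Adm.col_add {M : LinDer N} {T : Set ℝ} (hM : M.Adm T) {u v : Gen N → ℂ}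
    (hu : UTame T u) (hv : UTame T v) (a : Gen N) :
    M.col a (fun b => u b + v b) = M.col a u + M.col a v := by
  unfold LinDer.col
  rw [← (hM.summable hu a).tsum_add (hM.summable hv a)]
  simp only [mul_add]

theorem LinDer.col_mul_left (M : LinDer N) (c : ℂ) (u : Gen N → ℂ) (a : Gen N) :
    M.col a (fun b => c * u b) = c * M.col a u := by
  unfold LinDer.col
  rw [← tsum_mul_left]
  congr 1; funext n; ring

/-- A sign that depends only on the parity is constant along a column. -/
theorem LinDer.IsOdd.col_twist {M : LinDer N} (hM : M.IsOdd) (a : Gen N) (c : Gen N → ℂ) (c' : ℂ)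
    (h : ∀ b : Gen N, b.odd = (!a.odd) → c b = c') (u : Gen N → ℂ) :
    M.col a (fun b => c b * u b) = c' * M.col a u := by
  rw [← LinDer.col_mul_left]
  unfold LinDer.col
  congr 1; funext n
  by_cases hk : M.ker a n = 0
  · simp [hk]
  · simp only [h _ (hM a n hk)]

theorem LinDer.col_zero (M : LinDer N) (a : Gen N) : M.col a (fun _ => 0) = 0 := by
  simp [LinDer.col]

/-- Two columns can be summed in either order. -/
theorem LinDer.Adm.col_comm {M M' : LinDer N} {T : Set ℝ} (hM : M.Adm T) (hM' : M'.Adm T)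
    {F : Gen N → Gen N → ℂ} {t B : ℝ} (ht : t ∈ T)
    (hF : ∀ b b', ‖F b b'‖ ≤ B * (Real.exp (-(t * b.sz)) * Real.exp (-(t * b'.sz))))
    (a a' : Gen N) :
    M.col a (fun b => M'.col a' (fun b' => F b b')) =
      M'.col a' (fun b' => M.col a (fun b => F b b')) := by
  obtain ⟨_, _, _, _, h⟩ := hM t ht
  obtain ⟨_, _, _, _, h'⟩ := hM' t ht
  have hs : Summable (Function.uncurry fun n m : ℤ =>
      M.ker a n * (M'.ker a' m * F (M.src a n) (M'.src a' m))) := by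
    apply Summable.of_norm_bounded (((h a).1.mul_of_nonneg (h' a').1
      (fun n => by positivity) (fun n => by positivity)).mul_left B)
    rintro ⟨n, m⟩
    have e := hF (M.src a n) (M'.src a' m)
    have e2 : ‖M.ker a n‖ * (‖M'.ker a' m‖ * ‖F (M.src a n) (M'.src a' m)‖) ≤
        ‖M.ker a n‖ * (‖M'.ker a' m‖ *
          (B * (Real.exp (-(t * (M.src a n).sz)) * Real.exp (-(t * (M'.src a' m).sz))))) := by
      gcongr
    rw [Function.uncurry_apply_pair, norm_mul, norm_mul]
    refine e2.trans (le_of_eq ?_)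
    ring
  have e := hs.tsum_comm
  unfold LinDer.col
  simp only [← tsum_mul_left]
  rw [← e]
  refine tsum_congr fun m => tsum_congr fun n => ?_
  ring

/-! ### The action on words -/

/-- A linear derivation with summable columns preserves exponential decay on words of a fixed
length; the new rate and constant depend only on the length and the old rate, not on the series. -/
theorem LinDer.Adm.app_bound {M : LinDer N} {T : Set ℝ} (hM : M.Adm T) (d : ℕ) :
    ∀ t ∈ T, ∃ t' ∈ T, ∃ G : ℝ, 0 ≤ G ∧ ∀ (f : Raw N) (L : ℝ), 0 ≤ L →
      (∀ w, w.length = d → ‖f w‖ ≤ L * Real.exp (-(t * wsz w))) →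
      ∀ w, w.length = d → ‖M.app f w‖ ≤ L * G * Real.exp (-(t' * wsz w)) := by
  induction d with
  | zero =>
    intro t ht
    refine ⟨t, ht, 0, le_rfl, fun f L hL _ w hw => ?_⟩
    rw [List.length_eq_zero_iff] at hw
    subst hw
    simp [LinDer.app_nil]
  | succ d ih =>
    intro t ht
    obtain ⟨t1, ht1, G1, hG1, h1⟩ := ih t ht
    obtain ⟨t2, ht2, G2, hG2, h2⟩ := hM t ht
    refine ⟨min t (min t1 t2), min_mem_rates ht (min_mem_rates ht1 ht2), G1 + G2, by positivity,
      fun f L hL hf w hw => ?_⟩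
    obtain _ | ⟨a, w⟩ := w
    · simp at hw
    have hw' : w.length = d := by simpa using hw
    set m := min t (min t1 t2)
    have e0 : Real.exp (-(t * wsz w)) ≤ Real.exp (-(m * wsz w)) :=
      exp_rate_le (min_le_left _ _) (wsz_nonneg w)
    have e0' : Real.exp (-(t * a.sz)) ≤ Real.exp (-(m * a.sz)) :=
      exp_rate_le (min_le_left _ _) a.sz_nonneg
    have e1 : Real.exp (-(t1 * wsz w)) ≤ Real.exp (-(m * wsz w)) :=
      exp_rate_le ((min_le_right _ _).trans (min_le_left _ _)) (wsz_nonneg w)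
    have e2 : Real.exp (-(t2 * a.sz)) ≤ Real.exp (-(m * a.sz)) :=
      exp_rate_le ((min_le_right _ _).trans (min_le_right _ _)) a.sz_nonneg
    have hs : ∀ s : ℝ, Real.exp (-(s * wsz (a :: w))) =
        Real.exp (-(s * a.sz)) * Real.exp (-(s * wsz w)) := fun s => by
      rw [wsz_cons, ← Real.exp_add]; congr 1; ring
    have b1 : ‖M.col a (fun b => f (b :: w))‖ ≤
        (L * Real.exp (-(t * wsz w))) * (G2 * Real.exp (-(t2 * a.sz))) := by
      refine LinDer.col_bound (by positivity) (h2 a) (fun b => ?_)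
      refine (hf (b :: w) (by simp [hw'])).trans (le_of_eq ?_)
      rw [wsz_cons, mul_assoc, ← Real.exp_add]; congr 2; ring
    have b2 : ‖M.app (rawD a f) w‖ ≤
        (L * Real.exp (-(t * a.sz))) * G1 * Real.exp (-(t1 * wsz w)) := by
      refine h1 (rawD a f) _ (by positivity) (fun v hv => ?_) w hw'
      refine (hf (a :: v) (by simp [hv])).trans (le_of_eq ?_)
      rw [wsz_cons, mul_assoc, ← Real.exp_add]; congr 2; ring
    rw [LinDer.app_cons, hs]
    calc _ ≤ ‖M.col a (fun b => f (b :: w))‖ + ‖M.app (rawD a f) w‖ := by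
          refine (norm_add_le _ _).trans (le_of_eq ?_)
          rw [norm_mul, Gen.norm_sg, one_mul]
      _ ≤ (L * Real.exp (-(m * wsz w))) * (G2 * Real.exp (-(m * a.sz))) +
          (L * Real.exp (-(m * a.sz))) * G1 * Real.exp (-(m * wsz w)) := by
          refine add_le_add (b1.trans ?_) (b2.trans ?_) <;> gcongr
      _ = _ := by ring

theorem LinDer.Adm.tame {M : LinDer N} {T : Set ℝ} (hM : M.Adm T) {f : Raw N} (hf : Tame T f) :
    Tame T (M.app f) := by
  intro d
  obtain ⟨t, ht, L, hL, h⟩ := hf d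
  obtain ⟨t', ht', G, hG, h'⟩ := hM.app_bound d t ht
  exact ⟨t', ht', L * G, by positivity, h' f L hL h⟩

theorem LinDer.Adm.app_add {M : LinDer N} {T : Set ℝ} (hM : M.Adm T) {f g : Raw N}
    (hf : Tame T f) (hg : Tame T g) : M.app (f + g) = M.app f + M.app g := by
  funext w
  induction w generalizing f g with
  | nil => simp [LinDer.app_nil]
  | cons a w ih =>
    have e : rawD a (f + g) = rawD a f + rawD a g := rfl
    have e2 := hM.col_add (hf.utame w) (hg.utame w) a
    rw [LinDer.app_cons, e, ih (hf.rawD a) (hg.rawD a), Pi.add_apply, Pi.add_apply,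
      LinDer.app_cons, LinDer.app_cons]
    simp only [Pi.add_apply]
    rw [e2]
    ring

theorem LinDer.app_smul (M : LinDer N) (c : ℂ) (f : Raw N) : M.app (c • f) = c • M.app f := by
  funext w
  induction w generalizing f with
  | nil => simp [LinDer.app_nil]
  | cons a w ih =>
    rw [LinDer.app_cons, rawD_smul, ih, Pi.smul_apply, Pi.smul_apply, LinDer.app_cons]
    simp only [Pi.smul_apply, smul_eq_mul]
    rw [LinDer.col_mul_left]; ring

theorem LinDer.app_zero (M : LinDer N) : M.app 0 = 0 := by
  simpa using M.app_smul 0 0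

/-- A derivation commutes with summation along a column. -/
theorem LinDer.Adm.app_col {M M' : LinDer N} {T : Set ℝ} (hM : M.Adm T) (hM' : M'.Adm T)
    {F : Gen N → Raw N} (hF : JTame T F) (a : Gen N) (w : List (Gen N)) :
    M'.app (fun v => M.col a (fun b => F b v)) w = M.col a (fun b => M'.app (F b) w) := by
  induction w generalizing F with
  | nil => simp [LinDer.app_nil, LinDer.col_zero]
  | cons e w ih =>
    rw [LinDer.app_cons]
    have e1 : rawD e (fun v => M.col a (fun b => F b v)) =
        fun v => M.col a (fun b => rawD e (F b) v) := rfl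
    rw [e1, ih (hF.rawD e)]
    obtain ⟨t, ht, L, hL, h⟩ := hF (w.length + 1)
    have hb : ∀ b b' : Gen N, ‖F b (b' :: w)‖ ≤
        (L * Real.exp (-(t * wsz w))) * (Real.exp (-(t * b.sz)) * Real.exp (-(t * b'.sz))) := by
      intro b b'
      refine (h b (b' :: w) (by simp)).trans (le_of_eq ?_)
      rw [wsz_cons, wsz_cons, mul_assoc, ← Real.exp_add, ← Real.exp_add]; congr 2; ring
    rw [← hM.col_comm hM' ht hb]
    have u1 : UTame T (fun b => M'.col e (fun b' => F b (b' :: w))) := by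
      obtain ⟨t', ht', G, hG, h'⟩ := hM' t ht
      refine ⟨t, ht, (L * Real.exp (-(t * wsz w))) * (G * Real.exp (-(t' * e.sz))), by positivity,
        fun b => ?_⟩
      refine (LinDer.col_bound (B := (L * Real.exp (-(t * wsz w))) * Real.exp (-(t * b.sz)))
        (by positivity) (h' e) (fun b' => ?_)).trans (le_of_eq (by ring))
      exact (hb b b').trans (le_of_eq (by ring))
    have u2 : UTame T (fun b => e.sg * M'.app (rawD e (F b)) w) := by
      obtain ⟨s, hs, L1, hL1, h1⟩ := hF.rawD e w.length
      obtain ⟨s', hs', G, hG, h'⟩ := hM'.app_bound w.length s hs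
      refine ⟨s, hs, L1 * G * Real.exp (-(s' * wsz w)), by positivity, fun b => ?_⟩
      rw [norm_mul, Gen.norm_sg, one_mul]
      refine (h' (rawD e (F b)) (L1 * Real.exp (-(s * b.sz))) (by positivity) (fun v hv => ?_)
        w rfl).trans (le_of_eq (by ring))
      refine (h1 b v hv).trans (le_of_eq ?_)
      rw [wsz_cons, mul_assoc, ← Real.exp_add]; congr 2; ring
    rw [← LinDer.col_mul_left, ← hM.col_add u1 u2]
    congr 1

/-- The graded commutator of two odd derivations on the first letter of a word. -/
theorem LinDer.Adm.anticomm_cons {M M' : LinDer N} {T : Set ℝ} (hM : M.Adm T) (hM' : M'.Adm T)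
    (oM : M.IsOdd) (oM' : M'.IsOdd) {f : Raw N} (hf : Tame T f) (a : Gen N) (w : List (Gen N)) :
    (M.app (M'.app f) + M'.app (M.app f)) (a :: w) =
      M.col a (fun b => M'.col b (fun c => f (c :: w))) +
      M'.col a (fun b => M.col b (fun c => f (c :: w))) +
      (M.app (M'.app (rawD a f)) + M'.app (M.app (rawD a f))) w := by
  have key : ∀ {P P' : LinDer N}, P.Adm T → P'.Adm T → P.IsOdd →
      P.app (P'.app f) (a :: w) = P.col a (fun b => P'.col b (fun c => f (c :: w)))
        - a.sg * P'.app (fun v => P.col a (fun b => f (b :: v))) w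
        + a.sg * P.app (fun v => P'.col a (fun b => f (b :: v))) w
        + P.app (P'.app (rawD a f)) w := by
    intro P P' hP hP' oP
    rw [LinDer.app_cons]
    have c1 : P.col a (fun b => P'.app f (b :: w)) =
        P.col a (fun b => P'.col b (fun c => f (c :: w))) +
        (-a.sg) * P.col a (fun b => P'.app (rawD b f) w) := by
      have t1 : UTame T (fun b => P'.col b (fun c => f (c :: w))) := hP'.utame (hf.utame w)
      have t2 : UTame T (fun b => b.sg * P'.app (rawD b f) w) := by
        obtain ⟨s, hs, L1, hL1, h1⟩ := hf.jtame w.length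
        obtain ⟨s', hs', G, hG, h'⟩ := hP'.app_bound w.length s hs
        refine ⟨s, hs, L1 * G * Real.exp (-(s' * wsz w)), by positivity, fun b => ?_⟩
        rw [norm_mul, Gen.norm_sg, one_mul]
        refine (h' (rawD b f) (L1 * Real.exp (-(s * b.sz))) (by positivity) (fun v hv => ?_)
          w rfl).trans (le_of_eq (by ring))
        refine (h1 b v hv).trans (le_of_eq ?_)
        rw [wsz_cons, mul_assoc, ← Real.exp_add]; congr 2; ring
      rw [← oP.col_twist a (fun b => b.sg) (-a.sg), ← hP.col_add t1 t2]
      · congr 1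
      · intro b hb
        unfold Gen.sg; rw [hb]; cases a.odd <;> simp
    have c2 : rawD a (P'.app f) = (fun v => P'.col a (fun b => f (b :: v))) +
        a.sg • P'.app (rawD a f) := by
      funext v
      simp only [rawD, LinDer.app_cons, Pi.add_apply, Pi.smul_apply, smul_eq_mul]
    have t3 : Tame T (fun v => P'.col a (fun b => f (b :: v))) := by
      intro d
      obtain ⟨s, hs, L1, hL1, h1⟩ := hf (d + 1)
      obtain ⟨s', hs', G, hG, h'⟩ := hP' s hs
      refine ⟨s, hs, L1 * (G * Real.exp (-(s' * a.sz))), by positivity, fun v hv => ?_⟩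
      refine (LinDer.col_bound (B := L1 * Real.exp (-(s * wsz v))) (by positivity) (h' a)
        (fun b => ?_)).trans (le_of_eq (by ring))
      refine (h1 (b :: v) (by simp [hv])).trans (le_of_eq ?_)
      rw [wsz_cons, mul_assoc, ← Real.exp_add]; congr 2; ring
    rw [c1, c2, hP.app_add t3 ((hP'.tame (hf.rawD a)).smul _), LinDer.app_smul,
      show (fun v => P.col a (fun b => f (b :: v))) =
        (fun v => P.col a (fun b => rawD b f v)) from rfl, hP.app_col hP' hf.jtame]
    simp only [Pi.add_apply, Pi.smul_apply, smul_eq_mul]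
    linear_combination (P.app (P'.app (rawD a f)) w) * a.sg_sq
  rw [Pi.add_apply, Pi.add_apply, key hM hM' oM, key hM' hM oM']
  ring

/-- Two odd derivations anticommute if they do so on generators. -/
theorem LinDer.Adm.anticomm {M M' : LinDer N} {T : Set ℝ} (hM : M.Adm T) (hM' : M'.Adm T)
    (oM : M.IsOdd) (oM' : M'.IsOdd)
    (h : ∀ (a : Gen N) (u : Gen N → ℂ), UTame T u →
      M.col a (fun b => M'.col b u) + M'.col a (fun b => M.col b u) = 0)
    {f : Raw N} (hf : Tame T f) : M.app (M'.app f) + M'.app (M.app f) = 0 := by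
  funext w
  induction w generalizing f with
  | nil => simp [LinDer.app_nil]
  | cons a w ih =>
    rw [hM.anticomm_cons hM' oM oM' hf, h a _ (hf.utame w), ih (hf.rawD a)]
    simp

/-- The additive extension of a weight of letters to words. -/
def wt (ω : Gen N → ℤ) (w : List (Gen N)) : ℤ := (w.map ω).sum

@[simp] theorem wt_cons (ω : Gen N → ℤ) (a : Gen N) (w : List (Gen N)) :
    wt ω (a :: w) = ω a + wt ω w := by simp [wt]

@[simp] theorem wt_nil (ω : Gen N → ℤ) : wt ω ([] : List (Gen N)) = 0 := rfl

@[simp] theorem wt_append (ω : Gen N → ℤ) (v w : List (Gen N)) :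
    wt ω (v ++ w) = wt ω v + wt ω w := by simp [wt]

theorem wt_perm (ω : Gen N → ℤ) {v w : List (Gen N)} (h : v.Perm w) : wt ω v = wt ω w :=
  (h.map ω).sum_eq

/-- If the anticommutator of two odd derivations is diagonal on generators, it is diagonal on words.
-/
theorem LinDer.Adm.anticomm_diag {M M' : LinDer N} {T : Set ℝ} (hM : M.Adm T) (hM' : M'.Adm T)
    (oM : M.IsOdd) (oM' : M'.IsOdd) (ω : Gen N → ℤ)
    (h : ∀ (a : Gen N) (u : Gen N → ℂ), UTame T u →
      M.col a (fun b => M'.col b u) + M'.col a (fun b => M.col b u) = ω a * u a)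
    {f : Raw N} (hf : Tame T f) (w : List (Gen N)) :
    (M.app (M'.app f) + M'.app (M.app f)) w = wt ω w * f w := by
  induction w generalizing f with
  | nil => simp [LinDer.app_nil]
  | cons a w ih =>
    rw [hM.anticomm_cons hM' oM oM' hf, h a _ (hf.utame w), ih (hf.rawD a)]
    simp [rawD]; ring

/-! ### Weights -/

/-- `M` lowers the weight `ω` of Taylor coefficients by `c`. -/
def LinDer.Shifts (M : LinDer N) (ω : Gen N → ℤ) (c : ℤ) : Prop :=
  ∀ a n, M.ker a n ≠ 0 → ω (M.src a n) = ω a + c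

/-- The part of `f` on the words of weight `k`. -/
def proj (ω : Gen N → ℤ) (k : ℤ) (f : Raw N) : Raw N := fun w => if wt ω w = k then f w else 0

/-- `f` is supported on the words of weight `k`. -/
def HasWt (ω : Gen N → ℤ) (k : ℤ) (f : Raw N) : Prop := ∀ w, f w ≠ 0 → wt ω w = k

theorem hasWt_proj (ω : Gen N → ℤ) (k : ℤ) (f : Raw N) : HasWt ω k (proj ω k f) := by
  intro w hw
  by_contra h
  exact hw (by simp [proj, h])

theorem HasWt.proj_eq {ω : Gen N → ℤ} {k : ℤ} {f : Raw N} (h : HasWt ω k f) : proj ω k f = f := by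
  funext w
  by_cases h0 : f w = 0
  · simp [proj, h0]
  · simp [proj, h w h0]

theorem HasWt.proj {ω ω' : Gen N → ℤ} {k k' : ℤ} {f : Raw N} (h : HasWt ω k f) :
    HasWt ω k (proj ω' k' f) := by
  intro w hw
  apply h w
  intro h0
  apply hw
  simp [LatticeSusy.proj, h0]

theorem HasWt.rawD {ω : Gen N → ℤ} {k : ℤ} {f : Raw N} (h : HasWt ω k f) (a : Gen N) :
    HasWt ω (k - ω a) (rawD a f) := by
  intro w hw
  have := h (a :: w) hw
  rw [wt_cons] at this
  omega

theorem LinDer.Shifts.app_proj {M : LinDer N} {ω : Gen N → ℤ} {c : ℤ} (h : M.Shifts ω c) (k : ℤ)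
    (f : Raw N) : M.app (proj ω (k + c) f) = proj ω k (M.app f) := by
  funext w
  induction w generalizing f k with
  | nil => simp [LinDer.app_nil, proj]
  | cons a w ih =>
    have e1 : rawD a (proj ω (k + c) f) = proj ω (k - ω a + c) (rawD a f) := by
      funext v
      simp only [rawD, proj, wt_cons]
      have : ω a + wt ω v = k + c ↔ wt ω v = k - ω a + c := by constructor <;> intro h <;> omega
      simp only [this]
    have e2 : M.col a (fun b => proj ω (k + c) f (b :: w)) =
        if wt ω (a :: w) = k then M.col a (fun b => f (b :: w)) else 0 := by
      have : ∀ n, M.ker a n * proj ω (k + c) f (M.src a n :: w) =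
          (if wt ω (a :: w) = k then M.ker a n * f (M.src a n :: w) else 0) := by
        intro n
        by_cases hk : M.ker a n = 0
        · simp [hk]
        · have := h a n hk
          simp only [proj, wt_cons, this]
          have : ω a + c + wt ω w = k + c ↔ ω a + wt ω w = k := by
            constructor <;> intro h <;> omega
          simp only [this, mul_ite, mul_zero]
      simp only [LinDer.col, this]
      split_ifs <;> simp
    rw [LinDer.app_cons, e1, ih, e2]
    have : wt ω w = k - ω a ↔ wt ω (a :: w) = k := by
      rw [wt_cons]; constructor <;> intro h <;> omega
    simp only [proj, this, LinDer.app_cons]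
    split_ifs <;> simp

theorem LinDer.Shifts.hasWt {M : LinDer N} {ω : Gen N → ℤ} {c : ℤ} (h : M.Shifts ω c) {k : ℤ}
    {f : Raw N} (hf : HasWt ω (k + c) f) : HasWt ω k (M.app f) := by
  rw [← hf.proj_eq, h.app_proj]
  exact hasWt_proj _ _ _

theorem GradedSymm.proj {f : Raw N} (hf : GradedSymm f) (ω : Gen N → ℤ) (k : ℤ) :
    GradedSymm (proj ω k f) := by
  intro u v a b
  have : wt ω (u ++ a :: b :: v) = wt ω (u ++ b :: a :: v) := by
    simp only [wt_append, wt_cons]; ring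
  simp only [LatticeSusy.proj, this, hf u v a b]
  split_ifs <;> simp

theorem Tame.proj {T : Set ℝ} {f : Raw N} (hf : Tame T f) (ω : Gen N → ℤ) (k : ℤ) :
    Tame T (proj ω k f) :=
  hf.mono_of_le fun w => by
    unfold LatticeSusy.proj; split_ifs <;> simp

/-! ### Graded symmetry -/

theorem eps_of_odd_eq {a b b' : Gen N} (h : b'.odd = !b.odd) : eps a b' = eps a b * a.sg := by
  unfold eps Gen.sg; rw [h]; cases a.odd <;> cases b.odd <;> simp

theorem GradedSymm.col {f : Raw N} (hf : GradedSymm f) (M : LinDer N) (a : Gen N) :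
    GradedSymm (fun v => M.col a (fun b => f (b :: v))) := by
  intro u v c d
  show M.col a (fun b => f (b :: (u ++ c :: d :: v))) = _ * M.col a (fun b => f (b :: (u ++ d :: c :: v)))
  rw [← LinDer.col_mul_left]
  congr 1; funext b
  exact hf (b :: u) v c d

theorem GradedSymm.swap {f : Raw N} (hf : GradedSymm f) (a b : Gen N) :
    LatticeSusy.rawD b (LatticeSusy.rawD a f) =
      eps a b • LatticeSusy.rawD a (LatticeSusy.rawD b f) := by
  funext w; exact hf [] w a b

/-- An odd derivation maps coefficients of a formal series to coefficients of a formal series. -/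
theorem GradedSymm.app {M : LinDer N} (oM : M.IsOdd) {f : Raw N} (hf : GradedSymm f) :
    GradedSymm (M.app f) := by
  intro u
  induction u generalizing f with
  | nil =>
    intro v a b
    have key : ∀ a b : Gen N, M.col a (fun c => f (c :: b :: v)) =
        eps a b * b.sg * M.col a (fun c => LatticeSusy.rawD b f (c :: v)) := by
      intro a b
      rw [← oM.col_twist a (fun c => eps c b) (eps a b * b.sg)]
      · congr 1; funext c
        exact hf [] v c b
      · intro c hc
        rw [eps_comm c b, eps_comm a b]
        exact eps_of_odd_eq hc
    have key2 : ∀ a b : Gen N, M.col b (fun c => LatticeSusy.rawD a f (c :: v)) =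
        M.col b (fun c => f (a :: c :: v)) := fun a b => rfl
    have e1 : M.app f ([] ++ a :: b :: v) = M.col a (fun c => f (c :: b :: v)) +
        a.sg * (M.col b (fun c => LatticeSusy.rawD a f (c :: v)) +
          b.sg * M.app (LatticeSusy.rawD b (LatticeSusy.rawD a f)) v) := by
      rw [List.nil_append, LinDer.app_cons, LinDer.app_cons]
    have e2 : M.app f ([] ++ b :: a :: v) = M.col b (fun c => f (c :: a :: v)) +
        b.sg * (M.col a (fun c => LatticeSusy.rawD b f (c :: v)) +
          a.sg * M.app (LatticeSusy.rawD a (LatticeSusy.rawD b f)) v) := by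
      rw [List.nil_append, LinDer.app_cons, LinDer.app_cons]
    rw [e1, e2, key a b, key b a, hf.swap a b, LinDer.app_smul, Pi.smul_apply, smul_eq_mul,
      eps_comm b a]
    linear_combination (-(a.sg * M.col b fun c => LatticeSusy.rawD a f (c :: v))) * eps_sq a b
  | cons c u ih =>
    intro v a b
    rw [List.cons_append, List.cons_append, LinDer.app_cons, LinDer.app_cons, ih (hf.rawD c)]
    have := hf.col M c u v a b
    simp only at this
    rw [this]; ring

/-- Permuting the letters of a word changes a graded symmetric coefficient by a sign. -/
theorem GradedSymm.perm {v w : List (Gen N)} (h : v.Perm w) :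
    ∃ c : ℂ, ‖c‖ = 1 ∧ ∀ f : Raw N, GradedSymm f → f v = c * f w := by
  induction h with
  | nil => exact ⟨1, by simp, by simp⟩
  | cons a _ ih =>
    obtain ⟨c, hc, h⟩ := ih
    exact ⟨c, hc, fun f hf => h _ (hf.rawD a)⟩
  | swap a b l =>
    refine ⟨eps b a, ?_, fun f hf => hf [] l b a⟩
    unfold eps; split_ifs <;> simp
  | trans _ _ ih1 ih2 =>
    obtain ⟨c, hc, h⟩ := ih1
    obtain ⟨c', hc', h'⟩ := ih2
    exact ⟨c * c', by simp [hc, hc'], fun f hf => by rw [h f hf, h' f hf]; ring⟩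

theorem GradedSymm.norm_perm {v w : List (Gen N)} (h : v.Perm w) {f : Raw N} (hf : GradedSymm f) :
    ‖f v‖ = ‖f w‖ := by
  obtain ⟨c, hc, h⟩ := GradedSymm.perm h
  rw [h f hf, norm_mul, hc, one_mul]

theorem GradedSymm.eq_zero_of_perm {v w : List (Gen N)} (h : v.Perm w) {f : Raw N}
    (hf : GradedSymm f) (h0 : f w = 0) : f v = 0 := by
  rw [← norm_eq_zero, hf.norm_perm h, h0, norm_zero]

/-- No sign occurs if the word has at most one odd letter. -/
theorem GradedSymm.perm_eq {v w : List (Gen N)} (h : v.Perm w) (ho : v.countP Gen.odd ≤ 1)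
    {f : Raw N} (hf : GradedSymm f) : f v = f w := by
  induction h generalizing f with
  | nil => rfl
  | cons a _ ih =>
    exact ih (by rw [List.countP_cons] at ho; omega) (hf.rawD a)
  | swap a b l =>
    rw [show f (b :: a :: l) = _ from hf [] l b a]
    simp only [List.countP_cons] at ho
    have : eps b a = 1 := by
      unfold eps
      cases ha : a.odd <;> cases hb : b.odd <;> simp_all
    rw [this, one_mul]; rfl
  | trans p1 _ ih1 ih2 =>
    rw [ih1 ho hf, ih2 (by rw [← p1.countP_eq]; exact ho) hf]

/-- The square of an odd generator vanishes. -/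
theorem GradedSymm.eq_zero_of_repeat {f : Raw N} (hf : GradedSymm f) {a : Gen N}
    (ha : a.odd = true) (w : List (Gen N)) : f (a :: a :: w) = 0 := by
  have h := hf [] w a a
  simp only [List.nil_append, eps, ha, Bool.and_self, if_true] at h
  linear_combination h / 2

end LatticeSusy

namespace LatticeSusy

variable {N : ℕ}

/-! ### Products of generators and Taylor expansion -/

/-- The product of the generators in a word. -/
noncomputable def mono : List (Gen N) → Raw N
  | [] => rawOne
  | b :: l => rawMul (X b).1 (mono l)

theorem rawD_X (a b : Gen N) : rawD a (X b).1 = if a = b then rawOne else 0 := by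
  funext w
  show (if a :: w = [b] then (1 : ℂ) else 0) = _
  by_cases h : a = b
  · cases w <;> simp [h, rawOne]
  · simp [h]

theorem rawS_X (a b : Gen N) : rawS a (X b).1 = eps a b • (X b).1 := by
  funext w
  show (w.map (eps a)).prod * (if w = [b] then (1 : ℂ) else 0) =
    eps a b * (if w = [b] then (1 : ℂ) else 0)
  by_cases h : w = [b]
  · simp [h]
  · simp [h]

theorem X_mul_nil (b : Gen N) (h : Raw N) : rawMul (X b).1 h [] = 0 := by
  simp [rawMul, X]

theorem X_mul_cons (b : Gen N) (h : Raw N) (a : Gen N) (w : List (Gen N)) :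
    rawMul (X b).1 h (a :: w) =
      (if a = b then h w else 0) + eps a b * rawMul (X b).1 (rawD a h) w := by
  rw [rawMul, rawD_X, rawS_X, rawMul_smul_left]
  split_ifs
  · rw [rawOne_mul]; rfl
  · rw [rawMul_zero_left]; rfl

/-- The product with a generator is supported on the words that contain it. -/
theorem X_mul_support (b : Gen N) (h : Raw N) (w : List (Gen N)) (hw : rawMul (X b).1 h w ≠ 0) :
    ∃ w', w.Perm (b :: w') ∧ h w' ≠ 0 := by
  induction w generalizing h with
  | nil => exact absurd (X_mul_nil b h) hw
  | cons a w ih =>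
    rw [X_mul_cons] at hw
    by_cases h1 : rawMul (X b).1 (rawD a h) w = 0
    · rw [h1, mul_zero, add_zero] at hw
      split_ifs at hw with hab
      · exact ⟨w, by rw [hab], hw⟩
      · exact absurd rfl hw
    · obtain ⟨w', p, hw'⟩ := ih (rawD a h) h1
      exact ⟨a :: w', (p.cons a).trans (List.Perm.swap b a w'), hw'⟩

theorem mono_mul_support (l : List (Gen N)) (h : Raw N) (w : List (Gen N))
    (hw : rawMul (mono l) h w ≠ 0) : ∃ w', w.Perm (l ++ w') ∧ h w' ≠ 0 := by
  induction l generalizing w with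
  | nil => rw [mono, rawOne_mul] at hw; exact ⟨w, List.Perm.refl _, hw⟩
  | cons b l ih =>
    rw [mono, rawMul_assoc] at hw
    obtain ⟨w1, p1, h1⟩ := X_mul_support b _ w hw
    obtain ⟨w2, p2, h2⟩ := ih w1 h1
    exact ⟨w2, p1.trans (p2.cons b), h2⟩

theorem mono_support (l w : List (Gen N)) (hw : mono l w ≠ 0) : w.Perm l := by
  rw [← rawMul_one (mono l)] at hw
  obtain ⟨w', p, h⟩ := mono_mul_support l _ w hw
  cases w' with
  | nil => simpa using p
  | cons => exact absurd rfl h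

theorem mono_append (l l' : List (Gen N)) : mono (l ++ l') = rawMul (mono l) (mono l') := by
  induction l with
  | nil => rw [mono, rawOne_mul]; rfl
  | cons b l ih => rw [List.cons_append, mono, mono, ih, rawMul_assoc]

/-- The product is continuous in its left factor. -/
theorem rawMul_hasSum_left {I : Type*} {F : I → Raw N} {f : Raw N}
    (hF : ∀ w, HasSum (fun i => F i w) (f w)) (g : Raw N) (w : List (Gen N)) :
    HasSum (fun i => rawMul (F i) g w) (rawMul f g w) := by
  induction w generalizing F f g with
  | nil => simp only [rawMul]; exact (hF []).mul_right _
  | cons a w ih =>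
    simp only [rawMul]
    exact (ih (F := fun i => rawD a (F i)) (f := rawD a f) (fun v => hF (a :: v)) g).add
      (ih (F := fun i => rawS a (F i)) (f := rawS a f) (fun v => (hF v).mul_left _) _)

/-- The product is continuous in its right factor. -/
theorem rawMul_hasSum_right {I : Type*} {F : I → Raw N} {f : Raw N}
    (hF : ∀ w, HasSum (fun i => F i w) (f w)) (g : Raw N) (w : List (Gen N)) :
    HasSum (fun i => rawMul g (F i) w) (rawMul g f w) := by
  induction w generalizing F f g with
  | nil => simp only [rawMul]; exact (hF []).mul_left _
  | cons a w ih =>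
    simp only [rawMul]
    exact (ih hF (rawD a g)).add
      (ih (F := fun i => rawD a (F i)) (f := rawD a f) (fun v => hF (a :: v)) (rawS a g))

/-- Euler's identity for the letters `ℓ b`: the operator `∑_b ℓ_b ∂_{ℓ_b}` counts them. -/
theorem hasSum_euler {ι : Type*} {ℓ : ι → Gen N} (hℓ : Function.Injective ℓ) {ω : Gen N → ℤ}
    (h1 : ∀ b, ω (ℓ b) = 1) (h0 : ∀ a, (∀ b, ℓ b ≠ a) → ω a = 0) {h : Raw N} (hh : GradedSymm h)
    (w : List (Gen N)) :
    HasSum (fun b => rawMul (X (ℓ b)).1 (rawD (ℓ b) h) w) (wt ω w * h w) := by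
  induction w generalizing h with
  | nil => simp only [X_mul_nil]; simp
  | cons a w ih =>
    simp only [X_mul_cons]
    have e1 : ∀ b, eps a (ℓ b) * rawMul (X (ℓ b)).1 (rawD a (rawD (ℓ b) h)) w =
        rawMul (X (ℓ b)).1 (rawD (ℓ b) (rawD a h)) w := by
      intro b
      rw [hh.swap (ℓ b) a, rawMul_smul_right, Pi.smul_apply, smul_eq_mul, ← mul_assoc,
        eps_comm (ℓ b) a, eps_sq, one_mul]
    simp only [e1]
    rw [wt_cons, Int.cast_add, add_mul]
    refine HasSum.add ?_ (ih (hh.rawD a))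
    by_cases ha : ∃ b, ℓ b = a
    · obtain ⟨b, rfl⟩ := ha
      rw [h1]
      have := hasSum_single (f := fun b' => if ℓ b = ℓ b' then rawD (ℓ b') h w else 0) b
        (fun b' hb' => if_neg fun e => hb' (hℓ e).symm)
      simpa [rawD] using this
    · push Not at ha
      rw [h0 a ha]
      have : ∀ b, (if a = ℓ b then rawD (ℓ b) h w else 0) = 0 := fun b => if_neg (ha b).symm
      simp only [this]
      simp

theorem finite_letters {ι : Type*} {ℓ : ι → Gen N} (hℓ : Function.Injective ℓ) (m : ℕ)
    (w : List (Gen N)) : {a : Fin m → ι | ∀ i, ℓ (a i) ∈ w}.Finite := by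
  have : {b : ι | ℓ b ∈ w}.Finite :=
    (List.finite_toSet w).preimage hℓ.injOn
  exact Set.Finite.pi' fun _ => this

/-- Taylor expansion in the letters `ℓ b`, of a series homogeneous of degree `m` in them. -/
theorem hasSum_taylor {ι : Type*} {ℓ : ι → Gen N} (hℓ : Function.Injective ℓ) {ω : Gen N → ℤ}
    (h1 : ∀ b, ω (ℓ b) = 1) (h0 : ∀ a, (∀ b, ℓ b ≠ a) → ω a = 0) (m : ℕ) {h : Raw N}
    (hh : GradedSymm h) (hm : HasWt ω m h) (w : List (Gen N)) :
    HasSum (fun a : Fin m → ι => rawMul (mono (List.ofFn fun i => ℓ (a i)))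
      (fun v => h ((List.ofFn fun i => ℓ (a i)) ++ v)) w) (m.factorial * h w) := by
  induction m generalizing h w with
  | zero =>
    have : ∀ a : Fin 0 → ι, rawMul (mono (List.ofFn fun i => ℓ (a i)))
        (fun v => h ((List.ofFn fun i => ℓ (a i)) ++ v)) w = h w := by
      intro a
      simp only [List.ofFn_zero, mono, rawOne_mul, List.nil_append]
    simp only [this]
    simp
  | succ m ih =>
    have hD : ∀ b, HasWt ω m (rawD (ℓ b) h) := fun b => by
      have := hm.rawD (ℓ b)
      rw [h1] at this
      simpa using this
    -- the sum over the remaining letters, for fixed first letter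
    have inner : ∀ b, HasSum (fun a : Fin m → ι =>
        rawMul (mono (List.ofFn fun i => ℓ ((Fin.cons b a : Fin (m + 1) → ι) i)))
          (fun v => h ((List.ofFn fun i => ℓ ((Fin.cons b a : Fin (m + 1) → ι) i)) ++ v)) w)
        (m.factorial * rawMul (X (ℓ b)).1 (rawD (ℓ b) h) w) := by
      intro b
      have := rawMul_hasSum_right (f := (m.factorial : ℂ) • rawD (ℓ b) h)
        (fun v => ih (hh.rawD (ℓ b)) (hD b) v) (X (ℓ b)).1 w
      rw [rawMul_smul_right] at this
      simp only [List.ofFn_succ, Fin.cons_zero, Fin.cons_succ, mono, rawMul_assoc]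
      exact this
    have outer := (hasSum_euler hℓ h1 h0 hh w).mul_left (m.factorial : ℂ)
    have total : Summable (fun a : Fin (m + 1) → ι => rawMul (mono (List.ofFn fun i => ℓ (a i)))
        (fun v => h ((List.ofFn fun i => ℓ (a i)) ++ v)) w) := by
      apply summable_of_hasFiniteSupport
      refine (finite_letters hℓ (m + 1) w).subset fun a ha => ?_
      obtain ⟨w', p, _⟩ := mono_mul_support _ _ _ ha
      intro i
      rw [p.mem_iff, List.mem_append]
      exact Or.inl (List.mem_ofFn.mpr ⟨i, rfl⟩)
    have e := (Fin.consEquiv (fun _ : Fin (m + 1) => ι)).hasSum_iff.mpr total.hasSum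
    have e2 := HasSum.prod_fiberwise e inner
    have e3 := e2.unique outer
    have e4 : ((m + 1).factorial : ℂ) * h w = m.factorial * (wt ω w * h w) := by
      by_cases hw : h w = 0
      · simp [hw]
      · rw [hm w hw, Nat.factorial_succ]; push_cast; ring
    rw [e4, ← e3]
    exact total.hasSum

theorem HasWt.rawMul {ω : Gen N → ℤ} {i j : ℤ} {f g : Raw N} (hf : HasWt ω i f)
    (hg : HasWt ω j g) : HasWt ω (i + j) (rawMul f g) := by
  intro w hw
  induction w generalizing f g i j with
  | nil =>
    simp only [LatticeSusy.rawMul] at hw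
    have h1 := hf [] (left_ne_zero_of_mul hw)
    have h2 := hg [] (right_ne_zero_of_mul hw)
    simp at h1 h2 ⊢; omega
  | cons a w ih =>
    rw [LatticeSusy.rawMul] at hw
    rw [wt_cons]
    by_cases h : LatticeSusy.rawMul (LatticeSusy.rawD a f) g w = 0
    · rw [h, zero_add] at hw
      have hs : HasWt ω i (rawS a f) := fun v hv => hf v (right_ne_zero_of_mul hv)
      have := ih hs (hg.rawD a) hw
      omega
    · have := ih (hf.rawD a) hg h
      omega

theorem HasWt.add {ω : Gen N → ℤ} {i : ℤ} {f g : Raw N} (hf : HasWt ω i f)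
    (hg : HasWt ω i g) : HasWt ω i (f + g) := by
  intro w hw
  by_cases h : f w = 0
  · exact hg w (by simpa [h] using hw)
  · exact hf w h

theorem HasWt.smul {ω : Gen N → ℤ} {i : ℤ} {f : Raw N} (hf : HasWt ω i f) (c : ℂ) :
    HasWt ω i (c • f) := fun w hw => hf w (right_ne_zero_of_mul hw)

theorem hasWt_one (ω : Gen N → ℤ) : HasWt ω 0 (rawOne : Raw N) := by
  intro w hw
  cases w with
  | nil => rfl
  | cons => exact absurd rfl hw

theorem hasWt_X (ω : Gen N → ℤ) (a : Gen N) : HasWt ω (ω a) (X a).1 := by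
  intro w hw
  have : w = [a] := by
    by_contra h
    exact hw (if_neg h)
  simp [this]

theorem HasWt.hasSum {ω : Gen N → ℤ} {k : ℤ} {I : Type*} {F : I → Raw N} {f : Raw N}
    (hF : ∀ i, HasWt ω k (F i)) {w : List (Gen N)} (h : HasSum (fun i => F i w) (f w))
    (hw : f w ≠ 0) : wt ω w = k := by
  by_contra hne
  apply hw
  have : ∀ i, F i w = 0 := fun i => by
    by_contra h0; exact hne (hF i w h0)
  simp only [this] at h
  exact h.unique hasSum_zero

/-! ### The part without Grassmann variables -/

/-- The Grassmann variables `θ_±`. -/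
def Gen.isTheta : Gen N → Bool
  | Gen.theta _ => true
  | _ => false

/-- `f` and `g` agree at `θ_± = 0`. -/
def EqBody (f g : Raw N) : Prop := ∀ w, (∀ a ∈ w, a.isTheta = false) → f w = g w

theorem EqBody.rawMul {f f' g g' : Raw N} (hf : EqBody f f') (hg : EqBody g g') :
    EqBody (rawMul f g) (rawMul f' g') := by
  intro w
  induction w generalizing f f' g g' with
  | nil =>
    intro _
    simp only [LatticeSusy.rawMul, hf [] (by simp), hg [] (by simp)]
  | cons a w ih =>
    intro hw
    have ha : a.isTheta = false := hw a (by simp)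
    have hw' : ∀ b ∈ w, b.isTheta = false := fun b hb => hw b (by simp [hb])
    have d : ∀ {f f' : Raw N}, EqBody f f' → EqBody (rawD a f) (rawD a f') :=
      fun h v hv => h (a :: v) (by simpa [ha] using hv)
    have s : EqBody (rawS a f) (rawS a f') := fun v hv => by
      simp only [rawS, hf v hv]
    simp only [LatticeSusy.rawMul, ih (d hf) hg hw', ih s (d hg) hw']

theorem EqBody.refl (f : Raw N) : EqBody f f := fun _ _ => rfl

/-! ### Uniformly summable families of series -/

/-- In each length, the coefficients of the family are absolutely summable, with uniformly bounded
sums. -/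
def USummable {I : Type*} (F : I → Raw N) : Prop :=
  ∀ d : ℕ, ∃ G : ℝ, 0 ≤ G ∧ ∀ w, w.length = d →
    Summable (fun i => ‖F i w‖) ∧ ∑' i, ‖F i w‖ ≤ G

theorem norm_rawS (a : Gen N) (f : Raw N) (w : List (Gen N)) : ‖rawS a f w‖ = ‖f w‖ := by
  have : ‖(w.map (eps a)).prod‖ = 1 := by
    induction w with
    | nil => simp
    | cons b w ih =>
      rw [List.map_cons, List.prod_cons, norm_mul, ih, mul_one]
      unfold eps; split_ifs <;> simp
  rw [rawS, norm_mul, this, one_mul]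

/-- Products of two uniformly summable families, with a bound that depends only on the bounds of the
factors: that is what the induction on the length of the word needs, since `rawMul` splits off a
letter by replacing a factor with its derivative. -/
theorem usummable_rawMul_aux {I J : Type*} (d : ℕ) : ∀ A B : ℕ → ℝ, (∀ n, 0 ≤ A n) →
    (∀ n, 0 ≤ B n) → ∃ C : ℝ, 0 ≤ C ∧ ∀ (F : I → Raw N) (G : J → Raw N),
      (∀ d w, w.length = d → Summable (fun i => ‖F i w‖) ∧ ∑' i, ‖F i w‖ ≤ A d) →
      (∀ d w, w.length = d → Summable (fun i => ‖G i w‖) ∧ ∑' i, ‖G i w‖ ≤ B d) →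
      ∀ w, w.length = d → Summable (fun p : I × J => ‖rawMul (F p.1) (G p.2) w‖) ∧
        ∑' p : I × J, ‖rawMul (F p.1) (G p.2) w‖ ≤ C := by
  induction d with
  | zero =>
    intro A B hA hB
    refine ⟨A 0 * B 0, mul_nonneg (hA 0) (hB 0), fun F G h1 h2 w hw => ?_⟩
    rw [List.length_eq_zero_iff] at hw
    subst hw
    simp only [rawMul, norm_mul]
    have s1 := h1 0 [] rfl
    have s2 := h2 0 [] rfl
    have s3 := s1.1.mul_of_nonneg s2.1 (fun _ => norm_nonneg _) (fun _ => norm_nonneg _)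
    refine ⟨s3, ?_⟩
    rw [← s1.1.tsum_mul_tsum s2.1 s3]
    exact mul_le_mul s1.2 s2.2 (tsum_nonneg fun _ => norm_nonneg _) (hA 0)
  | succ d ih =>
    intro A B hA hB
    obtain ⟨C1, hC1, k1⟩ := ih (fun n => A (n + 1)) B (fun n => hA _) hB
    obtain ⟨C2, hC2, k2⟩ := ih A (fun n => B (n + 1)) hA (fun n => hB _)
    refine ⟨C1 + C2, by positivity, fun F G h1 h2 w hw => ?_⟩
    obtain _ | ⟨a, w⟩ := w
    · simp at hw
    have hw' : w.length = d := by simpa using hw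
    obtain ⟨s1, b1⟩ := k1 (fun i => rawD a (F i)) G
      (fun d v hv => h1 (d + 1) (a :: v) (by simp [hv])) h2 w hw'
    obtain ⟨s2, b2⟩ := k2 (fun i => rawS a (F i)) (fun j => rawD a (G j))
      (fun d v hv => by simpa only [norm_rawS] using h1 d v hv)
      (fun d v hv => h2 (d + 1) (a :: v) (by simp [hv])) w hw'
    have key : ∀ p : I × J, ‖rawMul (F p.1) (G p.2) (a :: w)‖ ≤
        ‖rawMul (rawD a (F p.1)) (G p.2) w‖ + ‖rawMul (rawS a (F p.1)) (rawD a (G p.2)) w‖ :=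
      fun p => norm_add_le _ _
    have s := Summable.of_nonneg_of_le (fun p => norm_nonneg _) key (s1.add s2)
    refine ⟨s, (s.tsum_le_tsum key (s1.add s2)).trans ?_⟩
    rw [s1.tsum_add s2]
    exact add_le_add b1 b2

theorem USummable.rawMul {I J : Type*} {F : I → Raw N} {G : J → Raw N} (hF : USummable F)
    (hG : USummable G) : USummable (fun p : I × J => rawMul (F p.1) (G p.2)) := by
  choose A hA h1 using hF
  choose B hB h2 using hG
  intro d
  obtain ⟨C, hC, h⟩ := usummable_rawMul_aux (N := N) (I := I) (J := J) d A B hA hB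
  exact ⟨C, hC, h F G h1 h2⟩

theorem USummable.reindex {I J : Type*} {F : I → Raw N} (hF : USummable F) (e : J ≃ I) :
    USummable (fun j => F (e j)) := by
  intro d
  obtain ⟨G, hG, h⟩ := hF d
  refine ⟨G, hG, fun w hw => ?_⟩
  have h1 : Summable ((fun i => ‖F i w‖) ∘ e) := e.summable_iff.mpr (h w hw).1
  refine ⟨h1, ?_⟩
  rw [e.tsum_eq (fun i => ‖F i w‖)]
  exact (h w hw).2

theorem USummable.smul {I : Type*} {F : I → Raw N} (hF : USummable F) {c : I → ℂ} {L : ℝ}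
    (hc : ∀ i, ‖c i‖ ≤ L) : USummable (fun i => c i • F i) := by
  intro d
  obtain ⟨G, hG, h⟩ := hF d
  refine ⟨|L| * G, by positivity, fun w hw => ?_⟩
  have key : ∀ i, ‖(c i • F i) w‖ ≤ |L| * ‖F i w‖ := fun i => by
    rw [Pi.smul_apply, norm_smul]
    exact mul_le_mul_of_nonneg_right ((hc i).trans (le_abs_self L)) (norm_nonneg _)
  have sl : Summable (fun i => |L| * ‖F i w‖) := Summable.mul_left |L| (h w hw).1
  have s := Summable.of_nonneg_of_le (fun p => norm_nonneg _) key sl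
  refine ⟨s, (s.tsum_le_tsum key sl).trans ?_⟩
  rw [tsum_mul_left]
  exact mul_le_mul_of_nonneg_left (h w hw).2 (abs_nonneg L)

theorem USummable.add {I : Type*} {F F' : I → Raw N} (hF : USummable F) (hF' : USummable F') :
    USummable (fun i => F i + F' i) := by
  intro d
  obtain ⟨G, hG, h⟩ := hF d
  obtain ⟨G', hG', h'⟩ := hF' d
  refine ⟨G + G', by positivity, fun w hw => ?_⟩
  have key : ∀ i, ‖(F i + F' i) w‖ ≤ ‖F i w‖ + ‖F' i w‖ := fun i => norm_add_le _ _
  have s' := (h w hw).1.add (h' w hw).1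
  have s := Summable.of_nonneg_of_le (fun p => norm_nonneg _) key s'
  refine ⟨s, (s.tsum_le_tsum key s').trans ?_⟩
  rw [(h w hw).1.tsum_add (h' w hw).1]
  exact add_le_add (h w hw).2 (h' w hw).2

theorem tame_zero_iff {f : Raw N} :
    Tame {0} f ↔ ∀ d : ℕ, ∃ G : ℝ, 0 ≤ G ∧ ∀ w, w.length = d → ‖f w‖ ≤ G := by
  refine forall_congr' fun d => ?_
  simp

theorem Tame.usummable {f : Raw N} (hf : Tame {0} f) : USummable (fun _ : Unit => f) := by
  rw [tame_zero_iff] at hf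
  intro d
  obtain ⟨G, hG, h⟩ := hf d
  exact ⟨G, hG, fun w hw => ⟨(hasSum_unique _).summable, by simpa using h w hw⟩⟩

theorem USummable.const_mul {I : Type*} {F : I → Raw N} (hF : USummable F) {f : Raw N}
    (hf : Tame {0} f) : USummable (fun i => LatticeSusy.rawMul f (F i)) :=
  (hf.usummable.rawMul hF).reindex (Equiv.punitProd I).symm

theorem USummable.tame_sum {I : Type*} {F : I → Raw N} (hF : USummable F) :
    Tame {0} (fun w => ∑' i, F i w) := by
  rw [tame_zero_iff]
  intro d
  obtain ⟨G, hG, h⟩ := hF d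
  exact ⟨G, hG, fun w hw => (norm_tsum_le_tsum_norm (h w hw).1).trans (h w hw).2⟩

theorem USummable.tame {I : Type*} {F : I → Raw N} (hF : USummable F) (i : I) :
    Tame {0} (F i) := by
  rw [tame_zero_iff]
  intro d
  obtain ⟨G, hG, h⟩ := hF d
  exact ⟨G, hG, fun w hw => ((h w hw).1.le_tsum i fun _ _ => norm_nonneg _).trans (h w hw).2⟩

theorem USummable.hasSum {I : Type*} {F : I → Raw N} (hF : USummable F) (w : List (Gen N)) :
    HasSum (fun i => F i w) (∑' i, F i w) := by
  obtain ⟨G, hG, h⟩ := hF w.length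
  exact (h w rfl).1.of_norm.hasSum

theorem Tame.rawMul {f g : Raw N} (hf : Tame {0} f) (hg : Tame {0} g) :
    Tame {0} (rawMul f g) :=
  (hg.usummable.const_mul hf).tame ()

theorem tame_one : Tame {0} (rawOne : Raw N) := by
  rw [tame_zero_iff]
  intro d
  exact ⟨1, by norm_num, fun w _ => by cases w <;> simp [rawOne]⟩

/-- A bounded derivation can be applied term by term to a uniformly summable family. -/
theorem USummable.app {M : LinDer N} (hM : M.Adm {0}) {I : Type*} {F : I → Raw N}
    (hF : USummable F) (w : List (Gen N)) :
    HasSum (fun i => M.app (F i) w) (M.app (fun v => ∑' i, F i v) w) := by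
  induction w generalizing F with
  | nil => simp only [LinDer.app_nil]; exact hasSum_zero
  | cons a w ih =>
    have hD : USummable (fun i => rawD a (F i)) := by
      intro d
      obtain ⟨G, hG, h⟩ := hF (d + 1)
      exact ⟨G, hG, fun v hv => h (a :: v) (by simp [hv])⟩
    have e6 : HasSum (fun i => a.sg * M.app (rawD a (F i)) w)
        (a.sg * M.app (rawD a (fun v => ∑' i, F i v)) w) := HasSum.mul_left a.sg (ih hD)
    suffices e7 : HasSum (fun i => M.col a (fun b => F i (b :: w)))
        (M.col a (fun b => ∑' i, F i (b :: w))) by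
      have e8 := HasSum.add e7 e6
      simpa only [LinDer.app_cons] using e8
    obtain ⟨t', ht', G', hG', h'⟩ := hM 0 (Set.mem_singleton 0)
    obtain ⟨G, hG, h⟩ := hF (w.length + 1)
    have hs : Summable (fun p : ℤ × I => M.ker a p.1 * F p.2 (M.src a p.1 :: w)) := by
      have hb : Summable (fun n => ‖M.ker a n‖) := by simpa using (h' a).1
      have hl : ∀ n, (M.src a n :: w).length = w.length + 1 := fun n => rfl
      have h1 : ∀ n, Summable (fun i => ‖M.ker a n * F i (M.src a n :: w)‖) := fun n => by
        simp only [norm_mul]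
        exact Summable.mul_left ‖M.ker a n‖ (h (M.src a n :: w) (hl n)).1
      have h2 : ∀ n, ∑' i, ‖M.ker a n * F i (M.src a n :: w)‖ ≤ ‖M.ker a n‖ * G := fun n => by
        simp only [norm_mul]
        rw [tsum_mul_left]
        exact mul_le_mul_of_nonneg_left (h (M.src a n :: w) (hl n)).2 (norm_nonneg _)
      have h3 : Summable (fun n => ∑' i, ‖M.ker a n * F i (M.src a n :: w)‖) :=
        Summable.of_nonneg_of_le (fun n => tsum_nonneg fun _ => norm_nonneg _) h2 (hb.mul_right G)
      exact ((summable_prod_of_nonneg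
        (f := fun p : ℤ × I => ‖M.ker a p.1 * F p.2 (M.src a p.1 :: w)‖)
        (fun p => norm_nonneg _)).mpr ⟨h1, h3⟩).of_norm
    have e1 := hs.hasSum
    have e0 : ∀ n, HasSum (fun i => M.ker a n * F i (M.src a n :: w))
        (M.ker a n * ∑' i, F i (M.src a n :: w)) :=
      fun n => HasSum.mul_left (M.ker a n) (hF.hasSum (M.src a n :: w))
    have e2 := HasSum.prod_fiberwise e1 e0
    have hs' : Summable (fun p : I × ℤ => M.ker a p.2 * F p.1 (M.src a p.2 :: w)) := by
      have h4 := hs.comp_injective (Equiv.prodComm I ℤ).injective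
      simpa only [Function.comp_def, Equiv.prodComm_apply, Prod.fst_swap, Prod.snd_swap] using h4
    have e3 := hs'.hasSum
    have f3 : ∀ i, HasSum (fun n => M.ker a n * F i (M.src a n :: w))
        (M.col a (fun b => F i (b :: w))) := fun i =>
      Summable.hasSum (f := fun n => M.ker a n * F i (M.src a n :: w)) (hs'.prod_factor i)
    have e4 := HasSum.prod_fiberwise e3 f3
    have e5 : ∑' p : I × ℤ, M.ker a p.2 * F p.1 (M.src a p.2 :: w) =
        M.col a (fun b => ∑' i, F i (b :: w)) := by
      have e9 := (Equiv.prodComm I ℤ).tsum_eq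
        (fun p : ℤ × I => M.ker a p.1 * F p.2 (M.src a p.1 :: w))
      exact e9.trans e2.tsum_eq.symm
    rw [← e5]
    exact e4

end LatticeSusy

namespace LatticeSusy

variable {N : ℕ}

/-! ### Convergence of series of formal power series -/

theorem series_one_val : (1 : Series N).1 = rawOne := rfl

theorem hasSum_series_iff {I : Type*} {F : I → Series N} {x : Series N} :
    HasSum F x ↔ ∀ w, HasSum (fun i => (F i).1 w) (x.1 w) := by
  have hi : Topology.IsInducing ((Series N).subtype) := Topology.IsInducing.subtypeVal
  rw [← hi.hasSum_iff, Pi.hasSum]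
  rfl

theorem hasSum_series_of_summable {I : Type*} {F : I → Series N}
    (h : ∀ w, Summable (fun i => (F i).1 w)) :
    ∃ x : Series N, HasSum F x ∧ ∀ w, x.1 w = ∑' i, (F i).1 w := by
  refine ⟨⟨fun w => ∑' i, (F i).1 w, fun u v a b => ?_⟩, ?_, fun w => rfl⟩
  · simp only
    rw [← tsum_mul_left]
    exact tsum_congr fun i => (F i).2 u v a b
  · rw [hasSum_series_iff]
    exact fun w => (h w).hasSum

/-! ### Linear elements -/

/-- `Y` is a (possibly infinite) linear combination of generators of parity `p`. -/
def IsLin (p : Bool) (Y : Raw N) : Prop := ∀ w, Y w ≠ 0 → ∃ a, w = [a] ∧ a.odd = p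

theorem isLin_X (a : Gen N) : IsLin a.odd (X a).1 := by
  intro w hw
  refine ⟨a, ?_, rfl⟩
  by_contra h
  exact hw (if_neg h)

theorem IsLin.smul {p : Bool} {Y : Raw N} (h : IsLin p Y) (c : ℂ) : IsLin p (c • Y) :=
  fun w hw => h w (right_ne_zero_of_mul hw)

theorem IsLin.nil {p : Bool} {Y : Raw N} (h : IsLin p Y) : Y [] = 0 := by
  by_contra h0
  obtain ⟨a, ha, _⟩ := h _ h0
  exact absurd ha (by simp)

theorem IsLin.rawD {p : Bool} {Y : Raw N} (h : IsLin p Y) (a : Gen N) :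
    rawD a Y = Y [a] • rawOne := by
  funext w
  cases w with
  | nil => simp [LatticeSusy.rawD, rawOne]
  | cons b w =>
    have : Y (a :: b :: w) = 0 := by
      by_contra h0
      obtain ⟨a, ha, _⟩ := h _ h0
      simp at ha
    simp [LatticeSusy.rawD, rawOne, this]

theorem IsLin.ext {p q : Bool} {Y Z : Raw N} (hY : IsLin p Y) (hZ : IsLin q Z)
    (h : ∀ a, Y [a] = Z [a]) : Y = Z := by
  funext w
  by_cases h0 : Y w = 0
  · by_cases h1 : Z w = 0
    · rw [h0, h1]
    · obtain ⟨a, rfl, _⟩ := hZ w h1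
      exact h a
  · obtain ⟨a, rfl, _⟩ := hY w h0
    exact h a

theorem IsLin.app {p : Bool} {Y : Raw N} (h : IsLin p Y) {M : LinDer N} (hM : M.IsOdd) :
    IsLin (!p) (M.app Y) := by
  intro w hw
  have hone : M.app (rawOne : Raw N) = 0 := by
    funext w
    induction w with
    | nil => exact LinDer.app_nil _ _
    | cons a w ih =>
      have : LatticeSusy.rawD a (rawOne : Raw N) = 0 := rfl
      rw [LinDer.app_cons, this, LinDer.app_zero]
      simp [rawOne, LinDer.col]
  obtain _ | ⟨a, w⟩ := w
  · exact absurd (LinDer.app_nil _ _) hw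
  rw [LinDer.app_cons, h.rawD, LinDer.app_smul, hone] at hw
  cases w with
  | nil =>
    refine ⟨a, rfl, ?_⟩
    by_contra hne
    apply hw
    have : ∀ n, M.ker a n * Y [M.src a n] = 0 := fun n => by
      by_cases hk : M.ker a n = 0
      · simp [hk]
      · by_cases hY : Y [M.src a n] = 0
        · simp [hY]
        · obtain ⟨b, hb, hbp⟩ := h _ hY
          have hb' : M.src a n = b := by simpa using hb
          have := hM a n hk
          rw [hb', hbp] at this
          exact absurd (by rw [this]; simp) hne
    simp [LinDer.col, this]
  | cons b w =>
    exfalso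
    apply hw
    have : ∀ n, Y (M.src a n :: b :: w) = 0 := fun n => by
      by_contra h0
      obtain ⟨c, hc, _⟩ := h _ h0
      simp at hc
    simp [LinDer.col, this]

theorem LinDer.app_singleton (M : LinDer N) (Y : Raw N) (a : Gen N) :
    M.app Y [a] = M.col a (fun b => Y [b]) := by
  rw [LinDer.app_cons, LinDer.app_nil]; simp

theorem X_val (g a : Gen N) : (X g).1 [a] = if a = g then 1 else 0 := by
  show (if [a] = [g] then (1 : ℂ) else 0) = _
  simp

/-- The series `(∇A)_n` is linear, with coefficient `∇(n - m)` at the letter `A_m`. -/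
theorem applyNabla_coeff (nabla : ℤ → ℂ) {A : ℤ → Gen N} (hA : Function.Injective A) (n : ℤ) :
    (∀ w, (applyNabla nabla A n).1 w ≠ 0 → ∃ m, w = [A m]) ∧
    ∀ m, (applyNabla nabla A n).1 [A m] = nabla (n - m) := by
  have hc : ∀ m w, (nabla (n - m) • X (A m) : Series N).1 w =
      if w = [A m] then nabla (n - m) else 0 := by
    intro m w
    show nabla (n - m) * (if w = [A m] then (1 : ℂ) else 0) = _
    split_ifs <;> simp
  have hs : ∀ w, Summable (fun m => (nabla (n - m) • X (A m) : Series N).1 w) := by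
    intro w
    apply summable_of_hasFiniteSupport
    refine Set.Subsingleton.finite ?_
    intro m hm m' hm'
    simp only [Function.mem_support, hc] at hm hm'
    have h1 : w = [A m] := by by_contra h; simp [h] at hm
    have h2 : w = [A m'] := by by_contra h; simp [h] at hm'
    rw [h1] at h2
    exact hA (by simpa using h2)
  obtain ⟨x, hx, hv⟩ := hasSum_series_of_summable hs
  have hx' : applyNabla nabla A n = x := hx.tsum_eq
  rw [hx']
  refine ⟨fun w hw => ?_, fun m => ?_⟩
  · rw [hv] at hw
    obtain ⟨m, hm⟩ : ∃ m, (nabla (n - m) • X (A m) : Series N).1 w ≠ 0 := by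
      by_contra! h
      exact hw (by simp only [h, tsum_zero])
    refine ⟨m, ?_⟩
    by_contra h
    rw [hc, if_neg h] at hm
    exact hm rfl
  · rw [hv, tsum_eq_single m]
    · rw [hc, if_pos rfl]
    · intro m' hm'
      rw [hc, if_neg]
      intro h
      exact hm' (hA (by simpa using h)).symm

theorem isLin_applyNabla (nabla : ℤ → ℂ) {A : ℤ → Gen N} (hA : Function.Injective A) {p : Bool}
    (hp : ∀ m, (A m).odd = p) (n : ℤ) : IsLin p (applyNabla nabla A n).1 := by
  intro w hw
  obtain ⟨m, hm⟩ := (applyNabla_coeff nabla hA n).1 w hw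
  exact ⟨A m, hm, hp m⟩

theorem applyNabla_coeff_of_ne (nabla : ℤ → ℂ) {A : ℤ → Gen N} (hA : Function.Injective A) (n : ℤ)
    {a : Gen N} (ha : ∀ m, A m ≠ a) : (applyNabla nabla A n).1 [a] = 0 := by
  by_contra h
  obtain ⟨m, hm⟩ := (applyNabla_coeff nabla hA n).1 _ h
  exact ha m (by simpa using hm.symm)

/-- Sums of products of linear elements with derivatives, as in the definition of the supercharges,
act on Taylor coefficients as the derivation with the corresponding columns. -/
theorem hasSum_linear_derivation {I J K : Type*} [Fintype J] [Fintype K] (M : LinDer N)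
    (Y : I → J → Raw N) (b : I → J → Gen N) (hY : ∀ i j, IsLin (!(b i j).odd) (Y i j))
    (Z : K → Raw N) (c : K → Gen N) (hZ : ∀ k, IsLin (!(c k).odd) (Z k))
    (hcol : ∀ a u, UTame {0} u → HasSum (fun i => ∑ j, Y i j [a] * u (b i j))
      (M.col a u - ∑ k, Z k [a] * u (c k)))
    {f : Raw N} (hf : GradedSymm f) (ht : Tame {0} f) (w : List (Gen N)) :
    HasSum (fun i => ∑ j, rawMul (Y i j) (rawD (b i j) f) w)
      (M.app f w - ∑ k, rawMul (Z k) (rawD (c k) f) w) := by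
  have step : ∀ (Y : Raw N) (b : Gen N), IsLin (!b.odd) Y → ∀ (f : Raw N), GradedSymm f →
      ∀ a w, rawMul Y (rawD b f) (a :: w) =
        Y [a] * f (b :: w) + a.sg * rawMul Y (rawD b (rawD a f)) w := by
    intro Y b hY f hf a w
    have hS : rawS a Y = (eps a b * a.sg) • Y := by
      funext v
      by_cases h0 : Y v = 0
      · simp [rawS, h0]
      · obtain ⟨e, rfl, he⟩ := hY v h0
        simp [rawS, eps_of_odd_eq he]
    rw [rawMul, hY.rawD, hS, rawMul_smul_left, rawMul_smul_left, rawOne_mul, hf.swap b a,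
      rawMul_smul_right]
    simp only [Pi.smul_apply, smul_eq_mul]
    rw [eps_comm b a]
    have := eps_sq a b
    rw [show rawD b f w = f (b :: w) from rfl]
    linear_combination (a.sg * rawMul Y (rawD b (rawD a f)) w) * this
  induction w generalizing f with
  | nil =>
    have h1 : ∀ i j, rawMul (Y i j) (rawD (b i j) f) [] = 0 := fun i j => by
      rw [rawMul, (hY i j).nil, zero_mul]
    have h2 : ∀ k, rawMul (Z k) (rawD (c k) f) [] = 0 := fun k => by
      rw [rawMul, (hZ k).nil, zero_mul]
    simp only [h1, h2, LinDer.app_nil, Finset.sum_const_zero, sub_zero]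
    exact hasSum_zero
  | cons a w ih =>
    simp only [fun i j => step _ _ (hY i j) f hf a w, fun k => step _ _ (hZ k) f hf a w,
      Finset.sum_add_distrib, ← Finset.mul_sum]
    have e1 := HasSum.add (hcol a _ (ht.utame w))
      (HasSum.mul_left a.sg (ih (hf.rawD a) (ht.rawD a)))
    convert e1 using 1
    rw [LinDer.app_cons]; ring

/-! ### The supercharges on Taylor coefficients -/

@[simp] theorem Sgn.opp_opp (s : Sgn) : s.opp.opp = s := by cases s <;> rfl

@[simp] theorem Sgn.opp_ne (s : Sgn) : s.opp ≠ s := by cases s <;> simp [Sgn.opp]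

@[simp] theorem Sgn.ne_opp (s : Sgn) : s ≠ s.opp := by cases s <;> simp [Sgn.opp]

theorem Sgn.eq_or_opp (s t : Sgn) : t = s ∨ t = s.opp := by cases s <;> cases t <;> simp [Sgn.opp]

@[simp] theorem Sgn.toC_opp (s : Sgn) : s.opp.toC = -s.toC := by
  cases s <;> simp [Sgn.opp, Sgn.toC]

theorem Sgn.toC_sq (s : Sgn) : s.toC * s.toC = 1 := by cases s <;> simp [Sgn.toC]

theorem Sgn.norm_toC (s : Sgn) : ‖s.toC‖ = 1 := by cases s <;> simp [Sgn.toC]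

/-- The supercharge `Q'_s` as a linear derivation. -/
noncomputable def QD (nabla : ℤ → ℂ) (s : Sgn) : LinDer N where
  src
    | Gen.chibar s' m, n => if s' = s then Gen.phi s' m else Gen.F s' n
    | Gen.F s' m, _ => Gen.chi s' m
    | Gen.phi s' _, n => Gen.chi s' n
    | Gen.zeta s' i, _ => Gen.rho s' i
    | a, _ => a
  ker
    | Gen.chibar s' m, n =>
        if s' = s then (if n = 0 then s.toC else 0) else -Complex.I * nabla (n - m)
    | Gen.F s' _, n => if s' = s then (if n = 0 then 1 else 0) else 0
    | Gen.phi s' m, n => if s' = s then 0 else -(s.toC * Complex.I) * nabla (n - m)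
    | Gen.zeta s' _, n => if s' = s then (if n = 0 then s.toC else 0) else 0
    | _, _ => 0

section columns
variable (nabla : ℤ → ℂ) (s : Sgn) (u : Gen N → ℂ) (m : ℤ) (i : Fin N)

theorem QD_col_chibar : (QD nabla s).col (Gen.chibar s m) u = s.toC * u (Gen.phi s m) := by
  simp [LinDer.col, QD]

theorem QD_col_chibar_opp : (QD nabla s).col (Gen.chibar s.opp m) u =
    -Complex.I * ∑' n, nabla (n - m) * u (Gen.F s.opp n) := by
  simp only [LinDer.col, QD, Sgn.opp_ne, if_false, ← tsum_mul_left, mul_assoc]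

theorem QD_col_F : (QD nabla s).col (Gen.F s m) u = u (Gen.chi s m) := by
  simp [LinDer.col, QD]

theorem QD_col_F_opp : (QD nabla s).col (Gen.F s.opp m) u = 0 := by
  simp [LinDer.col, QD]

theorem QD_col_phi : (QD nabla s).col (Gen.phi s m) u = 0 := by
  simp [LinDer.col, QD]

theorem QD_col_phi_opp : (QD nabla s).col (Gen.phi s.opp m) u =
    -(s.toC * Complex.I) * ∑' n, nabla (n - m) * u (Gen.chi s.opp n) := by
  simp only [LinDer.col, QD, Sgn.opp_ne, if_false, ← tsum_mul_left, mul_assoc]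

theorem QD_col_chi (t : Sgn) : (QD nabla s).col (Gen.chi t m) u = 0 := by
  simp [LinDer.col, QD]

theorem QD_col_zeta : (QD nabla s).col (Gen.zeta s i) u = s.toC * u (Gen.rho s i) := by
  simp [LinDer.col, QD]

theorem QD_col_zeta_opp : (QD nabla s).col (Gen.zeta s.opp i) u = 0 := by
  simp [LinDer.col, QD]

theorem QD_col_rho (t : Sgn) : (QD nabla s).col (Gen.rho t i) u = 0 := by
  simp [LinDer.col, QD]

theorem QD_col_theta (t : Sgn) : (QD nabla s).col (Gen.theta t) u = 0 := by
  simp [LinDer.col, QD]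

end columns

theorem QD_isOdd (nabla : ℤ → ℂ) (s : Sgn) : (QD (N := N) nabla s).IsOdd := by
  intro a n h
  cases a with
  | phi => rfl
  | chibar s' m => simp only [QD]; split_ifs <;> rfl
  | chi => simp [QD] at h
  | F => rfl
  | rho => simp [QD] at h
  | zeta => rfl
  | theta => simp [QD] at h

/-- Weighted column sums of the difference operator: a rate `t` is kept up to a rate `t'` at which
`∇` is still summable. -/
theorem nabla_weighted {nabla : ℤ → ℂ} {t' t : ℝ} (h0 : 0 ≤ t') (hle : t' ≤ t)
    (hs : Summable (fun j : ℤ => ‖nabla j‖ * Real.exp (t' * |(j : ℝ)|))) (m : ℤ) :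
    Summable (fun n : ℤ => ‖nabla (n - m)‖ * Real.exp (-(t * |(n : ℝ)|))) ∧
    ∑' n : ℤ, ‖nabla (n - m)‖ * Real.exp (-(t * |(n : ℝ)|)) ≤
      (∑' j : ℤ, ‖nabla j‖ * Real.exp (t' * |(j : ℝ)|)) * Real.exp (-(t' * |(m : ℝ)|)) := by
  have hs' : Summable (fun n : ℤ => ‖nabla (n - m)‖ * Real.exp (t' * |((n - m : ℤ) : ℝ)|)) := by
    have h4 := hs.comp_injective (sub_left_injective (b := m))
    simpa only [Function.comp_def] using h4
  have key : ∀ n : ℤ, ‖nabla (n - m)‖ * Real.exp (-(t * |(n : ℝ)|)) ≤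
      (‖nabla (n - m)‖ * Real.exp (t' * |((n - m : ℤ) : ℝ)|)) * Real.exp (-(t' * |(m : ℝ)|)) := by
    intro n
    rw [mul_assoc, ← Real.exp_add]
    refine mul_le_mul_of_nonneg_left (Real.exp_le_exp.mpr ?_) (norm_nonneg _)
    have h1 : |(m : ℝ)| ≤ |((n - m : ℤ) : ℝ)| + |(n : ℝ)| := by
      push_cast
      have := abs_sub (n : ℝ) ((n : ℝ) - m)
      rw [sub_sub_cancel] at this
      linarith
    have h2 := mul_le_mul_of_nonneg_left h1 h0
    have h3 := mul_le_mul_of_nonneg_right hle (abs_nonneg (n : ℝ))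
    linarith
  have s1 := hs'.mul_right (Real.exp (-(t' * |(m : ℝ)|)))
  have s2 := Summable.of_nonneg_of_le (fun n => by positivity) key s1
  refine ⟨s2, (s2.tsum_le_tsum key s1).trans ?_⟩
  rw [tsum_mul_right]
  apply le_of_eq
  congr 1
  exact (Equiv.subRight m).tsum_eq (fun j : ℤ => ‖nabla j‖ * Real.exp (t' * |(j : ℝ)|))

/-- A column with a single entry, at the same site. -/
theorem single_column {c : ℂ} {C t t' x : ℝ} (hc : ‖c‖ ≤ C) (hle : t' ≤ t) (hx : 0 ≤ x)
    {k : ℤ → ℂ} {y : ℤ → ℝ} (hk : ∀ n, k n = if n = 0 then c else 0) (hy : ∀ n, y n = x) :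
    Summable (fun n => ‖k n‖ * Real.exp (-(t * y n))) ∧
    ∑' n, ‖k n‖ * Real.exp (-(t * y n)) ≤ C * Real.exp (-(t' * x)) := by
  have h := hasSum_single (f := fun n => ‖k n‖ * Real.exp (-(t * y n))) 0
    (fun n hn => by simp [hk, hn])
  refine ⟨h.summable, ?_⟩
  rw [h.tsum_eq, hk, hy]
  simp only [if_true]
  exact mul_le_mul hc (exp_rate_le hle hx) (Real.exp_pos _).le ((norm_nonneg c).trans hc)

theorem QD_adm_of_summable {nabla : ℤ → ℂ} {t' t : ℝ} (h0 : 0 ≤ t') (hle : t' ≤ t)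
    (hs : Summable (fun j : ℤ => ‖nabla j‖ * Real.exp (t' * |(j : ℝ)|))) (s : Sgn) :
    ∃ G : ℝ, 0 ≤ G ∧ ∀ a : Gen N,
      Summable (fun n => ‖(QD nabla s).ker a n‖ * Real.exp (-(t * ((QD nabla s).src a n).sz))) ∧
      ∑' n, ‖(QD nabla s).ker a n‖ * Real.exp (-(t * ((QD nabla s).src a n).sz)) ≤
        G * Real.exp (-(t' * a.sz)) := by
  set B := ∑' j : ℤ, ‖nabla j‖ * Real.exp (t' * |(j : ℝ)|) with hB
  have hB0 : 0 ≤ B := tsum_nonneg fun _ => by positivity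
  have zero : ∀ (x : ℝ) (y : ℤ → ℝ) (k : ℤ → ℂ), (∀ n, k n = 0) →
      Summable (fun n => ‖k n‖ * Real.exp (-(t * y n))) ∧
      ∑' n, ‖k n‖ * Real.exp (-(t * y n)) ≤ (1 + B) * Real.exp (-(t' * x)) := by
    intro x y k hk
    simp only [hk, norm_zero, zero_mul, tsum_zero]
    exact ⟨summable_zero, by positivity⟩
  have nab : ∀ (m : ℤ) (c : ℂ), ‖c‖ = 1 →
      Summable (fun n : ℤ => ‖c * nabla (n - m)‖ * Real.exp (-(t * |(n : ℝ)|))) ∧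
      ∑' n : ℤ, ‖c * nabla (n - m)‖ * Real.exp (-(t * |(n : ℝ)|)) ≤
        (1 + B) * Real.exp (-(t' * |(m : ℝ)|)) := by
    intro m c hc
    simp only [norm_mul, hc, one_mul]
    obtain ⟨h1, h2⟩ := nabla_weighted h0 hle hs m
    refine ⟨h1, h2.trans ?_⟩
    exact mul_le_mul_of_nonneg_right (by linarith) (Real.exp_pos _).le
  have h1B : (1 : ℝ) ≤ 1 + B := by linarith
  refine ⟨1 + B, by positivity, fun a => ?_⟩
  cases a with
  | phi s' m =>
    rcases Sgn.eq_or_opp s s' with rfl | rfl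
    · exact zero _ _ _ fun n => by simp [QD]
    · simp only [QD, Sgn.opp_ne, if_false]
      exact nab m _ (by simp [Sgn.norm_toC])
  | chibar s' m =>
    rcases Sgn.eq_or_opp s s' with rfl | rfl
    · exact single_column (c := s'.toC) (by rw [Sgn.norm_toC]; exact h1B) hle (Gen.sz_nonneg _)
        (fun n => by simp [QD]) (fun n => by simp [QD, Gen.sz, Gen.site])
    · simp only [QD, Sgn.opp_ne, if_false]
      exact nab m _ (by simp)
  | chi s' m => exact zero _ _ _ fun n => by simp [QD]
  | F s' m =>
    rcases Sgn.eq_or_opp s s' with rfl | rfl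
    · exact single_column (c := 1) (by simpa using h1B) hle (Gen.sz_nonneg _)
        (fun n => by simp [QD]) (fun n => by simp [QD, Gen.sz, Gen.site])
    · exact zero _ _ _ fun n => by simp [QD]
  | rho s' i => exact zero _ _ _ fun n => by simp [QD]
  | zeta s' i =>
    rcases Sgn.eq_or_opp s s' with rfl | rfl
    · exact single_column (c := s'.toC) (by rw [Sgn.norm_toC]; exact h1B) hle (Gen.sz_nonneg _)
        (fun n => by simp [QD]) (fun n => by simp [QD, Gen.sz, Gen.site])
    · exact zero _ _ _ fun n => by simp [QD]
  | theta s' => exact zero _ _ _ fun n => by simp [QD]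

theorem IsDifferenceOperator.decay {nabla : ℤ → ℂ} (h : IsDifferenceOperator nabla) :
    ∃ L M : ℝ, 0 < L ∧ 0 < M ∧ ∀ j : ℤ, ‖nabla j‖ ≤ L * Real.exp (-(M * |(j : ℝ)|)) := by
  obtain ⟨L, M, hL, hM, hd⟩ := h.tilc.decay
  refine ⟨L, M, hL, hM, fun j => ?_⟩
  have := hd ![j, 0] 0 1
  simpa using this

theorem summable_exp_neg_abs {c : ℝ} (hc : 0 < c) :
    Summable (fun n : ℤ => Real.exp (-(c * |(n : ℝ)|))) := by
  have h : Summable (fun n : ℕ => Real.exp (-(c * (n : ℝ)))) := by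
    have := Real.summable_exp_nat_mul_iff.mpr (neg_neg_of_pos hc)
    refine this.congr fun n => ?_
    congr 1; ring
  refine Summable.of_nat_of_neg ?_ ?_ <;> simpa using h

theorem summable_nabla_weighted {nabla : ℤ → ℂ} {L M t : ℝ} (htM : t < M)
    (h : ∀ j : ℤ, ‖nabla j‖ ≤ L * Real.exp (-(M * |(j : ℝ)|))) :
    Summable (fun j : ℤ => ‖nabla j‖ * Real.exp (t * |(j : ℝ)|)) := by
  refine Summable.of_nonneg_of_le (fun j => by positivity) (fun j => ?_)
    ((summable_exp_neg_abs (sub_pos.mpr htM)).mul_left L)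
  calc _ ≤ L * Real.exp (-(M * |(j : ℝ)|)) * Real.exp (t * |(j : ℝ)|) :=
        mul_le_mul_of_nonneg_right (h j) (Real.exp_pos _).le
    _ = _ := by rw [mul_assoc, ← Real.exp_add]; congr 2; ring

/-- The supercharges act on bounded series. -/
theorem QD_adm_zero {nabla : ℤ → ℂ} (h : IsDifferenceOperator nabla) (s : Sgn) :
    (QD (N := N) nabla s).Adm {0} := by
  obtain ⟨L, M, hL, hM, hd⟩ := h.decay
  intro t ht
  rw [Set.mem_singleton_iff] at ht
  subst ht
  exact ⟨0, Set.mem_singleton 0, QD_adm_of_summable le_rfl le_rfl (summable_nabla_weighted hM hd) s⟩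

/-- The supercharges preserve exponential decay, at a possibly smaller rate. -/
theorem QD_adm_pos {nabla : ℤ → ℂ} (h : IsDifferenceOperator nabla) (s : Sgn) :
    (QD (N := N) nabla s).Adm (Set.Ioi 0) := by
  obtain ⟨L, M, hL, hM, hd⟩ := h.decay
  intro t ht
  have ht : 0 < t := ht
  have hm : 0 < min t (M / 2) := lt_min ht (by positivity)
  exact ⟨min t (M / 2), hm, QD_adm_of_summable hm.le (min_le_left _ _)
    (summable_nabla_weighted (lt_of_le_of_lt (min_le_right _ _) (by linarith)) hd) s⟩

end LatticeSusy

namespace LatticeSusy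

variable {N : ℕ}

/-! ### The supercharges as linear derivations -/

theorem phi_injective (s : Sgn) : Function.Injective (Gen.phi (N := N) s) :=
  fun _ _ h => by simpa using h

theorem chibar_injective (s : Sgn) : Function.Injective (Gen.chibar (N := N) s) :=
  fun _ _ h => by simpa using h

/-- On bounded series the supercharge is the linear derivation `QD`. -/
theorem Q_val {nabla : ℤ → ℂ} (hn : IsDifferenceOperator nabla) (s : Sgn) (f : Series N)
    (ht : Tame {0} f.1) : (Q nabla s f).1 = (QD nabla s).app f.1 := by
  have lphi : ∀ n, IsLin false (applyNabla (N := N) nabla (Gen.phi s.opp) n).1 :=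
    isLin_applyNabla nabla (phi_injective s.opp) (fun _ => rfl)
  have lchibar : ∀ n, IsLin true (applyNabla (N := N) nabla (Gen.chibar s.opp) n).1 :=
    isLin_applyNabla nabla (chibar_injective s.opp) (fun _ => rfl)
  have cphi := fun n => (applyNabla_coeff (N := N) nabla (phi_injective s.opp) n).2
  have cchibar := fun n => (applyNabla_coeff (N := N) nabla (chibar_injective s.opp) n).2
  have cphi0 := fun n a => applyNabla_coeff_of_ne (N := N) nabla (phi_injective s.opp) n (a := a)
  have cchibar0 := fun n a =>
    applyNabla_coeff_of_ne (N := N) nabla (chibar_injective s.opp) n (a := a)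
  have main := hasSum_linear_derivation (I := ℤ) (J := Fin 4) (K := Fin N) (QD (N := N) nabla s)
    (fun n => ![s.toC • (X (Gen.chibar s n)).1, (X (Gen.F s n)).1,
      (-(s.toC * Complex.I)) • (applyNabla nabla (Gen.phi s.opp) n).1,
      (-Complex.I) • (applyNabla nabla (Gen.chibar s.opp) n).1])
    (fun n => ![Gen.phi s n, Gen.chi s n, Gen.chi s.opp n, Gen.F s.opp n])
    (fun n j => by
      fin_cases j
      · exact (isLin_X _).smul _
      · exact isLin_X _
      · exact (lphi n).smul _
      · exact (lchibar n).smul _)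
    (fun i => s.toC • (X (Gen.zeta s i)).1) (fun i => Gen.rho s i) (fun i => (isLin_X _).smul _)
    (by
      intro a u hu
      simp only [Fin.sum_univ_four, Matrix.cons_val_zero, Matrix.cons_val_one, Matrix.cons_val,
        Pi.smul_apply, smul_eq_mul, X_val]
      cases a with
      | phi s' m =>
        rcases Sgn.eq_or_opp s s' with rfl | rfl
        · rw [QD_col_phi]
          have h1 : ∀ n, (applyNabla (N := N) nabla (Gen.phi s'.opp) n).1 [Gen.phi s' m] = 0 :=
            fun n => cphi0 n _ (by simp)
          have h2 : ∀ n, (applyNabla (N := N) nabla (Gen.chibar s'.opp) n).1 [Gen.phi s' m] = 0 :=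
            fun n => cchibar0 n _ (by simp)
          simp [h1, h2]
        · have h2 : ∀ n, (applyNabla (N := N) nabla (Gen.chibar s.opp) n).1
              [Gen.phi s.opp m] = 0 := fun n => cchibar0 n _ (by simp)
          have := ((QD_adm_zero (N := N) hn s).summable hu (Gen.phi s.opp m)).hasSum
          simp only [QD, Sgn.opp_ne, if_false] at this
          simpa [h2, cphi, LinDer.col, QD] using this
      | chibar s' m =>
        rcases Sgn.eq_or_opp s s' with rfl | rfl
        · rw [QD_col_chibar]
          have h1 : ∀ n, (applyNabla (N := N) nabla (Gen.phi s'.opp) n).1 [Gen.chibar s' m] = 0 :=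
            fun n => cphi0 n _ (by simp)
          have h2 : ∀ n, (applyNabla (N := N) nabla (Gen.chibar s'.opp) n).1
            [Gen.chibar s' m] = 0 := fun n => cchibar0 n _ (by simp)
          have := hasSum_single (f := fun n => s'.toC * (if m = n then 1 else 0) *
            u (Gen.phi s' n)) m (fun n hn => by simp [Ne.symm hn])
          simpa [h1, h2] using this
        · have h1 : ∀ n, (applyNabla (N := N) nabla (Gen.phi s.opp) n).1
              [Gen.chibar s.opp m] = 0 := fun n => cphi0 n _ (by simp)
          have := ((QD_adm_zero (N := N) hn s).summable hu (Gen.chibar s.opp m)).hasSum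
          simp only [QD, Sgn.opp_ne, if_false] at this
          simpa [h1, cchibar, LinDer.col, QD] using this
      | chi s' m =>
        rw [QD_col_chi]
        have h1 : ∀ n, (applyNabla (N := N) nabla (Gen.phi s.opp) n).1 [Gen.chi s' m] = 0 :=
          fun n => cphi0 n _ (by simp)
        have h2 : ∀ n, (applyNabla (N := N) nabla (Gen.chibar s.opp) n).1 [Gen.chi s' m] = 0 :=
          fun n => cchibar0 n _ (by simp)
        simp [h1, h2]
      | F s' m =>
        have h1 : ∀ n, (applyNabla (N := N) nabla (Gen.phi s.opp) n).1 [Gen.F s' m] = 0 :=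
          fun n => cphi0 n _ (by simp)
        have h2 : ∀ n, (applyNabla (N := N) nabla (Gen.chibar s.opp) n).1 [Gen.F s' m] = 0 :=
          fun n => cchibar0 n _ (by simp)
        rcases Sgn.eq_or_opp s s' with rfl | rfl
        · rw [QD_col_F]
          have := hasSum_single (f := fun n => (if m = n then 1 else 0) *
            u (Gen.chi s' n)) m (fun n hn => by simp [Ne.symm hn])
          simpa [h1, h2] using this
        · rw [QD_col_F_opp]
          simp [h1, h2]
      | rho s' i =>
        have h1 : ∀ n, (applyNabla (N := N) nabla (Gen.phi s.opp) n).1 [Gen.rho s' i] = 0 :=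
          fun n => cphi0 n _ (by simp)
        have h2 : ∀ n, (applyNabla (N := N) nabla (Gen.chibar s.opp) n).1 [Gen.rho s' i] = 0 :=
          fun n => cchibar0 n _ (by simp)
        rw [QD_col_rho]
        simp [h1, h2]
      | zeta s' i =>
        have h1 : ∀ n, (applyNabla (N := N) nabla (Gen.phi s.opp) n).1 [Gen.zeta s' i] = 0 :=
          fun n => cphi0 n _ (by simp)
        have h2 : ∀ n, (applyNabla (N := N) nabla (Gen.chibar s.opp) n).1 [Gen.zeta s' i] = 0 :=
          fun n => cchibar0 n _ (by simp)
        rcases Sgn.eq_or_opp s s' with rfl | rfl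
        · rw [QD_col_zeta]
          simp [h1, h2]
        · rw [QD_col_zeta_opp]
          simp [h1, h2]
      | theta s' =>
        have h1 : ∀ n, (applyNabla (N := N) nabla (Gen.phi s.opp) n).1 [Gen.theta s'] = 0 :=
          fun n => cphi0 n _ (by simp)
        have h2 : ∀ n, (applyNabla (N := N) nabla (Gen.chibar s.opp) n).1 [Gen.theta s'] = 0 :=
          fun n => cchibar0 n _ (by simp)
        rw [QD_col_theta]
        simp [h1, h2])
    f.2 ht
  simp only [Fin.sum_univ_four, Matrix.cons_val_zero, Matrix.cons_val_one, Matrix.cons_val] at main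
  set P : Series N := ∑ i : Fin N, X (Gen.zeta s i) * deriv (Gen.rho s i) f with hP
  have hPv : ∀ w, (s.toC • P).1 w =
      ∑ k, rawMul (s.toC • (X (Gen.zeta s k)).1) (rawD (Gen.rho s k) f.1) w := by
    intro w
    have : (P.1 w : ℂ) = ∑ k, rawMul (X (Gen.zeta s k)).1 (rawD (Gen.rho s k) f.1) w := by
      rw [hP, AddSubmonoidClass.coe_finsetSum, Finset.sum_apply]; rfl
    show s.toC * P.1 w = _
    rw [this, Finset.mul_sum]
    refine Finset.sum_congr rfl fun k _ => ?_
    rw [rawMul_smul_left]; rfl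
  have hs : HasSum (fun n : ℤ =>
      (s.toC • (X (Gen.chibar s n) * deriv (Gen.phi s n) f)
      + X (Gen.F s n) * deriv (Gen.chi s n) f
      - (s.toC * Complex.I) • (applyNabla nabla (Gen.phi s.opp) n * deriv (Gen.chi s.opp n) f)
      - Complex.I • (applyNabla nabla (Gen.chibar s.opp) n * deriv (Gen.F s.opp n) f)))
      (⟨(QD nabla s).app f.1, f.2.app (QD_isOdd nabla s)⟩ - s.toC • P) := by
    rw [hasSum_series_iff]
    intro w
    have e : (((⟨(QD nabla s).app f.1, f.2.app (QD_isOdd nabla s)⟩ : Series N) -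
        s.toC • P) : Series N).1 w = (QD nabla s).app f.1 w - (s.toC • P).1 w := rfl
    rw [e, hPv]
    have h := main w
    simp only [rawMul_smul_left, Pi.smul_apply, smul_eq_mul] at h ⊢
    convert h using 1
    funext n
    show s.toC * rawMul (X (Gen.chibar s n)).1 (rawD (Gen.phi s n) f.1) w
      + rawMul (X (Gen.F s n)).1 (rawD (Gen.chi s n) f.1) w
      - s.toC * Complex.I * rawMul (applyNabla nabla (Gen.phi s.opp) n).1
        (rawD (Gen.chi s.opp n) f.1) w
      - Complex.I * rawMul (applyNabla nabla (Gen.chibar s.opp) n).1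
        (rawD (Gen.F s.opp n) f.1) w = _
    ring
  unfold Q
  rw [hs.tsum_eq, ← hP]
  simp

/-! ### The graded Leibniz rule -/

theorem app_rawS {M : LinDer N} (hM : M.IsOdd) (c : Gen N) (f : Raw N) :
    M.app (rawS c f) = c.sg • rawS c (M.app f) := by
  funext w
  induction w generalizing f with
  | nil => simp [LinDer.app_nil, rawS]
  | cons a w ih =>
    have e1 : rawD a (rawS c f) = eps c a • rawS c (rawD a f) := rawD_rawS c a f
    have e2 : M.col a (fun b => rawS c f (b :: w)) =
        (eps c a * c.sg * (w.map (eps c)).prod) * M.col a (fun b => f (b :: w)) := by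
      rw [← hM.col_twist a (fun b => eps c b * (w.map (eps c)).prod)]
      · rfl
      · intro b hb
        rw [eps_of_odd_eq hb]
    rw [LinDer.app_cons, e1, LinDer.app_smul, Pi.smul_apply, ih, e2]
    simp only [Pi.smul_apply, smul_eq_mul, rawS, List.map_cons, List.prod_cons, LinDer.app_cons]
    ring

/-- The parity automorphism, which multiplies odd series by `-1`. -/
def par (f : Raw N) : Raw N := rawS (Gen.theta Sgn.plus) f

theorem eps_theta (s : Sgn) (b : Gen N) : eps (Gen.theta s) b = b.sg := by
  unfold eps Gen.sg; cases b.odd <;> rfl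

theorem rawS_theta (s : Sgn) (f : Raw N) : rawS (Gen.theta s) f = par f := by
  funext w
  simp only [par, rawS]
  congr 3

theorem rawS_of_odd_eq {a b : Gen N} (h : b.odd = !a.odd) (f : Raw N) :
    rawS b f = rawS a (par f) := by
  funext w
  simp only [par, rawS, ← mul_assoc]
  congr 1
  induction w with
  | nil => simp
  | cons c w ih =>
    simp only [List.map_cons, List.prod_cons, ih]
    rw [eps_comm b c, eps_of_odd_eq h, eps_comm c a, eps_theta]; ring

/-- An odd linear derivation acting on bounded series satisfies the graded Leibniz rule; `par` is
the grading automorphism, which carries the sign. -/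
theorem LinDer.Adm.leibniz {M : LinDer N} (hM : M.Adm {0}) (oM : M.IsOdd) {f g : Raw N}
    (hf : Tame {0} f) (hg : Tame {0} g) :
    M.app (rawMul f g) = rawMul (M.app f) g + rawMul (par f) (M.app g) := by
  have tS : ∀ (a : Gen N) {f : Raw N}, Tame {0} f → Tame {0} (rawS a f) := fun a f h =>
    h.mono_of_le fun w => (norm_rawS a f w).le
  funext w
  induction w generalizing f g with
  | nil => simp [LinDer.app_nil, rawMul]
  | cons a w ih =>
    have colS : ∀ {f : Raw N}, Tame {0} f → ∀ v, HasSum (fun n => M.ker a n * f (M.src a n :: v))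
        (M.col a (fun b => f (b :: v))) := fun h v =>
      (hM.summable (h.utame v) a).hasSum
    have dApp : ∀ f : Raw N, rawD a (M.app f) =
        (fun v => M.col a (fun b => f (b :: v))) + a.sg • M.app (rawD a f) := by
      intro f; funext v
      simp only [Pi.add_apply, Pi.smul_apply, smul_eq_mul]
      exact LinDer.app_cons M f a v
    have c1 : M.col a (fun b => rawMul f g (b :: w)) =
        rawMul (fun v => M.col a (fun b => f (b :: v))) g w +
        rawMul (rawS a (par f)) (fun v => M.col a (fun b => g (b :: v))) w := by
      have h1 := rawMul_hasSum_left (F := fun n => M.ker a n • rawD (M.src a n) f)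
        (f := fun v => M.col a (fun b => f (b :: v))) (colS hf) g w
      have h2 := rawMul_hasSum_right (F := fun n => M.ker a n • rawD (M.src a n) g)
        (f := fun v => M.col a (fun b => g (b :: v))) (colS hg) (rawS a (par f)) w
      rw [← (HasSum.add h1 h2).tsum_eq]
      refine tsum_congr fun n => ?_
      by_cases hk : M.ker a n = 0
      · simp [hk, rawMul_zero_left, rawMul_zero_right]
      · show M.ker a n * (rawMul (rawD (M.src a n) f) g w +
          rawMul (rawS (M.src a n) f) (rawD (M.src a n) g) w) = _
        rw [rawS_of_odd_eq (oM a n hk), rawMul_smul_left, rawMul_smul_right]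
        simp only [Pi.smul_apply, smul_eq_mul]; ring
    have e1 : rawD a (rawMul f g) = rawMul (rawD a f) g + rawMul (rawS a f) (rawD a g) := rfl
    rw [LinDer.app_cons, c1, e1,
      hM.app_add ((hf.rawD a).rawMul hg) ((tS a hf).rawMul (hg.rawD a)), Pi.add_apply,
      ih (hf.rawD a) hg, ih (tS a hf) (hg.rawD a), app_rawS oM]
    have e2 : (rawMul (M.app f) g + rawMul (par f) (M.app g)) (a :: w) =
        rawMul (rawD a (M.app f)) g w + rawMul (rawS a (M.app f)) (rawD a g) w +
        (rawMul (rawD a (par f)) (M.app g) w + rawMul (rawS a (par f)) (rawD a (M.app g)) w) := rfl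
    have e3 : rawD a (par f) = a.sg • par (rawD a f) := by
      rw [par, rawD_rawS, eps_theta]; rfl
    have e4 : par (rawS a f) = rawS a (par f) := rawS_comm _ _ _
    rw [e2, dApp, dApp, e3, e4]
    simp only [rawMul_add_left, rawMul_add_right, rawMul_smul_left, rawMul_smul_right,
      Pi.add_apply, Pi.smul_apply, smul_eq_mul]
    linear_combination (rawMul (rawS a (M.app f)) (rawD a g) w) * a.sg_sq

end LatticeSusy

namespace LatticeSusy

variable {N : ℕ}

/-! ### Superfields -/

/-- `Q'_r x = ∂x/∂θ_r` for both signs `r`, together with boundedness of the coefficients. -/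
structure IsSuperfield (nabla : ℤ → ℂ) (x : Raw N) : Prop where
  tame : Tame {0} x
  susy : ∀ r, (QD nabla r).app x = rawD (Gen.theta r) x

theorem tame_X (a : Gen N) : Tame {0} (X a).1 := by
  rw [tame_zero_iff]
  intro d
  refine ⟨1, by norm_num, fun w _ => ?_⟩
  show ‖(if w = [a] then (1 : ℂ) else 0)‖ ≤ 1
  split_ifs <;> simp

theorem tame_applyNabla {nabla : ℤ → ℂ} (hn : IsDifferenceOperator nabla) {A : ℤ → Gen N}
    (hA : Function.Injective A) (n : ℤ) : Tame {0} (applyNabla nabla A n).1 := by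
  obtain ⟨L, M, hL, hM, h⟩ := hn.decay
  rw [tame_zero_iff]
  refine fun d => ⟨L, hL.le, fun w _ => ?_⟩
  by_cases h0 : (applyNabla nabla A n).1 w = 0
  · rw [h0, norm_zero]; exact hL.le
  · obtain ⟨m, rfl⟩ := (applyNabla_coeff nabla hA n).1 w h0
    rw [(applyNabla_coeff nabla hA n).2]
    refine (h _).trans ?_
    have : Real.exp (-(M * |((n - m : ℤ) : ℝ)|)) ≤ 1 := by
      rw [Real.exp_le_one_iff]; have := mul_nonneg hM.le (abs_nonneg ((n - m : ℤ) : ℝ)); linarith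
    nlinarith

theorem IsSuperfield.mul {nabla : ℤ → ℂ} (hn : IsDifferenceOperator nabla) {x y : Raw N}
    (hx : IsSuperfield nabla x) (hy : IsSuperfield nabla y) : IsSuperfield nabla (rawMul x y) where
  tame := hx.tame.rawMul hy.tame
  susy r := by
    rw [(QD_adm_zero hn r).leibniz (QD_isOdd nabla r) hx.tame hy.tame, hx.susy, hy.susy,
      rawD_rawMul, rawS_theta]

theorem IsSuperfield.add {nabla : ℤ → ℂ} (hn : IsDifferenceOperator nabla) {x y : Raw N}
    (hx : IsSuperfield nabla x) (hy : IsSuperfield nabla y) : IsSuperfield nabla (x + y) where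
  tame := hx.tame.add hy.tame
  susy r := by
    rw [(QD_adm_zero hn r).app_add hx.tame hy.tame, hx.susy, hy.susy]; rfl

theorem IsSuperfield.smul {nabla : ℤ → ℂ} {x : Raw N} (hx : IsSuperfield nabla x) (c : ℂ) :
    IsSuperfield nabla (c • x) where
  tame := hx.tame.smul c
  susy r := by rw [LinDer.app_smul, hx.susy]; rfl

theorem isSuperfield_one (nabla : ℤ → ℂ) : IsSuperfield nabla (rawOne : Raw N) where
  tame := tame_one
  susy r := by
    funext w
    induction w with
    | nil => exact LinDer.app_nil _ _
    | cons a w ih =>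
      have : rawD a (rawOne : Raw N) = 0 := rfl
      rw [LinDer.app_cons, this, LinDer.app_zero]
      simp [rawOne, LinDer.col, rawD]

theorem isSuperfield_tsum {nabla : ℤ → ℂ} (hn : IsDifferenceOperator nabla) {I : Type*}
    {F : I → Raw N} (hF : USummable F) (h : ∀ i, IsSuperfield nabla (F i)) :
    IsSuperfield nabla (fun w => ∑' i, F i w) where
  tame := hF.tame_sum
  susy r := by
    funext w
    have h1 := hF.app (QD_adm_zero hn r) w
    simp only [(h _).susy] at h1
    exact h1.tsum_eq.symm

section generators
variable (nabla : ℤ → ℂ) (r : Sgn) (n : ℤ) (i : Fin N)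

theorem app_X_eq {Y : Raw N} {p : Bool} (g : Gen N) (hY : IsLin p Y)
    (h : ∀ a, (QD nabla r).col a (fun b => if b = g then 1 else 0) = Y [a]) :
    (QD nabla r).app (X g).1 = Y := by
  refine ((isLin_X g).app (QD_isOdd nabla r)).ext hY fun a => ?_
  rw [LinDer.app_singleton, ← h a]
  simp only [X_val]

theorem isLin_zero (p : Bool) : IsLin p (0 : Raw N) := fun _ h => absurd rfl h

theorem app_X_eq_zero (g : Gen N)
    (h : ∀ a, (QD nabla r).col a (fun b => if b = g then 1 else 0) = 0) :
    (QD nabla r).app (X g).1 = 0 :=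
  app_X_eq nabla r g (isLin_zero true) h

/-- Case distinction on a letter, with labels relative to `r`. -/
theorem Gen.cases_sgn (r : Sgn) {motive : Gen N → Prop} (h1 : ∀ m, motive (Gen.phi r m))
    (h2 : ∀ m, motive (Gen.phi r.opp m)) (h3 : ∀ m, motive (Gen.chibar r m))
    (h4 : ∀ m, motive (Gen.chibar r.opp m)) (h5 : ∀ t m, motive (Gen.chi t m)) (h6 : ∀ m, motive (Gen.F r m))
    (h7 : ∀ m, motive (Gen.F r.opp m)) (h8 : ∀ t i, motive (Gen.rho t i)) (h9 : ∀ i, motive (Gen.zeta r i))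
    (h10 : ∀ i, motive (Gen.zeta r.opp i)) (h11 : ∀ t, motive (Gen.theta t)) (a : Gen N) : motive a := by
  cases a with
  | phi s m => rcases Sgn.eq_or_opp r s with rfl | rfl <;> [exact h1 m; exact h2 m]
  | chibar s m => rcases Sgn.eq_or_opp r s with rfl | rfl <;> [exact h3 m; exact h4 m]
  | chi s m => exact h5 s m
  | F s m => rcases Sgn.eq_or_opp r s with rfl | rfl <;> [exact h6 m; exact h7 m]
  | rho s i => exact h8 s i
  | zeta s i => rcases Sgn.eq_or_opp r s with rfl | rfl <;> [exact h9 i; exact h10 i]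
  | theta s => exact h11 s

theorem app_X_phi : (QD (N := N) nabla r).app (X (Gen.phi r n)).1 =
    r.toC • (X (Gen.chibar r n)).1 := by
  refine app_X_eq nabla r _ ((isLin_X _).smul _) ?_
  intro a
  induction a using Gen.cases_sgn r <;>
    simp [QD_col_phi, QD_col_phi_opp, QD_col_chibar, QD_col_chibar_opp, QD_col_chi, QD_col_F,
      QD_col_F_opp, QD_col_rho, QD_col_zeta, QD_col_zeta_opp, QD_col_theta, X_val]

theorem app_X_phi_opp : (QD (N := N) nabla r).app (X (Gen.phi r.opp n)).1 = 0 := by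
  refine app_X_eq_zero nabla r _ ?_
  intro a
  induction a using Gen.cases_sgn r <;>
    simp [QD_col_phi, QD_col_phi_opp, QD_col_chibar, QD_col_chibar_opp, QD_col_chi, QD_col_F,
      QD_col_F_opp, QD_col_rho, QD_col_zeta, QD_col_zeta_opp, QD_col_theta]

theorem app_X_chibar (t : Sgn) : (QD (N := N) nabla r).app (X (Gen.chibar t n)).1 = 0 := by
  refine app_X_eq_zero nabla r _ ?_
  intro a
  induction a using Gen.cases_sgn r <;>
    simp [QD_col_phi, QD_col_phi_opp, QD_col_chibar, QD_col_chibar_opp, QD_col_chi, QD_col_F,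
      QD_col_F_opp, QD_col_rho, QD_col_zeta, QD_col_zeta_opp, QD_col_theta]

theorem app_X_chi : (QD (N := N) nabla r).app (X (Gen.chi r n)).1 = (X (Gen.F r n)).1 := by
  refine app_X_eq nabla r _ (isLin_X _) ?_
  intro a
  induction a using Gen.cases_sgn r <;>
    simp [QD_col_phi, QD_col_phi_opp, QD_col_chibar, QD_col_chibar_opp, QD_col_chi, QD_col_F,
      QD_col_F_opp, QD_col_rho, QD_col_zeta, QD_col_zeta_opp, QD_col_theta, X_val]

theorem app_X_chi_opp : (QD (N := N) nabla r).app (X (Gen.chi r.opp n)).1 =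
    (-(r.toC * Complex.I)) • (applyNabla nabla (Gen.phi r.opp) n).1 := by
  have hA := phi_injective (N := N) r.opp
  refine app_X_eq nabla r _ ((isLin_applyNabla nabla hA (fun _ => rfl) n).smul _) ?_
  intro a
  induction a using Gen.cases_sgn r
  case h2 m =>
    rw [QD_col_phi_opp, Pi.smul_apply, (applyNabla_coeff nabla hA n).2]
    simp
  all_goals
    rw [Pi.smul_apply, applyNabla_coeff_of_ne nabla hA n (by simp)]
    simp [QD_col_phi, QD_col_chibar, QD_col_chibar_opp, QD_col_chi, QD_col_F,
      QD_col_F_opp, QD_col_rho, QD_col_zeta, QD_col_zeta_opp, QD_col_theta]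

theorem app_X_F : (QD (N := N) nabla r).app (X (Gen.F r n)).1 = 0 := by
  refine app_X_eq_zero nabla r _ ?_
  intro a
  induction a using Gen.cases_sgn r <;>
    simp [QD_col_phi, QD_col_phi_opp, QD_col_chibar, QD_col_chibar_opp, QD_col_chi, QD_col_F,
      QD_col_F_opp, QD_col_rho, QD_col_zeta, QD_col_zeta_opp, QD_col_theta]

theorem app_X_F_opp : (QD (N := N) nabla r).app (X (Gen.F r.opp n)).1 =
    (-Complex.I) • (applyNabla nabla (Gen.chibar r.opp) n).1 := by
  have hA := chibar_injective (N := N) r.opp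
  refine app_X_eq nabla r _ ((isLin_applyNabla nabla hA (fun _ => rfl) n).smul _) ?_
  intro a
  induction a using Gen.cases_sgn r
  case h4 m =>
    rw [QD_col_chibar_opp, Pi.smul_apply, (applyNabla_coeff nabla hA n).2]
    simp
  all_goals
    rw [Pi.smul_apply, applyNabla_coeff_of_ne nabla hA n (by simp)]
    simp [QD_col_phi, QD_col_phi_opp, QD_col_chibar, QD_col_chi, QD_col_F,
      QD_col_F_opp, QD_col_rho, QD_col_zeta, QD_col_zeta_opp, QD_col_theta]

theorem app_X_rho : (QD (N := N) nabla r).app (X (Gen.rho r i)).1 =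
    r.toC • (X (Gen.zeta r i)).1 := by
  refine app_X_eq nabla r _ ((isLin_X _).smul _) ?_
  intro a
  induction a using Gen.cases_sgn r <;>
    simp [QD_col_phi, QD_col_phi_opp, QD_col_chibar, QD_col_chibar_opp, QD_col_chi, QD_col_F,
      QD_col_F_opp, QD_col_rho, QD_col_zeta, QD_col_zeta_opp, QD_col_theta, X_val]

theorem app_X_rho_opp : (QD (N := N) nabla r).app (X (Gen.rho r.opp i)).1 = 0 := by
  refine app_X_eq_zero nabla r _ ?_
  intro a
  induction a using Gen.cases_sgn r <;>
    simp [QD_col_phi, QD_col_phi_opp, QD_col_chibar, QD_col_chibar_opp, QD_col_chi, QD_col_F,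
      QD_col_F_opp, QD_col_rho, QD_col_zeta, QD_col_zeta_opp, QD_col_theta]

theorem app_X_zeta (t : Sgn) : (QD (N := N) nabla r).app (X (Gen.zeta t i)).1 = 0 := by
  refine app_X_eq_zero nabla r _ ?_
  intro a
  induction a using Gen.cases_sgn r <;>
    simp [QD_col_phi, QD_col_phi_opp, QD_col_chibar, QD_col_chibar_opp, QD_col_chi, QD_col_F,
      QD_col_F_opp, QD_col_rho, QD_col_zeta, QD_col_zeta_opp, QD_col_theta]

theorem app_X_theta (t : Sgn) : (QD (N := N) nabla r).app (X (Gen.theta t)).1 = 0 := by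
  refine app_X_eq_zero nabla r _ ?_
  intro a
  induction a using Gen.cases_sgn r <;>
    simp [QD_col_phi, QD_col_phi_opp, QD_col_chibar, QD_col_chibar_opp, QD_col_chi, QD_col_F,
      QD_col_F_opp, QD_col_rho, QD_col_zeta, QD_col_zeta_opp, QD_col_theta]

theorem app_applyNabla_phi : (QD (N := N) nabla r).app (applyNabla nabla (Gen.phi r) n).1 =
    r.toC • (applyNabla nabla (Gen.chibar r) n).1 := by
  have hA := phi_injective (N := N) r
  have hB := chibar_injective (N := N) r
  refine ((isLin_applyNabla nabla hA (fun _ => rfl) n).app (QD_isOdd nabla r)).ext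
    ((isLin_applyNabla nabla hB (fun _ => rfl) n).smul _) ?_
  simp only [LinDer.app_singleton]
  intro a
  induction a using Gen.cases_sgn r
  case h3 m =>
    rw [QD_col_chibar, Pi.smul_apply, (applyNabla_coeff nabla hB n).2,
      (applyNabla_coeff nabla hA n).2, smul_eq_mul]
  all_goals
    rw [Pi.smul_apply, applyNabla_coeff_of_ne nabla hB n (by simp)]
    simp [QD_col_phi, QD_col_phi_opp, QD_col_chibar_opp, QD_col_chi, QD_col_F, QD_col_F_opp,
      QD_col_rho, QD_col_zeta, QD_col_zeta_opp, QD_col_theta, applyNabla_coeff_of_ne nabla hA n]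

theorem app_applyNabla_phi_opp :
    (QD (N := N) nabla r).app (applyNabla nabla (Gen.phi r.opp) n).1 = 0 := by
  have hA := phi_injective (N := N) r.opp
  refine ((isLin_applyNabla nabla hA (fun _ => rfl) n).app (QD_isOdd nabla r)).ext
    (isLin_zero true) ?_
  simp only [LinDer.app_singleton]
  intro a
  induction a using Gen.cases_sgn r <;>
    simp [QD_col_phi, QD_col_phi_opp, QD_col_chibar, QD_col_chibar_opp, QD_col_chi, QD_col_F,
      QD_col_F_opp, QD_col_rho, QD_col_zeta, QD_col_zeta_opp, QD_col_theta,
      applyNabla_coeff_of_ne nabla hA n]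

theorem app_applyNabla_chibar (t : Sgn) :
    (QD (N := N) nabla r).app (applyNabla nabla (Gen.chibar t) n).1 = 0 := by
  have hA := chibar_injective (N := N) t
  refine ((isLin_applyNabla nabla hA (fun _ => rfl) n).app (QD_isOdd nabla r)).ext
    (isLin_zero true) ?_
  simp only [LinDer.app_singleton]
  intro a
  induction a using Gen.cases_sgn r <;>
    simp [QD_col_phi, QD_col_phi_opp, QD_col_chibar, QD_col_chibar_opp, QD_col_chi, QD_col_F,
      QD_col_F_opp, QD_col_rho, QD_col_zeta, QD_col_zeta_opp, QD_col_theta,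
      applyNabla_coeff_of_ne nabla hA n]

end generators

theorem par_X_theta (t : Sgn) : par (X (Gen.theta (N := N) t)).1 = -(X (Gen.theta t)).1 := by
  rw [par, rawS_X]
  simp [eps, Gen.odd]

theorem app_theta_mul {nabla : ℤ → ℂ} (hn : IsDifferenceOperator nabla) (r t : Sgn) {g : Raw N}
    (hg : Tame {0} g) : (QD nabla r).app (rawMul (X (Gen.theta t)).1 g) =
      -rawMul (X (Gen.theta t)).1 ((QD nabla r).app g) := by
  rw [(QD_adm_zero hn r).leibniz (QD_isOdd nabla r) (tame_X _) hg, app_X_theta, rawMul_zero_left,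
    zero_add, par_X_theta, ← neg_one_smul ℂ, rawMul_smul_left, neg_one_smul]

theorem rawD_theta_mul (r t : Sgn) (g : Raw N) :
    rawD (Gen.theta r) (rawMul (X (Gen.theta t)).1 g) =
      (if r = t then g else 0) - rawMul (X (Gen.theta t)).1 (rawD (Gen.theta r) g) := by
  rw [rawD_rawMul, rawD_X, rawS_theta, par_X_theta, ← neg_one_smul ℂ, rawMul_smul_left,
    neg_one_smul, sub_eq_add_neg]
  congr 1
  by_cases h : r = t
  · simp [h, rawOne_mul]
  · simp [h, rawMul_zero_left]

theorem rawD_theta_X (r : Sgn) {a : Gen N} (ha : a.isTheta = false) :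
    rawD (Gen.theta r) (X a).1 = 0 := by
  rw [rawD_X, if_neg]
  rintro rfl
  simp [Gen.isTheta] at ha

theorem rawD_theta_applyNabla (nabla : ℤ → ℂ) (r : Sgn) {A : ℤ → Gen N}
    (hA : Function.Injective A) (h : ∀ m, (A m).isTheta = false) (n : ℤ) :
    rawD (Gen.theta r) (applyNabla nabla A n).1 = 0 := by
  funext w
  by_contra h0
  obtain ⟨m, hm⟩ := (applyNabla_coeff nabla hA n).1 _ h0
  have := h m
  have e : Gen.theta r = A m := by simpa using congrArg List.head? hm
  rw [← e] at this
  simp [Gen.isTheta] at this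

theorem isSuperfield_Phi {nabla : ℤ → ℂ} (hn : IsDifferenceOperator nabla) (s : Sgn) (n : ℤ) :
    IsSuperfield (N := N) nabla (Phi s n).1 := by
  have e : (Phi (N := N) s n).1 = (X (Gen.phi s n)).1 +
    s.toC • rawMul (X (Gen.theta s)).1 (X (Gen.chibar s n)).1 := rfl
  have t1 : Tame {0} (rawMul (X (Gen.theta s)).1 (X (Gen.chibar (N := N) s n)).1) :=
    (tame_X _).rawMul (tame_X _)
  rw [e]
  refine ⟨(tame_X _).add (t1.smul _), fun r => ?_⟩
  have e2 : ∀ f g : Raw N, rawD (Gen.theta r) (f + g) =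
    rawD (Gen.theta r) f + rawD (Gen.theta r) g := fun _ _ => rfl
  rw [(QD_adm_zero hn r).app_add (tame_X _) (t1.smul _), LinDer.app_smul,
    app_theta_mul hn r s (tame_X _), app_X_chibar, rawMul_zero_right, e2, rawD_smul,
    rawD_theta_mul, rawD_theta_X r (by rfl), rawD_theta_X r (by rfl), rawMul_zero_right]
  rcases Sgn.eq_or_opp r s with rfl | rfl
  · rw [app_X_phi]; simp
  · rw [app_X_phi_opp]; simp

theorem tame_Upsilon {nabla : ℤ → ℂ} (hn : IsDifferenceOperator nabla) (s : Sgn) (n : ℤ) :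
    Tame {0} (Upsilon (N := N) nabla s n).1 := by
  have e : (Upsilon (N := N) nabla s n).1 = (X (Gen.F s n)).1 +
    (-Complex.I) • rawMul (X (Gen.theta s.opp)).1 (applyNabla nabla (Gen.chibar s) n).1 := by
    rw [neg_smul, ← sub_eq_add_neg]; rfl
  rw [e]
  exact (tame_X _).add (((tame_X _).rawMul (tame_applyNabla hn (chibar_injective s) n)).smul _)

theorem isSuperfield_Upsilon {nabla : ℤ → ℂ} (hn : IsDifferenceOperator nabla) (s : Sgn) (n : ℤ) :
    IsSuperfield (N := N) nabla (Upsilon nabla s n).1 := by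
  refine ⟨tame_Upsilon hn s n, fun r => ?_⟩
  have e : (Upsilon (N := N) nabla s n).1 = (X (Gen.F s n)).1 +
    (-Complex.I) • rawMul (X (Gen.theta s.opp)).1 (applyNabla nabla (Gen.chibar s) n).1 := by
    rw [neg_smul, ← sub_eq_add_neg]; rfl
  have tN := tame_applyNabla (N := N) hn (chibar_injective s) n
  have t1 := (tame_X (N := N) (Gen.theta s.opp)).rawMul tN
  have e2 : ∀ f g : Raw N, rawD (Gen.theta r) (f + g) =
    rawD (Gen.theta r) f + rawD (Gen.theta r) g := fun _ _ => rfl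
  rw [e, (QD_adm_zero hn r).app_add (tame_X _) (t1.smul _), LinDer.app_smul,
    app_theta_mul hn r _ tN, app_applyNabla_chibar, rawMul_zero_right, e2, rawD_smul,
    rawD_theta_mul, rawD_theta_X r (by rfl), rawD_theta_applyNabla nabla r (chibar_injective s)
    (fun _ => rfl), rawMul_zero_right]
  rcases Sgn.eq_or_opp r s with rfl | rfl
  · rw [app_X_F]; simp
  · rw [app_X_F_opp]; simp

theorem isSuperfield_Psi {nabla : ℤ → ℂ} (hn : IsDifferenceOperator nabla) (s : Sgn) (n : ℤ) :
    IsSuperfield (N := N) nabla (Psi nabla s n).1 := by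
  have e : (Psi (N := N) nabla s n).1 = ((X (Gen.chi s n)).1 +
    rawMul (X (Gen.theta s)).1 (Upsilon nabla s n).1) +
    (s.toC * Complex.I) • rawMul (X (Gen.theta s.opp)).1 (applyNabla nabla (Gen.phi s) n).1 := rfl
  have tN := tame_applyNabla (N := N) hn (phi_injective s) n
  have tU := tame_Upsilon (N := N) hn s n
  have t1 := (tame_X (N := N) (Gen.theta s.opp)).rawMul tN
  have t2 := (tame_X (N := N) (Gen.theta s)).rawMul tU
  have t3 := (tame_X (Gen.chi s n)).add t2
  rw [e]
  refine ⟨t3.add (t1.smul _), fun r => ?_⟩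
  have e2 : ∀ f g : Raw N, rawD (Gen.theta r) (f + g) =
    rawD (Gen.theta r) f + rawD (Gen.theta r) g := fun _ _ => rfl
  rw [(QD_adm_zero hn r).app_add t3 (t1.smul _), (QD_adm_zero hn r).app_add (tame_X _) t2,
    LinDer.app_smul, app_theta_mul hn r _ tN, app_theta_mul hn r _ tU,
    (isSuperfield_Upsilon hn s n).susy, e2, e2, rawD_smul,
    rawD_theta_mul, rawD_theta_mul, rawD_theta_X r (by rfl),
    rawD_theta_applyNabla nabla r (phi_injective s) (fun _ => rfl), rawMul_zero_right]
  rcases Sgn.eq_or_opp r s with rfl | rfl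
  · have eU : (Upsilon (N := N) nabla s n).1 = (X (Gen.F s n)).1 + (-Complex.I) •
        rawMul (X (Gen.theta s.opp)).1 (applyNabla nabla (Gen.chibar s) n).1 := by
      rw [neg_smul, ← sub_eq_add_neg]; rfl
    rw [app_X_chi, app_applyNabla_phi, rawMul_smul_right, smul_neg, smul_smul,
      show s.toC * Complex.I * s.toC = Complex.I by linear_combination Complex.I * s.toC_sq]
    simp only [if_true, Sgn.ne_opp, if_false, sub_zero, smul_zero, add_zero, zero_add]
    rw [eU, neg_smul]
    abel
  · rw [app_X_chi_opp, app_applyNabla_phi_opp, rawMul_zero_right]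
    simp [add_comm]

theorem isSuperfield_X {nabla : ℤ → ℂ} {a : Gen N} (ha : a.isTheta = false)
    (h : ∀ r, (QD nabla r).app (X a).1 = 0) : IsSuperfield nabla (X a).1 :=
  ⟨tame_X a, fun r => by rw [h, rawD_theta_X r ha]⟩

theorem isSuperfield_rho {nabla : ℤ → ℂ} (hn : IsDifferenceOperator nabla) (s : Sgn) (i : Fin N) :
    IsSuperfield nabla (rhoSF s i).1 := by
  have e : (rhoSF s i).1 = (X (Gen.rho s i)).1 +
    s.toC • rawMul (X (Gen.theta s)).1 (X (Gen.zeta s i)).1 := rfl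
  have t1 : Tame {0} (rawMul (X (Gen.theta s)).1 (X (Gen.zeta s i)).1) :=
    (tame_X _).rawMul (tame_X _)
  rw [e]
  refine ⟨(tame_X _).add (t1.smul _), fun r => ?_⟩
  have e2 : ∀ f g : Raw N, rawD (Gen.theta r) (f + g) =
    rawD (Gen.theta r) f + rawD (Gen.theta r) g := fun _ _ => rfl
  rw [(QD_adm_zero hn r).app_add (tame_X _) (t1.smul _), LinDer.app_smul,
    app_theta_mul hn r s (tame_X _), app_X_zeta, rawMul_zero_right, e2, rawD_smul,
    rawD_theta_mul, rawD_theta_X r (by rfl), rawD_theta_X r (by rfl), rawMul_zero_right]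
  rcases Sgn.eq_or_opp r s with rfl | rfl
  · rw [app_X_rho]; simp
  · rw [app_X_rho_opp]; simp

theorem FieldLetter.isSuperfield {nabla : ℤ → ℂ} (hn : IsDifferenceOperator nabla)
    (t : FieldLetter) (n : ℤ) : IsSuperfield (N := N) nabla (t.val nabla n).1 := by
  cases t with
  | Phi s => exact isSuperfield_Phi hn s n
  | Psi s => exact isSuperfield_Psi hn s n
  | Upsilon s => exact isSuperfield_Upsilon hn s n
  | S s => exact isSuperfield_X rfl fun r => app_X_chibar nabla r n s

theorem ConstLetter.isSuperfield {nabla : ℤ → ℂ} (hn : IsDifferenceOperator nabla)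
    (t : ConstLetter N) : IsSuperfield nabla t.val.1 := by
  cases t with
  | rho s i => exact isSuperfield_rho hn s i
  | zeta s i => exact isSuperfield_X rfl fun r => app_X_zeta nabla r i s

end LatticeSusy

namespace LatticeSusy

variable {N : ℕ}

/-! ### Local functionals in terms of Taylor coefficients -/

/-- Translation of a letter by `k` sites. -/
def Gen.shift (k : ℤ) : Gen N → Gen N
  | Gen.phi s n => Gen.phi s (n + k)
  | Gen.chibar s n => Gen.chibar s (n + k)
  | Gen.chi s n => Gen.chi s (n + k)
  | Gen.F s n => Gen.F s (n + k)
  | Gen.rho s i => Gen.rho s i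
  | Gen.zeta s i => Gen.zeta s i
  | Gen.theta s => Gen.theta s

@[simp] theorem Gen.shift_odd (k : ℤ) (a : Gen N) : (a.shift k).odd = a.odd := by cases a <;> rfl

@[simp] theorem Gen.shift_isTheta (k : ℤ) (a : Gen N) : (a.shift k).isTheta = a.isTheta := by
  cases a <;> rfl

theorem Gen.shift_shift (k l : ℤ) (a : Gen N) : (a.shift k).shift l = a.shift (k + l) := by
  cases a <;> simp [Gen.shift, add_assoc]

@[simp] theorem Gen.shift_zero (a : Gen N) : a.shift 0 = a := by cases a <;> simp [Gen.shift]

theorem Gen.shift_injective (k : ℤ) : Function.Injective (Gen.shift (N := N) k) := by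
  intro a b h
  have := congrArg (Gen.shift (-k)) h
  simpa [Gen.shift_shift] using this

/-- The number of fields: `1` for every letter except `θ_±`. -/
def wField (a : Gen N) : ℤ := if a.isField then 1 else 0

/-- The fermion number of a letter; the value at `θ_±` plays no role. -/
def wNF : Gen N → ℤ
  | Gen.chibar _ _ => -1
  | Gen.chi _ _ => 1
  | Gen.zeta _ _ => -1
  | _ => 0

theorem wt_wField (w : List (Gen N)) : wt wField w = (w.countP Gen.isField : ℤ) := by
  induction w with
  | nil => simp
  | cons a w ih =>
    rw [wt_cons, ih, List.countP_cons, wField]; push_cast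
    rw [add_comm]

theorem homogPart_val (d : ℕ) (f : Series N) : (homogPart d f).1 = proj wField d f.1 := by
  funext w
  show (if w.countP Gen.isField = d then f.1 w else 0) = if wt wField w = d then f.1 w else 0
  simp only [wt_wField, Nat.cast_inj]

/-- The lowest component of a site-dependent superfield. -/
def FieldLetter.gen : FieldLetter → ℤ → Gen N
  | FieldLetter.Phi s, n => Gen.phi s n
  | FieldLetter.Psi s, n => Gen.chi s n
  | FieldLetter.Upsilon s, n => Gen.F s n
  | FieldLetter.S s, n => Gen.chibar s n

/-- The lowest component of a constant superfield. -/
def ConstLetter.gen : ConstLetter N → Gen N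
  | ConstLetter.rho s i => Gen.rho s i
  | ConstLetter.zeta s i => Gen.zeta s i

/-- The word of lowest components of a product of superfields. -/
def genWord (w : List (ConstLetter N)) {m : ℕ} (t : Fin m → FieldLetter) (k : Fin m → ℤ) :
    List (Gen N) := w.map ConstLetter.gen ++ List.ofFn fun i => (t i).gen (k i)

theorem eqBody_theta_mul (t : Sgn) (c : ℂ) (f g : Raw N) :
    EqBody (f + c • rawMul (X (Gen.theta t)).1 g) f := by
  intro w hw
  have : rawMul (X (Gen.theta t)).1 g w = 0 := by
    by_contra h
    obtain ⟨w', p, _⟩ := X_mul_support _ _ _ h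
    have := hw (Gen.theta t) (by rw [p.mem_iff]; simp)
    simp [Gen.isTheta] at this
  simp [this]

theorem eqBody_Upsilon (nabla : ℤ → ℂ) (s : Sgn) (n : ℤ) :
    (Upsilon (N := N) nabla s n).1 = (X (Gen.F s n)).1 +
    (-Complex.I) • rawMul (X (Gen.theta s.opp)).1 (applyNabla nabla (Gen.chibar s) n).1 := by
  rw [neg_smul, ← sub_eq_add_neg]; rfl

theorem FieldLetter.eqBody (nabla : ℤ → ℂ) (t : FieldLetter) (n : ℤ) :
    EqBody (t.val (N := N) nabla n).1 (X (t.gen n)).1 := by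
  cases t with
  | Phi s => exact eqBody_theta_mul s _ _ _
  | Psi s =>
    intro w hw
    have h1 := eqBody_theta_mul s.opp (s.toC * Complex.I) ((X (Gen.chi s n)).1 +
      rawMul (X (Gen.theta s)).1 (LatticeSusy.Upsilon nabla s n).1) (applyNabla nabla (Gen.phi s) n).1 w hw
    have h2 := eqBody_theta_mul s 1 (X (Gen.chi s n)).1 (LatticeSusy.Upsilon nabla s n).1 w hw
    rw [one_smul] at h2
    exact h1.trans h2
  | Upsilon s =>
    have := eqBody_theta_mul s.opp (-Complex.I) (X (Gen.F s n)).1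
      (applyNabla nabla (Gen.chibar (N := N) s) n).1
    rw [← eqBody_Upsilon] at this
    exact this
  | S s => exact EqBody.refl _

theorem ConstLetter.eqBody (t : ConstLetter N) : EqBody t.val.1 (X t.gen).1 := by
  cases t with
  | rho s i => exact eqBody_theta_mul s _ _ _
  | zeta s i => exact EqBody.refl _

theorem hasWt_theta_mul {ω : Gen N → ℤ} (h0 : ∀ t, ω (Gen.theta t) = 0) (t : Sgn) {k : ℤ}
    {g : Raw N} (hg : HasWt ω k g) : HasWt ω k (rawMul (X (Gen.theta t)).1 g) := by
  have := (hasWt_X ω (Gen.theta t)).rawMul hg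
  rwa [h0, zero_add] at this

theorem hasWt_applyNabla {ω : Gen N → ℤ} {k : ℤ} (nabla : ℤ → ℂ) {A : ℤ → Gen N}
    (hA : Function.Injective A) (h : ∀ m, ω (A m) = k) (n : ℤ) :
    HasWt ω k (applyNabla nabla A n).1 := by
  intro w hw
  obtain ⟨m, rfl⟩ := (applyNabla_coeff nabla hA n).1 w hw
  simp [h]

theorem FieldLetter.hasWt (nabla : ℤ → ℂ) (t : FieldLetter) (n : ℤ) :
    HasWt wField 1 (t.val (N := N) nabla n).1 := by
  have h0 : ∀ t : Sgn, wField (Gen.theta (N := N) t) = 0 := fun _ => rfl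
  have hU : ∀ s, HasWt wField 1 (LatticeSusy.Upsilon (N := N) nabla s n).1 := fun s => by
    rw [eqBody_Upsilon]
    exact (hasWt_X wField (Gen.F s n)).add ((hasWt_theta_mul h0 _
      (hasWt_applyNabla nabla (chibar_injective s) (fun _ => rfl) n)).smul _)
  cases t with
  | Phi s =>
    exact (hasWt_X wField (Gen.phi s n)).add
      ((hasWt_theta_mul h0 _ (hasWt_X wField (Gen.chibar s n))).smul _)
  | Psi s =>
    exact ((hasWt_X wField (Gen.chi s n)).add (hasWt_theta_mul h0 s (hU s))).add
      ((hasWt_theta_mul h0 _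
        (hasWt_applyNabla nabla (phi_injective s) (fun _ => rfl) n)).smul (s.toC * Complex.I))
  | Upsilon s => exact hU s
  | S s => exact hasWt_X wField (Gen.chibar s n)

theorem ConstLetter.hasWt (t : ConstLetter N) : HasWt wField 1 t.val.1 := by
  have h0 : ∀ t : Sgn, wField (Gen.theta (N := N) t) = 0 := fun _ => rfl
  cases t with
  | rho s i =>
    exact (hasWt_X wField (Gen.rho s i)).add
      ((hasWt_theta_mul h0 _ (hasWt_X wField (Gen.zeta s i))).smul _)
  | zeta s i => exact hasWt_X wField (Gen.zeta s i)

/-! ### Products of superfields -/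

/-- The product of constant and site-dependent superfields in a term of a local functional. -/
noncomputable def sfProd (nabla : ℤ → ℂ) (w : List (ConstLetter N)) {m : ℕ}
    (t : Fin m → FieldLetter) (k : Fin m → ℤ) : Series N :=
  (w.map ConstLetter.val).prod * (List.ofFn fun i => (t i).val nabla (k i)).prod

theorem isSuperfield_prod {nabla : ℤ → ℂ} (hn : IsDifferenceOperator nabla) (l : List (Series N))
    (h : ∀ x ∈ l, IsSuperfield nabla x.1) : IsSuperfield nabla l.prod.1 := by
  induction l with
  | nil => exact isSuperfield_one nabla
  | cons x l ih =>
    rw [List.prod_cons]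
    exact (h x (by simp)).mul hn (ih fun y hy => h y (by simp [hy]))

theorem hasWt_prod {ω : Gen N → ℤ} (l : List (Series N)) (h : ∀ x ∈ l, HasWt ω 1 x.1) :
    HasWt ω l.length l.prod.1 := by
  induction l with
  | nil => exact hasWt_one ω
  | cons x l ih =>
    rw [List.prod_cons, List.length_cons]
    have := (h x (by simp)).rawMul (ih fun y hy => h y (by simp [hy]))
    rw [add_comm] at this
    exact_mod_cast this

theorem isSuperfield_sfProd {nabla : ℤ → ℂ} (hn : IsDifferenceOperator nabla)
    (w : List (ConstLetter N)) {m : ℕ} (t : Fin m → FieldLetter) (k : Fin m → ℤ) :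
    IsSuperfield nabla (sfProd nabla w t k).1 := by
  refine (isSuperfield_prod hn _ ?_).mul hn (isSuperfield_prod hn _ ?_)
  · intro x hx
    obtain ⟨c, _, rfl⟩ := List.mem_map.mp hx
    exact c.isSuperfield hn
  · intro x hx
    obtain ⟨i, rfl⟩ := List.mem_ofFn.mp hx
    exact (t i).isSuperfield hn _

theorem hasWt_sfProd (nabla : ℤ → ℂ) (w : List (ConstLetter N)) {m : ℕ}
    (t : Fin m → FieldLetter) (k : Fin m → ℤ) :
    HasWt wField (w.length + m : ℕ) (sfProd nabla w t k).1 := by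
  have h1 : HasWt wField (w.map ConstLetter.val).length (w.map ConstLetter.val).prod.1 := by
    refine hasWt_prod _ fun x hx => ?_
    obtain ⟨c, _, rfl⟩ := List.mem_map.mp hx
    exact c.hasWt
  have h2 : HasWt wField (List.ofFn fun i => (t i).val (N := N) nabla (k i)).length
      (List.ofFn fun i => (t i).val (N := N) nabla (k i)).prod.1 := by
    refine hasWt_prod _ fun x hx => ?_
    obtain ⟨i, rfl⟩ := List.mem_ofFn.mp hx
    exact (t i).hasWt nabla _
  have := h1.rawMul h2
  rw [List.length_map, List.length_ofFn] at this
  exact_mod_cast this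

theorem eqBody_sfProd (nabla : ℤ → ℂ) (w : List (ConstLetter N)) {m : ℕ}
    (t : Fin m → FieldLetter) (k : Fin m → ℤ) :
    EqBody (sfProd nabla w t k).1 (mono (genWord w t k)) := by
  rw [genWord, mono_append]
  refine EqBody.rawMul ?_ ?_
  · induction w with
    | nil => exact EqBody.refl _
    | cons c w ih =>
      rw [List.map_cons, List.prod_cons, List.map_cons, mono]
      exact c.eqBody.rawMul ih
  · induction m with
    | zero => exact EqBody.refl _
    | succ m ih =>
      rw [List.ofFn_succ, List.ofFn_succ, List.prod_cons, mono]
      exact ((t 0).eqBody nabla _).rawMul (ih (fun i => t i.succ) (fun i => k i.succ))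

theorem usummable_X {A : ℤ → Gen N} (hA : Function.Injective A) :
    USummable (fun n => (X (A n)).1) := by
  refine fun d => ⟨1, by norm_num, fun w _ => ?_⟩
  have hv : ∀ n, (X (A n)).1 w = if w = [A n] then 1 else 0 := fun n => rfl
  by_cases h : ∃ n, w = [A n]
  · obtain ⟨n, rfl⟩ := h
    have := hasSum_single (f := fun m => ‖(X (A m)).1 [A n]‖) n (fun m hm => by
      rw [hv, if_neg, norm_zero]
      intro e
      exact hm (hA (by simpa using e)).symm)
    refine ⟨this.summable, ?_⟩
    rw [this.tsum_eq, hv]; simp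
  · push Not at h
    have : ∀ n, (X (A n)).1 w = 0 := fun n => by rw [hv, if_neg (h n)]
    simp only [this, norm_zero, tsum_zero]
    exact ⟨summable_zero, zero_le_one⟩

theorem IsDifferenceOperator.summable {nabla : ℤ → ℂ} (hn : IsDifferenceOperator nabla) :
    Summable (fun j => ‖nabla j‖) := by
  obtain ⟨L, M, hL, hM, h⟩ := hn.decay
  simpa using summable_nabla_weighted hM h

theorem usummable_applyNabla {nabla : ℤ → ℂ} (hn : IsDifferenceOperator nabla) {A : ℤ → Gen N}
    (hA : Function.Injective A) : USummable (fun n => (applyNabla nabla A n).1) := by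
  refine fun d => ⟨∑' j, ‖nabla j‖, tsum_nonneg fun _ => norm_nonneg _, fun w _ => ?_⟩
  by_cases h : ∃ m, w = [A m]
  · obtain ⟨m, rfl⟩ := h
    simp only [(applyNabla_coeff nabla hA _).2]
    have h4 := hn.summable.comp_injective (sub_left_injective (b := m))
    refine ⟨by simpa only [Function.comp_def] using h4, le_of_eq ?_⟩
    exact (Equiv.subRight m).tsum_eq (fun j => ‖nabla j‖)
  · have : ∀ n, (applyNabla nabla A n).1 w = 0 := fun n => by
      by_contra h0
      exact h ((applyNabla_coeff nabla hA n).1 w h0)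
    simp only [this, norm_zero, tsum_zero]
    exact ⟨summable_zero, tsum_nonneg fun _ => norm_nonneg _⟩

theorem USummable.const_smul {I : Type*} {F : I → Raw N} (hF : USummable F) (c : ℂ) :
    USummable (fun i => c • F i) :=
  hF.smul (c := fun _ => c) (L := ‖c‖) fun _ => le_rfl

theorem FieldLetter.usummable {nabla : ℤ → ℂ} (hn : IsDifferenceOperator nabla) (t : FieldLetter) :
    USummable (fun n => (t.val (N := N) nabla n).1) := by
  have hU : ∀ s, USummable (fun n => (LatticeSusy.Upsilon (N := N) nabla s n).1) := fun s => by
    simp only [eqBody_Upsilon]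
    exact (usummable_X (fun _ _ h => by simpa using h)).add
      (((usummable_applyNabla hn (chibar_injective s)).const_mul (tame_X _)).const_smul _)
  cases t with
  | Phi s =>
    exact (usummable_X (phi_injective s)).add
      (((usummable_X (chibar_injective s)).const_mul (tame_X (Gen.theta s))).const_smul s.toC)
  | Psi s =>
    have h1 : USummable (fun n => (X (Gen.chi (N := N) s n)).1) :=
      usummable_X (fun _ _ h => by simpa using h)
    exact (h1.add ((hU s).const_mul (tame_X (Gen.theta s)))).add
      (((usummable_applyNabla hn (phi_injective s)).const_mul
        (tame_X (Gen.theta s.opp))).const_smul (s.toC * Complex.I))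
  | Upsilon s => exact hU s
  | S s => exact usummable_X (chibar_injective s)

theorem usummable_sfProd {nabla : ℤ → ℂ} (hn : IsDifferenceOperator nabla)
    (w : List (ConstLetter N)) {m : ℕ} (t : Fin m → FieldLetter) :
    USummable (fun k => (sfProd nabla w t k).1) := by
  have h1 : USummable (fun k : Fin m → ℤ =>
      (List.ofFn fun i => (t i).val (N := N) nabla (k i)).prod.1) := by
    induction m with
    | zero =>
      have h0 : USummable (fun _ : Fin 0 → ℤ => (rawOne : Raw N)) :=
        tame_one.usummable.reindex (Equiv.equivPUnit (Fin 0 → ℤ))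
      simpa [series_one_val] using h0
    | succ m ih =>
      have h2 := (((t 0).usummable (N := N) hn).rawMul (ih (fun i => t i.succ))).reindex
        (Fin.consEquiv (fun _ : Fin (m + 1) => ℤ)).symm
      refine Eq.mp ?_ h2
      congr 1
      funext k
      rw [List.ofFn_succ, List.prod_cons]
      rfl
  refine h1.const_mul (f := (w.map ConstLetter.val).prod.1) ?_
  refine (isSuperfield_prod hn _ fun x hx => ?_).tame
  obtain ⟨c, _, rfl⟩ := List.mem_map.mp hx
  exact c.isSuperfield hn

theorem IsTILC.bounded {n : ℕ} {C : (Fin (n + 1) → ℤ) → ℂ} (hC : IsTILC C) :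
    ∃ L : ℝ, ∀ k, ‖C k‖ ≤ L := by
  obtain ⟨L, M, hL, hM, h⟩ := hC.decay
  exact ⟨L, fun k => by simpa using h k 0 0⟩

theorem IsTILC.translate {n : ℕ} {C : (Fin n → ℤ) → ℂ} (hC : IsTILC C) (j : ℤ) (k : Fin n → ℤ) :
    C (fun i => k i + j) = C k := by
  induction j using Int.induction_on generalizing k with
  | zero => simp
  | succ j ih =>
    rw [← ih k, ← hC.translation (fun i => k i + ↑j)]
    congr 1; funext i; ring
  | pred j ih =>
    rw [← ih k, ← hC.translation (fun i => k i + (-↑j - 1))]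
    congr 1; funext i; ring

/-- Sums of products of superfields with bounded coefficients converge. -/
theorem exists_sum_sfProd {nabla : ℤ → ℂ} (hn : IsDifferenceOperator nabla)
    (w : List (ConstLetter N)) {m : ℕ} (t : Fin m → FieldLetter) {C : (Fin m → ℤ) → ℂ} {L : ℝ}
    (hC : ∀ k, ‖C k‖ ≤ L) : ∃ x : Series N, HasSum (fun k => C k • sfProd nabla w t k) x ∧
      ∀ v, x.1 v = ∑' k, C k * (sfProd nabla w t k).1 v :=
  hasSum_series_of_summable fun v => (((usummable_sfProd hn w t).smul hC).hasSum v).summable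

/-- Relabelling the letters of words. -/
theorem mono_map {σ : Gen N → Gen N} (hσ : Function.Injective σ) (ho : ∀ a, (σ a).odd = a.odd)
    (l w : List (Gen N)) : mono (l.map σ) (w.map σ) = mono l w := by
  have key : ∀ (b : Gen N) (w : List (Gen N)) (f g : Raw N), (∀ v, f (v.map σ) = g v) →
      rawMul (X (σ b)).1 f (w.map σ) = rawMul (X b).1 g w := by
    intro b w
    induction w with
    | nil => intros; simp [X_mul_nil]
    | cons a w ih =>
      intro f g hfg
      have e : eps (σ a) (σ b) = eps a b := by unfold eps; rw [ho, ho]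
      rw [List.map_cons, X_mul_cons, X_mul_cons, e,
        ih (rawD (σ a) f) (rawD a g) (fun v => hfg (a :: v)), hfg]
      simp only [hσ.eq_iff]
  induction l generalizing w with
  | nil => cases w <;> rfl
  | cons b l ih => exact key b w _ _ ih

theorem genWord_shift (w : List (ConstLetter N)) {m : ℕ} (t : Fin m → FieldLetter) (k : Fin m → ℤ)
    (j : ℤ) : genWord w t (fun i => k i + j) = (genWord w t k).map (Gen.shift j) := by
  rw [genWord, genWord, List.map_append, List.map_map, List.map_ofFn]
  congr 1
  · refine List.map_congr_left fun c _ => ?_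
    cases c <;> rfl
  · congr 1; funext i
    simp only [Function.comp]
    cases t i <;> rfl

/-- The properties of the Taylor coefficients of a local functional of degree `d` and fermion number
`q`; locality is stated at `θ_± = 0`. -/
structure LocalCoeffs (nabla : ℤ → ℂ) (q : ℤ) (d : ℕ) (x : Raw N) : Prop where
  superfield : IsSuperfield nabla x
  degree : HasWt wField d x
  support : ∀ w, (∀ a ∈ w, a.isTheta = false) → x w ≠ 0 →
    wt wNF w = q ∧ ∃ a ∈ w, a.site ≠ none
  trans : ∀ j w, (∀ a ∈ w, a.isTheta = false) → x (w.map (Gen.shift j)) = x w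
  decay : ∃ L M : ℝ, 0 < M ∧ 0 ≤ L ∧ ∀ (w : List (Gen N)), (∀ a ∈ w, a.isTheta = false) →
    ∀ m n : ℤ, some m ∈ w.map Gen.site → some n ∈ w.map Gen.site →
      ‖x w‖ ≤ L * Real.exp (-(M * |((m - n : ℤ) : ℝ)|))

theorem site_gen (t : FieldLetter) (n : ℤ) : (t.gen (N := N) n).site = some n := by
  cases t <;> rfl

theorem site_constGen (c : ConstLetter N) : c.gen.site = none := by cases c <;> rfl

theorem wNF_genWord (w : List (ConstLetter N)) {m : ℕ} (t : Fin m → FieldLetter) (k : Fin m → ℤ) :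
    wt wNF (genWord w t k) = (w.map ConstLetter.nF).sum + ∑ i, (t i).nF := by
  rw [genWord, wt_append, wt, wt, List.map_map, List.map_ofFn, List.sum_ofFn]
  congr 1
  · congr 1
    refine List.map_congr_left fun c _ => ?_
    cases c <;> rfl
  · refine Finset.sum_congr rfl fun i _ => ?_
    simp only [Function.comp]
    cases t i <;> rfl

/-- At `θ_± = 0` every site-dependent superfield is a single letter, so the coefficients of a local
monomial there are those of the defining sum, with signs. -/
theorem localCoeffs_of_monomial {nabla : ℤ → ℂ} (hn : IsDifferenceOperator nabla) {q : ℤ} {d : ℕ}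
    {x : Series N} (hx : IsLocalMonomial nabla q d x) : LocalCoeffs nabla q d x.1 := by
  obtain ⟨w, r, t, C, hC, hd, hq, hs⟩ := hx
  have hs : HasSum (fun k => C k • sfProd nabla w t k) x := hs
  rw [hasSum_series_iff] at hs
  obtain ⟨L0, hL0⟩ := hC.bounded
  have hU := (usummable_sfProd hn w t).smul hL0
  have hx : x.1 = fun v => ∑' k, (C k • (sfProd nabla w t k).1) v := by
    funext v; exact (hs v).tsum_eq.symm
  have hbody : ∀ v, (∀ a ∈ v, a.isTheta = false) →
      x.1 v = ∑' k, C k * mono (genWord w t k) v := by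
    intro v hv
    rw [hx]
    refine tsum_congr fun k => ?_
    rw [Pi.smul_apply, smul_eq_mul, eqBody_sfProd nabla w t k v hv]
  have hsupp : ∀ v, (∀ a ∈ v, a.isTheta = false) → x.1 v ≠ 0 → ∃ k, v.Perm (genWord w t k) := by
    intro v hv h0
    rw [hbody v hv] at h0
    obtain ⟨k, hk⟩ : ∃ k, C k * mono (genWord w t k) v ≠ 0 := by
      by_contra! h
      exact h0 (by simp only [h, tsum_zero])
    exact ⟨k, mono_support _ _ (right_ne_zero_of_mul hk)⟩
  refine ⟨?_, ?_, ?_, ?_, ?_⟩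
  · rw [hx]
    exact isSuperfield_tsum hn hU fun k => (isSuperfield_sfProd hn w t k).smul _
  · intro v hv
    refine HasWt.hasSum (F := fun k => (C k • sfProd nabla w t k : Series N).1)
      (fun k => ?_) (hs v) hv
    rw [← hd]
    exact (hasWt_sfProd nabla w t k).smul _
  · intro v hv h0
    obtain ⟨k, p⟩ := hsupp v hv h0
    refine ⟨by rw [wt_perm _ p, wNF_genWord, hq], (t 0).gen (k 0), ?_, by rw [site_gen]; simp⟩
    rw [p.mem_iff, genWord, List.mem_append]
    exact Or.inr (List.mem_ofFn.mpr ⟨0, rfl⟩)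
  · intro j v hv
    have hv' : ∀ a ∈ v.map (Gen.shift j), a.isTheta = false := by
      intro a ha
      obtain ⟨b, hb, rfl⟩ := List.mem_map.mp ha
      rw [Gen.shift_isTheta]; exact hv b hb
    rw [hbody v hv, hbody _ hv']
    rw [← (Equiv.addRight (fun _ : Fin (r + 1) => j)).tsum_eq
      (fun k => C k * mono (genWord w t k) (v.map (Gen.shift j)))]
    refine tsum_congr fun k => ?_
    have e : (Equiv.addRight (fun _ : Fin (r + 1) => j)) k = fun i => k i + j := rfl
    rw [e, hC.translate, genWord_shift, mono_map (Gen.shift_injective j) (Gen.shift_odd j)]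
  · obtain ⟨L, M, hL, hM, hdec⟩ := hC.decay
    obtain ⟨G, hG, hb⟩ := usummable_sfProd (N := N) hn w t (w.length + (r + 1))
    refine ⟨L * G, M, hM, by positivity, fun v hv m n hm hn' => ?_⟩
    by_cases h0 : x.1 v = 0
    · rw [h0, norm_zero]; positivity
    obtain ⟨k0, p0⟩ := hsupp v hv h0
    have hlen : v.length = w.length + (r + 1) := by
      rw [p0.length_eq, genWord]; simp
    obtain ⟨s1, b1⟩ := hb v hlen
    have hsite : ∀ (k : Fin (r + 1) → ℤ) (m : ℤ), v.Perm (genWord w t k) →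
        some m ∈ v.map Gen.site → ∃ i, k i = m := by
      intro k m p hm
      obtain ⟨a, ha, ham⟩ := List.mem_map.mp hm
      rw [p.mem_iff, genWord, List.mem_append] at ha
      rcases ha with ha | ha
      · obtain ⟨c, _, rfl⟩ := List.mem_map.mp ha
        rw [site_constGen] at ham
        simp at ham
      · obtain ⟨i, rfl⟩ := List.mem_ofFn.mp ha
        rw [site_gen] at ham
        exact ⟨i, by simpa using ham⟩
    have key : ∀ k, ‖C k * mono (genWord w t k) v‖ ≤
        (L * Real.exp (-(M * |((m - n : ℤ) : ℝ)|))) * ‖(sfProd nabla w t k).1 v‖ := by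
      intro k
      rw [eqBody_sfProd nabla w t k v hv, norm_mul]
      by_cases h1 : mono (genWord w t k) v = 0
      · simp [h1]
      · have p := mono_support _ _ h1
        obtain ⟨i, hi⟩ := hsite k m p hm
        obtain ⟨j, hj⟩ := hsite k n p hn'
        refine mul_le_mul_of_nonneg_right ?_ (norm_nonneg _)
        have := hdec k i j
        rw [hi, hj, neg_mul] at this
        exact this
    have s2 : Summable (fun k => (L * Real.exp (-(M * |((m - n : ℤ) : ℝ)|))) *
        ‖(sfProd nabla w t k).1 v‖) := Summable.mul_left _ s1
    have s3 := Summable.of_nonneg_of_le (fun k => norm_nonneg _) key s2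
    rw [hbody v hv]
    refine (norm_tsum_le_tsum_norm s3).trans ((s3.tsum_le_tsum key s2).trans ?_)
    rw [tsum_mul_left]
    calc _ ≤ (L * Real.exp (-(M * |((m - n : ℤ) : ℝ)|))) * G :=
          mul_le_mul_of_nonneg_left b1 (by positivity)
      _ = _ := by ring

theorem localCoeffs_zero {nabla : ℤ → ℂ} (q : ℤ) (d : ℕ) :
    LocalCoeffs nabla q d (0 : Raw N) where
  superfield := by simpa using (isSuperfield_one (N := N) nabla).smul 0
  degree := fun w hw => absurd rfl hw
  support := fun w _ hw => absurd rfl hw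
  trans := fun _ _ _ => rfl
  decay := ⟨0, 1, one_pos, le_rfl, fun w _ m n _ _ => by simp⟩

theorem LocalCoeffs.add {nabla : ℤ → ℂ} (hn : IsDifferenceOperator nabla) {q : ℤ} {d : ℕ}
    {x y : Raw N} (hx : LocalCoeffs nabla q d x) (hy : LocalCoeffs nabla q d y) :
    LocalCoeffs nabla q d (x + y) where
  superfield := hx.superfield.add hn hy.superfield
  degree := hx.degree.add hy.degree
  support := fun w hw h0 => by
    by_cases h : x w = 0
    · exact hy.support w hw (by simpa [h] using h0)
    · exact hx.support w hw h
  trans := fun j w hw => by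
    rw [Pi.add_apply, Pi.add_apply, hx.trans j w hw, hy.trans j w hw]
  decay := by
    obtain ⟨L, M, hM, hL, h⟩ := hx.decay
    obtain ⟨L', M', hM', hL', h'⟩ := hy.decay
    refine ⟨L + L', min M M', lt_min hM hM', by positivity, fun w hw m n hm hn' => ?_⟩
    rw [Pi.add_apply, add_mul]
    refine (norm_add_le _ _).trans (add_le_add ?_ ?_)
    · exact (h w hw m n hm hn').trans (mul_le_mul_of_nonneg_left
        (exp_rate_le (min_le_left _ _) (abs_nonneg _)) hL)
    · exact (h' w hw m n hm hn').trans (mul_le_mul_of_nonneg_left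
        (exp_rate_le (min_le_right _ _) (abs_nonneg _)) hL')

theorem LocalCoeffs.smul {nabla : ℤ → ℂ} {q : ℤ} {d : ℕ}
    {x : Raw N} (hx : LocalCoeffs nabla q d x) (c : ℂ) : LocalCoeffs nabla q d (c • x) where
  superfield := hx.superfield.smul c
  degree := hx.degree.smul c
  support := fun w hw h0 => hx.support w hw (right_ne_zero_of_mul h0)
  trans := fun j w hw => by rw [Pi.smul_apply, Pi.smul_apply, hx.trans j w hw]
  decay := by
    obtain ⟨L, M, hM, hL, h⟩ := hx.decay
    refine ⟨‖c‖ * L, M, hM, by positivity, fun w hw m n hm hn' => ?_⟩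
    rw [Pi.smul_apply, smul_eq_mul, norm_mul, mul_assoc]
    exact mul_le_mul_of_nonneg_left (h w hw m n hm hn') (norm_nonneg c)

theorem localCoeffs_of_mem_span {nabla : ℤ → ℂ} (hn : IsDifferenceOperator nabla) {q : ℤ} {d : ℕ}
    {x : Series N} (hx : x ∈ Submodule.span ℂ {y | IsLocalMonomial nabla q d y}) :
    LocalCoeffs nabla q d x.1 := by
  induction hx using Submodule.span_induction with
  | mem x h => exact localCoeffs_of_monomial hn h
  | zero => exact localCoeffs_zero q d
  | add x y _ _ hx hy => exact hx.add hn hy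
  | smul c x _ hx => exact hx.smul c

end LatticeSusy

namespace LatticeSusy

variable {N : ℕ}

/-! ### Local coefficient functions and their superfield lifts -/

/-- Taylor coefficients at `θ_± = 0` of a local functional of degree `d`: supported on words of `d`
letters with at least one site letter and without `θ_±`, invariant under translations, and decaying
exponentially in all differences of sites. -/
structure IsLoc (d : ℕ) (f : Raw N) : Prop where
  symm : GradedSymm f
  length : ∀ w, f w ≠ 0 → w.length = d
  body : ∀ w, f w ≠ 0 → ∀ a ∈ w, a.isTheta = false
  site : ∀ w, f w ≠ 0 → ∃ a ∈ w, a.site ≠ none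
  trans : ∀ j w, f (w.map (Gen.shift j)) = f w
  decay : ∃ L M : ℝ, 0 < M ∧ 0 ≤ L ∧ ∀ (w : List (Gen N)) (m n : ℤ),
    some m ∈ w.map Gen.site → some n ∈ w.map Gen.site →
      ‖f w‖ ≤ L * Real.exp (-(M * |((m - n : ℤ) : ℝ)|))

theorem IsLoc.smul {d : ℕ} {f : Raw N} (hf : IsLoc d f) (c : ℂ) : IsLoc d (c • f) where
  symm := (Series N).smul_mem c hf.symm
  length w h := hf.length w (right_ne_zero_of_mul h)
  body w h := hf.body w (right_ne_zero_of_mul h)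
  site w h := hf.site w (right_ne_zero_of_mul h)
  trans j w := by rw [Pi.smul_apply, Pi.smul_apply, hf.trans]
  decay := by
    obtain ⟨L, M, hM, hL, h⟩ := hf.decay
    refine ⟨‖c‖ * L, M, hM, by positivity, fun w m n hm hn => ?_⟩
    rw [Pi.smul_apply, smul_eq_mul, norm_mul, mul_assoc]
    exact mul_le_mul_of_nonneg_left (h w m n hm hn) (norm_nonneg c)

theorem IsLoc.add {d : ℕ} {f g : Raw N} (hf : IsLoc d f) (hg : IsLoc d g) : IsLoc d (f + g) := by
  have key : ∀ w, (f + g) w ≠ 0 → f w ≠ 0 ∨ g w ≠ 0 := by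
    intro w h
    by_contra! h'
    exact h (by simp [h'.1, h'.2])
  refine ⟨(Series N).add_mem hf.symm hg.symm, fun w h => (key w h).elim (hf.length w) (hg.length w),
    fun w h => (key w h).elim (hf.body w) (hg.body w),
    fun w h => (key w h).elim (hf.site w) (hg.site w), fun j w => ?_, ?_⟩
  · rw [Pi.add_apply, Pi.add_apply, hf.trans, hg.trans]
  · obtain ⟨L, M, hM, hL, h⟩ := hf.decay
    obtain ⟨L', M', hM', hL', h'⟩ := hg.decay
    refine ⟨L + L', min M M', lt_min hM hM', by positivity, fun w m n hm hn' => ?_⟩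
    rw [Pi.add_apply, add_mul]
    refine (norm_add_le _ _).trans (add_le_add ?_ ?_)
    · exact (h w m n hm hn').trans (mul_le_mul_of_nonneg_left
        (exp_rate_le (min_le_left _ _) (abs_nonneg _)) hL)
    · exact (h' w m n hm hn').trans (mul_le_mul_of_nonneg_left
        (exp_rate_le (min_le_right _ _) (abs_nonneg _)) hL')

theorem isLoc_zero (d : ℕ) : IsLoc d (0 : Raw N) where
  symm := (Series N).zero_mem
  length _ h := absurd rfl h
  body _ h := absurd rfl h
  site _ h := absurd rfl h
  trans _ _ := rfl
  decay := ⟨0, 1, one_pos, le_rfl, fun w m n _ _ => by simp⟩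

theorem isLoc_sum {d : ℕ} {I : Type*} (s : Finset I) (F : I → Raw N) (h : ∀ i ∈ s, IsLoc d (F i)) :
    IsLoc d (∑ i ∈ s, F i) := by
  classical
  induction s using Finset.induction_on with
  | empty => simpa using isLoc_zero d
  | insert a s ha ih =>
    rw [Finset.sum_insert ha]
    exact (h a (by simp)).add (ih fun i hi => h i (by simp [hi]))

/-- Projections to a fixed translation-invariant weight preserve locality. -/
theorem IsLoc.proj {d : ℕ} {f : Raw N} (hf : IsLoc d f) {ω : Gen N → ℤ}
    (hω : ∀ j a, ω (Gen.shift j a) = ω a) (k : ℤ) : IsLoc d (proj ω k f) := by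
  have h0 : ∀ w, LatticeSusy.proj ω k f w ≠ 0 → f w ≠ 0 := by
    intro w h; unfold LatticeSusy.proj at h; split_ifs at h; exact h; exact absurd rfl h
  refine ⟨hf.symm.proj ω k, fun w h => hf.length w (h0 w h), fun w h => hf.body w (h0 w h),
    fun w h => hf.site w (h0 w h), fun j w => ?_, ?_⟩
  · have : wt ω (w.map (Gen.shift j)) = wt ω w := by
      rw [wt, wt, List.map_map]
      congr 1
      exact List.map_congr_left fun a _ => hω j a
    simp only [LatticeSusy.proj, this, hf.trans]
  · obtain ⟨L, M, hM, hL, h⟩ := hf.decay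
    refine ⟨L, M, hM, hL, fun w m n hm hn => ?_⟩
    unfold LatticeSusy.proj
    split_ifs
    · exact h w m n hm hn
    · rw [norm_zero]; positivity

theorem IsLoc.tame {d : ℕ} {f : Raw N} (hf : IsLoc d f) : Tame {0} f := by
  obtain ⟨L, M, hM, hL, h⟩ := hf.decay
  rw [tame_zero_iff]
  intro _
  refine ⟨L, hL, fun w _ => ?_⟩
  by_cases h0 : f w = 0
  · rw [h0, norm_zero]; exact hL
  obtain ⟨a, ha, hs⟩ := hf.site w h0
  obtain ⟨m, hm⟩ := Option.ne_none_iff_exists'.mp hs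
  have hm' : some m ∈ w.map Gen.site := List.mem_map.mpr ⟨a, ha, hm⟩
  simpa using h w m m hm' hm'

/-- The number of constant letters. -/
def wConst : Gen N → ℤ
  | Gen.rho _ _ => 1
  | Gen.zeta _ _ => 1
  | _ => 0

/-- The number of site letters. -/
def wSite (a : Gen N) : ℤ := if a.site = none then 0 else 1

theorem wt_const_add_site {w : List (Gen N)} (h : ∀ a ∈ w, a.isTheta = false) :
    wt wConst w + wt wSite w = w.length := by
  induction w with
  | nil => simp
  | cons a w ih =>
    have := ih fun b hb => h b (by simp [hb])
    have h1 : wConst a + wSite a = 1 := by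
      have := h a (by simp)
      cases a <;> simp [wConst, wSite, Gen.site, Gen.isTheta] at this ⊢
    rw [wt_cons, wt_cons, List.length_cons]
    push_cast
    linarith

theorem wt_nonneg {ω : Gen N → ℤ} (h : ∀ a, 0 ≤ ω a) (w : List (Gen N)) : 0 ≤ wt ω w := by
  refine List.sum_nonneg fun x hx => ?_
  obtain ⟨a, _, rfl⟩ := List.mem_map.mp hx
  exact h a

theorem wSite_nonneg (a : Gen N) : 0 ≤ wSite a := by unfold wSite; split_ifs <;> simp

theorem wConst_nonneg (a : Gen N) : 0 ≤ wConst a := by cases a <;> simp [wConst]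

theorem wt_site_pos {w : List (Gen N)} (h : ∃ a ∈ w, a.site ≠ none) : 0 < wt wSite w := by
  induction w with
  | nil => simp at h
  | cons a w ih =>
    rw [wt_cons]
    obtain ⟨b, hb, hs⟩ := h
    rcases List.mem_cons.mp hb with rfl | hb
    · have : wSite b = 1 := by simp [wSite, hs]
      have := wt_nonneg wSite_nonneg w
      omega
    · have := ih ⟨b, hb, hs⟩
      have := wSite_nonneg a
      omega

instance : Fintype Sgn := ⟨{Sgn.plus, Sgn.minus}, fun s => by cases s <;> simp⟩

open Classical in
noncomputable instance : Fintype FieldLetter :=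
  Fintype.ofSurjective (fun p : Fin 4 × Sgn => match p.1 with
    | 0 => FieldLetter.Phi p.2
    | 1 => FieldLetter.Psi p.2
    | 2 => FieldLetter.Upsilon p.2
    | 3 => FieldLetter.S p.2) fun t => by
    cases t with
    | Phi s => exact ⟨(0, s), rfl⟩
    | Psi s => exact ⟨(1, s), rfl⟩
    | Upsilon s => exact ⟨(2, s), rfl⟩
    | S s => exact ⟨(3, s), rfl⟩

open Classical in
noncomputable instance : Fintype (ConstLetter N) :=
  Fintype.ofSurjective (fun p : (Sgn × Fin N) ⊕ (Sgn × Fin N) => match p with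
    | Sum.inl p => ConstLetter.rho p.1 p.2
    | Sum.inr p => ConstLetter.zeta p.1 p.2) fun t => by
    cases t with
    | rho s i => exact ⟨Sum.inl (s, i), rfl⟩
    | zeta s i => exact ⟨Sum.inr (s, i), rfl⟩

theorem constGen_injective : Function.Injective (ConstLetter.gen (N := N)) := by
  intro a b h
  cases a <;> cases b <;> simp_all [ConstLetter.gen]

theorem fieldGen_injective :
    Function.Injective (fun p : FieldLetter × ℤ => p.1.gen (N := N) p.2) := by
  rintro ⟨a, m⟩ ⟨b, n⟩ h
  cases a <;> cases b <;> simp_all [FieldLetter.gen]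

theorem rawMul_smul_one (f : Raw N) (c : ℂ) : rawMul f (c • rawOne) = c • f := by
  rw [rawMul_smul_right, rawMul_one]

/-- A family supported on words of `l + m` letters is constant after `l + m` derivatives. -/
theorem eq_smul_one_of_length {f : Raw N} {d : ℕ} (h : ∀ w, f w ≠ 0 → w.length = d)
    {u : List (Gen N)} (hu : u.length = d) : (fun v => f (u ++ v)) = f u • rawOne := by
  funext v
  cases v with
  | nil => simp [rawOne]
  | cons a v =>
    have : f (u ++ a :: v) = 0 := by
      by_contra h0
      have := h _ h0
      rw [List.length_append, hu, List.length_cons] at this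
      omega
    simp [this, rawOne]

/-- The Taylor expansion in the constants and then in the site letters. -/
theorem taylor_expansion {f : Raw N} {l m : ℕ} (hf : GradedSymm f) (hc : HasWt wConst l f)
    (hs : HasWt wSite m f) (hlen : ∀ w, f w ≠ 0 → w.length = l + m) (w : List (Gen N))
    (hsum : ∀ (c : Fin l → ConstLetter N) (t : Fin m → FieldLetter),
      Summable fun k : Fin m → ℤ => f (genWord (List.ofFn c) t k) *
        mono (genWord (List.ofFn c) t k) w) :
    (l.factorial * m.factorial : ℂ) * f w = ∑ c : Fin l → ConstLetter N,
      ∑ t : Fin m → FieldLetter, ∑' k : Fin m → ℤ,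
        f (genWord (List.ofFn c) t k) * mono (genWord (List.ofFn c) t k) w := by
  have h1 := hasSum_taylor (ℓ := ConstLetter.gen) constGen_injective (ω := wConst)
    (fun b => by cases b <;> rfl) (fun a ha => by
      cases a with
      | rho s i => exact absurd rfl (ha (ConstLetter.rho s i))
      | zeta s i => exact absurd rfl (ha (ConstLetter.zeta s i))
      | _ => rfl) l hf hc w
  have h1' := h1.unique (hasSum_fintype _)
  rw [mul_right_comm, h1', Finset.sum_mul]
  refine Finset.sum_congr rfl fun c _ => ?_
  set u : List (Gen N) := List.ofFn fun i => (c i).gen with hu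
  have hu' : (List.ofFn c).map ConstLetter.gen = u := by rw [List.map_ofFn, hu]; rfl
  have hsu : wt wSite u = 0 := by
    rw [wt]
    refine List.sum_eq_zero fun x hx => ?_
    obtain ⟨a, ha, rfl⟩ := List.mem_map.mp hx
    obtain ⟨i, rfl⟩ := List.mem_ofFn.mp ha
    simp [wSite, site_constGen]
  have hsymm : GradedSymm (fun v => f (u ++ v)) := by
    intro x y a b
    have := hf (u ++ x) y a b
    rwa [List.append_assoc, List.append_assoc] at this
  have hwt : HasWt wSite m (fun v => f (u ++ v)) := by
    intro v hv
    have := hs _ hv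
    rwa [wt_append, hsu, zero_add] at this
  have h2 := hasSum_taylor (ℓ := fun p : FieldLetter × ℤ => p.1.gen (N := N) p.2)
    fieldGen_injective (ω := wSite) (fun b => by simp [wSite, site_gen]) (fun a ha => by
      cases a with
      | phi s n => exact absurd rfl (ha (FieldLetter.Phi s, n))
      | chi s n => exact absurd rfl (ha (FieldLetter.Psi s, n))
      | F s n => exact absurd rfl (ha (FieldLetter.Upsilon s, n))
      | chibar s n => exact absurd rfl (ha (FieldLetter.S s, n))
      | _ => rfl) m hsymm hwt
  have h3 := rawMul_hasSum_right (f := (m.factorial : ℂ) • fun v => f (u ++ v)) h2 (mono u) w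
  rw [rawMul_smul_right, Pi.smul_apply, smul_eq_mul] at h3
  have hterm : ∀ a : Fin m → FieldLetter × ℤ,
      rawMul (mono u) (rawMul (mono (List.ofFn fun i => (a i).1.gen (a i).2))
        (fun v => f (u ++ ((List.ofFn fun i => (a i).1.gen (a i).2) ++ v)))) w =
      f (genWord (List.ofFn c) (fun i => (a i).1) (fun i => (a i).2)) *
        mono (genWord (List.ofFn c) (fun i => (a i).1) (fun i => (a i).2)) w := by
    intro a
    have e : genWord (List.ofFn c) (fun i => (a i).1) (fun i => (a i).2) =
        u ++ (List.ofFn fun i => (a i).1.gen (a i).2) := by rw [genWord, hu']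
    have e2 := eq_smul_one_of_length hlen
      (u := u ++ (List.ofFn fun i => (a i).1.gen (a i).2)) (by simp [hu])
    simp only [List.append_assoc] at e2
    rw [e, e2, rawMul_smul_one, rawMul_smul_right, ← mono_append]
    rfl
  have h4 : HasSum (fun a : Fin m → FieldLetter × ℤ =>
      f (genWord (List.ofFn c) (fun i => (a i).1) (fun i => (a i).2)) *
        mono (genWord (List.ofFn c) (fun i => (a i).1) (fun i => (a i).2)) w)
      (m.factorial * rawMul (mono u) (fun v => f (u ++ v)) w) := by
    refine Eq.mp ?_ h3
    congr 1
    funext a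
    exact hterm a
  have h5 := (Equiv.arrowProdEquivProdArrow (Fin m) (fun _ => FieldLetter)
    (fun _ => ℤ)).symm.hasSum_iff.mpr h4
  have h6 := h5.prod_fiberwise (fun t => (hsum c t).hasSum)
  rw [mul_comm, (hasSum_fintype _).unique h6]

theorem shift_wConst (j : ℤ) (a : Gen N) : wConst (Gen.shift j a) = wConst a := by
  cases a <;> rfl

theorem IsLoc.isTILC {d : ℕ} {f : Raw N} (hf : IsLoc d f) (w : List (ConstLetter N)) {m : ℕ}
    (t : Fin m → FieldLetter) (c : ℂ) : IsTILC (fun k => c * f (genWord w t k)) where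
  translation k := by rw [genWord_shift, hf.trans]
  decay := by
    obtain ⟨L, M, hM, hL, h⟩ := hf.decay
    refine ⟨‖c‖ * L + 1, M, by positivity, hM, fun k i j => ?_⟩
    have hmem : ∀ i, some (k i) ∈ (genWord w t k).map Gen.site := by
      intro i
      refine List.mem_map.mpr ⟨(t i).gen (k i), ?_, site_gen _ _⟩
      rw [genWord, List.mem_append]
      exact Or.inr (List.mem_ofFn.mpr ⟨i, rfl⟩)
    rw [norm_mul, neg_mul]
    have h1 := mul_le_mul_of_nonneg_left (h _ _ _ (hmem i) (hmem j)) (norm_nonneg c)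
    refine h1.trans ?_
    rw [← mul_assoc]
    exact mul_le_mul_of_nonneg_right (by linarith) (Real.exp_pos _).le

/-- A local coefficient function of fermion number `q` is the value at `θ_± = 0` of a local
functional of the superfields: replace every letter by the superfield of which it is the lowest
component. -/
theorem IsLoc.exists_lift {nabla : ℤ → ℂ} (hn : IsDifferenceOperator nabla) {d : ℕ} {q : ℤ}
    {f : Raw N} (hf : IsLoc d f) (hq : HasWt wNF q f) :
    ∃ T ∈ Submodule.span ℂ {y : Series N | IsLocalMonomial nabla q d y}, EqBody T.1 f := by
  have key : ∀ l ∈ Finset.range d, ∃ T ∈ Submodule.span ℂ {y : Series N | IsLocalMonomial nabla q d y},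
      EqBody T.1 (LatticeSusy.proj wConst l f) := by
    intro l hl
    obtain ⟨r, rfl⟩ : ∃ r, d = l + (r + 1) := by
      have := Finset.mem_range.mp hl
      exact ⟨d - l - 1, by omega⟩
    set g := LatticeSusy.proj wConst l f with hg
    have hgl : IsLoc (l + (r + 1)) g := hf.proj shift_wConst l
    have hgq : HasWt wNF q g := hq.proj
    have hgc : HasWt wConst l g := hasWt_proj _ _ _
    have hgs : HasWt wSite (r + 1 : ℕ) g := by
      intro w hw
      have h1 := wt_const_add_site (hgl.body w hw)
      rw [hgc w hw, hgl.length w hw] at h1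
      push_cast at h1 ⊢
      linarith
    have hx : ∀ (c : Fin l → ConstLetter N) (t : Fin (r + 1) → FieldLetter), ∃ x : Series N,
        x ∈ Submodule.span ℂ {y : Series N | IsLocalMonomial nabla q (l + (r + 1)) y} ∧
        (∀ v, x.1 v = ∑' k, g (genWord (List.ofFn c) t k) *
          (sfProd nabla (List.ofFn c) t k).1 v) ∧
        (∀ v, Summable fun k => g (genWord (List.ofFn c) t k) *
          (sfProd nabla (List.ofFn c) t k).1 v) := by
      intro c t
      have hT := hgl.isTILC (List.ofFn c) t 1
      simp only [one_mul] at hT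
      obtain ⟨L, hL⟩ := hT.bounded
      obtain ⟨x, hx1, hx2⟩ := exists_sum_sfProd hn (List.ofFn c) t hL
      refine ⟨x, ?_, hx2, fun v => ((hasSum_series_iff.mp hx1) v).summable⟩
      by_cases hnf : ((List.ofFn c).map ConstLetter.nF).sum + ∑ i, (t i).nF = q
      · exact Submodule.subset_span ⟨List.ofFn c, r, t, _, hT, by simp, hnf, hx1⟩
      · have h0 : ∀ k, g (genWord (List.ofFn c) t k) = 0 := by
          intro k
          by_contra h0
          have := hgq _ h0
          rw [wNF_genWord] at this
          exact hnf this
        have : x = 0 := by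
          ext v
          rw [hx2 v]
          simp [h0]
        rw [this]
        exact Submodule.zero_mem _
    choose x hx1 hx2 hx3 using hx
    refine ⟨((l.factorial * (r + 1).factorial : ℂ)⁻¹) • ∑ c, ∑ t, x c t,
      Submodule.smul_mem _ _ (Submodule.sum_mem _ fun c _ => Submodule.sum_mem _ fun t _ =>
        hx1 c t), ?_⟩
    intro w hw
    have e : ∀ (c : Fin l → ConstLetter N) (t : Fin (r + 1) → FieldLetter) (k : Fin (r + 1) → ℤ),
        g (genWord (List.ofFn c) t k) * (sfProd nabla (List.ofFn c) t k).1 w =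
        g (genWord (List.ofFn c) t k) * mono (genWord (List.ofFn c) t k) w := by
      intro c t k
      rw [eqBody_sfProd nabla (List.ofFn c) t k w hw]
    have h1 := taylor_expansion hgl.symm hgc hgs hgl.length w (fun c t => by
      simpa only [e] using hx3 c t w)
    have h2 : (∑ c, ∑ t, x c t : Series N).1 w = ∑ c, ∑ t, (x c t).1 w := by
      simp only [AddSubmonoidClass.coe_finsetSum, Finset.sum_apply]
    have h3 : (((l.factorial * (r + 1).factorial : ℂ)⁻¹) • ∑ c, ∑ t, x c t : Series N).1 w =
        ((l.factorial * (r + 1).factorial : ℂ)⁻¹) * (∑ c, ∑ t, x c t : Series N).1 w := rfl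
    rw [h3, h2]
    simp only [hx2, e]
    rw [← h1, inv_mul_cancel_left₀]
    exact mul_ne_zero (Nat.cast_ne_zero.mpr (Nat.factorial_ne_zero _))
      (Nat.cast_ne_zero.mpr (Nat.factorial_ne_zero _))
  choose! T hT1 hT2 using key
  refine ⟨∑ l ∈ Finset.range d, T l, Submodule.sum_mem _ hT1, fun w hw => ?_⟩
  have h2 : (∑ l ∈ Finset.range d, T l : Series N).1 w = ∑ l ∈ Finset.range d, (T l).1 w := by
    simp only [AddSubmonoidClass.coe_finsetSum, Finset.sum_apply]
  rw [h2, Finset.sum_congr rfl fun l hl => hT2 l hl w hw]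
  by_cases h0 : f w = 0
  · simp [LatticeSusy.proj, h0]
  have h3 := wt_const_add_site (hf.body w h0)
  rw [hf.length w h0] at h3
  have h4 := wt_site_pos (hf.site w h0)
  obtain ⟨l, hl⟩ := Int.eq_ofNat_of_zero_le (wt_nonneg wConst_nonneg w)
  rw [Finset.sum_eq_single l]
  · simp [LatticeSusy.proj, hl]
  · intro l' _ hne
    have : ¬ wt wConst w = l' := fun h => hne (by rw [hl] at h; exact_mod_cast h.symm)
    simp [LatticeSusy.proj, this]
  · intro hl'
    rw [Finset.mem_range, not_lt] at hl'
    omega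

end LatticeSusy

namespace LatticeSusy

variable {N : ℕ}

/-! ### Cyclic Leibniz rule terms -/

/-- The number of letters `ρ_s`. -/
def wRho (s : Sgn) : Gen N → ℤ
  | Gen.rho s' _ => if s' = s then 1 else 0
  | _ => 0

/-- The number of letters `χ_s`. -/
def wChi (s : Sgn) : Gen N → ℤ
  | Gen.chi s' _ => if s' = s then 1 else 0
  | _ => 0

/-- The number of letters `φ_s`. -/
def wPhi (s : Sgn) : Gen N → ℤ
  | Gen.phi s' _ => if s' = s then 1 else 0
  | _ => 0

theorem wRho_nonneg (s : Sgn) (a : Gen N) : 0 ≤ wRho s a := by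
  unfold wRho; split <;> (try split_ifs) <;> simp

theorem wPhi_nonneg (s : Sgn) (a : Gen N) : 0 ≤ wPhi s a := by
  unfold wPhi; split <;> (try split_ifs) <;> simp

/-- The field letters `Ψ_s, Φ_s, …, Φ_s` of a cyclic Leibniz rule term. -/
def clrLetters (s : Sgn) (k : ℕ) : Fin (k + 1) → FieldLetter :=
  Fin.cons (FieldLetter.Psi s) fun _ => FieldLetter.Phi s

theorem genWord_clr (s : Sgn) (c : List (Fin N)) {k : ℕ} (m : Fin (k + 1) → ℤ) :
    genWord (c.map (ConstLetter.rho s)) (clrLetters s k) m =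
      c.map (Gen.rho s) ++ Gen.chi s (m 0) :: List.ofFn fun j : Fin k => Gen.phi s (m j.succ) := by
  rw [genWord, List.map_map, List.ofFn_succ]
  rfl

theorem sfProd_clr (nabla : ℤ → ℂ) (s : Sgn) (c : List (Fin N)) {k : ℕ} (m : Fin (k + 1) → ℤ) :
    sfProd nabla (c.map (ConstLetter.rho s)) (clrLetters s k) m =
      (c.map (rhoSF s)).prod *
        (Psi nabla s (m 0) * (List.ofFn fun j : Fin k => Phi s (m j.succ)).prod) := by
  rw [sfProd, List.map_map, List.ofFn_succ, List.prod_cons]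
  rfl

theorem IsCLRMonomial.isLocalMonomial {nabla : ℤ → ℂ} {s : Sgn} {d : ℕ} {x : Series N}
    (hx : IsCLRMonomial nabla s d x) : IsLocalMonomial nabla 1 d x := by
  obtain ⟨c, k, C, hC, _, hd, hs⟩ := hx
  refine ⟨c.map (ConstLetter.rho s), k, clrLetters s k, C, hC, by simpa using hd, ?_, ?_⟩
  · rw [Fin.sum_univ_succ]
    simp [clrLetters, FieldLetter.nF, Function.comp_def, ConstLetter.nF]
  · refine Eq.mp ?_ hs
    congr 1
    funext m
    rw [← sfProd_clr]
    rfl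

/-- The Taylor expansion in the `ρ_s`, then in the single `χ_s`, then in the `φ_s`. -/
theorem clr_expansion (s : Sgn) {f : Raw N} {l k : ℕ} (hf : GradedSymm f) (hr : HasWt (wRho s) l f)
    (hc : HasWt (wChi s) 1 f) (hp : HasWt (wPhi s) k f)
    (hlen : ∀ w, f w ≠ 0 → w.length = l + (k + 1)) (w : List (Gen N))
    (hsum : ∀ c : Fin l → Fin N, Summable fun m : Fin (k + 1) → ℤ =>
      f (genWord ((List.ofFn c).map (ConstLetter.rho s)) (clrLetters s k) m) *
        mono (genWord ((List.ofFn c).map (ConstLetter.rho s)) (clrLetters s k) m) w) :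
    (l.factorial * k.factorial : ℂ) * f w = ∑ c : Fin l → Fin N, ∑' m : Fin (k + 1) → ℤ,
      f (genWord ((List.ofFn c).map (ConstLetter.rho s)) (clrLetters s k) m) *
        mono (genWord ((List.ofFn c).map (ConstLetter.rho s)) (clrLetters s k) m) w := by
  have h1 := hasSum_taylor (ℓ := fun i => Gen.rho (N := N) s i) (fun i j h => by simpa using h)
    (ω := wRho s) (fun b => by simp [wRho]) (fun a ha => by
      cases a with
      | rho s' i =>
        by_cases h : s' = s
        · subst h; exact absurd rfl (ha i)
        · simp [wRho, h]
      | _ => rfl) l hf hr w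
  have h1' := h1.unique (hasSum_fintype _)
  rw [mul_right_comm, h1', Finset.sum_mul]
  refine Finset.sum_congr rfl fun c _ => ?_
  set u : List (Gen N) := List.ofFn fun i => Gen.rho s (c i) with hu
  have hu' : (List.ofFn c).map (Gen.rho s) = u := by rw [List.map_ofFn, hu]; rfl
  have hsymm : GradedSymm (fun v => f (u ++ v)) := by
    intro x y a b
    have := hf (u ++ x) y a b
    rwa [List.append_assoc, List.append_assoc] at this
  have hw0 : ∀ ω : Gen N → ℤ, (∀ i, ω (Gen.rho s i) = 0) → wt ω u = 0 := by
    intro ω hω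
    rw [wt]
    refine List.sum_eq_zero fun x hx => ?_
    obtain ⟨a, ha, rfl⟩ := List.mem_map.mp hx
    obtain ⟨i, rfl⟩ := List.mem_ofFn.mp ha
    exact hω _
  have hwc : HasWt (wChi s) 1 (fun v => f (u ++ v)) := by
    intro v hv
    have := hc _ hv
    rwa [wt_append, hw0 (wChi s) (fun i => rfl), zero_add] at this
  have hwp : HasWt (wPhi s) k (fun v => f (u ++ v)) := by
    intro v hv
    have := hp _ hv
    rwa [wt_append, hw0 (wPhi s) (fun i => rfl), zero_add] at this
  have h2 : ∀ v, HasSum (fun m => rawMul (X (Gen.chi s m)).1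
      (rawD (Gen.chi s m) (fun v => f (u ++ v))) v) (f (u ++ v)) := by
    intro v
    have := hasSum_euler (ℓ := fun m => Gen.chi (N := N) s m) (fun i j h => by simpa using h)
      (ω := wChi s) (fun b => by simp [wChi]) (fun a ha => by
        cases a with
        | chi s' i =>
          by_cases h : s' = s
          · subst h; exact absurd rfl (ha i)
          · simp [wChi, h]
        | _ => rfl) hsymm v
    by_cases h0 : f (u ++ v) = 0
    · rw [h0]; simpa [h0] using this
    · rw [hwc v h0] at this; simpa using this
  have h3 : ∀ m v, HasSum (fun n : Fin k → ℤ =>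
      rawMul (mono (List.ofFn fun j => Gen.phi s (n j)))
        (fun v => f (u ++ (Gen.chi s m :: ((List.ofFn fun j => Gen.phi s (n j)) ++ v)))) v)
      (k.factorial * f (u ++ Gen.chi s m :: v)) := by
    intro m v
    refine hasSum_taylor (ℓ := fun m => Gen.phi (N := N) s m) (phi_injective s)
      (ω := wPhi s) (fun b => by simp [wPhi]) (fun a ha => by
        cases a with
        | phi s' i =>
          by_cases h : s' = s
          · subst h; exact absurd rfl (ha i)
          · simp [wPhi, h]
        | _ => rfl) k (hsymm.rawD (Gen.chi s m)) ?_ v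
    have := hwp.rawD (Gen.chi s m)
    simpa [wPhi] using this
  set G : ℤ → (Fin k → ℤ) → ℂ := fun m n =>
    f (genWord ((List.ofFn c).map (ConstLetter.rho s)) (clrLetters s k) (Fin.cons m n)) *
      mono (genWord ((List.ofFn c).map (ConstLetter.rho s)) (clrLetters s k) (Fin.cons m n)) w
    with hG
  have h4 : ∀ m, HasSum (fun n => G m n) (rawMul (mono u) (rawMul (X (Gen.chi s m)).1
      ((k.factorial : ℂ) • rawD (Gen.chi s m) (fun v => f (u ++ v)))) w) := by
    intro m
    have e := rawMul_hasSum_right (f := rawMul (X (Gen.chi s m)).1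
      ((k.factorial : ℂ) • rawD (Gen.chi s m) (fun v => f (u ++ v))))
      (fun v => rawMul_hasSum_right (f := (k.factorial : ℂ) •
        rawD (Gen.chi s m) (fun v => f (u ++ v))) (h3 m) (X (Gen.chi s m)).1 v) (mono u) w
    refine Eq.mp ?_ e
    congr 1
    funext n
    have e2 := eq_smul_one_of_length hlen
      (u := u ++ Gen.chi s m :: List.ofFn fun j => Gen.phi s (n j)) (by simp [hu])
    simp only [List.append_assoc, List.cons_append] at e2
    rw [hG, e2, rawMul_smul_one, rawMul_smul_right, rawMul_smul_right]
    have e3 : genWord ((List.ofFn c).map (ConstLetter.rho s)) (clrLetters s k)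
        (Fin.cons m n : Fin (k + 1) → ℤ) =
        u ++ Gen.chi s m :: List.ofFn fun j => Gen.phi s (n j) := by
      rw [genWord_clr, hu']; simp
    simp only [e3]
    rw [mono_append]
    rfl
  have h5 := rawMul_hasSum_right h2 (mono u) w
  have h6 : HasSum (fun m => rawMul (mono u) (rawMul (X (Gen.chi s m)).1
      ((k.factorial : ℂ) • rawD (Gen.chi s m) (fun v => f (u ++ v)))) w)
      (k.factorial * rawMul (mono u) (fun v => f (u ++ v)) w) := by
    have := h5.mul_left (k.factorial : ℂ)
    simpa only [rawMul_smul_right, Pi.smul_apply, smul_eq_mul] using this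
  have h7 := (Fin.consEquiv (fun _ : Fin (k + 1) => ℤ)).hasSum_iff.mpr (hsum c).hasSum
  have h8 := h7.prod_fiberwise h4
  rw [mul_comm, h6.unique h8]

/-- A derivation passes over even letters on which it vanishes. -/
theorem LinDer.app_append (M : LinDer N) (f : Raw N) (u w : List (Gen N))
    (hu : ∀ a ∈ u, a.odd = false ∧ ∀ v, M.col a v = 0) :
    M.app f (u ++ w) = M.app (fun v => f (u ++ v)) w := by
  induction u generalizing f with
  | nil => rfl
  | cons a u ih =>
    have ha := hu a (by simp)
    rw [List.cons_append, LinDer.app_cons, ha.2, zero_add,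
      show a.sg = 1 by simp [Gen.sg, ha.1], one_mul, ih _ fun b hb => hu b (by simp [hb])]
    rfl

/-- A derivation on a word of even letters. -/
theorem LinDer.app_ofFn (M : LinDer N) (f : Raw N) {m : ℕ} (v : Fin m → Gen N)
    (hv : ∀ i, (v i).odd = false) :
    M.app f (List.ofFn v) =
      ∑ i, M.col (v i) (fun b => f (List.ofFn (Function.update v i b))) := by
  induction m generalizing f with
  | zero => rfl
  | succ m ih =>
    rw [List.ofFn_succ, LinDer.app_cons, show (v 0).sg = 1 by simp [Gen.sg, hv 0], one_mul,
      Fin.sum_univ_succ, ih _ _ fun i => hv i.succ]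
    congr 1
    · congr 1
      funext b
      rw [List.ofFn_succ]
      simp
    · refine Finset.sum_congr rfl fun i _ => ?_
      congr 1
      funext b
      rw [List.ofFn_succ, Function.update_of_ne (Fin.succ_ne_zero i).symm]
      congr 2
      funext j
      by_cases h : j = i
      · subst h; simp
      · rw [Function.update_of_ne h, Function.update_of_ne (by simpa using h)]

/-- Rotating a word so that the replaced letter comes first. -/
theorem ofFn_update_perm {m : ℕ} (v : Fin (m + 1) → Gen N) (p : Fin (m + 1)) (b : Gen N) :
    (List.ofFn (Function.update v p b)).Perm (b :: List.ofFn fun j : Fin m => v (p + j.succ)) := by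
  refine (Equiv.Perm.ofFn_comp_perm (Equiv.addLeft p) (Function.update v p b)).symm.trans ?_
  rw [List.ofFn_succ]
  have h0 : (Function.update v p b ∘ Equiv.addLeft p) 0 = b := by simp
  have h1 : (fun i : Fin m => (Function.update v p b ∘ Equiv.addLeft p) i.succ) =
      fun j => v (p + j.succ) := by
    funext j
    have : p + j.succ ≠ p := by
      intro h
      simp at h
    simp
  rw [h0, h1]

/-- A coefficient function linear in `χ_s`, with all other letters `φ_s` or `ρ_s`, satisfies the
cyclic Leibniz rule as soon as it is annihilated by `Q_{-s}`. -/
theorem isCLR_of_closed {nabla : ℤ → ℂ} (t : Sgn) {f : Raw N} (hf : GradedSymm f)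
    (h : (QD nabla t).app f = 0) (c : List (Fin N)) (k : ℕ) (x : ℂ) :
    IsCLR nabla (fun m : Fin (k + 1) → ℤ =>
      x * f (genWord (c.map (ConstLetter.rho t.opp)) (clrLetters t.opp k) m)) where
  symm m n σ := by
    rw [genWord_clr, genWord_clr]
    congr 1
    refine GradedSymm.perm_eq ?_ ?_ hf
    · refine List.Perm.append_left _ ?_
      simp only [Fin.cons_zero, Fin.cons_succ, Function.comp]
      refine List.Perm.cons _ ?_
      exact Equiv.Perm.ofFn_comp_perm σ (fun j => Gen.phi t.opp (n j))
    · rw [List.countP_append, List.countP_cons]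
      have h1 : (c.map (Gen.rho (N := N) t.opp)).countP Gen.odd = 0 := by
        rw [List.countP_eq_zero]; intro a ha
        obtain ⟨i, _, rfl⟩ := List.mem_map.mp ha
        simp [Gen.odd]
      have h2 : (List.ofFn fun j : Fin k => Gen.phi (N := N) t.opp
          ((Fin.cons m (n ∘ σ) : Fin (k + 1) → ℤ) j.succ)).countP Gen.odd = 0 := by
        rw [List.countP_eq_zero]; intro a ha
        obtain ⟨i, rfl⟩ := List.mem_ofFn.mp ha
        simp [Gen.odd]
      rw [h1, h2]
      split_ifs <;> simp
  cyclic n := by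
    have h1 := congrFun h (c.map (Gen.rho t.opp) ++ List.ofFn fun i => Gen.phi t.opp (n i))
    rw [LinDer.app_append _ _ _ _ (by
      intro a ha
      obtain ⟨i, _, rfl⟩ := List.mem_map.mp ha
      exact ⟨rfl, fun v => QD_col_rho _ _ _ _ _⟩), LinDer.app_ofFn _ _ _ fun i => rfl] at h1
    simp only [QD_col_phi_opp] at h1
    rw [← Finset.mul_sum, Pi.zero_apply, mul_eq_zero] at h1
    have h2 := h1.resolve_left (by
      have := t.toC_sq
      intro h0
      have h3 : t.toC ≠ 0 := by rintro e; rw [e] at this; simp at this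
      simp [h3] at h0)
    have h3 : ∀ p : Fin (k + 1), ∑' m : ℤ, nabla (m - n p) *
        (x * f (genWord (c.map (ConstLetter.rho t.opp)) (clrLetters t.opp k)
          (Fin.cons m fun j : Fin k => n (p + j.succ)))) =
        x * ∑' m : ℤ, nabla (m - n p) * f (c.map (Gen.rho t.opp) ++
          List.ofFn (Function.update (fun i => Gen.phi t.opp (n i)) p (Gen.chi t.opp m))) := by
      intro p
      rw [← tsum_mul_left]
      refine tsum_congr fun m => ?_
      rw [mul_left_comm]
      congr 2
      rw [genWord_clr]
      simp only [Fin.cons_zero, Fin.cons_succ]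
      refine GradedSymm.perm_eq ?_ ?_ hf
      · exact List.Perm.append_left _
          (ofFn_update_perm (fun i => Gen.phi t.opp (n i)) p (Gen.chi t.opp m)).symm
      · rw [List.countP_append, List.countP_cons]
        have h1 : (c.map (Gen.rho (N := N) t.opp)).countP Gen.odd = 0 := by
          rw [List.countP_eq_zero]; intro a ha
          obtain ⟨i, _, rfl⟩ := List.mem_map.mp ha
          simp [Gen.odd]
        have h2 : (List.ofFn fun j : Fin k => Gen.phi (N := N) t.opp
            (n (p + j.succ))).countP Gen.odd = 0 := by
          rw [List.countP_eq_zero]; intro a ha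
          obtain ⟨i, rfl⟩ := List.mem_ofFn.mp ha
          simp [Gen.odd]
        rw [h1, h2]
        split_ifs <;> simp
    rw [Finset.sum_congr rfl fun p _ => h3 p, ← Finset.mul_sum, h2, mul_zero]

theorem QD_shifts_wRho (nabla : ℤ → ℂ) (t : Sgn) : (QD (N := N) nabla t).Shifts (wRho t.opp) 0 := by
  intro a n h
  cases a with
  | zeta s' i =>
    by_cases hs : s' = t
    · subst hs; simp [QD, wRho, s'.ne_opp]
    · simp [QD, hs] at h
  | chibar s' m => simp only [QD]; split_ifs <;> simp [wRho]
  | _ => simp [QD, wRho] at h ⊢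

/-- A local coefficient function that is linear in `χ_s`, depends otherwise only on `φ_s` and
`ρ_s`, and is annihilated by `Q_{-s}`, is the value at `θ_± = 0` of a cyclic Leibniz rule term. -/
theorem IsLoc.exists_clr_lift {nabla : ℤ → ℂ} (hn : IsDifferenceOperator nabla) {d : ℕ} (t : Sgn)
    {f : Raw N} (hf : IsLoc d f) (hc : HasWt (wChi t.opp) 1 f)
    (hletters : ∀ w, f w ≠ 0 → wt (wRho t.opp) w + wt (wChi t.opp) w + wt (wPhi t.opp) w = w.length)
    (h : (QD nabla t).app f = 0) :
    ∃ T ∈ Submodule.span ℂ {y : Series N | IsCLRMonomial nabla t.opp d y}, EqBody T.1 f := by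
  have hpos := wt_nonneg (N := N) (wRho_nonneg t.opp)
  have hpos' := wt_nonneg (N := N) (wPhi_nonneg t.opp)
  have key : ∀ l ∈ Finset.range d, ∃ T ∈ Submodule.span ℂ
      {y : Series N | IsCLRMonomial nabla t.opp d y},
      EqBody T.1 (LatticeSusy.proj (wRho t.opp) l f) := by
    intro l hl
    obtain ⟨k, rfl⟩ : ∃ k, d = l + (k + 1) := by
      have := Finset.mem_range.mp hl
      exact ⟨d - l - 1, by omega⟩
    set g := LatticeSusy.proj (wRho t.opp) l f with hg
    have hgl : IsLoc (l + (k + 1)) g := hf.proj (fun j a => by cases a <;> rfl) l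
    have hgc : HasWt (wChi t.opp) 1 g := hc.proj
    have hgr : HasWt (wRho t.opp) l g := hasWt_proj _ _ _
    have hgp : HasWt (wPhi t.opp) k g := by
      intro w hw
      have h0 : f w ≠ 0 := by
        intro h0; apply hw; simp [hg, LatticeSusy.proj, h0]
      have h1 := hletters w h0
      rw [hgc w hw, hgr w hw, hgl.length w hw] at h1
      push_cast at h1
      linarith
    have hgQ : (QD nabla t).app g = 0 := by
      have := (QD_shifts_wRho (N := N) nabla t).app_proj l f
      rw [add_zero] at this
      rw [hg, this, h]
      funext w; simp [LatticeSusy.proj]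
    have hx : ∀ c : Fin l → Fin N, ∃ x : Series N,
        x ∈ Submodule.span ℂ {y : Series N | IsCLRMonomial nabla t.opp (l + (k + 1)) y} ∧
        (∀ v, x.1 v = ∑' m, g (genWord ((List.ofFn c).map (ConstLetter.rho t.opp))
            (clrLetters t.opp k) m) *
          (sfProd nabla ((List.ofFn c).map (ConstLetter.rho t.opp)) (clrLetters t.opp k) m).1 v) ∧
        (∀ v, Summable fun m => g (genWord ((List.ofFn c).map (ConstLetter.rho t.opp))
            (clrLetters t.opp k) m) *
          (sfProd nabla ((List.ofFn c).map (ConstLetter.rho t.opp))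
            (clrLetters t.opp k) m).1 v) := by
      intro c
      have hT := hgl.isTILC ((List.ofFn c).map (ConstLetter.rho t.opp)) (clrLetters t.opp k) 1
      have hCLR := isCLR_of_closed t hgl.symm hgQ (List.ofFn c) k 1
      simp only [one_mul] at hT hCLR
      obtain ⟨L, hL⟩ := hT.bounded
      obtain ⟨x, hx1, hx2⟩ := exists_sum_sfProd hn _ _ hL
      refine ⟨x, Submodule.subset_span ⟨List.ofFn c, k, _, hT, hCLR, by simp, ?_⟩, hx2,
        fun v => ((hasSum_series_iff.mp hx1) v).summable⟩
      simp only [sfProd_clr] at hx1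
      exact hx1
    choose x hx1 hx2 hx3 using hx
    refine ⟨((l.factorial * k.factorial : ℂ)⁻¹) • ∑ c, x c,
      Submodule.smul_mem _ _ (Submodule.sum_mem _ fun c _ => hx1 c), ?_⟩
    intro w hw
    have e : ∀ (c : Fin l → Fin N) (m : Fin (k + 1) → ℤ),
        g (genWord ((List.ofFn c).map (ConstLetter.rho t.opp)) (clrLetters t.opp k) m) *
          (sfProd nabla ((List.ofFn c).map (ConstLetter.rho t.opp)) (clrLetters t.opp k) m).1 w =
        g (genWord ((List.ofFn c).map (ConstLetter.rho t.opp)) (clrLetters t.opp k) m) *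
          mono (genWord ((List.ofFn c).map (ConstLetter.rho t.opp)) (clrLetters t.opp k) m) w := by
      intro c m
      rw [eqBody_sfProd nabla _ _ m w hw]
    have h1 := clr_expansion t.opp hgl.symm hgr hgc hgp hgl.length w (fun c => by
      simpa only [e] using hx3 c w)
    have h2 : (∑ c, x c : Series N).1 w = ∑ c, (x c).1 w := by
      simp only [AddSubmonoidClass.coe_finsetSum, Finset.sum_apply]
    have h3 : (((l.factorial * k.factorial : ℂ)⁻¹) • ∑ c, x c : Series N).1 w =
        ((l.factorial * k.factorial : ℂ)⁻¹) * (∑ c, x c : Series N).1 w := rfl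
    rw [h3, h2]
    simp only [hx2, e]
    rw [← h1, inv_mul_cancel_left₀]
    exact mul_ne_zero (Nat.cast_ne_zero.mpr (Nat.factorial_ne_zero _))
      (Nat.cast_ne_zero.mpr (Nat.factorial_ne_zero _))
  choose! T hT1 hT2 using key
  refine ⟨∑ l ∈ Finset.range d, T l, Submodule.sum_mem _ hT1, fun w hw => ?_⟩
  have h2 : (∑ l ∈ Finset.range d, T l : Series N).1 w = ∑ l ∈ Finset.range d, (T l).1 w := by
    simp only [AddSubmonoidClass.coe_finsetSum, Finset.sum_apply]
  rw [h2, Finset.sum_congr rfl fun l hl => hT2 l hl w hw]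
  by_cases h0 : f w = 0
  · simp [LatticeSusy.proj, h0]
  have h3 := hletters w h0
  rw [hf.length w h0, hc w h0] at h3
  obtain ⟨l, hl⟩ := Int.eq_ofNat_of_zero_le (hpos w)
  have h4 := hpos' w
  rw [Finset.sum_eq_single l]
  · simp [LatticeSusy.proj, hl]
  · intro l' _ hne
    have : ¬ wt (wRho t.opp) w = l' :=
      fun h => hne (by rw [hl] at h; exact_mod_cast h.symm)
    simp [LatticeSusy.proj, this]
  · intro hl'
    rw [Finset.mem_range, not_lt] at hl'
    omega

end LatticeSusy

namespace LatticeSusy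

/-! ### One-sided inverses of the difference operator -/

open MeasureTheory Filter Topology Complex

/-- The symbol `∑_j ∇(j) e^{jw}` of the difference operator. -/
noncomputable def symbol (nabla : ℤ → ℂ) (w : ℂ) : ℂ := ∑' j : ℤ, nabla j * exp (j * w)

theorem norm_exp_int_mul (j : ℤ) (w : ℂ) : ‖exp (j * w)‖ = Real.exp (j * w.re) := by
  rw [norm_exp]; simp

theorem norm_term_le {nabla : ℤ → ℂ} {L M : ℝ}
    (h : ∀ j : ℤ, ‖nabla j‖ ≤ L * Real.exp (-(M * |(j : ℝ)|))) (hL : 0 ≤ L) (j : ℤ) {w : ℂ}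
    {r : ℝ} (hw : |w.re| ≤ r) :
    ‖nabla j * exp (j * w)‖ ≤ L * Real.exp (-((M - r) * |(j : ℝ)|)) := by
  rw [norm_mul, norm_exp_int_mul]
  have h1 : (j : ℝ) * w.re ≤ r * |(j : ℝ)| := by
    calc (j : ℝ) * w.re ≤ |(j : ℝ) * w.re| := le_abs_self _
      _ = |w.re| * |(j : ℝ)| := by rw [abs_mul, mul_comm]
      _ ≤ _ := mul_le_mul_of_nonneg_right hw (abs_nonneg _)
  calc _ ≤ (L * Real.exp (-(M * |(j : ℝ)|))) * Real.exp (r * |(j : ℝ)|) :=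
        mul_le_mul (h j) (Real.exp_le_exp.mpr h1) (Real.exp_pos _).le (by positivity)
    _ = _ := by rw [mul_assoc, ← Real.exp_add]; congr 2; ring

theorem isOpen_strip (r : ℝ) : IsOpen {w : ℂ | |w.re| < r} :=
  isOpen_lt (by fun_prop) continuous_const

theorem isPreconnected_strip (r : ℝ) : IsPreconnected {w : ℂ | |w.re| < r} := by
  have : {w : ℂ | |w.re| < r} = reLm ⁻¹' Set.Ioo (-r) r := by
    ext w; simp [abs_lt]
  rw [this]
  exact ((convex_Ioo (-r) r).linear_preimage reLm).isPreconnected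

theorem differentiableOn_symbol {nabla : ℤ → ℂ} {L M : ℝ} (hM : 0 < M)
    (h : ∀ j : ℤ, ‖nabla j‖ ≤ L * Real.exp (-(M * |(j : ℝ)|))) (hL : 0 ≤ L) :
    DifferentiableOn ℂ (symbol nabla) {w | |w.re| < M / 2} := by
  refine differentiableOn_tsum_of_summable_norm
    ((summable_exp_neg_abs (c := M - M / 2) (by linarith)).mul_left L) (fun j => ?_)
    (isOpen_strip _) (fun j w hw => norm_term_le h hL j (le_of_lt hw))
  fun_prop

theorem exp_int_mul_periodic (j : ℤ) (w : ℂ) (n : ℤ) :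
    exp (j * (w + n * (2 * Real.pi * I))) = exp (j * w) := by
  rw [exp_eq_exp_iff_exists_int]
  exact ⟨j * n, by push_cast; ring⟩

theorem symbol_periodic (nabla : ℤ → ℂ) (w : ℂ) (n : ℤ) :
    symbol nabla (w + n * (2 * Real.pi * I)) = symbol nabla w := by
  unfold symbol
  simp only [exp_int_mul_periodic]

/-- `(1/2π) ∫_0^{2π} e^{j(x+iy)} dy = δ_{j0}`. -/
theorem integral_exp_int (x : ℝ) (j : ℤ) :
    ∫ y in (0 : ℝ)..2 * Real.pi, exp (j * (x + y * I)) = if j = 0 then 2 * (Real.pi : ℂ) else 0 := by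
  split_ifs with h
  · subst h; simp
  · have hc : (j : ℂ) * I ≠ 0 := mul_ne_zero (by exact_mod_cast h) I_ne_zero
    have e : ∀ y : ℝ, exp (j * (x + y * I)) = exp (j * x) * exp ((j * I) * y) := by
      intro y; rw [← exp_add]; congr 1; ring
    simp only [e]
    rw [intervalIntegral.integral_const_mul, integral_exp_mul_complex hc]
    have : exp (j * I * ((2 * Real.pi : ℝ) : ℂ)) = 1 := by
      rw [exp_eq_one_iff]; exact ⟨j, by push_cast; ring⟩
    rw [this]; simp

theorem continuous_vertical (x : ℝ) : Continuous fun y : ℝ => (x : ℂ) + y * I := by fun_prop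

/-- The symbol does not vanish identically, since `2π ∇(n)` are its Fourier coefficients on the
imaginary axis. -/
theorem symbol_ne_zero {nabla : ℤ → ℂ} {L M : ℝ} (hM : 0 < M)
    (h : ∀ j : ℤ, ‖nabla j‖ ≤ L * Real.exp (-(M * |(j : ℝ)|))) (hL : 0 ≤ L) (h0 : nabla ≠ 0) :
    ∃ w : ℂ, |w.re| < M / 2 ∧ symbol nabla w ≠ 0 := by
  by_contra! hz
  apply h0
  funext n
  have hF : HasSum (fun j : ℤ => ∫ y in (0 : ℝ)..2 * Real.pi,
      nabla j * exp ((j - n : ℤ) * ((0 : ℝ) + y * I)))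
      (∫ y in (0 : ℝ)..2 * Real.pi, ∑' j : ℤ, nabla j * exp ((j - n : ℤ) * ((0 : ℝ) + y * I))) := by
    refine intervalIntegral.hasSum_intervalIntegral_of_summable_norm (f := fun j : ℤ =>
      (⟨fun y : ℝ => nabla j * exp ((j - n : ℤ) * ((0 : ℝ) + y * I)), by fun_prop⟩ : C(ℝ, ℂ))) ?_
    refine Summable.of_nonneg_of_le (fun _ => norm_nonneg _) (fun j => ?_)
      ((summable_exp_neg_abs hM).mul_left L)
    rw [ContinuousMap.norm_le _ (by positivity)]
    intro y
    have e : ‖nabla j * exp ((j - n : ℤ) * ((0 : ℝ) + (y : ℝ) * I))‖ ≤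
        L * Real.exp (-(M * |(j : ℝ)|)) := by
      rw [norm_mul, norm_exp_int_mul]
      simpa using h j
    exact e
  have e1 : ∀ y : ℝ, ∑' j : ℤ, nabla j * exp ((j - n : ℤ) * ((0 : ℝ) + y * I)) = 0 := by
    intro y
    have := hz ((0 : ℝ) + y * I) (by simpa using by linarith)
    unfold symbol at this
    have e2 : ∀ j : ℤ, nabla j * exp ((j - n : ℤ) * ((0 : ℝ) + y * I)) =
        (nabla j * exp (j * ((0 : ℝ) + y * I))) * exp (-(n * ((0 : ℝ) + y * I))) := by
      intro j; rw [mul_assoc, ← exp_add]; congr 2; push_cast; ring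
    simp only [e2]
    rw [tsum_mul_right, this, zero_mul]
  simp only [e1, intervalIntegral.integral_zero, intervalIntegral.integral_const_mul,
    integral_exp_int] at hF
  have h3 := hasSum_single (f := fun j : ℤ => nabla j * if j - n = 0 then 2 * (Real.pi : ℂ) else 0) n
    (fun j hj => by simp [sub_eq_zero, hj])
  have h4 := hF.unique h3
  simpa [Real.pi_ne_zero] using h4.symm

/-- The zeros of the symbol are isolated, so none lies close to, but off, the imaginary axis. -/
theorem exists_zero_free_strip {nabla : ℤ → ℂ} {L M : ℝ} (hM : 0 < M)
    (h : ∀ j : ℤ, ‖nabla j‖ ≤ L * Real.exp (-(M * |(j : ℝ)|))) (hL : 0 ≤ L) (h0 : nabla ≠ 0) :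
    ∃ r : ℝ, 0 < r ∧ r ≤ M / 2 ∧ ∀ w : ℂ, 0 < |w.re| → |w.re| < r → symbol nabla w ≠ 0 := by
  by_contra! hcon
  have hpos : ∀ n : ℕ, 0 < min (M / 2) (1 / ((n : ℝ) + 1)) := fun n => by positivity
  choose z hz1 hz2 hz3 using fun n => hcon _ (hpos n) (min_le_left _ _)
  set z' : ℕ → ℂ := fun n => z n + ((-⌊(z n).im / (2 * Real.pi)⌋ : ℤ) : ℂ) * (2 * Real.pi * I) with hz'
  have hre : ∀ n, (z' n).re = (z n).re := by intro n; simp [hz']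
  have him : ∀ n, (z' n).im ∈ Set.Icc 0 (2 * Real.pi) := by
    intro n
    have e : (z' n).im = Int.fract ((z n).im / (2 * Real.pi)) * (2 * Real.pi) := by
      have : (z' n).im = (z n).im - ⌊(z n).im / (2 * Real.pi)⌋ * (2 * Real.pi) := by
        simp [hz']; ring
      rw [this, Int.fract, sub_mul, div_mul_cancel₀ _ Real.two_pi_pos.ne']
    rw [e]
    refine ⟨mul_nonneg (Int.fract_nonneg _) Real.two_pi_pos.le, ?_⟩
    exact mul_le_of_le_one_left Real.two_pi_pos.le (Int.fract_lt_one _).le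
  have hzero : ∀ n, symbol nabla (z' n) = 0 := by
    intro n; rw [hz', symbol_periodic, hz3]
  have hcpt : IsCompact (Set.Icc (-(M / 2)) (M / 2) ×ℂ Set.Icc 0 (2 * Real.pi)) :=
    isCompact_Icc.reProdIm isCompact_Icc
  obtain ⟨a, _, φ, hφ, hlim⟩ := hcpt.tendsto_subseq (x := z') (fun n => by
    rw [mem_reProdIm]
    refine ⟨?_, him n⟩
    rw [hre]
    exact abs_le.mp ((hz2 n).le.trans (min_le_left _ _)))
  have hre0 : a.re = 0 := by
    have h1 : Tendsto (fun n => (z' (φ n)).re) atTop (𝓝 a.re) :=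
      (continuous_re.tendsto a).comp hlim
    have h2 : Tendsto (fun n => (z' (φ n)).re) atTop (𝓝 0) := by
      refine squeeze_zero_norm (fun n => ?_)
        (tendsto_one_div_add_atTop_nhds_zero_nat.comp hφ.tendsto_atTop)
      rw [hre, Real.norm_eq_abs]
      exact ((hz2 (φ n)).le.trans (min_le_right _ _))
    exact tendsto_nhds_unique h1 h2
  have hfreq : ∃ᶠ w in 𝓝[≠] a, symbol nabla w = 0 := by
    have h1 : Tendsto (fun n => z' (φ n)) atTop (𝓝[≠] a) := by
      refine tendsto_nhdsWithin_iff.mpr ⟨hlim, Eventually.of_forall fun n => ?_⟩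
      intro he
      have : (z' (φ n)).re = 0 := by rw [Set.mem_singleton_iff.mp he, hre0]
      rw [hre] at this
      have h2 := hz1 (φ n)
      rw [this] at h2
      simp at h2
    exact h1.frequently (Frequently.of_forall fun n => hzero (φ n))
  have han : AnalyticOnNhd ℂ (symbol nabla) {w | |w.re| < M / 2} :=
    (differentiableOn_symbol hM h hL).analyticOnNhd (isOpen_strip _)
  have := han.eqOn_zero_of_preconnected_of_frequently_eq_zero (isPreconnected_strip _)
    (z₀ := a) (by simpa [hre0] using hM) hfreq
  obtain ⟨w, hw, hne⟩ := symbol_ne_zero hM h hL h0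
  exact hne (this hw)

/-- The Laurent coefficients of the inverse of the symbol, on the line `Re w = x`. -/
noncomputable def invCoeff (nabla : ℤ → ℂ) (x : ℝ) (j : ℤ) : ℂ :=
  (2 * (Real.pi : ℂ))⁻¹ * ∫ y in (0 : ℝ)..2 * Real.pi,
    exp (-(j : ℂ) * (x + y * I)) / symbol nabla (x + y * I)

theorem continuous_symbol_vertical {nabla : ℤ → ℂ} {M : ℝ}
    (hd : DifferentiableOn ℂ (symbol nabla) {w | |w.re| < M / 2})
    {x : ℝ} (hx : |x| < M / 2) : Continuous fun y : ℝ => symbol nabla (x + y * I) :=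
  hd.continuousOn.comp_continuous (continuous_vertical x) fun y => by simpa using hx

/-- Moving the line of integration to `Re w = x` gives decay `e^{-jx}`: on one side of the lattice
only. -/
theorem invCoeff_bound {nabla : ℤ → ℂ} {M r : ℝ}
    (hd : DifferentiableOn ℂ (symbol nabla) {w | |w.re| < M / 2}) (hr : r ≤ M / 2)
    (h0 : ∀ w : ℂ, 0 < |w.re| → |w.re| < r → symbol nabla w ≠ 0) {x : ℝ} (hx0 : x ≠ 0)
    (hx : |x| < r) : ∃ C : ℝ, 0 ≤ C ∧ ∀ j : ℤ, ‖invCoeff nabla x j‖ ≤ C * Real.exp (-(j * x)) := by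
  have hne : ∀ y : ℝ, symbol nabla (x + y * I) ≠ 0 := fun y =>
    h0 _ (by simpa using hx0) (by simpa using hx)
  have hcont : Continuous fun y : ℝ => ‖(symbol nabla (x + y * I))⁻¹‖ :=
    ((continuous_symbol_vertical hd (hx.trans_le hr)).inv₀ hne).norm
  obtain ⟨K, hK⟩ := (isCompact_uIcc (a := (0 : ℝ)) (b := 2 * Real.pi)).exists_bound_of_continuousOn
    hcont.continuousOn
  have hK' : ∀ y ∈ Set.uIcc 0 (2 * Real.pi), ‖(symbol nabla (x + y * I))⁻¹‖ ≤ K := by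
    intro y hy; simpa using hK y hy
  have hK0 : 0 ≤ K := (norm_nonneg _).trans (hK' 0 Set.left_mem_uIcc)
  refine ⟨K, hK0, fun j => ?_⟩
  rw [invCoeff, norm_mul]
  have h1 : ‖∫ y in (0 : ℝ)..2 * Real.pi, exp (-(j : ℂ) * (x + y * I)) / symbol nabla (x + y * I)‖ ≤
      (K * Real.exp (-(j * x))) * |2 * Real.pi - 0| := by
    refine intervalIntegral.norm_integral_le_of_norm_le_const fun y hy => ?_
    rw [div_eq_mul_inv, norm_mul, mul_comm, norm_exp]
    have e : (-(j : ℂ) * (x + y * I)).re = -(j * x) := by simp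
    rw [e]
    exact mul_le_mul_of_nonneg_right (hK' y (Set.uIoc_subset_uIcc hy)) (Real.exp_pos _).le
  have h2 : ‖(2 * (Real.pi : ℂ))⁻¹‖ = (2 * Real.pi)⁻¹ := by
    rw [norm_inv, norm_mul]; simp [abs_of_pos Real.pi_pos]
  rw [h2]
  rw [sub_zero, abs_of_pos Real.two_pi_pos] at h1
  calc _ ≤ (2 * Real.pi)⁻¹ * ((K * Real.exp (-(j * x))) * (2 * Real.pi)) :=
        mul_le_mul_of_nonneg_left h1 (inv_nonneg.mpr Real.two_pi_pos.le)
    _ = _ := by field_simp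

/-- On either side of the imaginary axis the coefficients do not depend on the line: the integrals
over opposite horizontal sides of a rectangle of height `2π` cancel. -/
theorem invCoeff_eq {nabla : ℤ → ℂ} {M r : ℝ}
    (hd : DifferentiableOn ℂ (symbol nabla) {w | |w.re| < M / 2}) (hr : r ≤ M / 2)
    (h0 : ∀ w : ℂ, 0 < |w.re| → |w.re| < r → symbol nabla w ≠ 0) {x x' : ℝ}
    (hx : ∀ u ∈ Set.uIcc x x', 0 < |u| ∧ |u| < r) (j : ℤ) :
    invCoeff nabla x j = invCoeff nabla x' j := by
  set f : ℂ → ℂ := fun w => exp (-(j : ℂ) * w) / symbol nabla w with hf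
  have H := integral_boundary_rect_eq_zero_of_differentiableOn f (x : ℂ)
    ((x' : ℂ) + (2 * Real.pi : ℝ) * I) (by
      intro w hw
      rw [mem_reProdIm] at hw
      have h1 : 0 < |w.re| ∧ |w.re| < r := hx _ (by simpa using hw.1)
      have h2 : DifferentiableAt ℂ (symbol nabla) w :=
        (hd w (h1.2.trans_le hr)).differentiableAt ((isOpen_strip _).mem_nhds (h1.2.trans_le hr))
      exact (DifferentiableAt.div (by fun_prop) h2 (h0 w h1.1 h1.2)).differentiableWithinAt)
  have hper : ∀ u : ℝ, f (u + (2 * Real.pi : ℝ) * I) = f u := by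
    intro u
    have e : (u : ℂ) + (2 * Real.pi : ℝ) * I = u + ((1 : ℤ) : ℂ) * (2 * Real.pi * I) := by
      push_cast; ring
    simp only [hf]
    rw [e, symbol_periodic]
    have := exp_int_mul_periodic (-j) u 1
    push_cast at this ⊢
    rw [this]
  simp only [ofReal_re, ofReal_im, add_re, mul_re, I_re, mul_zero, I_im, mul_one, sub_self,
    add_zero, add_im, mul_im, zero_add, ofReal_zero, zero_mul] at H
  have hper' : (∫ u : ℝ in x..x', f (u + ((2 * Real.pi : ℝ) : ℂ) * I)) = ∫ u : ℝ in x..x', f u := by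
    refine intervalIntegral.integral_congr fun u _ => ?_
    exact hper u
  rw [hper', sub_self, zero_add, sub_eq_zero] at H
  have H2 := smul_right_injective ℂ I_ne_zero H
  rw [invCoeff, invCoeff]
  congr 1
  exact H2.symm

/-- Convolution with the Laurent coefficients inverts the difference operator. -/
theorem hasSum_invCoeff {nabla : ℤ → ℂ} {M r L : ℝ} (hM : 0 < M)
    (h : ∀ j : ℤ, ‖nabla j‖ ≤ L * Real.exp (-(M * |(j : ℝ)|))) (hL : 0 ≤ L)
    (hr : r ≤ M / 2) (h0 : ∀ w : ℂ, 0 < |w.re| → |w.re| < r → symbol nabla w ≠ 0) {x : ℝ}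
    (hx0 : x ≠ 0) (hx : |x| < r) (m n : ℤ) :
    HasSum (fun k => invCoeff nabla x (k - m) * nabla (n - k)) (if m = n then 1 else 0) := by
  have hd := differentiableOn_symbol hM h hL
  have hxM : |x| < M / 2 := hx.trans_le hr
  have hne : ∀ y : ℝ, symbol nabla (x + y * I) ≠ 0 := fun y =>
    h0 _ (by simpa using hx0) (by simpa using hx)
  have hcs := continuous_symbol_vertical hd hxM
  have hci : Continuous fun y : ℝ => (symbol nabla (x + y * I))⁻¹ := hcs.inv₀ hne
  obtain ⟨K, hK⟩ := (isCompact_uIcc (a := (0 : ℝ)) (b := 2 * Real.pi)).exists_bound_of_continuousOn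
    hci.continuousOn
  have hK0 : 0 ≤ K := (norm_nonneg _).trans (hK 0 Set.left_mem_uIcc)
  set F : ℤ → C(ℝ, ℂ) := fun j => ⟨fun y : ℝ => (nabla j * exp (j * (x + y * I))) *
    (exp ((m - n : ℤ) * (x + y * I)) * (symbol nabla (x + y * I))⁻¹), by fun_prop⟩ with hF
  have hsum : HasSum (fun j : ℤ => ∫ y in (0 : ℝ)..2 * Real.pi, F j y)
      (∫ y in (0 : ℝ)..2 * Real.pi, ∑' j : ℤ, F j y) := by
    refine intervalIntegral.hasSum_intervalIntegral_of_summable_norm ?_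
    refine Summable.of_nonneg_of_le (fun _ => norm_nonneg _) (fun j => ?_)
      (((summable_exp_neg_abs (c := M - |x|) (by linarith)).mul_left L).mul_right
        (Real.exp ((m - n : ℤ) * x) * K))
    rw [ContinuousMap.norm_le _ (by positivity)]
    intro y
    have e : ‖(nabla j * exp (j * (x + (y : ℝ) * I))) *
        (exp ((m - n : ℤ) * (x + (y : ℝ) * I)) * (symbol nabla (x + (y : ℝ) * I))⁻¹)‖ ≤
        (L * Real.exp (-((M - |x|) * |(j : ℝ)|))) * (Real.exp ((m - n : ℤ) * x) * K) := by
      rw [norm_mul, norm_mul (exp _)]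
      refine mul_le_mul (norm_term_le h hL j (by simp)) ?_ (by positivity) (by positivity)
      rw [norm_exp_int_mul]
      refine mul_le_mul (by simp) (hK y y.2) (norm_nonneg _) (by positivity)
    exact e
  have e1 : ∀ y : ℝ, ∑' j : ℤ, F j y = exp ((m - n : ℤ) * (x + y * I)) := by
    intro y
    have e2 : ∀ j : ℤ, F j y = (nabla j * exp (j * (x + y * I))) *
      (exp ((m - n : ℤ) * (x + y * I)) * (symbol nabla (x + y * I))⁻¹) := fun j => rfl
    simp only [e2]
    rw [tsum_mul_right]
    have e3 : ∑' j : ℤ, nabla j * exp (j * (x + y * I)) = symbol nabla (x + y * I) := rfl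
    rw [e3, mul_left_comm, mul_inv_cancel₀ (hne y), mul_one]
  simp only [e1, integral_exp_int] at hsum
  have h1 := (Equiv.subLeft n).hasSum_iff.mpr (hsum.mul_left ((2 * (Real.pi : ℂ))⁻¹))
  have h2 : (2 * (Real.pi : ℂ))⁻¹ * (if m - n = 0 then 2 * (Real.pi : ℂ) else 0) =
      if m = n then 1 else 0 := by
    simp only [sub_eq_zero, mul_ite, mul_zero]
    rw [inv_mul_cancel₀ (by simp [Real.pi_ne_zero])]
  rw [h2] at h1
  refine Eq.mp ?_ h1
  congr 1
  funext k
  simp only [Function.comp, Equiv.subLeft_apply]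
  rw [invCoeff, mul_assoc, ← intervalIntegral.integral_mul_const]
  congr 1
  refine intervalIntegral.integral_congr fun y _ => ?_
  have e2 : F (n - k) y = (nabla (n - k) * exp ((n - k : ℤ) * (x + y * I))) *
      (exp ((m - n : ℤ) * (x + y * I)) * (symbol nabla (x + y * I))⁻¹) := rfl
  have e3 : exp (-((k - m : ℤ) : ℂ) * (x + y * I)) =
      exp ((n - k : ℤ) * (x + y * I)) * exp ((m - n : ℤ) * (x + y * I)) := by
    rw [← exp_add]; congr 1; push_cast; ring
  simp only [e2, e3]
  ring

/-- A one-sided inverse of the difference operator. Its symbol may vanish on the unit circle, so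
there is no decaying translation-invariant inverse; but using one of the two Laurent expansions on
either half of the lattice gives an inverse that preserves exponential decay at slow rates. -/
theorem IsDifferenceOperator.exists_inverse {nabla : ℤ → ℂ} (hn : IsDifferenceOperator nabla) :
    ∃ (K : ℤ → ℤ → ℂ) (r : ℝ), 0 < r ∧
      (∀ ε : ℝ, 0 < ε → ε < r → ∃ C : ℝ, 0 ≤ C ∧ ∀ m k : ℤ,
        ‖K m k‖ ≤ C * (Real.exp (-(ε * |(m : ℝ)|)) * Real.exp (ε * |(k : ℝ)|))) ∧
      ∀ m n : ℤ, HasSum (fun k => K m k * nabla (n - k)) (if m = n then 1 else 0) := by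
  obtain ⟨L, M, hL, hM, h⟩ := hn.decay
  obtain ⟨r, hr, hrM, h0⟩ := exists_zero_free_strip hM h hL.le hn.ne_zero
  have hd := differentiableOn_symbol hM h hL.le
  refine ⟨fun m k => if 0 ≤ m then invCoeff nabla (-(r / 2)) (k - m) else
    invCoeff nabla (r / 2) (k - m), r, hr, fun ε hε hεr => ?_, fun m n => ?_⟩
  · have heq1 : ∀ j, invCoeff nabla (-(r / 2)) j = invCoeff nabla (-ε) j := by
      refine invCoeff_eq hd hrM h0 fun u hu => ?_
      have h1 : u < 0 ∧ -r < u := by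
        rcases Set.mem_uIcc.mp hu with h | h <;> constructor <;> linarith
      rw [abs_of_neg h1.1]
      constructor <;> linarith
    have heq2 : ∀ j, invCoeff nabla (r / 2) j = invCoeff nabla ε j := by
      refine invCoeff_eq hd hrM h0 fun u hu => ?_
      have h1 : 0 < u ∧ u < r := by
        rcases Set.mem_uIcc.mp hu with h | h <;> constructor <;> linarith
      rwa [abs_of_pos h1.1]
    obtain ⟨C, hC, hb⟩ := invCoeff_bound hd hrM h0 (x := -ε) (by linarith)
      (by rwa [abs_neg, abs_of_pos hε])
    obtain ⟨C', hC', hb'⟩ := invCoeff_bound hd hrM h0 (x := ε) hε.ne' (by rwa [abs_of_pos hε])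
    refine ⟨max C C', le_max_of_le_left hC, fun m k => ?_⟩
    rw [← Real.exp_add]
    have hk1 := mul_le_mul_of_nonneg_left (le_abs_self (k : ℝ)) hε.le
    have hk2 := mul_le_mul_of_nonneg_left (neg_abs_le (k : ℝ)) hε.le
    dsimp only
    split_ifs with hm
    · rw [heq1]
      refine (hb _).trans (mul_le_mul (le_max_left _ _) (Real.exp_le_exp.mpr ?_)
        (Real.exp_pos _).le (le_max_of_le_left hC))
      rw [abs_of_nonneg (by exact_mod_cast hm : (0 : ℝ) ≤ m)]
      push_cast
      linarith
    · rw [heq2]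
      refine (hb' _).trans (mul_le_mul (le_max_right _ _) (Real.exp_le_exp.mpr ?_)
        (Real.exp_pos _).le (le_max_of_le_left hC))
      rw [abs_of_neg (by exact_mod_cast not_le.mp hm : (m : ℝ) < 0)]
      push_cast
      linarith
  · dsimp only
    by_cases hm : 0 ≤ m
    · simp only [hm, if_true]
      exact hasSum_invCoeff hM h hL.le hrM h0 (by linarith)
        (by rw [abs_neg, abs_of_pos (by linarith)]; linarith) m n
    · simp only [hm, if_false]
      exact hasSum_invCoeff hM h hL.le hrM h0 (by linarith)
        (by rw [abs_of_pos (by linarith)]; linarith) m n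

end LatticeSusy

namespace LatticeSusy

variable {N : ℕ}

/-! ### Gradings preserved by the supercharges -/

theorem wt_one (w : List (Gen N)) : wt (fun _ => 1) w = w.length := by
  induction w with
  | nil => rfl
  | cons a w ih => rw [wt_cons, ih]; push_cast [List.length_cons]; ring

/-- The number of letters with label `t`. -/
def wSec (t : Sgn) : Gen N → ℤ
  | Gen.theta _ => 0
  | Gen.phi s _ | Gen.chibar s _ | Gen.chi s _ | Gen.F s _ => if s = t then 1 else 0
  | Gen.rho s _ | Gen.zeta s _ => if s = t then 1 else 0

/-- The Koszul grading of `Q_t`: on letters with label `-t` it counts the `χ` and the `F`. -/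
def wKoszul (t : Sgn) : Gen N → ℤ
  | Gen.phi s _ => if s = t then 1 else 0
  | Gen.chibar _ _ => 0
  | Gen.chi _ _ => 1
  | Gen.F s _ => if s = t then 0 else 1
  | Gen.rho s _ => if s = t then 1 else 0
  | Gen.zeta _ _ => 0
  | Gen.theta _ => 0

/-- The number of letters `θ_±`. -/
def wTheta (a : Gen N) : ℤ := if a.isTheta then 1 else 0

/-- A weight that every term of the supercharge changes by the same amount `c` grades it. -/
theorem QD_shifts {nabla : ℤ → ℂ} {t : Sgn} {ω : Gen N → ℤ} {c : ℤ}
    (h1 : ∀ m, ω (Gen.phi t m) = ω (Gen.chibar t m) + c)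
    (h2 : ∀ m n, ω (Gen.F t.opp n) = ω (Gen.chibar t.opp m) + c)
    (h3 : ∀ m, ω (Gen.chi t m) = ω (Gen.F t m) + c)
    (h4 : ∀ m n, ω (Gen.chi t.opp n) = ω (Gen.phi t.opp m) + c)
    (h5 : ∀ i, ω (Gen.rho t i) = ω (Gen.zeta t i) + c) : (QD nabla t).Shifts ω c := by
  intro a n h
  cases a with
  | phi s m =>
    rcases Sgn.eq_or_opp t s with rfl | rfl
    · simp [QD] at h
    · exact h4 m n
  | chibar s m =>
    rcases Sgn.eq_or_opp t s with rfl | rfl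
    · simpa [QD] using h1 m
    · simpa [QD, Sgn.opp_ne] using h2 m n
  | F s m =>
    rcases Sgn.eq_or_opp t s with rfl | rfl
    · exact h3 m
    · simp [QD, Sgn.opp_ne] at h
  | zeta s i =>
    rcases Sgn.eq_or_opp t s with rfl | rfl
    · exact h5 i
    · simp [QD, Sgn.opp_ne] at h
  | _ => simp [QD] at h

theorem QD_shifts_one (nabla : ℤ → ℂ) (t : Sgn) : (QD (N := N) nabla t).Shifts (fun _ => 1) 0 :=
  QD_shifts (by simp) (by simp) (by simp) (by simp) (by simp)

theorem QD_shifts_wSec (nabla : ℤ → ℂ) (t s : Sgn) : (QD (N := N) nabla t).Shifts (wSec s) 0 :=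
  QD_shifts (by simp [wSec]) (by simp [wSec]) (by simp [wSec]) (by simp [wSec]) (by simp [wSec])

theorem QD_shifts_wKoszul (nabla : ℤ → ℂ) (t : Sgn) :
    (QD (N := N) nabla t).Shifts (wKoszul t) 1 :=
  QD_shifts (by simp [wKoszul]) (by simp [wKoszul, Sgn.opp_ne]) (by simp [wKoszul])
    (by simp [wKoszul, Sgn.opp_ne]) (by simp [wKoszul])

theorem QD_shifts_wTheta (nabla : ℤ → ℂ) (t : Sgn) : (QD (N := N) nabla t).Shifts wTheta 0 :=
  QD_shifts (by simp [wTheta, Gen.isTheta]) (by simp [wTheta, Gen.isTheta])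
    (by simp [wTheta, Gen.isTheta]) (by simp [wTheta, Gen.isTheta]) (by simp [wTheta, Gen.isTheta])

theorem QD_shifts_wSite (nabla : ℤ → ℂ) (t : Sgn) : (QD (N := N) nabla t).Shifts wSite 0 :=
  QD_shifts (by simp [wSite, Gen.site]) (by simp [wSite, Gen.site])
    (by simp [wSite, Gen.site]) (by simp [wSite, Gen.site]) (by simp [wSite, Gen.site])

theorem QD_shifts_wNF (nabla : ℤ → ℂ) (t : Sgn) : (QD (N := N) nabla t).Shifts wNF 1 :=
  QD_shifts (by simp [wNF]) (by simp [wNF]) (by simp [wNF]) (by simp [wNF]) (by simp [wNF])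

theorem QD_shifts_wField (nabla : ℤ → ℂ) (t : Sgn) : (QD (N := N) nabla t).Shifts wField 0 :=
  QD_shifts (by simp [wField, Gen.isField]) (by simp [wField, Gen.isField])
    (by simp [wField, Gen.isField]) (by simp [wField, Gen.isField]) (by simp [wField, Gen.isField])

/-! ### Anticommutators of the supercharges -/

theorem QD_col_sq (nabla : ℤ → ℂ) (t : Sgn) (a : Gen N) (u : Gen N → ℂ) :
    (QD nabla t).col a (fun b => (QD nabla t).col b u) = 0 := by
  induction a using Gen.cases_sgn t with
  | h1 m => exact QD_col_phi _ _ _ _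
  | h2 m => rw [QD_col_phi_opp]; simp [QD_col_chi]
  | h3 m => rw [QD_col_chibar, QD_col_phi, mul_zero]
  | h4 m => rw [QD_col_chibar_opp]; simp [QD_col_F_opp]
  | h5 r m => exact QD_col_chi _ _ _ _ _
  | h6 m => rw [QD_col_F, QD_col_chi]
  | h7 m => exact QD_col_F_opp _ _ _ _
  | h8 r i => exact QD_col_rho _ _ _ _ _
  | h9 i => rw [QD_col_zeta, QD_col_rho, mul_zero]
  | h10 i => exact QD_col_zeta_opp _ _ _ _
  | h11 r => exact QD_col_theta _ _ _ _

theorem toC_mul_opp (t : Sgn) : t.toC * t.opp.toC = -1 := by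
  rw [Sgn.toC_opp, mul_neg, Sgn.toC_sq]

theorem QD_col_anticomm (nabla : ℤ → ℂ) (t : Sgn) (a : Gen N) (u : Gen N → ℂ) :
    (QD nabla t).col a (fun b => (QD nabla t.opp).col b u) +
      (QD nabla t.opp).col a (fun b => (QD nabla t).col b u) = 0 := by
  have phi' : ∀ m v, (QD nabla t.opp).col (Gen.phi t m) v =
      -(t.opp.toC * Complex.I) * ∑' n, nabla (n - m) * v (Gen.chi (N := N) t n) := by
    intro m v; simpa using QD_col_phi_opp nabla t.opp v m
  have chibar' : ∀ m v, (QD nabla t.opp).col (Gen.chibar t m) v =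
      -Complex.I * ∑' n, nabla (n - m) * v (Gen.F (N := N) t n) := by
    intro m v; simpa using QD_col_chibar_opp nabla t.opp v m
  have F' : ∀ m v, (QD nabla t.opp).col (Gen.F (N := N) t m) v = 0 := by
    intro m v; simpa using QD_col_F_opp nabla t.opp v m
  have zeta' : ∀ i v, (QD nabla t.opp).col (Gen.zeta (N := N) t i) v = 0 := by
    intro m v; simpa using QD_col_zeta_opp nabla t.opp v m
  have hs := toC_mul_opp t
  induction a using Gen.cases_sgn t with
  | h1 m => rw [QD_col_phi, phi']; simp [QD_col_chi]
  | h2 m => rw [QD_col_phi_opp, QD_col_phi]; simp [QD_col_chi]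
  | h3 m =>
    rw [QD_col_chibar, chibar', phi']
    simp only [QD_col_F]
    linear_combination (-Complex.I * ∑' n, nabla (n - m) * u (Gen.chi t n)) * hs
  | h4 m =>
    rw [QD_col_chibar_opp, QD_col_chibar, QD_col_phi_opp]
    simp only [QD_col_F]
    linear_combination (-Complex.I * ∑' n, nabla (n - m) * u (Gen.chi t.opp n)) * hs
  | h5 r m => rw [QD_col_chi, QD_col_chi, add_zero]
  | h6 m => rw [QD_col_F, F', QD_col_chi, add_zero]
  | h7 m => rw [QD_col_F_opp, QD_col_F, QD_col_chi, add_zero]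
  | h8 r i => rw [QD_col_rho, QD_col_rho, add_zero]
  | h9 i => rw [QD_col_zeta, zeta', QD_col_rho, mul_zero, add_zero]
  | h10 i => rw [QD_col_zeta_opp, QD_col_zeta, QD_col_rho, mul_zero, add_zero]
  | h11 r => rw [QD_col_theta, QD_col_theta, add_zero]

theorem QD_app_sq {nabla : ℤ → ℂ} {t : Sgn} {T : Set ℝ} (hM : (QD (N := N) nabla t).Adm T)
    {f : Raw N} (hf : Tame T f) : (QD nabla t).app ((QD nabla t).app f) = 0 := by
  have h := hM.anticomm hM (QD_isOdd nabla t) (QD_isOdd nabla t)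
    (fun a u _ => by rw [QD_col_sq, add_zero]) hf
  rw [← two_smul ℂ, smul_eq_zero] at h
  exact h.resolve_left two_ne_zero

theorem QD_app_anticomm {nabla : ℤ → ℂ} (hn : IsDifferenceOperator nabla) (t : Sgn)
    {f : Raw N} (hf : Tame {0} f) :
    (QD nabla t).app ((QD nabla t.opp).app f) + (QD nabla t.opp).app ((QD nabla t).app f) = 0 :=
  (QD_adm_zero hn t).anticomm (QD_adm_zero hn t.opp) (QD_isOdd nabla t) (QD_isOdd nabla t.opp)
    (fun a u _ => QD_col_anticomm nabla t a u) hf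

/-! ### The contracting homotopy -/

/-- The odd derivation `χ_{-t} ↦ K φ_{-t}`, `F_{-t} ↦ K χ̄_{-t}`, normalized to invert `Q_t` when
the kernel `K` inverts the difference operator. -/
noncomputable def HD (K : ℤ → ℤ → ℂ) (t : Sgn) : LinDer N where
  src
    | Gen.chi s _, n => Gen.phi s n
    | Gen.F s _, n => Gen.chibar s n
    | a, _ => a
  ker
    | Gen.chi s m, n => if s = t then 0 else (-(t.toC * Complex.I))⁻¹ * K m n
    | Gen.F s m, n => if s = t then 0 else (-Complex.I)⁻¹ * K m n
    | _, _ => 0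

theorem HD_isOdd (K : ℤ → ℤ → ℂ) (t : Sgn) : (HD (N := N) K t).IsOdd := by
  intro a n h
  cases a <;> simp [HD, Gen.odd] at h ⊢

variable (K : ℤ → ℤ → ℂ) (t : Sgn) (u : Gen N → ℂ)

theorem HD_col_chi_opp (m : ℤ) : (HD K t).col (Gen.chi t.opp m) u =
    (-(t.toC * Complex.I))⁻¹ * ∑' k, K m k * u (Gen.phi t.opp k) := by
  rw [← tsum_mul_left]
  refine tsum_congr fun k => ?_
  simp [HD, Sgn.opp_ne, mul_assoc]

theorem HD_col_F_opp (m : ℤ) : (HD K t).col (Gen.F t.opp m) u =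
    (-Complex.I)⁻¹ * ∑' k, K m k * u (Gen.chibar t.opp k) := by
  rw [← tsum_mul_left]
  refine tsum_congr fun k => ?_
  simp [HD, Sgn.opp_ne, mul_assoc]

theorem HD_col_zero {a : Gen N} (h1 : ∀ m, a ≠ Gen.chi t.opp m) (h2 : ∀ m, a ≠ Gen.F t.opp m) :
    (HD K t).col a u = 0 := by
  have : ∀ n, (HD K t).ker a n = 0 := by
    intro n
    cases a with
    | chi s m =>
      rcases Sgn.eq_or_opp t s with rfl | rfl
      · simp [HD]
      · exact absurd rfl (h1 m)
    | F s m =>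
      rcases Sgn.eq_or_opp t s with rfl | rfl
      · simp [HD]
      · exact absurd rfl (h2 m)
    | _ => rfl
  simp [LinDer.col, this]

variable {K t u}

theorem summable_weighted_of_kernel {r : ℝ} (hr : 0 < r)
    (hK : ∀ ε : ℝ, 0 < ε → ε < r → ∃ C : ℝ, 0 ≤ C ∧ ∀ m k : ℤ,
        ‖K m k‖ ≤ C * (Real.exp (-(ε * |(m : ℝ)|)) * Real.exp (ε * |(k : ℝ)|)))
    {τ : ℝ} (hτ : 0 < τ) : ∃ τ' : ℝ, 0 < τ' ∧ τ' ≤ τ ∧ ∃ G : ℝ, 0 ≤ G ∧ ∀ m : ℤ,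
      Summable (fun k : ℤ => ‖K m k‖ * Real.exp (-(τ * |(k : ℝ)|))) ∧
      ∑' k : ℤ, ‖K m k‖ * Real.exp (-(τ * |(k : ℝ)|)) ≤ G * Real.exp (-(τ' * |(m : ℝ)|)) := by
  set ε := min τ r / 2 with hε
  have hε0 : 0 < ε := by have := lt_min hτ hr; linarith
  have hετ : ε < τ := by have := min_le_left τ r; have := lt_min hτ hr; linarith
  have hεr : ε < r := by have := min_le_right τ r; have := lt_min hτ hr; linarith
  obtain ⟨C, hC, hb⟩ := hK ε hε0 hεr
  have hs := summable_exp_neg_abs (c := τ - ε) (by linarith)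
  have key : ∀ m k : ℤ, ‖K m k‖ * Real.exp (-(τ * |(k : ℝ)|)) ≤
      (C * Real.exp (-(ε * |(m : ℝ)|))) * Real.exp (-((τ - ε) * |(k : ℝ)|)) := by
    intro m k
    have e : Real.exp (-((τ - ε) * |(k : ℝ)|)) =
        Real.exp (ε * |(k : ℝ)|) * Real.exp (-(τ * |(k : ℝ)|)) := by
      rw [← Real.exp_add]; congr 1; ring
    rw [e, ← mul_assoc, mul_assoc C]
    exact mul_le_mul_of_nonneg_right (hb m k) (Real.exp_pos _).le
  refine ⟨ε, hε0, hετ.le, C * ∑' k : ℤ, Real.exp (-((τ - ε) * |(k : ℝ)|)),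
    mul_nonneg hC (tsum_nonneg fun _ => (Real.exp_pos _).le), fun m => ?_⟩
  have s2 : Summable (fun k : ℤ => (C * Real.exp (-(ε * |(m : ℝ)|))) *
      Real.exp (-((τ - ε) * |(k : ℝ)|))) := hs.mul_left _
  have s1 : Summable (fun k : ℤ => ‖K m k‖ * Real.exp (-(τ * |(k : ℝ)|))) :=
    Summable.of_nonneg_of_le (fun k => by positivity) (key m) s2
  refine ⟨s1, (s1.tsum_le_tsum (key m) s2).trans (le_of_eq ?_)⟩
  rw [tsum_mul_left]
  ring

/-- The homotopy preserves exponential decay, because its kernel does for small rates. -/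
theorem HD_adm {r : ℝ} (hr : 0 < r)
    (hK : ∀ ε : ℝ, 0 < ε → ε < r → ∃ C : ℝ, 0 ≤ C ∧ ∀ m k : ℤ,
        ‖K m k‖ ≤ C * (Real.exp (-(ε * |(m : ℝ)|)) * Real.exp (ε * |(k : ℝ)|))) (t : Sgn) :
    (HD (N := N) K t).Adm (Set.Ioi 0) := by
  intro τ hτ
  obtain ⟨τ', hτ', hle, G, hG, h⟩ := summable_weighted_of_kernel hr hK hτ
  refine ⟨τ', hτ', G, hG, fun a => ?_⟩
  have hzero : (∀ n, (HD K t).ker a n = 0) →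
      Summable (fun n => ‖(HD K t).ker a n‖ * Real.exp (-(τ * ((HD K t).src a n).sz))) ∧
      ∑' n, ‖(HD K t).ker a n‖ * Real.exp (-(τ * ((HD K t).src a n).sz)) ≤
        G * Real.exp (-(τ' * a.sz)) := by
    intro h0
    simp only [h0, norm_zero, zero_mul, tsum_zero]
    exact ⟨summable_zero, by positivity⟩
  have hone : ∀ (c : ℂ) (m : ℤ), ‖c‖ = 1 →
      Summable (fun n : ℤ => ‖c * K m n‖ * Real.exp (-(τ * |(n : ℝ)|))) ∧
      ∑' n : ℤ, ‖c * K m n‖ * Real.exp (-(τ * |(n : ℝ)|)) ≤ G * Real.exp (-(τ' * |(m : ℝ)|)) := by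
    intro c m hc
    simp only [norm_mul, hc, one_mul]
    exact h m
  cases a with
  | chi s m =>
    rcases Sgn.eq_or_opp t s with rfl | rfl
    · exact hzero fun n => by simp [HD]
    · have := hone (-(t.toC * Complex.I))⁻¹ m (by simp [Sgn.norm_toC])
      simpa [HD, Sgn.opp_ne, Gen.sz, Gen.site] using this
  | F s m =>
    rcases Sgn.eq_or_opp t s with rfl | rfl
    · exact hzero fun n => by simp [HD]
    · have := hone (-Complex.I)⁻¹ m (by simp)
      simpa [HD, Sgn.opp_ne, Gen.sz, Gen.site] using this
  | _ => exact hzero fun n => rfl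

/-- The kernel `K` undoes the difference operator on decaying sequences. -/
theorem kernel_inverse {nabla : ℤ → ℂ} {L M r : ℝ} (hM : 0 < M) (hr : 0 < r)
    (hn : ∀ j : ℤ, ‖nabla j‖ ≤ L * Real.exp (-(M * |(j : ℝ)|)))
    (hK : ∀ ε : ℝ, 0 < ε → ε < r → ∃ C : ℝ, 0 ≤ C ∧ ∀ m k : ℤ,
        ‖K m k‖ ≤ C * (Real.exp (-(ε * |(m : ℝ)|)) * Real.exp (ε * |(k : ℝ)|)))
    (hinv : ∀ m n : ℤ, HasSum (fun k => K m k * nabla (n - k)) (if m = n then 1 else 0))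
    {v : ℤ → ℂ} {B τ : ℝ} (hτ : 0 < τ) (hv : ∀ n : ℤ, ‖v n‖ ≤ B * Real.exp (-(τ * |(n : ℝ)|)))
    (m : ℤ) : ∑' k, K m k * ∑' n, nabla (n - k) * v n = v m := by
  set μ := min M τ / 2 with hμ
  have hμ0 : 0 < μ := by have := lt_min hM hτ; linarith
  have hμM : 2 * μ ≤ M := by have := min_le_left M τ; linarith
  have hμτ : 2 * μ ≤ τ := by have := min_le_right M τ; linarith
  set ε := min r μ / 2 with hε
  have hε0 : 0 < ε := by have := lt_min hr hμ0; linarith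
  have hεr : ε < r := by have := min_le_left r μ; have := lt_min hr hμ0; linarith
  have hεμ : ε < μ := by have := min_le_right r μ; have := lt_min hr hμ0; linarith
  obtain ⟨C, hC, hb⟩ := hK ε hε0 hεr
  have hL : 0 ≤ L := by
    have := (norm_nonneg _).trans (hn 0); simpa using this
  have hB : 0 ≤ B := by
    have := (norm_nonneg _).trans (hv 0); simpa using this
  have hsum : Summable (fun p : ℤ × ℤ => K m p.1 * (nabla (p.2 - p.1) * v p.2)) := by
    have s1 := (summable_exp_neg_abs (c := μ - ε) (by linarith)).mul_of_nonneg
      (summable_exp_neg_abs hμ0) (fun _ => (Real.exp_pos _).le) (fun _ => (Real.exp_pos _).le)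
    refine Summable.of_norm_bounded (s1.mul_left (C * (L * B))) fun p => ?_
    obtain ⟨k, n⟩ := p
    simp only [norm_mul]
    have h1 : ‖K m k‖ ≤ C * Real.exp (ε * |(k : ℝ)|) := by
      refine (hb m k).trans (mul_le_mul_of_nonneg_left ?_ hC)
      refine mul_le_of_le_one_left (Real.exp_pos _).le (Real.exp_le_one_iff.mpr ?_)
      have : 0 ≤ ε * |(m : ℝ)| := by positivity
      linarith
    have h2 : ‖nabla (n - k)‖ * ‖v n‖ ≤
        (L * B) * (Real.exp (-(μ * |(k : ℝ)|)) * Real.exp (-(μ * |(n : ℝ)|))) := by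
      calc ‖nabla (n - k)‖ * ‖v n‖ ≤ (L * Real.exp (-(M * |((n - k : ℤ) : ℝ)|))) *
            (B * Real.exp (-(τ * |(n : ℝ)|))) :=
            mul_le_mul (hn _) (hv _) (norm_nonneg _) (by positivity)
        _ = (L * B) * Real.exp (-(M * |((n - k : ℤ) : ℝ)|) + -(τ * |(n : ℝ)|)) := by
            rw [Real.exp_add]; ring
        _ ≤ _ := by
            rw [← Real.exp_add]
            refine mul_le_mul_of_nonneg_left (Real.exp_le_exp.mpr ?_) (by positivity)
            have h3 : |(k : ℝ)| ≤ |(n : ℝ)| + |((n - k : ℤ) : ℝ)| := by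
              have := abs_sub (n : ℝ) ((n - k : ℤ) : ℝ)
              simpa using this
            have h4 := mul_le_mul_of_nonneg_right hμM (abs_nonneg ((n - k : ℤ) : ℝ))
            have h5 := mul_le_mul_of_nonneg_right hμτ (abs_nonneg (n : ℝ))
            have h6 := mul_le_mul_of_nonneg_left h3 hμ0.le
            have h7 : 0 ≤ μ * |((n - k : ℤ) : ℝ)| := by positivity
            linarith
    calc ‖K m k‖ * (‖nabla (n - k)‖ * ‖v n‖) ≤ (C * Real.exp (ε * |(k : ℝ)|)) *
          ((L * B) * (Real.exp (-(μ * |(k : ℝ)|)) * Real.exp (-(μ * |(n : ℝ)|)))) :=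
          mul_le_mul h1 h2 (by positivity) (by positivity)
      _ = _ := by
          have e : Real.exp (-((μ - ε) * |(k : ℝ)|)) =
              Real.exp (ε * |(k : ℝ)|) * Real.exp (-(μ * |(k : ℝ)|)) := by
            rw [← Real.exp_add]; congr 1; ring
          rw [e]; ring
  have h1 : ∀ k, K m k * ∑' n, nabla (n - k) * v n = ∑' n, K m k * (nabla (n - k) * v n) :=
    fun k => tsum_mul_left.symm
  simp only [h1]
  have h2 : ∑' (k : ℤ) (n : ℤ), K m k * (nabla (n - k) * v n) =
      ∑' (n : ℤ) (k : ℤ), K m k * (nabla (n - k) * v n) :=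
    Summable.tsum_comm (f := fun n k : ℤ => K m k * (nabla (n - k) * v n))
      (by
        have := (Equiv.prodComm ℤ ℤ).summable_iff.mpr hsum
        exact this)
  rw [h2]
  have h3 : ∀ n, ∑' k, K m k * (nabla (n - k) * v n) = if n = m then v m else 0 := by
    intro n
    simp only [← mul_assoc]
    rw [tsum_mul_right, (hinv m n).tsum_eq]
    by_cases h : m = n
    · subst h; simp
    · simp [h, Ne.symm h]
  simp only [h3, tsum_ite_eq]

end LatticeSusy

namespace LatticeSusy

variable {N : ℕ}

/-! ### Decaying series and the homotopy -/

/-- `K` inverts the difference operator on the right and preserves slow exponential decay. -/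
structure IsInverseKernel (nabla : ℤ → ℂ) (K : ℤ → ℤ → ℂ) : Prop where
  bound : ∃ r : ℝ, 0 < r ∧ ∀ ε : ℝ, 0 < ε → ε < r → ∃ C : ℝ, 0 ≤ C ∧ ∀ m k : ℤ,
    ‖K m k‖ ≤ C * (Real.exp (-(ε * |(m : ℝ)|)) * Real.exp (ε * |(k : ℝ)|))
  inv : ∀ m n : ℤ, HasSum (fun k => K m k * nabla (n - k)) (if m = n then 1 else 0)

theorem IsInverseKernel.adm {nabla : ℤ → ℂ} {K : ℤ → ℤ → ℂ} (hK : IsInverseKernel nabla K)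
    (t : Sgn) : (HD (N := N) K t).Adm (Set.Ioi 0) := by
  obtain ⟨r, hr, h⟩ := hK.bound
  exact HD_adm hr h t

theorem IsInverseKernel.apply {nabla : ℤ → ℂ} (hn : IsDifferenceOperator nabla)
    {K : ℤ → ℤ → ℂ} (hK : IsInverseKernel nabla K) {u : Gen N → ℂ} (hu : UTame (Set.Ioi 0) u)
    {A : ℤ → Gen N} (hA : ∀ n, (A n).site = some n) (m : ℤ) :
    ∑' k, K m k * ∑' n, nabla (n - k) * u (A n) = u (A m) := by
  obtain ⟨r, hr, h⟩ := hK.bound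
  obtain ⟨L, M, _, hM, hd⟩ := hn.decay
  obtain ⟨τ, hτ, B, _, hB⟩ := hu
  refine kernel_inverse hM hr hd h hK.inv (B := B) hτ (v := fun n => u (A n)) (fun n => ?_) m
  have := hB (A n)
  rwa [Gen.sz, hA] at this

theorem exp_split_le {s t x y : ℝ} (hx : 0 ≤ x) (hy : 0 ≤ y) :
    Real.exp (-(s * x)) * Real.exp (-(t * y)) ≤ Real.exp (-(min s t * (x + y))) := by
  rw [← Real.exp_add]
  refine Real.exp_le_exp.mpr ?_
  have h1 := mul_le_mul_of_nonneg_right (min_le_left s t) hx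
  have h2 := mul_le_mul_of_nonneg_right (min_le_right s t) hy
  linarith

theorem JTame.col {T : Set ℝ} {M : LinDer N} (hM : M.Adm T) {F : Gen N → Raw N}
    (hF : JTame T F) : JTame T (fun a v => M.col a (fun b => F b v)) := by
  intro d
  obtain ⟨t, ht, L, hL, h⟩ := hF d
  obtain ⟨t', ht', G, hG, hs⟩ := hM t ht
  refine ⟨min t t', min_mem_rates ht ht', L * G, by positivity, fun a w hw => ?_⟩
  have h1 : ∀ b, ‖F b w‖ ≤ (L * Real.exp (-(t * wsz w))) * Real.exp (-(t * b.sz)) := by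
    intro b
    refine (h b w hw).trans (le_of_eq ?_)
    rw [mul_assoc, ← Real.exp_add, wsz_cons]; congr 2; ring
  refine (LinDer.col_bound (by positivity) (hs a) h1).trans ?_
  have h2 := exp_split_le (s := t) (t := t') (wsz_nonneg w) a.sz_nonneg
  rw [wsz_cons, add_comm a.sz]
  calc _ = (L * G) * (Real.exp (-(t * wsz w)) * Real.exp (-(t' * a.sz))) := by ring
    _ ≤ _ := mul_le_mul_of_nonneg_left h2 (by positivity)

theorem JTame.app {T : Set ℝ} {M : LinDer N} (hM : M.Adm T) {F : Gen N → Raw N}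
    (hF : JTame T F) : JTame T (fun b => M.app (F b)) := by
  intro d
  obtain ⟨t, ht, L, hL, h⟩ := hF d
  obtain ⟨t', ht', G, hG, hs⟩ := hM.app_bound d t ht
  refine ⟨min t t', min_mem_rates ht ht', L * G, by positivity, fun b w hw => ?_⟩
  have h1 := hs (F b) (L * Real.exp (-(t * b.sz))) (by positivity) (fun v hv => by
    refine (h b v hv).trans (le_of_eq ?_)
    rw [mul_assoc, ← Real.exp_add, wsz_cons]; congr 2; ring) w hw
  refine h1.trans ?_
  have h2 := exp_split_le (s := t) (t := t') b.sz_nonneg (wsz_nonneg w)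
  rw [wsz_cons]
  calc _ = (L * G) * (Real.exp (-(t * b.sz)) * Real.exp (-(t' * wsz w))) := by ring
    _ ≤ _ := mul_le_mul_of_nonneg_left h2 (by positivity)

theorem UTame.add {T : Set ℝ} {u v : Gen N → ℂ} (hu : UTame T u) (hv : UTame T v) :
    UTame T (fun b => u b + v b) := by
  obtain ⟨t, ht, L, hL, h⟩ := hu
  obtain ⟨t', ht', L', hL', h'⟩ := hv
  refine ⟨min t t', min_mem_rates ht ht', L + L', by positivity, fun b => ?_⟩
  rw [add_mul]
  exact (norm_add_le _ _).trans (add_le_add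
    ((h b).trans (mul_le_mul_of_nonneg_left
      (exp_rate_le (min_le_left _ _) b.sz_nonneg) hL))
    ((h' b).trans (mul_le_mul_of_nonneg_left
      (exp_rate_le (min_le_right _ _) b.sz_nonneg) hL')))

/-! ### The anticommutator of the homotopy and the supercharge -/

/-- The columns of the even derivation `Q_t h + h Q_t`, where `h` is the homotopy. -/
noncomputable def homotopyCol (nabla : ℤ → ℂ) (K : ℤ → ℤ → ℂ) (t : Sgn) (a : Gen N)
    (u : Gen N → ℂ) : ℂ :=
  (QD nabla t).col a (fun b => (HD K t).col b u) + (HD K t).col a (fun b => (QD nabla t).col b u)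

theorem HD_QD_col_chi {nabla : ℤ → ℂ} (hn : IsDifferenceOperator nabla) {K : ℤ → ℤ → ℂ}
    (hK : IsInverseKernel nabla K) (t : Sgn)
    {u : Gen N → ℂ} (hu : UTame (Set.Ioi 0) u) (m : ℤ) :
    (HD K t).col (Gen.chi t.opp m) (fun b => (QD nabla t).col b u) = u (Gen.chi t.opp m) := by
  rw [HD_col_chi_opp]
  simp only [QD_col_phi_opp]
  have hc : -(t.toC * Complex.I) ≠ 0 := by
    rw [← norm_ne_zero_iff]; simp [Sgn.norm_toC]
  have e : ∀ k, K m k * (-(t.toC * Complex.I) * ∑' n, nabla (n - k) * u (Gen.chi t.opp n)) =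
      -(t.toC * Complex.I) * (K m k * ∑' n, nabla (n - k) * u (Gen.chi t.opp n)) :=
    fun k => by ring
  simp only [e]
  rw [tsum_mul_left, inv_mul_cancel_left₀ hc,
    hK.apply hn hu (A := fun n => Gen.chi t.opp n) (fun _ => rfl)]

theorem HD_QD_col_F {nabla : ℤ → ℂ} (hn : IsDifferenceOperator nabla) {K : ℤ → ℤ → ℂ}
    (hK : IsInverseKernel nabla K) (t : Sgn)
    {u : Gen N → ℂ} (hu : UTame (Set.Ioi 0) u) (m : ℤ) :
    (HD K t).col (Gen.F t.opp m) (fun b => (QD nabla t).col b u) = u (Gen.F t.opp m) := by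
  rw [HD_col_F_opp]
  simp only [QD_col_chibar_opp]
  have hc : -Complex.I ≠ 0 := by simp
  have e : ∀ k, K m k * (-Complex.I * ∑' n, nabla (n - k) * u (Gen.F t.opp n)) =
      -Complex.I * (K m k * ∑' n, nabla (n - k) * u (Gen.F t.opp n)) :=
    fun k => by ring
  simp only [e]
  rw [tsum_mul_left, inv_mul_cancel_left₀ hc,
    hK.apply hn hu (A := fun n => Gen.F t.opp n) (fun _ => rfl)]

theorem homotopyCol_chi {nabla : ℤ → ℂ} (hn : IsDifferenceOperator nabla) {K : ℤ → ℤ → ℂ}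
    (hK : IsInverseKernel nabla K) (t : Sgn)
    {u : Gen N → ℂ} (hu : UTame (Set.Ioi 0) u) (m : ℤ) :
    homotopyCol nabla K t (Gen.chi t.opp m) u = u (Gen.chi t.opp m) := by
  rw [homotopyCol, QD_col_chi, HD_QD_col_chi hn hK t hu, zero_add]

theorem homotopyCol_F {nabla : ℤ → ℂ} (hn : IsDifferenceOperator nabla) {K : ℤ → ℤ → ℂ}
    (hK : IsInverseKernel nabla K) (t : Sgn)
    {u : Gen N → ℂ} (hu : UTame (Set.Ioi 0) u) (m : ℤ) :
    homotopyCol nabla K t (Gen.F t.opp m) u = u (Gen.F t.opp m) := by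
  rw [homotopyCol, QD_col_F_opp, HD_QD_col_F hn hK t hu, zero_add]

theorem homotopyCol_phi (nabla : ℤ → ℂ) (K : ℤ → ℤ → ℂ) (t : Sgn) (u : Gen N → ℂ) (m : ℤ) :
    homotopyCol nabla K t (Gen.phi t.opp m) u = -(t.toC * Complex.I) *
      ∑' n, nabla (n - m) * (HD K t).col (Gen.chi t.opp n) u := by
  rw [homotopyCol, QD_col_phi_opp, HD_col_zero _ _ _ (by simp) (by simp), add_zero]

theorem homotopyCol_chibar (nabla : ℤ → ℂ) (K : ℤ → ℤ → ℂ) (t : Sgn) (u : Gen N → ℂ) (m : ℤ) :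
    homotopyCol nabla K t (Gen.chibar t.opp m) u = -Complex.I *
      ∑' n, nabla (n - m) * (HD K t).col (Gen.F t.opp n) u := by
  rw [homotopyCol, QD_col_chibar_opp, HD_col_zero _ _ _ (by simp) (by simp), add_zero]

/-- The even derivation `Q_t h + h Q_t` acts on linear series by an idempotent, so that on words its
eigenvalues are natural numbers. It need not be the number operator, because `K` inverts the
difference operator on one side only. -/
theorem homotopyCol_idem {nabla : ℤ → ℂ} (hn : IsDifferenceOperator nabla) {K : ℤ → ℤ → ℂ}
    (hK : IsInverseKernel nabla K) (t : Sgn)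
    {u : Gen N → ℂ} (hu : UTame (Set.Ioi 0) u) (a : Gen N) :
    homotopyCol nabla K t a (fun b => homotopyCol nabla K t b u) = homotopyCol nabla K t a u := by
  have hv : UTame (Set.Ioi 0) (fun b => homotopyCol nabla K t b u) :=
    ((QD_adm_pos hn t).utame ((hK.adm t).utame hu)).add
      ((hK.adm t).utame ((QD_adm_pos hn t).utame hu))
  have hz : ∀ s, s ≠ t.opp → s = t := fun s hs => (Sgn.eq_or_opp t s).resolve_right hs
  -- The homotopy sees only the letters `φ` and `χ̄`, on which it forgets the kernel of `K`.
  have h1 : ∀ n, (HD K t).col (Gen.chi t.opp n) (fun b => homotopyCol nabla K t b u) =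
      (HD K t).col (Gen.chi t.opp n) u := by
    intro n
    have := HD_QD_col_chi hn hK t ((hK.adm t).utame hu) n
    rw [HD_col_chi_opp] at this ⊢
    rw [← this]
    simp only [homotopyCol_phi nabla K t, QD_col_phi_opp]
  have h2 : ∀ n, (HD K t).col (Gen.F t.opp n) (fun b => homotopyCol nabla K t b u) =
      (HD K t).col (Gen.F t.opp n) u := by
    intro n
    have := HD_QD_col_F hn hK t ((hK.adm t).utame hu) n
    rw [HD_col_F_opp] at this ⊢
    rw [← this]
    simp only [homotopyCol_chibar nabla K t, QD_col_chibar_opp]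
  induction a using Gen.cases_sgn t with
  | h1 m => simp [homotopyCol, QD_col_phi, HD_col_zero]
  | h2 m => rw [homotopyCol_phi nabla K, homotopyCol_phi nabla K]; simp only [h1]
  | h3 m => simp [homotopyCol, QD_col_chibar, HD_col_zero]
  | h4 m => rw [homotopyCol_chibar nabla K, homotopyCol_chibar nabla K]; simp only [h2]
  | h5 r m =>
    rcases Sgn.eq_or_opp t r with rfl | rfl
    · simp [homotopyCol, QD_col_chi, HD_col_zero]
    · rw [homotopyCol_chi hn hK t hv]
  | h6 m => simp [homotopyCol, QD_col_F, HD_col_zero]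
  | h7 m => rw [homotopyCol_F hn hK t hv]
  | h8 r i => simp [homotopyCol, QD_col_rho, HD_col_zero]
  | h9 i => simp [homotopyCol, QD_col_zeta, HD_col_zero]
  | h10 i => simp [homotopyCol, QD_col_zeta_opp, HD_col_zero]
  | h11 r => simp [homotopyCol, QD_col_theta, HD_col_zero]

theorem homotopyCol_add {nabla : ℤ → ℂ} (hn : IsDifferenceOperator nabla) {K : ℤ → ℤ → ℂ}
    (hK : IsInverseKernel nabla K) (t : Sgn)
    {u v : Gen N → ℂ} (hu : UTame (Set.Ioi 0) u) (hv : UTame (Set.Ioi 0) v)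
    (a : Gen N) : homotopyCol nabla K t a (fun b => u b + v b) =
      homotopyCol nabla K t a u + homotopyCol nabla K t a v := by
  have hQ := QD_adm_pos (N := N) hn t
  have hH := hK.adm (N := N) t
  unfold homotopyCol
  simp only [hH.col_add hu hv, hQ.col_add hu hv]
  rw [hQ.col_add (hH.utame hu) (hH.utame hv), hH.col_add (hQ.utame hu) (hQ.utame hv)]
  ring

theorem app_homotopyCol {nabla : ℤ → ℂ} (hn : IsDifferenceOperator nabla) {K : ℤ → ℤ → ℂ}
    (hK : IsInverseKernel nabla K) (t : Sgn)
    {M : LinDer N} (hM : M.Adm (Set.Ioi 0)) {F : Gen N → Raw N}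
    (hF : JTame (Set.Ioi 0) F) (a : Gen N) (w : List (Gen N)) :
    M.app (fun v => homotopyCol nabla K t a (fun b => F b v)) w =
      homotopyCol nabla K t a (fun b => M.app (F b) w) := by
  have hQ := QD_adm_pos (N := N) hn t
  have hH := hK.adm (N := N) t
  have e : (fun v => homotopyCol nabla K t a (fun b => F b v)) =
      (fun v => (QD nabla t).col a (fun b => (HD K t).col b (fun c => F c v))) +
      (fun v => (HD K t).col a (fun b => (QD nabla t).col b (fun c => F c v))) := rfl
  have h1 := ((hF.col hH).col hQ).tame a
  have h2 := ((hF.col hQ).col hH).tame a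
  rw [e, hM.app_add h1 h2, Pi.add_apply, hQ.app_col hM (hF.col hH), hH.app_col hM (hF.col hQ)]
  unfold homotopyCol
  congr 1
  · congr 1; funext b; exact hH.app_col hM hF b w
  · congr 1; funext b; exact hQ.app_col hM hF b w

/-- Series whose coefficients decay exponentially in all sites. -/
def tameSeries (N : ℕ) : Submodule ℂ (Raw N) where
  carrier := {f | GradedSymm f ∧ Tame (Set.Ioi 0) f}
  add_mem' := fun hf hg => ⟨(Series N).add_mem hf.1 hg.1, hf.2.add hg.2⟩
  zero_mem' := ⟨(Series N).zero_mem, Tame.zero ⟨1, Set.mem_Ioi.mpr one_pos⟩⟩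
  smul_mem' := fun c _ hf => ⟨(Series N).smul_mem c hf.1, hf.2.smul c⟩

/-- An odd derivation as an endomorphism of the decaying series. -/
noncomputable def LinDer.toEnd (M : LinDer N) (hM : M.Adm (Set.Ioi 0)) (oM : M.IsOdd) :
    Module.End ℂ (tameSeries N) where
  toFun f := ⟨M.app f.1, And.intro (GradedSymm.app oM (And.left f.2)) (hM.tame (And.right f.2))⟩
  map_add' f g := Subtype.ext (hM.app_add (And.right f.2) (And.right g.2))
  map_smul' c f := Subtype.ext (M.app_smul c f.1)

/-- The left derivative as an endomorphism of the decaying series. -/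
def derivEnd (a : Gen N) : Module.End ℂ (tameSeries N) where
  toFun f := ⟨rawD a f.1,
    And.intro (GradedSymm.rawD (And.left f.2) a) (Tame.rawD (And.right f.2) a)⟩
  map_add' _ _ := rfl
  map_smul' _ _ := rfl

open Polynomial in
/-- If `D ν = e + ν D` and `e ν = (ν + 1) e`, then `D p(ν) = p(ν) (D - e) + p(ν + 1) e`. -/
theorem mul_aeval_eq {A : Type*} [Ring A] [Algebra ℂ A] {D ν e : A} (h1 : D * ν = e + ν * D)
    (h2 : e * ν = (ν + 1) * e) (p : ℂ[X]) :
    D * aeval ν p = aeval ν p * (D - e) + aeval ν (p.comp (Polynomial.X + 1)) * e := by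
  induction p using Polynomial.induction_on' with
  | add p q hp hq => rw [map_add, mul_add, hp, hq, add_comp, map_add]; noncomm_ring
  | monomial n c =>
    rw [← C_mul_X_pow_eq_monomial]
    induction n with
    | zero => simp [mul_sub, ← Algebra.commutes]
    | succ n ih =>
      have e1 : C c * Polynomial.X ^ (n + 1) = (C c * Polynomial.X ^ n) * Polynomial.X := by
        rw [pow_succ, mul_assoc]
      rw [e1]
      generalize C c * Polynomial.X ^ n = p at ih
      rw [map_mul, aeval_X, ← mul_assoc, ih, mul_comp, map_mul, X_comp, map_add, aeval_X,
        map_one, add_mul, mul_assoc _ (D - e), mul_assoc _ e, sub_mul, h1, h2]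
      noncomm_ring

open Polynomial in
theorem commute_aeval {A : Type*} [Ring A] [Algebra ℂ A] {D ν : A} (h : Commute D ν) (p : ℂ[X]) :
    Commute D (aeval ν p) := by
  induction p using Polynomial.induction_on' with
  | add p q hp hq => rw [map_add]; exact hp.add_right hq
  | monomial n c =>
    rw [aeval_monomial]
    exact (Algebra.commute_algebraMap_right c D).mul_right (h.pow_right n)

/-- The supercharge on decaying series. -/
noncomputable def QEnd {nabla : ℤ → ℂ} (hn : IsDifferenceOperator nabla) (t : Sgn) :
    Module.End ℂ (tameSeries N) := (QD nabla t).toEnd (QD_adm_pos hn t) (QD_isOdd nabla t)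

/-- The homotopy on decaying series. -/
noncomputable def HEnd {nabla : ℤ → ℂ} {K : ℤ → ℤ → ℂ} (hK : IsInverseKernel nabla K) (t : Sgn) :
    Module.End ℂ (tameSeries N) := (HD K t).toEnd (hK.adm t) (HD_isOdd K t)

/-- The anticommutator of supercharge and homotopy, an even derivation. -/
noncomputable def numEnd {nabla : ℤ → ℂ} (hn : IsDifferenceOperator nabla) {K : ℤ → ℤ → ℂ}
    (hK : IsInverseKernel nabla K) (t : Sgn) : Module.End ℂ (tameSeries N) :=
  QEnd hn t * HEnd hK t + HEnd hK t * QEnd hn t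

/-- The commutator of `numEnd` with a left derivative. -/
noncomputable def colEnd {nabla : ℤ → ℂ} (hn : IsDifferenceOperator nabla) {K : ℤ → ℤ → ℂ}
    (hK : IsInverseKernel nabla K) (t : Sgn) (a : Gen N) : Module.End ℂ (tameSeries N) :=
  derivEnd a * numEnd hn hK t - numEnd hn hK t * derivEnd a

theorem colEnd_apply {nabla : ℤ → ℂ} (hn : IsDifferenceOperator nabla) {K : ℤ → ℤ → ℂ}
    (hK : IsInverseKernel nabla K) (t : Sgn) (a : Gen N) (f : tameSeries N) (w : List (Gen N)) :
    (colEnd hn hK t a f).1 w = homotopyCol nabla K t a (fun b => f.1 (b :: w)) := by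
  have h := (QD_adm_pos hn t).anticomm_cons (hK.adm t) (QD_isOdd nabla t) (HD_isOdd K t)
    (And.right f.2) a w
  have e : (colEnd hn hK t a f).1 w =
      ((QD nabla t).app ((HD K t).app f.1) + (HD K t).app ((QD nabla t).app f.1)) (a :: w) -
      ((QD nabla t).app ((HD K t).app (rawD a f.1)) +
        (HD K t).app ((QD nabla t).app (rawD a f.1))) w := rfl
  rw [e, h, homotopyCol]
  ring

theorem numEnd_apply {nabla : ℤ → ℂ} (hn : IsDifferenceOperator nabla) {K : ℤ → ℤ → ℂ}
    (hK : IsInverseKernel nabla K) (t : Sgn) (f : tameSeries N) (w : List (Gen N)) :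
    (numEnd hn hK t f).1 w =
      (QD nabla t).app ((HD K t).app f.1) w + (HD K t).app ((QD nabla t).app f.1) w := rfl

/-- Splitting off a letter on which the idempotent columns act raises the eigenvalue by one. -/
theorem colEnd_mul_numEnd {nabla : ℤ → ℂ} (hn : IsDifferenceOperator nabla) {K : ℤ → ℤ → ℂ}
    (hK : IsInverseKernel nabla K) (t : Sgn) (a : Gen N) :
    colEnd hn hK t a * numEnd hn hK t = (numEnd hn hK t + 1) * colEnd hn hK t a := by
  have hQ := QD_adm_pos (N := N) hn t
  have hH := hK.adm (N := N) t
  refine LinearMap.ext fun f => Subtype.ext (funext fun w => ?_)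
  have hJ := Tame.jtame (And.right f.2)
  have hu := Tame.utame (And.right f.2) w
  have h1 : ∀ b, (numEnd hn hK t f).1 (b :: w) =
      homotopyCol nabla K t b (fun c => f.1 (c :: w)) +
      ((QD nabla t).app ((HD K t).app (rawD b f.1)) w +
        (HD K t).app ((QD nabla t).app (rawD b f.1)) w) := by
    intro b
    have e : (colEnd hn hK t b f).1 w = (numEnd hn hK t f).1 (b :: w) -
      ((QD nabla t).app ((HD K t).app (rawD b f.1)) w +
        (HD K t).app ((QD nabla t).app (rawD b f.1)) w) := rfl
    rw [colEnd_apply] at e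
    rw [e]; ring
  have hv : UTame (Set.Ioi 0) (fun b => homotopyCol nabla K t b (fun c => f.1 (c :: w))) :=
    (hQ.utame (hH.utame hu)).add (hH.utame (hQ.utame hu))
  have hQH := (hJ.app hH).app hQ
  have hHQ := (hJ.app hQ).app hH
  have e1 : ((colEnd hn hK t a * numEnd hn hK t : Module.End ℂ (tameSeries N)) f).1 w =
      (colEnd hn hK t a (numEnd hn hK t f)).1 w := rfl
  have e2 : (((numEnd hn hK t + 1) * colEnd hn hK t a : Module.End ℂ (tameSeries N)) f).1 w =
      (numEnd hn hK t (colEnd hn hK t a f)).1 w + (colEnd hn hK t a f).1 w := rfl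
  have e3 : (colEnd hn hK t a f).1 =
      fun v => homotopyCol nabla K t a (fun b => rawD b f.1 v) := by
    funext v; exact colEnd_apply hn hK t a f v
  rw [e1, e2, colEnd_apply, colEnd_apply]
  simp only [h1]
  rw [homotopyCol_add hn hK t hv ((hQH.utame w).add (hHQ.utame w)),
    homotopyCol_add hn hK t (hQH.utame w) (hHQ.utame w), homotopyCol_idem hn hK t hu,
    numEnd_apply, e3]
  have h2 : (HD K t).app (fun v => homotopyCol nabla K t a (fun b => rawD b f.1 v)) =
      fun v => homotopyCol nabla K t a (fun b => (HD K t).app (rawD b f.1) v) := by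
    funext v; exact app_homotopyCol hn hK t hH hJ a v
  have h3 : (QD nabla t).app (fun v => homotopyCol nabla K t a (fun b => rawD b f.1 v)) =
      fun v => homotopyCol nabla K t a (fun b => (QD nabla t).app (rawD b f.1) v) := by
    funext v; exact app_homotopyCol hn hK t hQ hJ a v
  rw [h2, h3, app_homotopyCol hn hK t hQ (hJ.app hH), app_homotopyCol hn hK t hH (hJ.app hQ)]
  ring

open Polynomial in
/-- The derivative of a polynomial in `numEnd` with respect to a letter: the part fixed by the
columns shifts the argument of the polynomial by one, the complementary part leaves it alone. -/
theorem deriv_aeval {nabla : ℤ → ℂ} (hn : IsDifferenceOperator nabla) {K : ℤ → ℤ → ℂ}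
    (hK : IsInverseKernel nabla K) (t : Sgn) (a : Gen N) (p : ℂ[X]) (f : tameSeries N)
    (w : List (Gen N)) :
    (aeval (numEnd hn hK t) p f).1 (a :: w) =
      (aeval (numEnd hn hK t) p ((derivEnd a - colEnd hn hK t a) f)).1 w +
      (aeval (numEnd hn hK t) (p.comp (Polynomial.X + 1)) (colEnd hn hK t a f)).1 w := by
  have h := mul_aeval_eq (D := derivEnd a) (ν := numEnd hn hK t) (e := colEnd hn hK t a)
    (by rw [colEnd]; abel) (colEnd_mul_numEnd hn hK t a) p
  exact congrFun (congrArg Subtype.val (LinearMap.congr_fun h f)) w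

open Polynomial in
/-- On words of fewer than `n` letters the eigenvalues of `numEnd` are among `0, …, n - 1`. -/
theorem aeval_descPochhammer {nabla : ℤ → ℂ} (hn : IsDifferenceOperator nabla) {K : ℤ → ℤ → ℂ}
    (hK : IsInverseKernel nabla K) (t : Sgn) (w : List (Gen N)) (n : ℕ) (hw : w.length < n)
    (f : tameSeries N) : (aeval (numEnd hn hK t) (descPochhammer ℂ n) f).1 w = 0 := by
  induction w generalizing n f with
  | nil =>
    obtain ⟨n, rfl⟩ := Nat.exists_eq_succ_of_ne_zero (by simpa using hw.ne' : n ≠ 0)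
    rw [Nat.succ_eq_add_one, descPochhammer_succ_left, map_mul, aeval_X]
    have e : ∀ g : tameSeries N, (numEnd hn hK t g).1 [] = 0 := by
      intro g; rw [numEnd_apply, LinDer.app_nil, LinDer.app_nil, add_zero]
    exact e _
  | cons a w ih =>
    obtain ⟨m, rfl⟩ := Nat.exists_eq_succ_of_ne_zero (by rintro rfl; simp at hw : n ≠ 0)
    have hwm : w.length < m := by simpa using hw
    have e : (descPochhammer ℂ (m + 1)).comp (Polynomial.X + 1) =
        descPochhammer ℂ m * (Polynomial.X + 1) := by
      rw [descPochhammer_succ_left, mul_comp, X_comp, comp_assoc, sub_comp, X_comp, one_comp,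
        add_sub_cancel_right, comp_X, mul_comm]
    rw [Nat.succ_eq_add_one, deriv_aeval, ih _ (by omega), e, map_mul, zero_add]
    exact ih m hwm _

open Polynomial in
/-- The polynomial `(x - 1) ⋯ (x - d)` kills the coefficients of words of `d` letters that contain
a letter `a` on which `numEnd` acts as the identity. -/
theorem aeval_descPochhammer_shift {nabla : ℤ → ℂ} (hn : IsDifferenceOperator nabla)
    {K : ℤ → ℤ → ℂ} (hK : IsInverseKernel nabla K) (t : Sgn) {a : Gen N}
    (ha : ∀ u, UTame (Set.Ioi 0) u → homotopyCol nabla K t a u = u a) (w : List (Gen N)) (d : ℕ)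
    (hw : w.length < d) (f : tameSeries N) :
    (aeval (numEnd hn hK t) ((descPochhammer ℂ d).comp (Polynomial.X - 1)) f).1 (a :: w) = 0 := by
  have h : colEnd hn hK t a = derivEnd a := by
    refine LinearMap.ext fun f => Subtype.ext (funext fun w => ?_)
    rw [colEnd_apply, ha _ (Tame.utame (And.right f.2) w)]
    rfl
  have h0 : (derivEnd a - colEnd hn hK t a) f = 0 := by
    rw [h]; exact sub_self (derivEnd a f)
  rw [deriv_aeval, h0, map_zero, comp_assoc, sub_comp, X_comp,
    one_comp, add_sub_cancel_right, comp_X, aeval_descPochhammer hn hK t w d hw]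
  simp

open Polynomial in
theorem eval_descPochhammer_neg_one (d : ℕ) : (descPochhammer ℂ d).eval (-1) ≠ 0 := by
  induction d with
  | zero => simp
  | succ d ih =>
    rw [descPochhammer_succ_right, eval_mul]
    refine mul_ne_zero ih ?_
    simp only [eval_sub, eval_X, eval_natCast]
    intro h
    have : ((d + 1 : ℕ) : ℂ) = 0 := by push_cast; linear_combination -h
    exact Nat.cast_ne_zero.mpr (Nat.succ_ne_zero d) this

/-- Exactness of the Koszul complex of `Q_t` in positive degree, on decaying series without letters
of label `t`. -/
theorem exists_primitive {nabla : ℤ → ℂ} (hn : IsDifferenceOperator nabla) (t : Sgn) {f : Raw N}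
    (hf : GradedSymm f) (ht : Tame (Set.Ioi 0) f) (hclosed : (QD nabla t).app f = 0) {d : ℕ} {k : ℤ}
    (hlen : HasWt (fun _ => 1) d f) (hsec : HasWt (wSec t) 0 f) (hk : HasWt (wKoszul t) k f)
    (hk1 : 1 ≤ k) :
    ∃ b : Raw N, GradedSymm b ∧ Tame (Set.Ioi 0) b ∧ (QD nabla t).app b = f ∧
      HasWt (fun _ => 1) d b ∧ HasWt (wSec t) 0 b ∧ HasWt (wKoszul t) (k + 1) b := by
  obtain ⟨K, r, hr, hb, hinv⟩ := hn.exists_inverse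
  have hK : IsInverseKernel nabla K := ⟨⟨r, hr, hb⟩, hinv⟩
  set F : tameSeries N := ⟨f, And.intro hf ht⟩ with hF
  -- `q = (x - 1) ⋯ (x - d)` kills the relevant coefficients of `f`, and `q 0 ≠ 0`. Hence
  -- `-q 0 • f = ν (q.divX ν) f = Q h (q.divX ν) f` there, with `ν = Q h + h Q`.
  set q : Polynomial ℂ := (descPochhammer ℂ d).comp (Polynomial.X - 1) with hq
  have hq0 : q.coeff 0 ≠ 0 := by
    rw [Polynomial.coeff_zero_eq_eval_zero, hq, Polynomial.eval_comp]
    simpa using eval_descPochhammer_neg_one d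
  have hQQ : QEnd (N := N) hn t * QEnd hn t = 0 := by
    refine LinearMap.ext fun g => Subtype.ext ?_
    exact QD_app_sq (QD_adm_pos hn t) (And.right g.2)
  have hcomm : Commute (QEnd (N := N) hn t) (numEnd hn hK t) := by
    rw [commute_iff_eq, numEnd, mul_add, add_mul, ← mul_assoc, hQQ, zero_mul, zero_add, mul_assoc,
      mul_assoc, hQQ, mul_zero, add_zero]
  set G := Polynomial.aeval (numEnd hn hK t) q.divX F with hG
  have hQG : QEnd hn t G = 0 := by
    have h0 : QEnd (N := N) hn t * Polynomial.aeval (numEnd hn hK t) q.divX =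
        Polynomial.aeval (numEnd hn hK t) q.divX * QEnd hn t :=
      commute_aeval (A := Module.End ℂ (tameSeries N)) hcomm q.divX
    have h1 := LinearMap.congr_fun h0 F
    have h2 : QEnd hn t F = 0 := Subtype.ext hclosed
    simp only [Module.End.mul_apply, h2, map_zero] at h1
    exact h1
  have hqF : Polynomial.aeval (numEnd hn hK t) q F =
      QEnd hn t (HEnd hK t G) + q.coeff 0 • F := by
    conv_lhs => rw [← Polynomial.X_mul_divX_add q]
    rw [map_add, map_mul, Polynomial.aeval_X, Polynomial.aeval_C]
    have e : numEnd hn hK t G = QEnd hn t (HEnd hK t G) + HEnd hK t (QEnd hn t G) := rfl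
    rw [hQG, map_zero, add_zero] at e
    rw [← e]
    rfl
  set b0 : Raw N := (-(q.coeff 0)⁻¹) • (HEnd hK t G).1 with hb0
  set b : Raw N := proj (fun _ => 1) d (proj (wSec t) 0 (proj (wKoszul t) (k + 1) b0)) with hbdef
  have hb0s : GradedSymm b0 := (Series N).smul_mem _ (And.left (HEnd hK t G).2)
  have hb0t : Tame (Set.Ioi 0) b0 := (And.right (HEnd hK t G).2).smul _
  refine ⟨b, ((hb0s.proj _ _).proj _ _).proj _ _, ((hb0t.proj _ _).proj _ _).proj _ _, ?_,
    hasWt_proj _ _ _, (hasWt_proj _ _ _).proj, (hasWt_proj _ _ _).proj.proj⟩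
  have happ : (QD nabla t).app b = proj (fun _ => 1) d (proj (wSec t) 0 (proj (wKoszul t) k
      ((QD nabla t).app b0))) := by
    have h1 := (QD_shifts_one (N := N) nabla t).app_proj d
      (proj (wSec t) 0 (proj (wKoszul t) (k + 1) b0))
    have h2 := (QD_shifts_wSec (N := N) nabla t t).app_proj 0 (proj (wKoszul t) (k + 1) b0)
    have h3 := (QD_shifts_wKoszul (N := N) nabla t).app_proj k b0
    rw [add_zero] at h1 h2
    rw [hbdef, h1, h2, h3]
  rw [happ]
  funext w
  unfold proj
  by_cases w1 : wt (fun _ => 1) w = d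
  swap
  · rw [if_neg w1]; by_contra h; exact w1 (hlen w (Ne.symm h))
  rw [if_pos w1]
  by_cases w2 : wt (wSec t) w = 0
  swap
  · rw [if_neg w2]; by_contra h; exact w2 (hsec w (Ne.symm h))
  rw [if_pos w2]
  by_cases w3 : wt (wKoszul t) w = k
  swap
  · rw [if_neg w3]; by_contra h; exact w3 (hk w (Ne.symm h))
  rw [if_pos w3]
  -- Such a word contains a letter `χ` or `F` of label `-t`; bring it to the front.
  obtain ⟨a, ha, hacol⟩ : ∃ a ∈ w, ∀ u, UTame (Set.Ioi 0) u → homotopyCol nabla K t a u = u a := by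
    by_contra! hcon
    have hall : ∀ a ∈ w, wKoszul t a ≤ wSec t a := by
      intro a ha
      obtain ⟨u, hu, hne⟩ := hcon a ha
      cases a with
      | chi s m =>
        rcases Sgn.eq_or_opp t s with rfl | rfl
        · simp [wKoszul, wSec]
        · exact absurd (homotopyCol_chi hn hK t hu m) hne
      | F s m =>
        rcases Sgn.eq_or_opp t s with rfl | rfl
        · simp [wKoszul, wSec]
        · exact absurd (homotopyCol_F hn hK t hu m) hne
      | chibar s m => simp only [wKoszul, wSec]; split_ifs <;> simp
      | zeta s m => simp only [wKoszul, wSec]; split_ifs <;> simp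
      | _ => exact le_rfl
    have hle : wt (wKoszul t) w ≤ wt (wSec t) w := List.sum_le_sum hall
    omega
  have hperm := List.perm_cons_erase ha
  have hlenw : (w.erase a).length < d := by
    rw [wt_one] at w1
    have := hperm.length_eq
    rw [List.length_cons] at this
    have : w.length = d := by exact_mod_cast w1
    omega
  have hz : (Polynomial.aeval (numEnd hn hK t) q F).1 w = 0 :=
    GradedSymm.eq_zero_of_perm hperm (And.left (Polynomial.aeval (numEnd hn hK t) q F).2)
      (aeval_descPochhammer_shift hn hK t hacol _ d hlenw F)
  rw [hqF] at hz
  have e1 : (QEnd hn t (HEnd hK t G) + q.coeff 0 • F).1 w =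
      (QD nabla t).app (HEnd hK t G).1 w + q.coeff 0 * f w := rfl
  rw [e1] at hz
  rw [hb0, LinDer.app_smul, Pi.smul_apply, smul_eq_mul, eq_neg_of_add_eq_zero_left hz]
  field_simp

end LatticeSusy

namespace LatticeSusy

variable {N : ℕ}

/-! ### Reconstruction of a series from its first variation -/

/-- The sum `∑_a a β_a` over all letters. -/
noncomputable def euler : (Gen N → Raw N) → Raw N
  | _, [] => 0
  | β, a :: w => β a w + euler (fun c v => eps a c * β c (a :: v)) w

theorem euler_cons (β : Gen N → Raw N) (a : Gen N) (w : List (Gen N)) :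
    euler β (a :: w) = β a w + euler (fun c v => eps a c * β c (a :: v)) w := rfl

theorem norm_eps (a b : Gen N) : ‖eps a b‖ = 1 := by unfold eps; split_ifs <;> simp

theorem euler_add (β γ : Gen N → Raw N) (w : List (Gen N)) :
    euler (fun c v => β c v + γ c v) w = euler β w + euler γ w := by
  induction w generalizing β γ with
  | nil => simp [euler]
  | cons a w ih => simp only [euler_cons, mul_add, ih]; ring

theorem euler_smul (x : ℂ) (β : Gen N → Raw N) (w : List (Gen N)) :
    euler (fun c v => x * β c v) w = x * euler β w := by
  induction w generalizing β with
  | nil => simp [euler]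
  | cons a w ih => simp only [euler_cons, mul_left_comm _ x, ih, mul_add]

theorem euler_symm {β : Gen N → Raw N} (h : ∀ c, GradedSymm (β c)) : GradedSymm (euler β) := by
  intro u
  induction u generalizing β with
  | nil =>
    intro v a b
    simp only [List.nil_append, euler_cons]
    have e : (fun (c : Gen N) (w : List (Gen N)) => eps b c * (eps a c * β c (a :: b :: w))) =
        fun c w => eps a b * (eps a c * (eps b c * β c (b :: a :: w))) := by
      funext c w
      have := (h c) [] w a b
      simp only [List.nil_append] at this
      rw [this]
      ring
    rw [e, euler_smul, eps_comm b a]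
    linear_combination (- β a (b :: v)) * eps_sq a b
  | cons c u ih =>
    intro v a b
    simp only [List.cons_append, euler_cons]
    have h1 := (h c) u v a b
    have h2 := ih (β := fun d w => eps c d * β d (c :: w)) (fun d x y p q => by
      have := (h d) (c :: x) y p q
      simp only [List.cons_append] at this
      show eps c d * β d (c :: (x ++ p :: q :: y)) =
        eps p q * (eps c d * β d (c :: (x ++ q :: p :: y)))
      rw [this]; ring) v a b
    rw [h1, h2]; ring

theorem euler_bound {β : Gen N → Raw N} {w : List (Gen N)} {C : ℝ}
    (h : ∀ a v, w.Perm (a :: v) → ‖β a v‖ ≤ C) : ‖euler β w‖ ≤ w.length * C := by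
  induction w generalizing β with
  | nil => simp [euler]
  | cons a w ih =>
    rw [euler_cons, List.length_cons]
    have h1 := h a w (List.Perm.refl _)
    have h2 := ih (β := fun c v => eps a c * β c (a :: v)) (fun c v p => by
      rw [norm_mul, norm_eps, one_mul]
      exact h c (a :: v) ((p.cons a).trans (List.Perm.swap _ _ _)))
    refine (norm_add_le _ _).trans ((add_le_add h1 h2).trans (le_of_eq ?_))
    push_cast; ring

theorem wsz_perm {v w : List (Gen N)} (h : v.Perm w) : wsz v = wsz w :=
  (h.map Gen.sz).sum_eq

theorem JTame.tame_euler {T : Set ℝ} {β : Gen N → Raw N} (h : JTame T β) : Tame T (euler β) := by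
  intro d
  obtain ⟨t, ht, L, hL, hb⟩ := h (d - 1)
  refine ⟨t, ht, d * L, by positivity, fun w hw => ?_⟩
  rw [mul_assoc, ← hw]
  refine euler_bound fun a v p => ?_
  have hlen := p.length_eq
  rw [List.length_cons] at hlen
  rw [wsz_perm p]
  exact hb a v (by omega)

theorem JTame.of_norm_le {T : Set ℝ} {F G : Gen N → Raw N} (h : JTame T F)
    (hle : ∀ b w, ‖G b w‖ ≤ ‖F b w‖) : JTame T G := by
  intro d
  obtain ⟨t, ht, L, hL, hb⟩ := h d
  exact ⟨t, ht, L, hL, fun b w hw => (hle b w).trans (hb b w hw)⟩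

theorem UTame.of_norm_le {T : Set ℝ} {u v : Gen N → ℂ} (h : UTame T u)
    (hle : ∀ b, ‖v b‖ ≤ ‖u b‖) : UTame T v := by
  obtain ⟨t, ht, L, hL, hb⟩ := h
  exact ⟨t, ht, L, hL, fun b => (hle b).trans (hb b)⟩

theorem euler_col {T : Set ℝ} (hT : T.Nonempty) {M : LinDer N} (hM : M.Adm T) (a : Gen N)
    (w : List (Gen N)) :
    ∀ {G : Gen N → Gen N → Raw N}, (∀ c v, UTame T (fun b => G b c v)) →
      UTame T (fun b => euler (G b) w) ∧
      euler (fun c v => M.col a (fun b => G b c v)) w = M.col a (fun b => euler (G b) w) := by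
  induction w with
  | nil =>
    intro G _
    refine ⟨?_, ?_⟩
    · obtain ⟨t, ht⟩ := hT
      exact ⟨t, ht, 0, le_rfl, fun b => by simp [euler]⟩
    · simp only [euler]; exact (M.col_zero a).symm
  | cons x w ih =>
    intro G hG
    have h1 := ih (G := fun b c v => eps x c * G b c (x :: v)) (fun c v =>
      (hG c (x :: v)).of_norm_le fun b => by rw [norm_mul, norm_eps, one_mul])
    simp only [euler_cons]
    refine ⟨(hG x w).add h1.1, ?_⟩
    rw [hM.col_add (hG x w) h1.1, ← h1.2]
    simp only [LinDer.col_mul_left]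

/-- An odd derivation maps `∑_a a β_a` to `∑_a a β'_a`, where `β'` is the image of the one-form
`β`. -/
theorem LinDer.Adm.app_euler {M : LinDer N} {T : Set ℝ} (hT : T.Nonempty) (hM : M.Adm T)
    (oM : M.IsOdd) {β : Gen N → Raw N} (hβ : JTame T β) (w : List (Gen N)) :
    M.app (euler β) w =
      euler (fun c v => M.col c (fun b => β b v) + c.sg * M.app (β c) v) w := by
  induction w generalizing β with
  | nil => rfl
  | cons a w ih =>
    have hβa : JTame T (fun c v => eps a c * β c (a :: v)) :=
      (hβ.rawD a).of_norm_le fun b w => by rw [norm_mul, norm_eps, one_mul]; exact le_rfl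
    have hG : ∀ c v, UTame T (fun b => eps b c * β c (b :: v)) := fun c v =>
      ((hβ.tame c).utame v).of_norm_le fun b => by rw [norm_mul, norm_eps, one_mul]
    have h1 := euler_col hT hM a w hG
    have e1 : (fun b => euler β (b :: w)) =
        fun b => β b w + euler (fun c v => eps b c * β c (b :: v)) w := rfl
    have e2 : rawD a (euler β) = β a + euler (fun c v => eps a c * β c (a :: v)) := rfl
    rw [LinDer.app_cons, e1, hM.col_add (hβ.utame w) h1.1, ← h1.2, e2,
      hM.app_add (hβ.tame a) hβa.tame_euler, Pi.add_apply, ih hβa, euler_cons]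
    have e3 : (fun (c : Gen N) (v : List (Gen N)) =>
        M.col a (fun b => eps b c * β c (b :: v))) =
        fun c v => (eps a c * c.sg) * M.col a (fun b => β c (b :: v)) := by
      funext c v
      refine oM.col_twist a (fun b => eps b c) (eps a c * c.sg) (fun b hb => ?_) _
      rw [eps_comm b c, eps_of_odd_eq hb, eps_comm c a]
    have e4 : (fun (c : Gen N) (v : List (Gen N)) =>
        M.col c (fun b => eps a b * β b (a :: v)) +
          c.sg * M.app (fun v => eps a c * β c (a :: v)) v) =
        fun c v => a.sg * ((eps a c) * M.col c (fun b => β b (a :: v)) +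
          (eps a c * c.sg) * (a.sg * M.app (rawD a (β c)) v)) := by
      funext c v
      rw [oM.col_twist c (fun b => eps a b) (eps a c * a.sg) (fun b hb => eps_of_odd_eq hb)]
      have : M.app (fun v => eps a c * β c (a :: v)) = eps a c • M.app (rawD a (β c)) :=
        M.app_smul (eps a c) (rawD a (β c))
      rw [this, Pi.smul_apply, smul_eq_mul]
      linear_combination (-(eps a c * c.sg * M.app (rawD a (β c)) v)) * a.sg_sq
    have e5 : (fun (c : Gen N) (v : List (Gen N)) =>
        eps a c * (M.col c (fun b => β b (a :: v)) + c.sg * M.app (β c) (a :: v))) =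
        fun c v => ((eps a c) * M.col c (fun b => β b (a :: v)) +
          (eps a c * c.sg) * (a.sg * M.app (rawD a (β c)) v)) +
          (eps a c * c.sg) * M.col a (fun b => β c (b :: v)) := by
      funext c v
      rw [LinDer.app_cons]; ring
    rw [e3, e4, e5, euler_smul, euler_add _ (fun c v =>
      (eps a c * c.sg) * M.col a (fun b => β c (b :: v)))]
    linear_combination (euler (fun c v => (eps a c) * M.col c (fun b => β b (a :: v)) +
          (eps a c * c.sg) * (a.sg * M.app (rawD a (β c)) v)) w) * a.sg_sq

/-- Euler's formula for a weight: weighting each derivative by the weight of its letter multiplies a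
series by its total weight. -/
theorem euler_weight {f : Raw N} (hf : GradedSymm f) (ω : Gen N → ℤ) (w : List (Gen N)) :
    euler (fun c v => ω c * f (c :: v)) w = wt ω w * f w := by
  induction w generalizing f with
  | nil => simp [euler]
  | cons a w ih =>
    rw [euler_cons]
    have e : (fun (c : Gen N) (v : List (Gen N)) => eps a c * (ω c * f (c :: a :: v))) =
        fun c v => ω c * rawD a f (c :: v) := by
      funext c v
      have := hf [] v c a
      simp only [List.nil_append] at this
      rw [this, eps_comm c a]
      unfold rawD
      linear_combination (ω c * f (a :: c :: v)) * eps_sq a c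
    rw [e, ih (hf.rawD a), wt_cons]
    unfold rawD
    push_cast; ring

/-! ### Translations -/

theorem shift_wSec (t : Sgn) (j : ℤ) (a : Gen N) : wSec t (Gen.shift j a) = wSec t a := by
  cases a <;> rfl

theorem shift_wKoszul (t : Sgn) (j : ℤ) (a : Gen N) :
    wKoszul t (Gen.shift j a) = wKoszul t a := by
  cases a <;> rfl

theorem site_shift (j : ℤ) (a : Gen N) : (a.shift j).site = a.site.map (· + j) := by
  cases a <;> rfl

theorem sg_shift (j : ℤ) (a : Gen N) : (a.shift j).sg = a.sg := by
  unfold Gen.sg; rw [Gen.shift_odd]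

theorem map_shift_shift (j k : ℤ) (w : List (Gen N)) :
    (w.map (Gen.shift j)).map (Gen.shift k) = w.map (Gen.shift (j + k)) := by
  rw [List.map_map]
  exact List.map_congr_left fun a _ => Gen.shift_shift j k a

theorem map_shift_zero (w : List (Gen N)) : w.map (Gen.shift 0) = w := by
  conv_rhs => rw [← List.map_id w]
  exact List.map_congr_left fun a _ => Gen.shift_zero a

theorem abs_le_wsz {w : List (Gen N)} {m : ℤ} (h : some m ∈ w.map Gen.site) :
    |(m : ℝ)| ≤ wsz w := by
  obtain ⟨a, ha, hm⟩ := List.mem_map.mp h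
  have h1 : a.sz = |(m : ℝ)| := by rw [Gen.sz, hm]
  rw [← h1]
  refine List.single_le_sum (fun x hx => ?_) _ (List.mem_map.mpr ⟨a, ha, rfl⟩)
  obtain ⟨b, _, rfl⟩ := List.mem_map.mp hx
  exact b.sz_nonneg

theorem wsz_le_shift (n : ℤ) (w : List (Gen N)) :
    wsz w ≤ wsz (w.map (Gen.shift (-n))) + w.length * |(n : ℝ)| := by
  induction w with
  | nil => simp
  | cons a w ih =>
    rw [List.map_cons, wsz_cons, wsz_cons, List.length_cons]
    have h1 : a.sz ≤ (a.shift (-n)).sz + |(n : ℝ)| := by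
      unfold Gen.sz
      rw [site_shift]
      cases a.site with
      | none => simp
      | some m =>
        simp only [Option.map_some]
        have := abs_add_le ((m : ℝ) - n) n
        push_cast
        simpa [sub_eq_add_neg] using this
    push_cast
    linarith

theorem QD_col_shift (nabla : ℤ → ℂ) (t : Sgn) (j : ℤ) (a : Gen N) (u : Gen N → ℂ) :
    (QD nabla t).col (a.shift j) u = (QD nabla t).col a (fun b => u (b.shift j)) := by
  have key : ∀ (m : ℤ) (v : ℤ → ℂ), ∑' n, nabla (n - (m + j)) * v n =
      ∑' n, nabla (n - m) * v (n + j) := by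
    intro m v
    rw [← (Equiv.addRight j).tsum_eq]
    refine tsum_congr fun n => ?_
    simp
  induction a using Gen.cases_sgn t with
  | h1 m => simp only [Gen.shift, QD_col_phi]
  | h2 m => simp only [Gen.shift, QD_col_phi_opp]; rw [key m fun n => u (Gen.chi t.opp n)]
  | h3 m => simp only [Gen.shift, QD_col_chibar]
  | h4 m => simp only [Gen.shift, QD_col_chibar_opp]; rw [key m fun n => u (Gen.F t.opp n)]
  | h5 r m => simp only [Gen.shift, QD_col_chi]
  | h6 m => simp only [Gen.shift, QD_col_F]
  | h7 m => simp only [Gen.shift, QD_col_F_opp]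
  | h8 r i => simp only [Gen.shift, QD_col_rho]
  | h9 i => simp only [Gen.shift, QD_col_zeta]
  | h10 i => simp only [Gen.shift, QD_col_zeta_opp]
  | h11 r => simp only [Gen.shift, QD_col_theta]

/-- Supercharges commute with translations. -/
theorem QD_app_shift (nabla : ℤ → ℂ) (t : Sgn) (j : ℤ) (f : Raw N) (w : List (Gen N)) :
    (QD nabla t).app (fun v => f (v.map (Gen.shift j))) w =
      (QD nabla t).app f (w.map (Gen.shift j)) := by
  induction w generalizing f with
  | nil => rfl
  | cons a w ih =>
    rw [List.map_cons, LinDer.app_cons, LinDer.app_cons, QD_col_shift, sg_shift,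
      ← ih (rawD (a.shift j) f)]
    rfl

theorem GradedSymm.shift {f : Raw N} (hf : GradedSymm f) (j : ℤ) :
    GradedSymm (fun v => f (v.map (Gen.shift j))) := by
  intro u v a b
  simp only [List.map_append, List.map_cons]
  rw [hf]
  unfold eps
  rw [Gen.shift_odd, Gen.shift_odd]

/-! ### Decay of slices and of convolutions -/

theorem exists_large_letter (w : List (Gen N)) :
    wsz w = 0 ∨ ∃ b ∈ w, wsz w ≤ w.length * b.sz := by
  rcases eq_or_ne w [] with rfl | hne
  · exact Or.inl rfl
  · right
    by_contra! h
    have h1 : (w.map Gen.sz).sum * w.length < w.length * wsz w := by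
      have h2 : ∀ b ∈ w, (w.length : ℝ) * b.sz < wsz w := fun b hb => h b hb
      have h3 := List.sum_lt_sum_of_ne_nil hne (fun b => (w.length : ℝ) * b.sz) (fun _ => wsz w) h2
      rw [List.sum_map_mul_left] at h3
      simp only [List.map_const', List.sum_replicate, nsmul_eq_mul] at h3
      rwa [mul_comm]
    rw [mul_comm] at h1
    exact lt_irrefl _ h1

/-- Fixing one letter of a local coefficient function at the origin leaves a function that decays
in all the other sites. -/
theorem IsLoc.tame_rawD {d : ℕ} {f : Raw N} (hf : IsLoc d f) {a : Gen N} (ha : a.site = some 0) :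
    Tame (Set.Ioi 0) (rawD a f) := by
  obtain ⟨L, M, hM, hL, h⟩ := hf.decay
  intro e
  have ha' : ∀ w : List (Gen N), some 0 ∈ (a :: w).map Gen.site := by
    intro w; rw [List.map_cons, ha]; simp
  refine ⟨M / (e + 1), Set.mem_Ioi.mpr (by positivity), L, hL, fun w hw => ?_⟩
  unfold rawD
  have h0 : ‖f (a :: w)‖ ≤ L := by simpa using h (a :: w) 0 0 (ha' w) (ha' w)
  rcases exists_large_letter w with h1 | ⟨b, hb, h1⟩
  · rw [h1]; simpa using h0
  · rcases hs : b.site with _ | m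
    · have : b.sz = 0 := by rw [Gen.sz, hs]
      rw [this, mul_zero] at h1
      rw [le_antisymm h1 (wsz_nonneg w)]; simpa using h0
    · have hbz : b.sz = |(m : ℝ)| := by rw [Gen.sz, hs]
      have h2 := h (a :: w) m 0 (by
        rw [List.map_cons]
        exact List.mem_cons_of_mem _ (List.mem_map.mpr ⟨b, hb, hs⟩)) (ha' w)
      refine h2.trans (mul_le_mul_of_nonneg_left (Real.exp_le_exp.mpr ?_) hL)
      rw [hw, hbz] at h1
      simp only [sub_zero]
      have h3 : wsz w ≤ (e + 1) * |(m : ℝ)| := h1.trans (by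
        have := abs_nonneg (m : ℝ); nlinarith)
      have h4 : M / (e + 1) * wsz w ≤ M * |(m : ℝ)| := by
        rw [div_mul_eq_mul_div, div_le_iff₀ (by positivity)]
        nlinarith
      linarith

/-- The convolution `∑_n ∇(n) b(· - n)`. -/
noncomputable def conv (nabla : ℤ → ℂ) (b : Raw N) : Raw N :=
  fun v => ∑' n : ℤ, nabla n * b (v.map (Gen.shift (-n)))

/-- Convolution with the difference operator preserves decay away from the origin. The rate shrinks
with the length of the words, since a translation by `n` moves each letter by `n`. -/
theorem conv_tame {nabla : ℤ → ℂ} (hn : IsDifferenceOperator nabla) {b : Raw N}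
    (hb : Tame (Set.Ioi 0) b) : Tame (Set.Ioi 0) (conv nabla b) := by
  obtain ⟨L, M, hL, hM, hd⟩ := hn.decay
  intro e
  obtain ⟨t, ht, B, hB, h⟩ := hb e
  have ht : 0 < t := ht
  set τ := min t (M / (2 * (e + 1))) with hτ
  have hτ0 : 0 < τ := lt_min ht (by positivity)
  have hs := summable_exp_neg_abs (c := M / 2) (by positivity)
  refine ⟨τ, hτ0, (L * B) * ∑' n : ℤ, Real.exp (-(M / 2 * |(n : ℝ)|)),
    mul_nonneg (by positivity) (tsum_nonneg fun _ => (Real.exp_pos _).le), fun w hw => ?_⟩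
  have key : ∀ n : ℤ, ‖nabla n * b (w.map (Gen.shift (-n)))‖ ≤
      ((L * B) * Real.exp (-(τ * wsz w))) * Real.exp (-(M / 2 * |(n : ℝ)|)) := by
    intro n
    rw [norm_mul]
    have h1 := h (w.map (Gen.shift (-n))) (by simpa using hw)
    have h2 := wsz_le_shift n w
    rw [hw] at h2
    have h3 : τ * wsz w ≤ t * wsz (w.map (Gen.shift (-n))) + M / 2 * |(n : ℝ)| := by
      have h4 := mul_le_mul_of_nonneg_left h2 hτ0.le
      have h5 := mul_le_mul_of_nonneg_right (min_le_left t (M / (2 * (e + 1))))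
        (wsz_nonneg (w.map (Gen.shift (-n))))
      have h6 : τ * e ≤ M / 2 := by
        calc τ * e ≤ (M / (2 * (e + 1))) * (e + 1) :=
              mul_le_mul (min_le_right _ _) (by linarith) (by positivity) (by positivity)
          _ = M / 2 := by field_simp
      have h7 := mul_le_mul_of_nonneg_right h6 (abs_nonneg (n : ℝ))
      have h8 : τ * (wsz (w.map (Gen.shift (-n))) + e * |(n : ℝ)|) =
        τ * wsz (w.map (Gen.shift (-n))) + τ * e * |(n : ℝ)| := by ring
      linarith
    calc _ ≤ (L * Real.exp (-(M * |(n : ℝ)|))) *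
          (B * Real.exp (-(t * wsz (w.map (Gen.shift (-n)))))) :=
          mul_le_mul (hd n) h1 (norm_nonneg _) (by positivity)
      _ = (L * B) * Real.exp (-(M * |(n : ℝ)|) + -(t * wsz (w.map (Gen.shift (-n))))) := by
          rw [Real.exp_add]; ring
      _ ≤ (L * B) * Real.exp (-(τ * wsz w) + -(M / 2 * |(n : ℝ)|)) := by
          refine mul_le_mul_of_nonneg_left (Real.exp_le_exp.mpr ?_) (by positivity)
          linarith
      _ = _ := by rw [Real.exp_add]; ring
  have s2 : Summable fun n : ℤ => ((L * B) * Real.exp (-(τ * wsz w))) *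
      Real.exp (-(M / 2 * |(n : ℝ)|)) := hs.mul_left _
  have s1 := Summable.of_nonneg_of_le (fun n => norm_nonneg _) key s2
  refine (norm_tsum_le_tsum_norm s1).trans ((s1.tsum_le_tsum key s2).trans (le_of_eq ?_))
  rw [tsum_mul_left]; ring

theorem conv_symm (nabla : ℤ → ℂ) {b : Raw N} (hb : GradedSymm b) : GradedSymm (conv nabla b) := by
  intro u v x y
  unfold conv
  rw [← tsum_mul_left]
  refine tsum_congr fun n => ?_
  have := (hb.shift (-n)) u v x y
  simp only at this
  rw [this]; ring

theorem wt_shift {ω : Gen N → ℤ} (hω : ∀ j a, ω (Gen.shift j a) = ω a) (j : ℤ)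
    (w : List (Gen N)) : wt ω (w.map (Gen.shift j)) = wt ω w := by
  rw [wt, wt, List.map_map]
  congr 1
  exact List.map_congr_left fun a _ => hω j a

theorem conv_hasWt (nabla : ℤ → ℂ) {b : Raw N} {ω : Gen N → ℤ}
    (hω : ∀ j a, ω (Gen.shift j a) = ω a) {k : ℤ} (hb : HasWt ω k b) :
    HasWt ω k (conv nabla b) := by
  intro w hw
  by_contra hne
  apply hw
  have : ∀ n, b (w.map (Gen.shift (-n))) = 0 := by
    intro n
    by_contra h
    exact hne ((wt_shift hω (-n) w).symm.trans (hb _ h))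
  simp [conv, this]

end LatticeSusy

namespace LatticeSusy

variable {N : ℕ}

/-! ### Primitives of local coefficient functions -/

theorem euler_map {σ : Gen N → Gen N} (ho : ∀ a, (σ a).odd = a.odd) (β : Gen N → Raw N)
    (w : List (Gen N)) : euler β (w.map σ) = euler (fun c v => β (σ c) (v.map σ)) w := by
  induction w generalizing β with
  | nil => rfl
  | cons a w ih =>
    rw [List.map_cons, euler_cons, euler_cons, ih]
    simp only [eps, ho, List.map_cons]

/-- The translation-equivariant one-form with prescribed components at the origin, without
components along the letters that have no site. -/
def spread (B : Gen N → Raw N) (a : Gen N) : Raw N := match a.site with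
  | some n => fun v => B (a.shift (-n)) (v.map (Gen.shift (-n)))
  | none => 0

theorem spread_of_none (B : Gen N → Raw N) {a : Gen N} (h : a.site = none) : spread B a = 0 := by
  unfold spread; rw [h]

theorem spread_of_some (B : Gen N → Raw N) {a : Gen N} {n : ℤ} (h : a.site = some n) :
    spread B a = fun v => B (a.shift (-n)) (v.map (Gen.shift (-n))) := by
  unfold spread; rw [h]

theorem spread_origin (B : Gen N → Raw N) {a : Gen N} (h : a.site = some 0) :
    spread B a = B a := by
  rw [spread_of_some B h]
  funext v
  simp only [neg_zero, Gen.shift_zero, map_shift_zero]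

theorem spread_shift (B : Gen N → Raw N) (j : ℤ) (a : Gen N) (v : List (Gen N)) :
    spread B (a.shift j) (v.map (Gen.shift j)) = spread B a v := by
  rcases h : a.site with _ | n
  · have h' : (a.shift j).site = none := by rw [site_shift, h]; rfl
    rw [spread_of_none B h, spread_of_none B h']; rfl
  · have h' : (a.shift j).site = some (n + j) := by rw [site_shift, h]; rfl
    rw [spread_of_some B h, spread_of_some B h']
    simp only [Gen.shift_shift, map_shift_shift]
    rw [show j + -(n + j) = -n by ring]

theorem spread_symm {B : Gen N → Raw N} (h : ∀ a, GradedSymm (B a)) (a : Gen N) :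
    GradedSymm (spread B a) := by
  rcases hs : a.site with _ | n
  · rw [spread_of_none B hs]; exact (Series N).zero_mem
  · rw [spread_of_some B hs]; exact (h _).shift (-n)

/-- Components that decay away from the origin, uniformly in the letter. -/
def OriginTame (B : Gen N → Raw N) : Prop :=
  ∀ d : ℕ, ∃ t : ℝ, 0 < t ∧ ∃ L : ℝ, 0 ≤ L ∧ ∀ a v, v.length = d →
    ‖B a v‖ ≤ L * Real.exp (-(t * wsz v))

theorem OriginTame.jtame {B : Gen N → Raw N} (hB : OriginTame B) : JTame {0} (spread B) := by
  intro d
  obtain ⟨t, ht, L, hL, h⟩ := hB d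
  refine ⟨0, Set.mem_singleton 0, L, hL, fun a v hv => ?_⟩
  simp only [zero_mul, neg_zero, Real.exp_zero, mul_one]
  rcases hs : a.site with _ | n
  · rw [spread_of_none B hs]; simpa using hL
  · rw [spread_of_some B hs]
    refine (h _ _ (by simpa using hv)).trans ?_
    have : Real.exp (-(t * wsz (v.map (Gen.shift (-n))))) ≤ 1 :=
      Real.exp_le_one_iff.mpr (by have := wsz_nonneg (v.map (Gen.shift (-n))); nlinarith)
    nlinarith

/-- If the components at the origin decay away from the origin, their translates add up, one for
each letter, to coefficients that decay in the distance of any two sites. -/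
theorem euler_spread_decay {B : Gen N → Raw N} (hB : OriginTame B) (e : ℕ) :
    ∃ L M : ℝ, 0 < M ∧ 0 ≤ L ∧ ∀ (w : List (Gen N)) (m n : ℤ), w.length = e + 1 →
      some m ∈ w.map Gen.site → some n ∈ w.map Gen.site →
      ‖euler (spread B) w‖ ≤ L * Real.exp (-(M * |((m - n : ℤ) : ℝ)|)) := by
  obtain ⟨t, ht, L, hL, h⟩ := hB e
  refine ⟨(e + 1) * L, t / 2, by positivity, by positivity, fun w m n hw hm hn => ?_⟩
  have key : ‖euler (spread B) w‖ ≤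
      w.length * (L * Real.exp (-(t / 2 * |((m - n : ℤ) : ℝ)|))) := by
    refine euler_bound fun a v p => ?_
    have hv : v.length = e := by have := p.length_eq; rw [List.length_cons] at this; omega
    rcases hs : a.site with _ | k
    · rw [spread_of_none B hs]
      simp only [Pi.zero_apply, norm_zero]; positivity
    · rw [spread_of_some B hs]
      refine (h _ _ (by simpa using hv)).trans
        (mul_le_mul_of_nonneg_left (Real.exp_le_exp.mpr ?_) hL)
      have hd : ∀ i : ℤ, some i ∈ w.map Gen.site →
          |((i + -k : ℤ) : ℝ)| ≤ wsz (v.map (Gen.shift (-k))) := by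
        intro i hi
        obtain ⟨b, hb, hbi⟩ := List.mem_map.mp hi
        have h1 : some (i + -k) ∈ ((a :: v).map (Gen.shift (-k))).map Gen.site := by
          refine List.mem_map.mpr ⟨b.shift (-k), List.mem_map.mpr ⟨b, p.subset hb, rfl⟩, ?_⟩
          rw [site_shift, hbi]; rfl
        have h2 := abs_le_wsz h1
        have h3 : (a.shift (-k)).sz = 0 := by
          rw [Gen.sz, site_shift, hs]; simp
        rwa [List.map_cons, wsz_cons, h3, zero_add] at h2
      have h1 := hd m hm
      have h2 := hd n hn
      have h3 : |((m - n : ℤ) : ℝ)| ≤ |((m + -k : ℤ) : ℝ)| + |((n + -k : ℤ) : ℝ)| := by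
        have := abs_sub (((m + -k : ℤ) : ℝ)) (((n + -k : ℤ) : ℝ))
        refine le_trans (le_of_eq ?_) this
        push_cast; congr 1; ring
      nlinarith
  rw [hw] at key
  push_cast at key ⊢
  linarith

/-- The one-form at the origin with given components along the fields of label `s`. -/
def originForm (s : Sgn) (bφ bη bχ bF : Raw N) : Gen N → Raw N
  | Gen.phi r _ => if r = s then bφ else 0
  | Gen.chibar r _ => if r = s then bη else 0
  | Gen.chi r _ => if r = s then bχ else 0
  | Gen.F r _ => if r = s then bF else 0
  | _ => 0

theorem originForm_cases {P : Raw N → Prop} (s : Sgn) {bφ bη bχ bF : Raw N} (h0 : P 0)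
    (h1 : P bφ) (h2 : P bη) (h3 : P bχ) (h4 : P bF) (a : Gen N) :
    P (originForm s bφ bη bχ bF a) := by
  cases a <;> simp only [originForm] <;> (try split_ifs) <;> assumption

theorem originTame_originForm (s : Sgn) {bφ bη bχ bF : Raw N} (h1 : Tame (Set.Ioi 0) bφ)
    (h2 : Tame (Set.Ioi 0) bη) (h3 : Tame (Set.Ioi 0) bχ) (h4 : Tame (Set.Ioi 0) bF) :
    OriginTame (originForm s bφ bη bχ bF) := by
  intro d
  obtain ⟨t1, ht1, L1, hL1, h1⟩ := h1 d
  obtain ⟨t2, ht2, L2, hL2, h2⟩ := h2 d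
  obtain ⟨t3, ht3, L3, hL3, h3⟩ := h3 d
  obtain ⟨t4, ht4, L4, hL4, h4⟩ := h4 d
  set t := min (min t1 t2) (min t3 t4) with ht
  refine ⟨t, lt_min (lt_min ht1 ht2) (lt_min ht3 ht4), L1 + L2 + L3 + L4, by positivity,
    fun a => ?_⟩
  have weaken : ∀ {f : Raw N} {u L : ℝ}, t ≤ u → 0 ≤ L → L ≤ L1 + L2 + L3 + L4 →
      (∀ w, w.length = d → ‖f w‖ ≤ L * Real.exp (-(u * wsz w))) →
      ∀ w, w.length = d → ‖f w‖ ≤ (L1 + L2 + L3 + L4) * Real.exp (-(t * wsz w)) := by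
    intro f u L hu hL hLL h w hw
    exact (h w hw).trans (mul_le_mul hLL (exp_rate_le hu (wsz_nonneg w)) (Real.exp_pos _).le
      (by positivity))
  refine originForm_cases (P := fun f : Raw N => ∀ w, w.length = d →
    ‖f w‖ ≤ (L1 + L2 + L3 + L4) * Real.exp (-(t * wsz w))) s (fun w _ => ?_)
    (weaken ((min_le_left _ _).trans (min_le_left _ _)) hL1 (by linarith) h1)
    (weaken ((min_le_left _ _).trans (min_le_right _ _)) hL2 (by linarith) h2)
    (weaken ((min_le_right _ _).trans (min_le_left _ _)) hL3 (by linarith) h3)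
    (weaken ((min_le_right _ _).trans (min_le_right _ _)) hL4 (by linarith) h4) a
  simp only [Pi.zero_apply, norm_zero]; positivity

/-- The components of a primitive along a letter on which `Q_t` does not act. -/
theorem IsLoc.exists_component {nabla : ℤ → ℂ} (hn : IsDifferenceOperator nabla) (t : Sgn)
    {A : Raw N} {e : ℕ} (hA : IsLoc (e + 1) A) {g : ℤ} (hsec : HasWt (wSec t) 0 A)
    (hk : HasWt (wKoszul t) g A) (hg : 2 ≤ g) (hclosed : (QD nabla t).app A = 0) {a : Gen N}
    (ha : a.site = some 0) (hcol : ∀ u, (QD nabla t).col a u = 0) (ha1 : wSec t a = 0)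
    (ha2 : wKoszul t a = 1) :
    ∃ b : Raw N, GradedSymm b ∧ Tame (Set.Ioi 0) b ∧ (QD nabla t).app b = a.sg • rawD a A ∧
      HasWt (fun _ => 1) e b ∧ HasWt (wSec t) 0 b ∧ HasWt (wKoszul t) g b := by
  have hc : (QD nabla t).app (rawD a A) = 0 := by
    funext v
    have := congrFun hclosed (a :: v)
    rw [LinDer.app_cons, hcol, zero_add, Pi.zero_apply] at this
    have h0 : a.sg ≠ 0 := fun h => by simpa [h] using a.sg_sq
    exact (mul_eq_zero.mp this).resolve_left h0
  have h1 : HasWt (fun _ => 1) e (rawD a A) := fun w hw => by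
    have := hA.length (a :: w) hw
    rw [List.length_cons] at this
    rw [wt_one]; omega
  have h2 := hsec.rawD a
  have h3 := hk.rawD a
  rw [ha1, sub_zero] at h2
  rw [ha2] at h3
  obtain ⟨b, b1, b2, b3, b4, b5, b6⟩ := LatticeSusy.exists_primitive hn t (hA.symm.rawD a)
    (hA.tame_rawD ha) hc h1 h2 h3 (by omega)
  refine ⟨a.sg • b, (Series N).smul_mem _ b1, b2.smul _, ?_, b4.smul _, b5.smul _, ?_⟩
  · rw [LinDer.app_smul, b3]
  · rw [sub_add_cancel] at b6
    exact b6.smul _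

/-- The components of a primitive along a letter that `Q_t` reaches from the translates of `c`. -/
theorem IsLoc.exists_component' {nabla : ℤ → ℂ} (hn : IsDifferenceOperator nabla) (t : Sgn)
    {A : Raw N} {e : ℕ} (hA : IsLoc (e + 1) A) {g : ℤ} (hsec : HasWt (wSec t) 0 A)
    (hk : HasWt (wKoszul t) g A) (hg : 2 ≤ g) (hclosed : (QD nabla t).app A = 0) {a c : Gen N}
    (ha : a.site = some 0) (hc : c.site = some 0) (hsg : c.sg = -a.sg) {x : ℂ}
    (hcol : ∀ u, (QD nabla t).col a u = x * ∑' n : ℤ, nabla n * u (c.shift n))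
    (ha1 : wSec t a = 0) (ha2 : wKoszul t a = 0) {b : Raw N} (b1 : GradedSymm b)
    (b2 : Tame (Set.Ioi 0) b) (b3 : (QD nabla t).app b = c.sg • rawD c A)
    (b4 : HasWt (fun _ => 1) e b) (b5 : HasWt (wSec t) 0 b) (b6 : HasWt (wKoszul t) g b) :
    ∃ b' : Raw N, GradedSymm b' ∧ Tame (Set.Ioi 0) b' ∧
      (QD nabla t).app b' = a.sg • (rawD a A + (-x) • conv nabla b) := by
  set B : Gen N → Raw N := fun a' => if a' = c then b else 0 with hB
  have hBt : OriginTame B := by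
    intro d
    obtain ⟨s, hs, L, hL, h⟩ := b2 d
    refine ⟨s, hs, L, hL, fun a' v hv => ?_⟩
    simp only [hB]
    split_ifs
    · exact h v hv
    · simp only [Pi.zero_apply, norm_zero]; positivity
  have hsp : ∀ n : ℤ, spread B (c.shift n) = fun v => b (v.map (Gen.shift (-n))) := by
    intro n
    have : (c.shift n).site = some n := by rw [site_shift, hc]; simp
    rw [spread_of_some B this]
    simp only [Gen.shift_shift, add_neg_cancel, Gen.shift_zero, hB, if_true]
  have hconv : (fun v => (QD nabla t).col a (fun b => spread B b v)) = x • conv nabla b := by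
    funext v
    rw [hcol]
    simp only [hsp, conv, Pi.smul_apply, smul_eq_mul]
  have hQc : (QD nabla t).app (x • conv nabla b) =
      fun v => c.sg * (QD nabla t).col a (fun b => A (b :: v)) := by
    rw [← hconv]
    funext v
    rw [(QD_adm_zero hn t).app_col (QD_adm_zero hn t) hBt.jtame a v, hcol, hcol,
      mul_left_comm c.sg, ← tsum_mul_left (a := c.sg)]
    congr 1
    refine tsum_congr fun n => ?_
    rw [hsp, QD_app_shift, b3]
    have : A (c :: v.map (Gen.shift (-n))) = A (c.shift n :: v) := by
      rw [← hA.trans n, List.map_cons, map_shift_shift, neg_add_cancel, map_shift_zero]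
    simp only [Pi.smul_apply, smul_eq_mul, rawD, this]
    ring
  have tc := conv_tame hn b2
  have hcl : (QD nabla t).app (rawD a A + (-x) • conv nabla b) = 0 := by
    rw [(QD_adm_zero hn t).app_add (hA.tame.rawD a) (tc.bounded.smul _)]
    have : (-x) • conv nabla b = (-1 : ℂ) • x • conv nabla b := by rw [smul_smul]; simp
    rw [this, LinDer.app_smul, hQc]
    funext v
    have h := congrFun hclosed (a :: v)
    rw [LinDer.app_cons, Pi.zero_apply] at h
    simp only [Pi.add_apply, Pi.smul_apply, smul_eq_mul, Pi.zero_apply, hsg]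
    linear_combination a.sg * h - (QD nabla t).app (rawD a A) v * a.sg_sq
  have h1 : HasWt (fun _ => 1) e (rawD a A) := fun w hw => by
    have := hA.length (a :: w) hw
    rw [List.length_cons] at this
    rw [wt_one]; omega
  have h2 := hsec.rawD a
  have h3 := hk.rawD a
  rw [ha1, sub_zero] at h2
  rw [ha2, sub_zero] at h3
  obtain ⟨b', c1, c2, c3, -⟩ := LatticeSusy.exists_primitive hn t
    ((Series N).add_mem (hA.symm.rawD a) ((Series N).smul_mem (-x) (conv_symm nabla b1)))
    ((hA.tame_rawD ha).add (tc.smul (-x))) hcl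
    (h1.add ((conv_hasWt nabla (fun _ _ => rfl) b4).smul _)) (h2.add ((conv_hasWt nabla (shift_wSec t) b5).smul _))
    (h3.add ((conv_hasWt nabla (shift_wKoszul t) b6).smul _)) (by omega)
  exact ⟨a.sg • b', (Series N).smul_mem _ c1, c2.smul _, by rw [LinDer.app_smul, c3]⟩

end LatticeSusy

namespace LatticeSusy

variable {N : ℕ}

/-! ### Primitives of the first variation -/

theorem shift_wTheta (j : ℤ) (a : Gen N) : wTheta (Gen.shift j a) = wTheta a := by cases a <;> rfl

theorem shift_wSite (j : ℤ) (a : Gen N) : wSite (Gen.shift j a) = wSite a := by cases a <;> rfl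

theorem shift_wNF (j : ℤ) (a : Gen N) : wNF (Gen.shift j a) = wNF a := by cases a <;> rfl

theorem wTheta_nonneg (a : Gen N) : 0 ≤ wTheta a := by unfold wTheta; split_ifs <;> simp

theorem wt_pos_of_mem {ω : Gen N → ℤ} (h : ∀ a, 0 ≤ ω a) {a : Gen N} {w : List (Gen N)}
    (ha : a ∈ w) (h1 : 0 < ω a) : 0 < wt ω w := by
  induction w with
  | nil => simp at ha
  | cons b w ih =>
    rw [wt_cons]
    have := wt_nonneg h w
    have := h b
    rcases List.mem_cons.mp ha with rfl | h'
    · omega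
    · have := ih h'; omega

theorem isTheta_of_hasWt_wTheta {f : Raw N} (hf : HasWt wTheta 0 f) {w : List (Gen N)}
    (hw : f w ≠ 0) : ∀ a ∈ w, a.isTheta = false := by
  intro a ha
  by_contra h
  have h1 := wt_pos_of_mem wTheta_nonneg ha (by simp [wTheta, h])
  rw [hf w hw] at h1
  exact lt_irrefl _ h1

theorem IsLoc.hasWt_wTheta {d : ℕ} {f : Raw N} (hf : IsLoc d f) : HasWt wTheta 0 f := by
  intro w hw
  have h := hf.body w hw
  clear hw
  induction w with
  | nil => rfl
  | cons a w ih =>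
    rw [wt_cons, ih fun b hb => h b (List.mem_cons_of_mem _ hb)]
    simp [wTheta, h a]

theorem IsLoc.hasWt_one {d : ℕ} {f : Raw N} (hf : IsLoc d f) : HasWt (fun _ => 1) d f :=
  fun w hw => by rw [wt_one, hf.length w hw]

/-- A one-form on the lattice fields of label `-t` that the supercharge maps to the first variation
of `A`. -/
theorem IsLoc.exists_form {nabla : ℤ → ℂ} (hn : IsDifferenceOperator nabla) (t : Sgn)
    {A : Raw N} {e : ℕ} (hA : IsLoc (e + 1) A) {g : ℤ} (hsec : HasWt (wSec t) 0 A)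
    (hk : HasWt (wKoszul t) g A) (hg : 2 ≤ g) (hclosed : (QD nabla t).app A = 0) :
    ∃ B : Gen N → Raw N, OriginTame B ∧ (∀ a, GradedSymm (B a)) ∧
      ∀ a v, (QD nabla t).col a (fun b => spread B b v) + a.sg * (QD nabla t).app (spread B a) v =
        wSite a * A (a :: v) := by
  obtain ⟨bχ, c1, c2, c3, c4, c5, c6⟩ := hA.exists_component hn t hsec hk hg hclosed
    (a := Gen.chi t.opp 0) rfl (fun u => QD_col_chi _ _ _ _ _) (by simp [wSec, Sgn.opp_ne]) rfl
  obtain ⟨bF, f1, f2, f3, f4, f5, f6⟩ := hA.exists_component hn t hsec hk hg hclosed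
    (a := Gen.F t.opp 0) rfl (fun u => QD_col_F_opp _ _ _ _) (by simp [wSec, Sgn.opp_ne])
    (by simp [wKoszul, Sgn.opp_ne])
  obtain ⟨bφ, p1, p2, p3⟩ := hA.exists_component' hn t hsec hk hg hclosed
    (a := Gen.phi t.opp 0) (c := Gen.chi t.opp 0) rfl rfl (by simp [Gen.sg, Gen.odd])
    (x := -(t.toC * Complex.I)) (fun u => by simp [QD_col_phi_opp, Gen.shift])
    (by simp [wSec, Sgn.opp_ne]) (by simp [wKoszul, Sgn.opp_ne]) c1 c2 c3 c4 c5 c6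
  obtain ⟨bη, q1, q2, q3⟩ := hA.exists_component' hn t hsec hk hg hclosed
    (a := Gen.chibar t.opp 0) (c := Gen.F t.opp 0) rfl rfl (by simp [Gen.sg, Gen.odd])
    (x := -Complex.I) (fun u => by simp [QD_col_chibar_opp, Gen.shift])
    (by simp [wSec, Sgn.opp_ne]) (by simp [wKoszul]) f1 f2 f3 f4 f5 f6
  set B := originForm t.opp bφ bη bχ bF with hB
  have hsymm : ∀ a, GradedSymm (B a) :=
    originForm_cases t.opp (Series N).zero_mem p1 q1 c1 f1
  refine ⟨B, originTame_originForm t.opp p2 q2 c2 f2, hsymm, ?_⟩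
  -- the letters with label `t`
  have hne : t ≠ t.opp := fun h => Sgn.opp_ne t h.symm
  have hA0 : ∀ (a : Gen N) v, wSec t a = 1 → A (a :: v) = 0 := by
    intro a v ha
    by_contra h
    have h1 := hsec (a :: v) h
    have h2 := wt_nonneg (ω := wSec t) (fun b => by cases b <;> simp [wSec] <;> split_ifs <;> simp) v
    rw [wt_cons, ha] at h1
    omega
  have hs0 : ∀ (a : Gen N), a.site = none ∨ wSec t a = 1 → spread B a = 0 := by
    intro a ha
    cases a with
    | phi s n | chibar s n | chi s n | F s n =>
      have : s = t := by simpa [Gen.site, wSec] using ha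
      subst this
      simp only [spread, Gen.site, Gen.shift, hB, originForm, hne, if_false]; rfl
    | rho s n | zeta s n | theta s => rfl
  have hz : ∀ (a : Gen N) v, (a.site = none ∨ wSec t a = 1) →
      (QD nabla t).col a (fun b => spread B b v) = 0 →
      (QD nabla t).col a (fun b => spread B b v) + a.sg * (QD nabla t).app (spread B a) v =
        wSite a * A (a :: v) := by
    intro a v ha hc
    rw [hc, hs0 a ha, LinDer.app_zero]
    rcases ha with ha | ha
    · simp [wSite, ha]
    · simp [hA0 a v ha]
  have ho : ∀ a v, a.site = some 0 →
      (QD nabla t).col a (fun b => spread B b v) + a.sg * (QD nabla t).app (B a) v =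
        A (a :: v) →
      (QD nabla t).col a (fun b => spread B b v) + a.sg * (QD nabla t).app (spread B a) v =
        wSite a * A (a :: v) := by
    intro a v ha h
    rw [spread_origin B ha, h, wSite, ha]; simp
  have red : ∀ (a : Gen N) (n : ℤ),
      (∀ v, (QD nabla t).col a (fun b => spread B b v) + a.sg * (QD nabla t).app (spread B a) v =
        wSite a * A (a :: v)) → ∀ v,
      (QD nabla t).col (a.shift n) (fun b => spread B b v) +
        (a.shift n).sg * (QD nabla t).app (spread B (a.shift n)) v =
        wSite (a.shift n) * A (a.shift n :: v) := by
    intro a n h v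
    obtain ⟨v', rfl⟩ : ∃ v', v = v'.map (Gen.shift n) :=
      ⟨v.map (Gen.shift (-n)), by rw [map_shift_shift, neg_add_cancel, map_shift_zero]⟩
    rw [QD_col_shift, sg_shift, shift_wSite, ← List.map_cons, hA.trans, ← h v', ← QD_app_shift]
    simp only [spread_shift]
  have hv : ∀ n v, spread B (Gen.chi t.opp n) v = bχ (v.map (Gen.shift (-n))) := by
    intro n v; simp [spread, Gen.site, Gen.shift, hB, originForm]
  have hv' : ∀ n v, spread B (Gen.F t.opp n) v = bF (v.map (Gen.shift (-n))) := by
    intro n v; simp [spread, Gen.site, Gen.shift, hB, originForm]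
  have fin : ∀ (a : Gen N) (f : Raw N) (y : ℂ) v, (QD nabla t).app (B a) = a.sg • (rawD a A + f) →
      y = - f v → y + a.sg * (QD nabla t).app (B a) v = A (a :: v) := by
    rintro a f y v h rfl
    rw [h]
    simp only [Pi.smul_apply, Pi.add_apply, smul_eq_mul, rawD]
    linear_combination (A (a :: v) + f v) * a.sg_sq
  intro a v
  induction a using Gen.cases_sgn t with
  | h1 m => exact hz _ v (Or.inr (by simp [wSec])) (QD_col_phi _ _ _ _)
  | h2 m =>
    rw [show (Gen.phi t.opp m : Gen N) = (Gen.phi t.opp 0).shift m by simp [Gen.shift]]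
    refine red _ m (fun v => ho _ v rfl (fin _ _ _ v (by rw [← p3]; simp [hB, originForm]) ?_)) v
    rw [QD_col_phi_opp]
    simp only [hv, sub_zero, Pi.smul_apply, smul_eq_mul, conv]
    ring
  | h3 m =>
    refine hz _ v (Or.inr (by simp [wSec])) ?_
    rw [QD_col_chibar, hs0 (Gen.phi t m) (Or.inr (by simp [wSec]))]; simp
  | h4 m =>
    rw [show (Gen.chibar t.opp m : Gen N) = (Gen.chibar t.opp 0).shift m by simp [Gen.shift]]
    refine red _ m (fun v => ho _ v rfl (fin _ _ _ v (by rw [← q3]; simp [hB, originForm]) ?_)) v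
    rw [QD_col_chibar_opp]
    simp only [hv', sub_zero, Pi.smul_apply, smul_eq_mul, conv]
    ring
  | h5 r m =>
    rcases Sgn.eq_or_opp t r with rfl | rfl
    · exact hz _ v (Or.inr (by simp [wSec])) (QD_col_chi _ _ _ _ _)
    · rw [show (Gen.chi t.opp m : Gen N) = (Gen.chi t.opp 0).shift m by simp [Gen.shift]]
      refine red _ m (fun v => ho _ v rfl (fin _ 0 _ v (by
        rw [add_zero, ← c3]; simp [hB, originForm]) ?_)) v
      rw [QD_col_chi]; simp
  | h6 m =>
    refine hz _ v (Or.inr (by simp [wSec])) ?_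
    rw [QD_col_F, hs0 (Gen.chi t m) (Or.inr (by simp [wSec]))]; simp
  | h7 m =>
    rw [show (Gen.F t.opp m : Gen N) = (Gen.F t.opp 0).shift m by simp [Gen.shift]]
    refine red _ m (fun v => ho _ v rfl (fin _ 0 _ v (by
      rw [add_zero, ← f3]; simp [hB, originForm]) ?_)) v
    rw [QD_col_F_opp]; simp
  | h8 r i => exact hz _ v (Or.inl rfl) (QD_col_rho _ _ _ _ _)
  | h9 i => exact hz _ v (Or.inl rfl) (by rw [QD_col_zeta, hs0 _ (Or.inl rfl)]; simp)
  | h10 i => exact hz _ v (Or.inl rfl) (QD_col_zeta_opp _ _ _ _)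
  | h11 r => exact hz _ v (Or.inl rfl) (QD_col_theta _ _ _ _)

/-- Exactness of the Koszul complex of `Q_t` on local coefficient functions, in Koszul degree at
least `2`: a local primitive is reconstructed from primitives of the first variation, which decay
away from the origin. -/
theorem IsLoc.exists_primitive {nabla : ℤ → ℂ} (hn : IsDifferenceOperator nabla) (t : Sgn)
    {A : Raw N} {d : ℕ} (hA : IsLoc d A) {g q r : ℤ} (hsec : HasWt (wSec t) 0 A)
    (hk : HasWt (wKoszul t) g A) (hg : 2 ≤ g) (hclosed : (QD nabla t).app A = 0)
    (hr : HasWt wSite r A) (hr0 : r ≠ 0) (hq : HasWt wNF q A) :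
    ∃ B : Raw N, IsLoc d B ∧ HasWt wNF (q + 1) B ∧ (QD nabla t).app B = A := by
  rcases d with _ | e
  · refine ⟨0, isLoc_zero 0, fun w hw => absurd rfl hw, ?_⟩
    rw [LinDer.app_zero]
    funext w
    by_contra h
    have h' : A w ≠ 0 := fun h0 => h h0.symm
    obtain ⟨a, ha, -⟩ := hA.site w h'
    rw [List.length_eq_zero_iff.mp (hA.length w h')] at ha
    simp at ha
  obtain ⟨B, hB, hBs, hBA⟩ := hA.exists_form hn t hsec hk hg hclosed
  have hJ := hB.jtame
  have happ : (QD nabla t).app (euler (spread B)) = (r : ℂ) • A := by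
    funext w
    rw [(QD_adm_zero hn t).app_euler ⟨0, Set.mem_singleton 0⟩ (QD_isOdd nabla t) hJ]
    have : (fun (c : Gen N) v => (QD nabla t).col c (fun b => spread B b v) +
        c.sg * (QD nabla t).app (spread B c) v) = fun c v => (wSite c : ℂ) * A (c :: v) := by
      funext c v; exact hBA c v
    rw [this, euler_weight hA.symm]
    by_cases h0 : A w = 0
    · simp [h0]
    · rw [hr w h0]; rfl
  set E := LatticeSusy.proj (fun _ => 1) ((e + 1 : ℕ) : ℤ)
    (LatticeSusy.proj wTheta 0 (LatticeSusy.proj wSite r (euler (spread B)))) with hE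
  have hEle : ∀ w, ‖E w‖ ≤ ‖euler (spread B) w‖ := by
    intro w
    simp only [hE, LatticeSusy.proj]
    split_ifs <;> simp
  have hE1 : HasWt (fun _ => 1) ((e + 1 : ℕ) : ℤ) E := hasWt_proj _ _ _
  have hE2 : HasWt wTheta 0 E := (hasWt_proj _ _ _).proj
  have hE3 : HasWt wSite r E := ((hasWt_proj _ _ _).proj).proj
  have hsE : GradedSymm E := (((euler_symm (spread_symm hBs)).proj _ _).proj _ _).proj _ _
  have htr : ∀ j w, euler (spread B) (w.map (Gen.shift j)) = euler (spread B) w := by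
    intro j w
    rw [euler_map (fun a => Gen.shift_odd j a)]
    congr 1
    funext c v
    exact spread_shift B j c v
  have hl : ∀ w, E w ≠ 0 → w.length = e + 1 := by
    intro w hw
    have := hE1 w hw
    rw [wt_one] at this
    exact_mod_cast this
  have hloc : IsLoc (e + 1) E := by
    refine ⟨hsE, hl, fun w hw => isTheta_of_hasWt_wTheta hE2 hw, fun w hw => ?_,
      fun j w => ?_, ?_⟩
    · by_contra! h
      apply hr0
      rw [← hE3 w hw]
      clear hw
      induction w with
      | nil => rfl
      | cons a w ih =>
        rw [wt_cons, ih fun b hb => h b (List.mem_cons_of_mem _ hb)]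
        simp [wSite, h a]
    · simp only [hE, LatticeSusy.proj, htr, wt_shift shift_wTheta, wt_shift shift_wSite, wt_one,
        List.length_map]
    · obtain ⟨L, M, hM, hL, h⟩ := euler_spread_decay hB e
      refine ⟨L, M, hM, hL, fun w m n hm hn' => ?_⟩
      by_cases h0 : E w = 0
      · rw [h0, norm_zero]; positivity
      · exact (hEle w).trans (h w m n (hl w h0) hm hn')
  have hEapp : (QD nabla t).app E = (r : ℂ) • A := by
    have s1 := (QD_shifts_one (N := N) nabla t).app_proj ((e + 1 : ℕ) : ℤ)
      (LatticeSusy.proj wTheta 0 (LatticeSusy.proj wSite r (euler (spread B))))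
    have s2 := (QD_shifts_wTheta (N := N) nabla t).app_proj 0
      (LatticeSusy.proj wSite r (euler (spread B)))
    have s3 := (QD_shifts_wSite (N := N) nabla t).app_proj r (euler (spread B))
    rw [add_zero] at s1 s2 s3
    rw [hE, s1, s2, s3, happ, (hr.smul _).proj_eq, (hA.hasWt_wTheta.smul _).proj_eq,
      (hA.hasWt_one.smul _).proj_eq]
  have hr' : (r : ℂ) ≠ 0 := Int.cast_ne_zero.mpr hr0
  refine ⟨(r : ℂ)⁻¹ • LatticeSusy.proj wNF (q + 1) E, (hloc.proj shift_wNF _).smul _,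
    (hasWt_proj _ _ _).smul _, ?_⟩
  rw [LinDer.app_smul, (QD_shifts_wNF nabla t).app_proj, hEapp, (hq.smul _).proj_eq, smul_smul,
    inv_mul_cancel₀ hr', one_smul]

end LatticeSusy

namespace LatticeSusy

variable {N : ℕ}

/-! ### The dual derivations and the number operators -/

/-- The letter whose image under the dual derivation contains `a`. -/
def dualGen : Gen N → Gen N
  | Gen.phi s n => Gen.chibar s n
  | Gen.chi s n => Gen.F s n
  | Gen.rho s i => Gen.zeta s i
  | a => a

/-- The coefficients of the dual derivation of label `s`. -/
noncomputable def dualCoeff (s : Sgn) : Gen N → ℂ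
  | Gen.phi r _ => if r = s then s.toC else 0
  | Gen.chi r _ => if r = s then 1 else 0
  | Gen.rho r _ => if r = s then s.toC else 0
  | _ => 0

/-- The odd derivation `χ̄_s ↦ s φ_s`, `F_s ↦ χ_s`, `ζ_s ↦ s ρ_s`, whose anticommutator with `Q_s`
counts the letters of label `s`. -/
noncomputable def KD (s : Sgn) : LinDer N where
  src a _ := dualGen a
  ker a n := if n = 0 then dualCoeff s a else 0

theorem KD_col (s : Sgn) (a : Gen N) (u : Gen N → ℂ) :
    (KD s).col a u = dualCoeff s a * u (dualGen a) := by
  simp [LinDer.col, KD]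

theorem KD_isOdd (s : Sgn) : (KD (N := N) s).IsOdd := by
  intro a n h
  cases a <;> simp_all [KD, dualCoeff, dualGen, Gen.odd]

theorem norm_dualCoeff_le (s : Sgn) (a : Gen N) : ‖dualCoeff s a‖ ≤ 1 := by
  cases a <;> simp only [dualCoeff] <;> (try split_ifs) <;> simp [Sgn.norm_toC]

theorem KD_adm (s : Sgn) : (KD (N := N) s).Adm {0} := by
  rintro t rfl
  refine ⟨0, Set.mem_singleton 0, 1, zero_le_one, fun a => ?_⟩
  have e : (fun n => ‖(KD s).ker a n‖ * Real.exp (-(0 * ((KD s).src a n).sz))) =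
      fun n : ℤ => if n = 0 then ‖dualCoeff s a‖ else 0 := by
    funext n
    by_cases h : n = 0 <;> simp [KD, h]
  rw [e]
  refine ⟨summable_of_ne_finset_zero (s := {0}) fun n hn => if_neg (by simpa using hn), ?_⟩
  rw [tsum_ite_eq]
  simpa using norm_dualCoeff_le s a

theorem KD_shifts {s : Sgn} {ω : Gen N → ℤ} {c : ℤ}
    (h1 : ∀ m, ω (Gen.chibar s m) = ω (Gen.phi s m) + c)
    (h2 : ∀ m, ω (Gen.F s m) = ω (Gen.chi s m) + c)
    (h3 : ∀ i, ω (Gen.zeta s i) = ω (Gen.rho s i) + c) : (KD s).Shifts ω c := by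
  intro a n h
  cases a with
  | phi r m | chi r m | rho r m =>
    obtain rfl : r = s := by
      by_contra hr
      simp [KD, dualCoeff, hr] at h
    first | exact h1 m | exact h2 m | exact h3 m
  | _ => simp [KD, dualCoeff] at h

theorem KD_col_comm_QD (nabla : ℤ → ℂ) (s : Sgn) (a : Gen N) (u : Gen N → ℂ) :
    (QD nabla s).col a (fun b => (KD s).col b u) + (KD s).col a (fun b => (QD nabla s).col b u) =
      wSec s a * u a := by
  simp only [KD_col]
  induction a using Gen.cases_sgn s with
  | h1 m =>
    simp only [QD_col_phi, dualCoeff, dualGen, QD_col_chibar, wSec, if_true]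
    rw [← mul_assoc, s.toC_sq]; simp
  | h2 m => simp [QD_col_phi_opp, dualCoeff, wSec]
  | h3 m =>
    simp only [dualCoeff, dualGen, QD_col_chibar, wSec, if_true]
    rw [← mul_assoc, s.toC_sq]; simp
  | h4 m => simp [QD_col_chibar_opp, dualCoeff, wSec]
  | h5 r m =>
    rcases Sgn.eq_or_opp s r with rfl | rfl
    · simp [QD_col_chi, QD_col_F, dualCoeff, dualGen, wSec]
    · simp [QD_col_chi, dualCoeff, wSec]
  | h6 m => simp [QD_col_F, dualCoeff, dualGen, wSec]
  | h7 m => simp [QD_col_F_opp, dualCoeff, wSec]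
  | h8 r i =>
    rcases Sgn.eq_or_opp s r with rfl | rfl
    · simp only [QD_col_rho, dualCoeff, dualGen, QD_col_zeta, wSec, if_true]
      rw [← mul_assoc, Sgn.toC_sq]; simp
    · simp [QD_col_rho, dualCoeff, wSec]
  | h9 i =>
    simp only [dualCoeff, dualGen, QD_col_zeta, wSec, if_true]
    rw [← mul_assoc, s.toC_sq]; simp
  | h10 i => simp [QD_col_zeta_opp, dualCoeff, wSec]
  | h11 r => simp [QD_col_theta, dualCoeff, wSec]

theorem KD_col_anticomm_QD (nabla : ℤ → ℂ) (t : Sgn) (a : Gen N) (u : Gen N → ℂ) :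
    (QD nabla t).col a (fun b => (KD t.opp).col b u) +
      (KD t.opp).col a (fun b => (QD nabla t).col b u) = 0 := by
  simp only [KD_col]
  induction a using Gen.cases_sgn t with
  | h2 m =>
    simp only [QD_col_phi_opp, dualCoeff, dualGen, QD_col_chibar_opp, if_true, Sgn.toC_opp, one_mul]
    ring
  | h5 r m =>
    rcases Sgn.eq_or_opp t r with rfl | rfl
    · simp [QD_col_chi, dualCoeff]
    · simp [QD_col_chi, QD_col_F_opp, dualGen]
  | h8 r i =>
    rcases Sgn.eq_or_opp t r with rfl | rfl
    · simp [QD_col_rho, dualCoeff]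
    · simp [QD_col_rho, QD_col_zeta_opp, dualGen]
  | _ => simp [QD_col_phi, QD_col_chibar, QD_col_chibar_opp, QD_col_F, QD_col_F_opp, QD_col_zeta,
      QD_col_zeta_opp, QD_col_theta, dualCoeff]

/-- `{Q_s, K_s}` is the number of letters of label `s`. -/
theorem QD_KD_app {nabla : ℤ → ℂ} (hn : IsDifferenceOperator nabla) (s : Sgn) {f : Raw N}
    (hf : Tame {0} f) {k : ℤ} (hk : HasWt (wSec s) k f) :
    (QD nabla s).app ((KD s).app f) + (KD s).app ((QD nabla s).app f) = (k : ℂ) • f := by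
  funext w
  rw [(QD_adm_zero hn s).anticomm_diag (KD_adm s) (QD_isOdd nabla s) (KD_isOdd s) (wSec s)
    (fun a u _ => KD_col_comm_QD nabla s a u) hf]
  by_cases h : f w = 0
  · simp [h]
  · rw [hk w h]; rfl

theorem QD_KD_opp_app {nabla : ℤ → ℂ} (hn : IsDifferenceOperator nabla) (t : Sgn) {f : Raw N}
    (hf : Tame {0} f) :
    (QD nabla t).app ((KD t.opp).app f) + (KD t.opp).app ((QD nabla t).app f) = 0 :=
  (QD_adm_zero hn t).anticomm (KD_adm t.opp) (QD_isOdd nabla t) (KD_isOdd t.opp)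
    (fun a u _ => KD_col_anticomm_QD nabla t a u) hf

theorem site_dualGen (a : Gen N) : (dualGen a).site = a.site := by cases a <;> rfl

theorem KD_app_bound (s : Sgn) {C : ℝ} (w : List (Gen N)) {f : Raw N}
    (h : ∀ v : List (Gen N), v.map Gen.site = w.map Gen.site → ‖f v‖ ≤ C) :
    ‖(KD s).app f w‖ ≤ w.length * C := by
  induction w generalizing f with
  | nil => simp [LinDer.app_nil]
  | cons a w ih =>
    have hC : 0 ≤ C := (norm_nonneg _).trans (h _ rfl)
    rw [LinDer.app_cons, KD_col]
    have h1 : ‖dualCoeff s a * f (dualGen a :: w)‖ ≤ C := by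
      rw [norm_mul]
      have := h (dualGen a :: w) (by simp [site_dualGen])
      have := mul_le_mul (norm_dualCoeff_le s a) this (norm_nonneg _) zero_le_one
      linarith
    have h2 := ih (f := rawD a f) fun v hv => h (a :: v) (by simp [hv])
    refine (norm_add_le _ _).trans ?_
    rw [norm_mul a.sg, Gen.norm_sg, one_mul, List.length_cons]
    push_cast
    linarith

theorem KD_app_shift (s : Sgn) (j : ℤ) (f : Raw N) (w : List (Gen N)) :
    (KD s).app (fun v => f (v.map (Gen.shift j))) w = (KD s).app f (w.map (Gen.shift j)) := by
  induction w generalizing f with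
  | nil => rfl
  | cons a w ih =>
    have hd : dualCoeff s (a.shift j) = dualCoeff s a := by cases a <;> rfl
    have hg : dualGen (a.shift j) = (dualGen a).shift j := by cases a <;> rfl
    rw [List.map_cons, LinDer.app_cons, LinDer.app_cons, KD_col, KD_col, sg_shift,
      ← ih (rawD (a.shift j) f), hd, hg]
    rfl

theorem IsLoc.KD_app {d : ℕ} {f : Raw N} (hf : IsLoc d f) (s : Sgn) : IsLoc d ((KD s).app f) := by
  have hl : HasWt (fun _ => 1) d ((KD s).app f) :=
    (KD_shifts (c := 0) (by simp) (by simp) (by simp)).hasWt (by simpa using hf.hasWt_one)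
  have hθ : HasWt wTheta 0 ((KD s).app f) :=
    (KD_shifts (c := 0) (fun _ => rfl) (fun _ => rfl) (fun _ => rfl)).hasWt
      (by simpa using hf.hasWt_wTheta)
  have hl' : ∀ w, (KD s).app f w ≠ 0 → w.length = d := fun w hw => by
    have := hl w hw
    rw [wt_one] at this
    exact_mod_cast this
  refine ⟨hf.symm.app (KD_isOdd s), hl', fun w hw => isTheta_of_hasWt_wTheta hθ hw,
    fun w hw => ?_, fun j w => ?_, ?_⟩
  · by_contra! h
    apply hw
    have := KD_app_bound s (C := 0) w (f := f) fun v hv => by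
      rw [norm_le_zero_iff]
      by_contra h0
      obtain ⟨a, ha, has⟩ := hf.site v h0
      have : a.site ∈ w.map Gen.site := hv ▸ List.mem_map.mpr ⟨a, ha, rfl⟩
      obtain ⟨b, hb, hba⟩ := List.mem_map.mp this
      exact has (hba ▸ h b hb)
    simpa using this
  · rw [← KD_app_shift]
    congr 1
    funext v
    exact hf.trans j v
  · obtain ⟨L, M, hM, hL, h⟩ := hf.decay
    refine ⟨d * L, M, hM, by positivity, fun w m n hm hn => ?_⟩
    by_cases h0 : (KD s).app f w = 0
    · rw [h0, norm_zero]; positivity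
    · rw [mul_assoc, ← hl' w h0]
      exact KD_app_bound s w fun v hv => h v m n (hv ▸ hm) (hv ▸ hn)

theorem KD_shifts_wNF (s : Sgn) : (KD (N := N) s).Shifts wNF (-1) :=
  KD_shifts (fun _ => rfl) (fun _ => rfl) (fun _ => rfl)

theorem KD_shifts_wSec (s r : Sgn) : (KD (N := N) s).Shifts (wSec r) 0 :=
  KD_shifts (by simp [wSec]) (by simp [wSec]) (by simp [wSec])

/-- A local coefficient function annihilated by both supercharges and containing letters of both
labels is exact. -/
theorem IsLoc.eq_QD_QD {nabla : ℤ → ℂ} (hn : IsDifferenceOperator nabla) {d : ℕ} {x : Raw N}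
    (hx : IsLoc d x) (hNF : HasWt wNF 0 x) (s : Sgn) (h1 : (QD nabla s).app x = 0)
    (h2 : (QD nabla s.opp).app x = 0) {a b : ℤ} (ha : HasWt (wSec s) a x)
    (hb : HasWt (wSec s.opp) b x) (ha0 : a ≠ 0) (hb0 : b ≠ 0) :
    ∃ B : Raw N, IsLoc d B ∧ HasWt wNF 2 B ∧
      (QD nabla s).app ((QD nabla s.opp).app B) = x := by
  set y := (KD s.opp).app x with hy
  have ly : IsLoc d y := hx.KD_app _
  have e1 : (QD nabla s.opp).app y = (b : ℂ) • x := by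
    have := QD_KD_app hn s.opp hx.tame hb
    rwa [h2, LinDer.app_zero, add_zero] at this
  have nf1 : HasWt wNF 1 y := (KD_shifts_wNF s.opp).hasWt (by simpa using hNF)
  have nf2 : HasWt wNF 2 ((KD s).app y) := (KD_shifts_wNF s).hasWt (by simpa using nf1)
  have e2 : (QD nabla s.opp).app ((KD s).app y) = (-(b : ℂ)) • (KD s).app x := by
    have h := QD_KD_opp_app hn s.opp ly.tame
    rw [Sgn.opp_opp, e1, LinDer.app_smul] at h
    rw [neg_smul]
    exact eq_neg_of_add_eq_zero_left h
  have e3 : (QD nabla s).app ((KD s).app x) = (a : ℂ) • x := by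
    have := QD_KD_app hn s hx.tame ha
    rwa [h1, LinDer.app_zero, add_zero] at this
  refine ⟨(-(b : ℂ) * a)⁻¹ • (KD s).app y, (ly.KD_app s).smul _, nf2.smul _, ?_⟩
  have hne : -(b : ℂ) * a ≠ 0 :=
    mul_ne_zero (neg_ne_zero.mpr (Int.cast_ne_zero.mpr hb0)) (Int.cast_ne_zero.mpr ha0)
  rw [LinDer.app_smul, e2, LinDer.app_smul, LinDer.app_smul, e3, smul_smul, smul_smul,
    mul_assoc, inv_mul_cancel₀ hne, one_smul]

/-- A local coefficient function annihilated by both supercharges and containing only letters of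
label `s` is `Q_s` of one annihilated by the other supercharge. -/
theorem IsLoc.eq_QD {nabla : ℤ → ℂ} (hn : IsDifferenceOperator nabla) {d : ℕ} {x : Raw N}
    (hx : IsLoc d x) (hNF : HasWt wNF 0 x) (s : Sgn) (h1 : (QD nabla s).app x = 0)
    (h2 : (QD nabla s.opp).app x = 0) {a : ℤ} (ha : HasWt (wSec s) a x)
    (hb : HasWt (wSec s.opp) 0 x) (ha0 : a ≠ 0) :
    ∃ A : Raw N, IsLoc d A ∧ HasWt wNF 1 A ∧ HasWt (wSec s.opp) 0 A ∧
      (QD nabla s.opp).app A = 0 ∧ (QD nabla s).app A = x := by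
  have e3 : (QD nabla s).app ((KD s).app x) = (a : ℂ) • x := by
    have := QD_KD_app hn s hx.tame ha
    rwa [h1, LinDer.app_zero, add_zero] at this
  have e4 : (QD nabla s.opp).app ((KD s).app x) = 0 := by
    have := QD_KD_opp_app hn s.opp hx.tame
    rwa [h2, Sgn.opp_opp, LinDer.app_zero, add_zero] at this
  refine ⟨(a : ℂ)⁻¹ • (KD s).app x, (hx.KD_app s).smul _,
    HasWt.smul ((KD_shifts_wNF s).hasWt (by simpa using hNF)) _,
    HasWt.smul ((KD_shifts_wSec s s.opp).hasWt (by simpa using hb)) _, ?_, ?_⟩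
  · rw [LinDer.app_smul, e4, smul_zero]
  · rw [LinDer.app_smul, e3, smul_smul, inv_mul_cancel₀ (Int.cast_ne_zero.mpr ha0), one_smul]

end LatticeSusy

namespace LatticeSusy

variable {N : ℕ}

/-! ### Berezin integrals of lifts -/

theorem eq_of_eqBody {f g : Raw N} (h : EqBody f g)
    (hf : ∀ w : List (Gen N), (∃ a ∈ w, a.isTheta = true) → f w = 0)
    (hg : ∀ w : List (Gen N), (∃ a ∈ w, a.isTheta = true) → g w = 0) : f = g := by
  funext w
  by_cases hw : ∃ a ∈ w, a.isTheta = true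
  · rw [hf w hw, hg w hw]
  · push Not at hw
    exact h w fun a ha => by simpa using hw a ha

theorem HasWt.eq_zero_of_isTheta {f : Raw N} (hf : HasWt wTheta 0 f) (w : List (Gen N))
    (hw : ∃ a ∈ w, a.isTheta = true) : f w = 0 := by
  by_contra h
  obtain ⟨a, ha, hat⟩ := hw
  rw [isTheta_of_hasWt_wTheta hf h a ha] at hat
  exact absurd hat (by simp)

theorem QD_hasWt_wTheta (nabla : ℤ → ℂ) (t : Sgn) {f : Raw N} (hf : HasWt wTheta 0 f) :
    HasWt wTheta 0 ((QD nabla t).app f) :=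
  (QD_shifts_wTheta nabla t).hasWt (by simpa using hf)

/-- The supercharges act on the values at `θ_± = 0`. -/
theorem EqBody.QD_app (nabla : ℤ → ℂ) (t : Sgn) {f g : Raw N} (h : EqBody f g) :
    EqBody ((QD nabla t).app f) ((QD nabla t).app g) := by
  have hw0 : ∀ w : List (Gen N), wt wTheta w = 0 ↔ ∀ a ∈ w, a.isTheta = false := by
    intro w
    constructor
    · intro hw a ha
      by_contra h
      have := wt_pos_of_mem wTheta_nonneg ha (by simp [wTheta, h])
      omega
    · intro hw
      induction w with
      | nil => rfl
      | cons a w ih =>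
        rw [wt_cons, ih fun b hb => hw b (List.mem_cons_of_mem _ hb)]
        simp [wTheta, hw a]
  have e : proj wTheta 0 f = proj wTheta 0 g := by
    funext w
    unfold proj
    split_ifs with hw
    · exact h w ((hw0 w).mp hw)
    · rfl
  have s := fun f : Raw N => (QD_shifts_wTheta (N := N) nabla t).app_proj 0 f
  rw [add_zero] at s
  intro w hw
  have h1 := congrFun ((s f).symm.trans ((congrArg _ e).trans (s g))) w
  simpa [proj, (hw0 w).mpr hw] using h1

theorem rawD_theta_QD (nabla : ℤ → ℂ) (r t : Sgn) (f : Raw N) :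
    rawD (Gen.theta r) ((QD nabla t).app f) = -(QD nabla t).app (rawD (Gen.theta r) f) := by
  funext w
  rw [rawD, LinDer.app_cons, QD_col_theta]
  simp [Gen.sg, Gen.odd]

theorem exists_theta_perm {w : List (Gen N)} (hw : ∃ a ∈ w, a.isTheta = true) :
    ∃ r w', w.Perm (Gen.theta r :: w') := by
  obtain ⟨a, ha, hat⟩ := hw
  cases a with
  | theta r => exact ⟨r, _, List.perm_cons_erase ha⟩
  | _ => simp [Gen.isTheta] at hat

/-- The Berezin integral of a superfield in terms of its value at `θ_± = 0`. -/
theorem berezin_eq {nabla : ℤ → ℂ} {T : Series N} (hT : IsSuperfield nabla T.1) {A : Raw N}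
    (hA : HasWt wTheta 0 A) (h : EqBody T.1 A) :
    (berezin T).1 = -(QD nabla Sgn.plus).app ((QD nabla Sgn.minus).app A) := by
  have e : (berezin T).1 = -(QD nabla Sgn.plus).app ((QD nabla Sgn.minus).app T.1) := by
    show rawD (Gen.theta Sgn.minus) (rawD (Gen.theta Sgn.plus) T.1) = _
    rw [← hT.susy, rawD_theta_QD, hT.susy]
  refine eq_of_eqBody (fun w hw => ?_) (fun w hw => ?_) (fun w hw => ?_)
  · rw [e, Pi.neg_apply, Pi.neg_apply, ((h.QD_app nabla Sgn.minus).QD_app nabla Sgn.plus) w hw]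
  · obtain ⟨r, w', p⟩ := exists_theta_perm hw
    show T.1 (Gen.theta Sgn.plus :: Gen.theta Sgn.minus :: w) = 0
    have h0 := T.2.eq_zero_of_repeat (a := Gen.theta r) rfl
    cases r with
    | plus =>
      refine T.2.eq_zero_of_perm ?_ (h0 (Gen.theta Sgn.minus :: w'))
      exact ((p.cons _).trans (List.Perm.swap _ _ _)).cons _
    | minus =>
      refine T.2.eq_zero_of_perm ?_ (h0 (Gen.theta Sgn.plus :: w'))
      exact (List.Perm.swap _ _ _).trans
        (((p.cons _).trans (List.Perm.swap _ _ _)).cons _)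
  · rw [Pi.neg_apply,
      (QD_hasWt_wTheta nabla _ (QD_hasWt_wTheta nabla _ hA)).eq_zero_of_isTheta w hw, neg_zero]

/-- The derivative `∂/∂θ_s` of a superfield whose highest component vanishes. -/
theorem rawD_theta_eq {nabla : ℤ → ℂ} {C : Series N} (hC : IsSuperfield nabla C.1) {A : Raw N}
    (hA : HasWt wTheta 0 A) (h : EqBody C.1 A)
    (h0 : rawD (Gen.theta Sgn.minus) (rawD (Gen.theta Sgn.plus) C.1) = 0) (s : Sgn) :
    rawD (Gen.theta s) C.1 = (QD nabla s).app A := by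
  refine eq_of_eqBody (fun w hw => ?_) (fun w hw => ?_)
    (QD_hasWt_wTheta nabla s hA).eq_zero_of_isTheta
  · rw [← hC.susy, (h.QD_app nabla s) w hw]
  · obtain ⟨r, w', p⟩ := exists_theta_perm hw
    refine (C.2.rawD (Gen.theta s)).eq_zero_of_perm p ?_
    show C.1 (Gen.theta s :: Gen.theta r :: w') = 0
    have h1 : C.1 (Gen.theta Sgn.plus :: Gen.theta Sgn.minus :: w') = 0 := congrFun h0 w'
    cases s <;> cases r
    · exact C.2.eq_zero_of_repeat rfl _
    · exact h1
    · exact C.2.eq_zero_of_perm (List.Perm.swap _ _ _) h1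
    · exact C.2.eq_zero_of_repeat rfl _

theorem berezin_theta_minus_mul {C : Series N}
    (h0 : rawD (Gen.theta Sgn.minus) (rawD (Gen.theta Sgn.plus) C.1) = 0) :
    (berezin (X (Gen.theta Sgn.minus) * C)).1 = -rawD (Gen.theta Sgn.plus) C.1 := by
  show rawD (Gen.theta Sgn.minus) (rawD (Gen.theta Sgn.plus)
    (rawMul (X (Gen.theta Sgn.minus)).1 C.1)) = _
  rw [rawD_theta_mul, if_neg (by simp), zero_sub]
  show -rawD (Gen.theta Sgn.minus) (rawMul (X (Gen.theta Sgn.minus)).1 _) = _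
  rw [rawD_theta_mul, if_pos rfl, h0, rawMul_zero_right, sub_zero]

theorem berezin_theta_plus_mul {C : Series N}
    (h0 : rawD (Gen.theta Sgn.minus) (rawD (Gen.theta Sgn.plus) C.1) = 0) :
    (berezin (X (Gen.theta Sgn.plus) * C)).1 = rawD (Gen.theta Sgn.minus) C.1 := by
  show rawD (Gen.theta Sgn.minus) (rawD (Gen.theta Sgn.plus)
    (rawMul (X (Gen.theta Sgn.plus)).1 C.1)) = _
  rw [rawD_theta_mul, if_pos rfl]
  show rawD (Gen.theta Sgn.minus) C.1 -
    rawD (Gen.theta Sgn.minus) (rawMul (X (Gen.theta Sgn.plus)).1 _) = _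
  rw [rawD_theta_mul, if_neg (by simp), h0, rawMul_zero_right, sub_zero, sub_zero]

/-! ### Decomposition in a fixed degree -/

/-- `x` is the sum of a Berezin integral of a local functional and of cyclic Leibniz rule terms of
both types, all of degree `d`. -/
def IsDecomposable (nabla : ℤ → ℂ) (d : ℕ) (x : Raw N) : Prop :=
  ∃ T ∈ Submodule.span ℂ {y : Series N | IsLocalMonomial nabla 2 d y},
  ∃ Cp ∈ Submodule.span ℂ {y : Series N | IsCLRMonomial nabla Sgn.plus d y},
  ∃ Cm ∈ Submodule.span ℂ {y : Series N | IsCLRMonomial nabla Sgn.minus d y},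
    x = (berezin T - berezin (X (Gen.theta Sgn.minus) * Cp) +
      berezin (X (Gen.theta Sgn.plus) * Cm)).1

theorem berezin_add (f g : Series N) : berezin (f + g) = berezin f + berezin g := by
  simp [berezin]

theorem berezin_neg (f : Series N) : berezin (-f) = -berezin f := by
  simp [berezin]

theorem berezin_zero : berezin (0 : Series N) = 0 := by
  simp [berezin]

theorem isDecomposable_zero (nabla : ℤ → ℂ) (d : ℕ) : IsDecomposable nabla d (0 : Raw N) :=
  ⟨0, Submodule.zero_mem _, 0, Submodule.zero_mem _, 0, Submodule.zero_mem _, by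
    simp [berezin_zero]⟩

theorem IsDecomposable.add {nabla : ℤ → ℂ} {d : ℕ} {x y : Raw N} (hx : IsDecomposable nabla d x)
    (hy : IsDecomposable nabla d y) : IsDecomposable nabla d (x + y) := by
  obtain ⟨T, hT, P, hP, M, hM, rfl⟩ := hx
  obtain ⟨T', hT', P', hP', M', hM', rfl⟩ := hy
  refine ⟨T + T', Submodule.add_mem _ hT hT', P + P', Submodule.add_mem _ hP hP', M + M',
    Submodule.add_mem _ hM hM', ?_⟩
  have : ∀ a b : Series N, a.1 + b.1 = (a + b).1 := fun _ _ => rfl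
  rw [this]
  congr 1
  simp only [mul_add, berezin_add]
  abel

theorem isDecomposable_sum {nabla : ℤ → ℂ} {d : ℕ} {I : Type*} (s : Finset I) (F : I → Raw N)
    (h : ∀ i ∈ s, IsDecomposable nabla d (F i)) : IsDecomposable nabla d (∑ i ∈ s, F i) := by
  classical
  induction s using Finset.induction_on with
  | empty => simpa using isDecomposable_zero nabla d
  | insert a s ha ih =>
    rw [Finset.sum_insert ha]
    exact (h a (by simp)).add (ih fun i hi => h i (by simp [hi]))

theorem isDecomposable_QD_QD {nabla : ℤ → ℂ} (hn : IsDifferenceOperator nabla) {d : ℕ} {B : Raw N}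
    (hB : IsLoc d B) (hq : HasWt wNF 2 B) (s : Sgn) :
    IsDecomposable nabla d ((QD nabla s).app ((QD nabla s.opp).app B)) := by
  obtain ⟨T, hT, hTB⟩ := hB.exists_lift hn hq
  have hb := berezin_eq (localCoeffs_of_mem_span hn hT).superfield hB.hasWt_wTheta hTB
  cases s with
  | plus =>
    refine ⟨-T, Submodule.neg_mem _ hT, 0, Submodule.zero_mem _, 0, Submodule.zero_mem _, ?_⟩
    rw [mul_zero, mul_zero, berezin_zero, sub_zero, add_zero, berezin_neg]
    show _ = -(berezin T).1
    rw [hb, neg_neg]; rfl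
  | minus =>
    refine ⟨T, hT, 0, Submodule.zero_mem _, 0, Submodule.zero_mem _, ?_⟩
    rw [mul_zero, mul_zero, berezin_zero, sub_zero, add_zero, hb]
    exact eq_neg_of_add_eq_zero_right (QD_app_anticomm hn Sgn.plus hB.tame)

theorem clr_mem_span {nabla : ℤ → ℂ} {s : Sgn} {d : ℕ} {x : Series N}
    (hx : x ∈ Submodule.span ℂ {y : Series N | IsCLRMonomial nabla s d y}) :
    x ∈ Submodule.span ℂ {y : Series N | IsLocalMonomial nabla 1 d y} :=
  Submodule.span_mono (fun _ h => h.isLocalMonomial) hx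

theorem isDecomposable_clr {nabla : ℤ → ℂ} (hn : IsDifferenceOperator nabla) {d : ℕ} {A : Raw N}
    (hA : IsLoc d A) (s : Sgn) (h0 : (QD nabla s.opp).app A = 0) {C : Series N}
    (hC : C ∈ Submodule.span ℂ {y : Series N | IsCLRMonomial nabla s d y}) (hCA : EqBody C.1 A) :
    IsDecomposable nabla d ((QD nabla s).app A) := by
  have hS := (localCoeffs_of_mem_span hn (clr_mem_span hC)).superfield
  have hpm : (QD nabla Sgn.plus).app ((QD nabla Sgn.minus).app A) = 0 := by
    cases s with
    | plus =>
      have h0 : (QD nabla Sgn.minus).app A = 0 := h0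
      rw [h0, LinDer.app_zero]
    | minus =>
      have h0 : (QD nabla Sgn.plus).app A = 0 := h0
      have h1 := QD_app_anticomm hn Sgn.plus hA.tame
      rwa [h0, LinDer.app_zero, add_zero] at h1
  have hb : rawD (Gen.theta Sgn.minus) (rawD (Gen.theta Sgn.plus) C.1) = 0 := by
    have := berezin_eq hS hA.hasWt_wTheta hCA
    rwa [hpm, neg_zero] at this
  have hd := rawD_theta_eq hS hA.hasWt_wTheta hCA hb s
  cases s with
  | plus =>
    refine ⟨0, Submodule.zero_mem _, C, hC, 0, Submodule.zero_mem _, ?_⟩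
    rw [mul_zero, berezin_zero, zero_sub, add_zero]
    show _ = -(berezin (X (Gen.theta Sgn.minus) * C)).1
    rw [berezin_theta_minus_mul hb, neg_neg, hd]
  | minus =>
    refine ⟨0, Submodule.zero_mem _, 0, Submodule.zero_mem _, C, hC, ?_⟩
    rw [mul_zero, berezin_zero, sub_zero, zero_add, berezin_theta_plus_mul hb, hd]

theorem wt_le_length {ω : Gen N → ℤ} (h : ∀ a, ω a ≤ 1) (w : List (Gen N)) :
    wt ω w ≤ w.length := by
  induction w with
  | nil => simp
  | cons a w ih => rw [wt_cons, List.length_cons]; push_cast; have := h a; omega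

theorem IsLoc.eq_sum_proj {d : ℕ} {f : Raw N} (hf : IsLoc d f) {ω : Gen N → ℤ}
    (h0 : ∀ a, 0 ≤ ω a) (h1 : ∀ a, ω a ≤ 1) :
    f = ∑ k ∈ Finset.range (d + 1), LatticeSusy.proj ω k f := by
  funext w
  rw [Finset.sum_apply]
  by_cases hw : f w = 0
  · simp [LatticeSusy.proj, hw]
  obtain ⟨k, hk⟩ := Int.eq_ofNat_of_zero_le (wt_nonneg h0 w)
  have h2 := wt_le_length h1 w
  rw [hf.length w hw] at h2
  rw [Finset.sum_eq_single k]
  · simp [LatticeSusy.proj, hk]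
  · intro k' _ hne
    have : ¬ wt ω w = k' := fun h => hne (by rw [hk] at h; exact_mod_cast h.symm)
    simp [LatticeSusy.proj, this]
  · intro hk'
    rw [Finset.mem_range] at hk'
    omega

theorem IsLoc.isDecomposable_of_proj {nabla : ℤ → ℂ} (hn : IsDifferenceOperator nabla) {d : ℕ}
    {A : Raw N} (hA : IsLoc d A) (s : Sgn) {ω : Gen N → ℤ} (h0 : ∀ a, 0 ≤ ω a) (h1 : ∀ a, ω a ≤ 1)
    (hω : ∀ j a, ω (Gen.shift j a) = ω a)
    (h : ∀ k : ℕ, IsDecomposable nabla d ((QD nabla s).app (LatticeSusy.proj ω k A))) :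
    IsDecomposable nabla d ((QD nabla s).app A) := by
  classical
  have key : ∀ t : Finset ℕ, (QD nabla s).app (∑ k ∈ t, LatticeSusy.proj ω k A) =
      ∑ k ∈ t, (QD nabla s).app (LatticeSusy.proj ω k A) := by
    intro t
    induction t using Finset.induction_on with
    | empty => simp [LinDer.app_zero]
    | insert a t ha ih =>
      rw [Finset.sum_insert ha, Finset.sum_insert ha, ← ih]
      exact (QD_adm_zero hn s).app_add (hA.proj hω _).tame
        (isLoc_sum t _ fun i _ => hA.proj hω _).tame
  rw [hA.eq_sum_proj h0 h1, key]
  exact isDecomposable_sum _ _ fun k _ => h k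

/-- On words whose letters all have label `s`, the Koszul degree bounds the fermion number, with
equality only for words in `φ_s, χ_s, ρ_s`. -/
theorem wNF_le_wKoszul (s : Sgn) {w : List (Gen N)}
    (h : ∀ a ∈ w, a.isTheta = false ∧ wSec s.opp a = 0) :
    wt wNF w ≤ wt (wKoszul s.opp) w ∧ (wt wNF w = wt (wKoszul s.opp) w →
      wt (wRho s) w + wt (wChi s) w + wt (wPhi s) w = w.length ∧ wt (wChi s) w = wt wNF w) := by
  induction w with
  | nil => simp
  | cons a w ih =>
    obtain ⟨h1, h2⟩ := ih fun b hb => h b (List.mem_cons_of_mem _ hb)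
    have h3 : wNF a ≤ wKoszul s.opp a ∧ (wNF a = wKoszul s.opp a →
        wRho s a + wChi s a + wPhi s a = 1 ∧ wChi s a = wNF a) := by
      obtain ⟨ha, hs⟩ := h a (by simp)
      cases a with
      | theta r => simp [Gen.isTheta] at ha
      | phi r m | chibar r m | chi r m | F r m | rho r m | zeta r m =>
        rcases Sgn.eq_or_opp s r with rfl | rfl
        · simp [wNF, wKoszul, wRho, wChi, wPhi]
        · simp [wSec] at hs
    simp only [wt_cons, List.length_cons]
    refine ⟨by omega, fun he => ?_⟩
    have h4 := h2 (by omega)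
    have h5 := h3.2 (by omega)
    push_cast
    omega

theorem wSec_nonneg (t : Sgn) (a : Gen N) : 0 ≤ wSec t a := by
  cases a <;> simp only [wSec] <;> (try split_ifs) <;> simp

theorem wSec_le_one (t : Sgn) (a : Gen N) : wSec t a ≤ 1 := by
  cases a <;> simp only [wSec] <;> (try split_ifs) <;> simp

theorem wKoszul_nonneg (t : Sgn) (a : Gen N) : 0 ≤ wKoszul t a := by
  cases a <;> simp only [wKoszul] <;> (try split_ifs) <;> simp

theorem wKoszul_le_one (t : Sgn) (a : Gen N) : wKoszul t a ≤ 1 := by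
  cases a <;> simp only [wKoszul] <;> (try split_ifs) <;> simp

theorem wSite_le_one (a : Gen N) : wSite a ≤ 1 := by
  unfold wSite; split_ifs <;> simp

theorem proj_zero (ω : Gen N → ℤ) (k : ℤ) : proj ω k (0 : Raw N) = 0 := by
  funext w; simp [proj]

/-- The image under `Q_s` of a function of the letters of label `s` with fermion number `1` that is
annihilated by the other supercharge. -/
theorem IsLoc.isDecomposable_QD {nabla : ℤ → ℂ} (hn : IsDifferenceOperator nabla) {d : ℕ}
    {A : Raw N} (hA : IsLoc d A) (hq : HasWt wNF 1 A) (s : Sgn) (hs : HasWt (wSec s.opp) 0 A)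
    (h0 : (QD nabla s.opp).app A = 0) : IsDecomposable nabla d ((QD nabla s).app A) := by
  refine hA.isDecomposable_of_proj hn s wSite_nonneg wSite_le_one shift_wSite fun r => ?_
  refine (hA.proj shift_wSite r).isDecomposable_of_proj hn s (wKoszul_nonneg s.opp)
    (wKoszul_le_one s.opp) (shift_wKoszul s.opp) fun g => ?_
  set B := LatticeSusy.proj (wKoszul s.opp) g (LatticeSusy.proj wSite r A) with hB
  have lB : IsLoc d B := (hA.proj shift_wSite r).proj (shift_wKoszul s.opp) g
  have qB : HasWt wNF 1 B := hq.proj.proj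
  have sB : HasWt (wSec s.opp) 0 B := hs.proj.proj
  have rB : HasWt wSite r B := (hasWt_proj _ _ _).proj
  have gB : HasWt (wKoszul s.opp) g B := hasWt_proj _ _ _
  have cB : (QD nabla s.opp).app B = 0 := by
    have s1 := (QD_shifts_wKoszul (N := N) nabla s.opp).app_proj ((g : ℤ) - 1)
      (LatticeSusy.proj wSite r A)
    have s2 := (QD_shifts_wSite (N := N) nabla s.opp).app_proj r A
    rw [sub_add_cancel] at s1
    rw [add_zero] at s2
    rw [hB, s1, s2, h0, proj_zero, proj_zero]
  by_cases hB0 : B = 0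
  · rw [hB0, LinDer.app_zero]; exact isDecomposable_zero nabla d
  obtain ⟨w, hw⟩ := Function.ne_iff.mp hB0
  have hletter : ∀ w, B w ≠ 0 → ∀ a ∈ w, a.isTheta = false ∧ wSec s.opp a = 0 := by
    intro w hw a ha
    refine ⟨lB.body w hw a ha, ?_⟩
    have h1 := wSec_nonneg s.opp a
    by_contra h2
    have := wt_pos_of_mem (wSec_nonneg s.opp) ha (by omega)
    rw [sB w hw] at this
    exact lt_irrefl _ this
  have hr : 0 < (r : ℤ) := by rw [← rB w hw]; exact wt_site_pos (lB.site w hw)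
  have hg : 1 ≤ (g : ℤ) := by
    have := (wNF_le_wKoszul s (hletter w hw)).1
    rwa [qB w hw, gB w hw] at this
  rcases eq_or_lt_of_le hg with hg1 | hg2
  · have hk : ∀ w, B w ≠ 0 → wt (wRho s) w + wt (wChi s) w + wt (wPhi s) w = w.length ∧
        wt (wChi s) w = 1 := by
      intro w hw
      have := (wNF_le_wKoszul s (hletter w hw)).2
      rw [qB w hw, gB w hw] at this
      exact this hg1
    obtain ⟨C, hC, hCB⟩ := lB.exists_clr_lift hn s.opp
      (by rw [Sgn.opp_opp]; exact fun w hw => (hk w hw).2)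
      (by rw [Sgn.opp_opp]; exact fun w hw => (hk w hw).1) cB
    rw [Sgn.opp_opp] at hC
    exact isDecomposable_clr hn lB s cB hC hCB
  · obtain ⟨E, hE, hEq, hEB⟩ := lB.exists_primitive hn s.opp sB gB (by omega) cB rB hr.ne' qB
    rw [← hEB]
    exact isDecomposable_QD_QD hn hE hEq s

theorem wSec_add {w : List (Gen N)} (h : ∀ a ∈ w, a.isTheta = false) :
    wt (wSec Sgn.plus) w + wt (wSec Sgn.minus) w = w.length := by
  induction w with
  | nil => rfl
  | cons a w ih =>
    have h1 := ih fun b hb => h b (List.mem_cons_of_mem _ hb)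
    have h2 : wSec Sgn.plus a + wSec Sgn.minus a = 1 := by
      have := h a (by simp)
      cases a with
      | theta r => simp [Gen.isTheta] at this
      | phi r m | chibar r m | chi r m | F r m | rho r m | zeta r m => cases r <;> simp [wSec]
    simp only [wt_cons, List.length_cons]
    push_cast
    omega

/-- Local coefficient functions with fermion number `0` annihilated by both supercharges. -/
theorem IsLoc.isDecomposable {nabla : ℤ → ℂ} (hn : IsDifferenceOperator nabla) {d : ℕ} {x : Raw N}
    (hx : IsLoc d x) (hq : HasWt wNF 0 x) (h0 : ∀ s, (QD nabla s).app x = 0) :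
    IsDecomposable nabla d x := by
  rw [hx.eq_sum_proj (wSec_nonneg Sgn.plus) (wSec_le_one Sgn.plus)]
  refine isDecomposable_sum _ _ fun a ha => ?_
  set y := LatticeSusy.proj (wSec Sgn.plus) a x with hy
  have ly : IsLoc d y := hx.proj (shift_wSec _) a
  have qy : HasWt wNF 0 y := hq.proj
  have y1 : HasWt (wSec Sgn.plus) a y := hasWt_proj _ _ _
  have y2 : HasWt (wSec Sgn.minus) ((d : ℤ) - a) y := fun w hw => by
    have h1 := wSec_add (ly.body w hw)
    rw [y1 w hw, ly.length w hw] at h1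
    omega
  have cy : ∀ s, (QD nabla s).app y = 0 := by
    intro s
    have := (QD_shifts_wSec (N := N) nabla s Sgn.plus).app_proj a x
    rw [add_zero] at this
    rw [hy, this, h0, proj_zero]
  by_cases hy0 : y = 0
  · rw [hy0]; exact isDecomposable_zero nabla d
  have hd : d ≠ 0 := by
    rintro rfl
    obtain ⟨w, hw⟩ := Function.ne_iff.mp hy0
    obtain ⟨b, hb, -⟩ := ly.site w hw
    rw [List.length_eq_zero_iff.mp (ly.length w hw)] at hb
    simp at hb
  have had := Finset.mem_range.mp ha
  by_cases ha0 : a = 0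
  · subst ha0
    obtain ⟨A, lA, qA, sA, cA, hA⟩ := ly.eq_QD hn qy Sgn.minus (cy _) (cy _) y2 (by exact y1)
      (by omega)
    rw [← hA]
    exact lA.isDecomposable_QD hn qA _ sA cA
  by_cases hda : (d : ℤ) - a = 0
  · rw [hda] at y2
    obtain ⟨A, lA, qA, sA, cA, hA⟩ := ly.eq_QD hn qy Sgn.plus (cy _) (cy _) y1 y2 (by omega)
    rw [← hA]
    exact lA.isDecomposable_QD hn qA _ sA cA
  · obtain ⟨B, lB, qB, hB⟩ := ly.eq_QD_QD hn qy Sgn.plus (cy _) (cy _) y1 y2 (by omega) hda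
    rw [← hB]
    exact isDecomposable_QD_QD hn lB qB _

end LatticeSusy

namespace LatticeSusy

variable {N : ℕ}

/-! ### From homogeneous parts to formal series -/

/-- A superfield of degree `d` annihilated by both supercharges does not contain `θ_±`, and its
coefficients are local. -/
theorem LocalCoeffs.isLoc {nabla : ℤ → ℂ} {q : ℤ} {d : ℕ} {x : Series N}
    (hx : LocalCoeffs nabla q d x.1) (h0 : ∀ s, (QD nabla s).app x.1 = 0) :
    IsLoc d x.1 ∧ HasWt wNF q x.1 := by
  have hθ : ∀ w : List (Gen N), (∃ a ∈ w, a.isTheta = true) → x.1 w = 0 := by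
    intro w hw
    obtain ⟨r, w', p⟩ := exists_theta_perm hw
    refine x.2.eq_zero_of_perm p ?_
    have h1 := hx.superfield.susy r
    rw [h0] at h1
    exact (congrFun h1 w').symm
  have hbody : ∀ w, x.1 w ≠ 0 → ∀ a ∈ w, a.isTheta = false := by
    intro w hw a ha
    by_contra h
    exact hw (hθ w ⟨a, ha, by simpa using h⟩)
  refine ⟨⟨x.2, fun w hw => ?_, hbody, fun w hw => (hx.support w (hbody w hw) hw).2,
    fun j w => ?_, ?_⟩, fun w hw => (hx.support w (hbody w hw) hw).1⟩
  · have h1 := hx.degree w hw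
    have h2 : ∀ v : List (Gen N), (∀ a ∈ v, a.isTheta = false) → wt wField v = v.length := by
      intro v hv
      induction v with
      | nil => rfl
      | cons a v ih =>
        rw [wt_cons, ih fun b hb => hv b (List.mem_cons_of_mem _ hb), List.length_cons]
        have : wField a = 1 := by
          have := hv a (by simp)
          cases a <;> simp_all [wField, Gen.isField, Gen.isTheta]
        push_cast; omega
    rw [h2 w (hbody w hw)] at h1
    exact_mod_cast h1
  · by_cases hw : ∀ a ∈ w, a.isTheta = false
    · exact hx.trans j w hw
    · push Not at hw
      obtain ⟨a, ha, hat⟩ := hw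
      have hat : a.isTheta = true := by simpa using hat
      rw [hθ w ⟨a, ha, hat⟩,
        hθ _ ⟨a.shift j, List.mem_map.mpr ⟨a, ha, rfl⟩, by rw [Gen.shift_isTheta, hat]⟩]
  · obtain ⟨L, M, hM, hL, h⟩ := hx.decay
    refine ⟨L, M, hM, hL, fun w m n hm hn => ?_⟩
    by_cases hw : x.1 w = 0
    · rw [hw, norm_zero]; positivity
    · exact h w (hbody w hw) m n hm hn

/-- The formal series with prescribed homogeneous parts. -/
def ofHomogParts (F : ℕ → Series N) : Series N :=
  ⟨fun w => (F (w.countP Gen.isField)).1 w, by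
    intro u v a b
    have h : (u ++ a :: b :: v).countP Gen.isField = (u ++ b :: a :: v).countP Gen.isField := by
      simp only [List.countP_append, List.countP_cons]; omega
    simp only [h]
    exact (F _).2 u v a b⟩

theorem homogPart_ofHomogParts {F : ℕ → Series N} (hF : ∀ d : ℕ, HasWt wField d (F d).1) (d : ℕ) :
    homogPart d (ofHomogParts F) = F d := by
  apply Subtype.ext
  rw [← (hF d).proj_eq, ← homogPart_val]
  funext w
  show (if w.countP Gen.isField = d then (F (w.countP Gen.isField)).1 w else 0) =
    if w.countP Gen.isField = d then (F d).1 w else 0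
  split_ifs with h
  · rw [h]
  · rfl

theorem eq_of_homogPart {f g : Series N} (h : ∀ d, homogPart d f = homogPart d g) : f = g := by
  apply Subtype.ext
  funext w
  have h1 := congrFun (congrArg Subtype.val (h (w.countP Gen.isField))) w
  simpa [homogPart] using h1

theorem homogPart_add (d : ℕ) (f g : Series N) :
    homogPart d (f + g) = homogPart d f + homogPart d g := by
  apply Subtype.ext
  funext w
  show (if _ then f.1 w + g.1 w else 0) = (if _ then f.1 w else 0) + (if _ then g.1 w else 0)
  split_ifs <;> simp

theorem homogPart_neg (d : ℕ) (f : Series N) : homogPart d (-f) = -homogPart d f := by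
  apply Subtype.ext
  funext w
  show (if _ then -(f.1 w) else 0) = -(if _ then f.1 w else 0)
  split_ifs <;> simp

theorem homogPart_berezin (d : ℕ) (f : Series N) :
    homogPart d (berezin f) = berezin (homogPart d f) := by
  apply Subtype.ext
  funext w
  show (if w.countP Gen.isField = d then f.1 (Gen.theta Sgn.plus :: Gen.theta Sgn.minus :: w)
      else 0) =
    if (Gen.theta Sgn.plus :: Gen.theta Sgn.minus :: w).countP Gen.isField = d then
      f.1 (Gen.theta Sgn.plus :: Gen.theta Sgn.minus :: w) else 0
  simp [Gen.isField]

theorem homogPart_theta_mul (d : ℕ) (s : Sgn) (f : Series N) :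
    homogPart d (X (Gen.theta s) * f) = X (Gen.theta s) * homogPart d f := by
  apply Subtype.ext
  funext w
  have key : ∀ g : Series N, (∀ v, wt wField v = wt wField w → g.1 v = 0) →
      rawMul (X (Gen.theta s)).1 g.1 w = 0 := by
    intro g hg
    by_contra h
    obtain ⟨v, p, hv⟩ := X_mul_support _ _ _ h
    refine hv (hg v ?_)
    rw [wt_perm wField p, wt_cons]
    simp [wField, Gen.isField]
  show (if w.countP Gen.isField = d then rawMul (X (Gen.theta s)).1 f.1 w else 0) =
    rawMul (X (Gen.theta s)).1 (homogPart d f).1 w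
  split_ifs with h
  · have h1 := key (f - homogPart d f) fun v hv => by
      rw [wt_wField, wt_wField, Nat.cast_inj, h] at hv
      show f.1 v - (if v.countP Gen.isField = d then f.1 v else 0) = 0
      rw [if_pos hv, sub_self]
    have h2 : f.1 = (f - homogPart d f).1 + (homogPart d f).1 := by
      show _ = f.1 - (homogPart d f).1 + (homogPart d f).1
      rw [sub_add_cancel]
    rw [h2, rawMul_add_right, Pi.add_apply, h1, zero_add]
  · refine (key _ fun v hv => ?_).symm
    rw [wt_wField, wt_wField, Nat.cast_inj] at hv
    show (if v.countP Gen.isField = d then f.1 v else 0) = 0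
    rw [if_neg (hv ▸ h)]

theorem tame_of_homogPart {f : Series N} (h : ∀ d, Tame {0} (homogPart d f).1) :
    Tame {0} f.1 := by
  simp only [tame_zero_iff] at h ⊢
  intro n
  choose G hG hb using fun d => h d n
  refine ⟨∑ d ∈ Finset.range (n + 1), G d, Finset.sum_nonneg fun d _ => hG d, fun w hw => ?_⟩
  have h1 : w.countP Gen.isField < n + 1 := by
    have := List.countP_le_length (p := Gen.isField) (l := w)
    omega
  have h2 := hb (w.countP Gen.isField) w hw
  have h3 : (homogPart (w.countP Gen.isField) f).1 w = f.1 w := if_pos rfl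
  rw [h3] at h2
  exact h2.trans (Finset.single_le_sum (fun d _ => hG d) (Finset.mem_range.mpr h1))

end LatticeSusy

open LatticeSusy

theorem proposition4 (N : ℕ) (nabla : ℤ → ℂ) (hnabla : LatticeSusy.IsDifferenceOperator nabla)
    (D : Set ℕ) (S : LatticeSusy.Series N)
    (hS : LatticeSusy.IsLocalFunctional nabla 0 D S)
    (hplus : LatticeSusy.Q nabla LatticeSusy.Sgn.plus S = 0)
    (hminus : LatticeSusy.Q nabla LatticeSusy.Sgn.minus S = 0) :
    ∃ T Cplus Cminus : LatticeSusy.Series N,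
      LatticeSusy.IsLocalFunctional nabla 2 D T ∧
      LatticeSusy.IsCLRExtended nabla LatticeSusy.Sgn.plus D Cplus ∧
      LatticeSusy.IsCLRExtended nabla LatticeSusy.Sgn.minus D Cminus ∧
      S = LatticeSusy.berezin T
        - LatticeSusy.berezin (LatticeSusy.X (LatticeSusy.Gen.theta LatticeSusy.Sgn.minus) * Cplus)
        + LatticeSusy.berezin
            (LatticeSusy.X (LatticeSusy.Gen.theta LatticeSusy.Sgn.plus) * Cminus) := by
  have hpart : ∀ d, homogPart d S ∈ Submodule.span ℂ {y | IsLocalMonomial nabla 0 d y} := by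
    intro d
    by_cases hd : d ∈ D
    · exact (hS d).1 hd
    · rw [(hS d).2 hd]; exact Submodule.zero_mem _
  have hloc := fun d => localCoeffs_of_mem_span hnabla (hpart d)
  have htame : Tame {0} S.1 := tame_of_homogPart fun d => (hloc d).superfield.tame
  have hQ : ∀ s, (QD nabla s).app S.1 = 0 := by
    intro s
    rw [← Q_val hnabla s S htame]
    cases s
    · rw [hplus]; rfl
    · rw [hminus]; rfl
  have hdec : ∀ d, IsDecomposable nabla d (homogPart d S).1 := by
    intro d
    obtain ⟨h1, h2⟩ := (hloc d).isLoc fun s => by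
      have := (QD_shifts_wField (N := N) nabla s).app_proj d S.1
      rw [add_zero] at this
      rw [homogPart_val, this, hQ, proj_zero]
    refine h1.isDecomposable hnabla h2 fun s => ?_
    have := (QD_shifts_wField (N := N) nabla s).app_proj d S.1
    rw [add_zero] at this
    rw [homogPart_val, this, hQ, proj_zero]
  have hdecD : ∀ d, ∃ T ∈ Submodule.span ℂ {y : Series N | IsLocalMonomial nabla 2 d y},
      ∃ Cp ∈ Submodule.span ℂ {y : Series N | IsCLRMonomial nabla Sgn.plus d y},
      ∃ Cm ∈ Submodule.span ℂ {y : Series N | IsCLRMonomial nabla Sgn.minus d y},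
        homogPart d S = berezin T - berezin (X (Gen.theta Sgn.minus) * Cp) +
          berezin (X (Gen.theta Sgn.plus) * Cm) ∧ (d ∉ D → T = 0 ∧ Cp = 0 ∧ Cm = 0) := by
    intro d
    by_cases hd : d ∈ D
    · obtain ⟨T, hT, P, hP, M, hM, h⟩ := hdec d
      exact ⟨T, hT, P, hP, M, hM, Subtype.ext h, fun h' => absurd hd h'⟩
    · refine ⟨0, Submodule.zero_mem _, 0, Submodule.zero_mem _, 0, Submodule.zero_mem _, ?_,
        fun _ => ⟨rfl, rfl, rfl⟩⟩
      rw [(hS d).2 hd, mul_zero, mul_zero, berezin_zero]; simp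
  choose T hT P hP M hM hSd h0 using hdecD
  have wT := fun d => (localCoeffs_of_mem_span hnabla (hT d)).degree
  have wP := fun d => (localCoeffs_of_mem_span hnabla (clr_mem_span (hP d))).degree
  have wM := fun d => (localCoeffs_of_mem_span hnabla (clr_mem_span (hM d))).degree
  refine ⟨ofHomogParts T, ofHomogParts P, ofHomogParts M, fun d => ?_, fun d => ?_, fun d => ?_,
    eq_of_homogPart fun d => ?_⟩
  · rw [homogPart_ofHomogParts wT]; exact ⟨fun _ => hT d, fun hd => (h0 d hd).1⟩
  · rw [homogPart_ofHomogParts wP]; exact ⟨fun _ => hP d, fun hd => (h0 d hd).2.1⟩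
  · rw [homogPart_ofHomogParts wM]; exact ⟨fun _ => hM d, fun hd => (h0 d hd).2.2⟩
  · rw [hSd d, sub_eq_add_neg, sub_eq_add_neg, homogPart_add, homogPart_add, homogPart_neg,
      homogPart_berezin, homogPart_berezin, homogPart_berezin, homogPart_theta_mul,
      homogPart_theta_mul, homogPart_ofHomogParts wT, homogPart_ofHomogParts wP,
      homogPart_ofHomogParts wM]
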